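/- **Setting.** Let $\mathcal T$ be a finite Cartesian mesh (hanging nodes allowed): pairwise disjoint open axis-parallel rectangles $K$, whose closures fill the domain $\Omega=(\bigcup_{K\in\mathcal T}\bar K)^\circ\subset\mathbb R^2$. Let $\Omega_1$ be open with $C^2$-smooth boundary $\Gamma$ (the interface) and $\bar\Omega_1\subset\Omega$, and $\Omega_2=\Omega\setminus\bar\Omega_1$. Let $\mathcal T^\Gamma=\{K\in\mathcal T:K\cap\Gamma\ne\emptyset\}$ be the set of interface elements. Assume that $\Gamma$ crosses each $K\in\mathcal T^\Gamma$ once: $\Gamma\cap\bar K$ is a simple arc, inside $K$ except for its two end points, which lie on $\partial K$ but not on one common closed side, and which separate $\partial K\cap\Omega_1$ from $\partial K\cap\Omega_2$. Then $K$ is of type $\mathcal T_1$ if the end points are inner points of two adjacent sides; of type $\mathcal T_2$ if one is an inner point of a side and the other lies on the opposite closed side; of type $\mathcal T_3$ if they are opposite vertices. For $\delta_0\in(0,1/5]$, a rectangle $R$ that meets $\Gamma$ is a *large element* if $|e\cap\Omega_i|\ge\delta_0|e|$ for $i=1,2$ and each side $e$ of $R$ that meets $\Omega_i$. **Chains.**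 A chain $\mathfrak C=\{G_1\to\dots\to G_n\}$ consists of interface elements such that $\bar\Gamma_{G_i}\cup\bar\Gamma_{G_{i+1}}$ is a continuous curve, where $\Gamma_G=\Gamma\cap G$; its elements are distinct, except that it may be closed: $G_1=G_n$ with $G_2,\dots,G_n$ distinct and $n\ge4$. Two elements are neighboring if they share a common side. Let $\mathcal S(K)_0=\{K\}$, and let $\mathcal S(K)_{j+1}$ be the set of elements whose closure meets the closure of an element of $\mathcal S(K)_j$. The chain is *admissible* if: 1. for $K\in\mathfrak C$, all elements in $\mathcal S(K)_2$ have the size of $K$ and form the full $5\times5$ block of translates of $K$; 2. if $K\in\mathfrak C$ has a side $e$ with $\bar e\subset\Omega_i$, then $e$ is a side of a neighboring element contained in $\Omega_i$. In addition (this concerns only elements with a vertex on $\Gamma$): for $K\in\mathcal T_2$ the same holds for both sides that join the two opposite sides met by $\Gamma$, taken without end points; for $K\in\mathcal T_3$ and each $i$, it holds for at least one of the two sides (without end points) of $K$ in $\Omega_i$; 3. each $K\in\mathcal T\setminus\mathcal T^\Gamma$ is neighboring at most two elements of $\mathfrak C$; 4. for each $K\in\mathcal T$ with $K\subset\Omega_i$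 and $j=1,2$, the interior of $\bigcup\{\bar G:G\in\mathcal S(K)_j\cap\mathcal T^\Gamma\}$ is connected (or empty). **Patterns.** Let $u,v,w$ denote unit axis directions, $K+au+bv$ the translate of $K$ by $a$ and $b$ element lengths, and "the side $u$ of $K$" the side with outer normal $u$. A pattern has interface elements (its input) and other elements. If all elements of the input are large, each is left unchanged, $M(\cdot)=\cdot$. Otherwise all are merged with the listed elements into one macro-element, the interior of the union of the closures. Ratios $r_i=|e_i|/|s_i|$ refer to the part $e_i$ of a side $s_i$ between $\Gamma$ and the stated end of $s_i$. * *Algorithm 1*, input $(N_1,K,N_2)$ of types $(\mathcal T_2,\mathcal T_1,\mathcal T_2)$, $N_1=K+u$, $N_2=K+v$, $u\perp v$. $e_1$: side $u$ of $N_1$, end $-v$; $e_2$: side $v$ of $N_2$, end $-u$. Always use $K+u+v$; if $r_1<2\delta_0$ use also $G_1=K+u-v$, $G_2=K-v$; if $r_2<2\delta_0$ use also $G_4=K-u$, $G_5=K-u+v$; if both, use also $G_3=K-u-v$. * *Algorithm 2*, input $(N_1,K,N_2)$ all of type $\mathcal T_1$, $N_1=K+u$, $N_2=K+v$, $u\perp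 v$, where $\Gamma$ leaves $N_1$ through its side $-v$ and $N_2$ through its side $-u$. $e_1$: side $-v$ of $N_1$, end $u$; $e_2$: side $-u$ of $N_2$, end $v$. Always use $K+u+v$; if $r_1<2\delta_0$ use also $G_1=K+2u$, $G_2=K+2u+v$; if $r_2<2\delta_0$ use also $G_4=K+u+2v$, $G_5=K+2v$; if both, use also $G_3=K+2u+2v$. * *Algorithm 3*, input $(K,N)$ of types $(\mathcal T_1,\mathcal T_1)$, $N=K+u$. $e_1$: the side of $K$ parallel to the direction $u$ through which $\Gamma$ leaves $K$, end $-u$; $e_2$: the side of $N$ parallel to the direction $u$ through which $\Gamma$ leaves $N$, end $u$. If $r_1,r_2\ge2\delta_0$ use nothing; else if $r_1\ge3\delta_0$ use $K+2u$; else if $r_2\ge3\delta_0$ use $K-u$; else use both. * *Algorithm 4*, input $(N_1,K,N_2)$ of types $(\mathcal T_1,\mathcal T_2,\mathcal T_1)$, $N_1=K-u$, $N_2=K+u$. $e_1$, $e_2$: the side of $N_1$, resp. $N_2$, parallel to the direction $u$ through which $\Gamma$ leaves it, end $-u$, resp. $u$. If $r_1,r_2\ge3\delta_0$ use nothing; else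 if $r_2\ge4\delta_0$ use $K-2u$; else if $r_1\ge4\delta_0$ use $K+2u$; else use both. * *Algorithm 5*, input $K$ of type $\mathcal T_2$, where $\Gamma$ joins the sides $\pm w$, and $u\perp w$ is either of the two perpendicular directions. $e_1,e_2$: the sides $w$ and $-w$ of $K$, end $u$. If $r_1,r_2<1-2\delta_0$ use $K+u$; else if $r_1,r_2\ge2\delta_0$ use $K-u$; else use both. **Algorithm 6** (merging algorithm; "remaining" elements have not yet been an input; subchains of a closed chain may pass through $G_1=G_n$, and their elements are distinct). Step 1: for each maximal subchain $\mathfrak S$ of length $m\ge2$ of elements of $\mathcal T_1$, call Algorithm 3 with $(\mathfrak S\{2i-1\},\mathfrak S\{2i\})$ for $1\le i\le m/2$ if $m$ is even; if $m=2k+1$ is odd, do so for $1\le i\le k-1$ and call Algorithm 2 with $(\mathfrak S\{2k-1\},\mathfrak S\{2k\},\mathfrak S\{2k+1\})$. Step 2: as long as there is a subchain of three remaining elements of types $\mathcal T_1,\mathcal T_2,\mathcal T_1$, call Algorithm 4 with it. Step 3: the same for types $\mathcal T_2,\mathcal T_1,\mathcal T_2$ and Algorithm 1. Step 4: call Algorithm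 5 with each remaining $K\in\mathcal T_2$ of the chain. The locally induced mesh $\mathrm{Induced}(\mathfrak C)$ consists of the elements $M(K)$, $K\in\mathfrak C$, with $M(K)=K$ if $K$ was not an input. **Theorem 3.1.** Let $\delta_0\in(0,1/5]$ and let $\mathfrak C$ be an admissible chain of interface elements of length $n\ge2$ such that either * $\mathfrak C$ is not closed, $\mathfrak C\{1\},\mathfrak C\{n\}\in\mathcal T_2$, and there is no interface element $G\notin\mathfrak C$ for which $\bar\Gamma_G$ meets both $\bar\Gamma_{\mathfrak C\{1\}}$ and $\bar\Gamma_{\mathfrak C\{n\}}$; or * $\mathfrak C$ is closed, and not all of its elements are of type $\mathcal T_1$. Then every execution of Algorithm 6 with input $\mathfrak C$ (whatever the order of the calls within a step and the choices of overlapping subchains) terminates after finitely many steps. When it has terminated, every element of $\mathfrak C$ of type $\mathcal T_1$ or $\mathcal T_2$ has been the input of exactly one call; all other elements that are merged are non-interface elements of $\mathcal T$; no non-interface element is used by two patterns; the elements of $\mathrm{Induced}(\mathfrak C)$ are pairwise disjoint rectangles, which contain the elements of $\mathfrak C$; and all elements of $\mathrm{Induced}(\mathfrak C)$ are large elements. 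-/

import Mathlib

open Set Topology MeasureTheory

noncomputable section

namespace Merging

/-- Points of the plane. -/
abbrev Pt : Type := ℝ × ℝ

/-! ### Rectangles -/

/-- An open axis-parallel rectangle `(x, x + w) × (y, y + h)`.  Here `w` is the length `h₁(K)` of
the sides parallel to the first axis and `h` is the length `h₂(K)` of the other sides. -/
@[ext] structure Cell where
  x : ℝ
  y : ℝ
  w : ℝ
  h : ℝ
  w_pos : 0 < w
  h_pos : 0 < h

/-- The four unit directions.  Sides of a rectangle are named by their outer direction. -/
def dirs : Finset (ℤ × ℤ) := {(1, 0), (0, 1), (-1, 0), (0, -1)}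

/-- Rotation by a right angle. -/
def rot (u : ℤ × ℤ) : ℤ × ℤ := (-u.2, u.1)

/-- `u` and `v` are two perpendicular directions. -/
def Perp (u v : ℤ × ℤ) : Prop := u ∈ dirs ∧ v ∈ dirs ∧ (v = rot u ∨ v = -rot u)

namespace Cell

/-- The open rectangle as a set of points. -/
def toSet (K : Cell) : Set Pt := Ioo K.x (K.x + K.w) ×ˢ Ioo K.y (K.y + K.h)

/-- The closed rectangle. -/
def closed (K : Cell) : Set Pt := Icc K.x (K.x + K.w) ×ˢ Icc K.y (K.y + K.h)

/-- The boundary of the rectangle. -/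
def bdry (K : Cell) : Set Pt := K.closed \ K.toSet

/-- The rectangle of the same size, translated by `a.1` widths and `a.2` heights. -/
def shift (K : Cell) (a : ℤ × ℤ) : Cell where
  x := K.x + a.1 * K.w
  y := K.y + a.2 * K.h
  w := K.w
  h := K.h
  w_pos := K.w_pos
  h_pos := K.h_pos

/-- For `a = (±1, ±1)`, the vertex of `K` in the direction `a` from its centre. -/
def vertex (K : Cell) (a : ℤ × ℤ) : Pt :=
  (K.x + (1 + (a.1 : ℝ)) / 2 * K.w, K.y + (1 + (a.2 : ℝ)) / 2 * K.h)

/-- The point with parameter `t ∈ [0, 1]` on the side of `K` in direction `u`, which is run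
through from the end `u + v` to the end `u - v`, where `v` is perpendicular to `u`. -/
def sidePt (K : Cell) (u v : ℤ × ℤ) (t : ℝ) : Pt :=
  AffineMap.lineMap (K.vertex (u + v)) (K.vertex (u - v)) t

/-- The closed side of `K` in direction `u`. -/
def side (K : Cell) (u : ℤ × ℤ) : Set Pt := K.sidePt u (rot u) '' Icc 0 1

/-- The side of `K` in direction `u` without its end points. -/
def openSide (K : Cell) (u : ℤ × ℤ) : Set Pt := K.sidePt u (rot u) '' Ioo 0 1

/-- The fraction `|e ∩ S| / |e|` for the side `e` of `K` in direction `u`. -/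
def sideFrac (K : Cell) (u : ℤ × ℤ) (S : Set Pt) : ℝ :=
  volume.real {t : ℝ | t ∈ Icc (0 : ℝ) 1 ∧ K.sidePt u (rot u) t ∈ S}

end Cell

/-- The macro-element `(⋃ K̄)°` made of the rectangles `K` of a list. -/
def macroElem (P : List Cell) : Set Pt := interior (⋃ K ∈ P, K.closed)

/-! ### Domain, interface, mesh -/

/-- The domain covered by a mesh: a union of rectangles. -/
def meshDomain (T : Finset Cell) : Set Pt := interior (⋃ K ∈ T, K.closed)

/-- The open set `U` has a `C²`-smooth boundary: near each boundary point, `U` is the sublevel set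
of a `C²` function with nonvanishing derivative. -/
def HasC2Boundary (U : Set Pt) : Prop :=
  ∀ p ∈ frontier U, ∃ φ : Pt → ℝ, ContDiffAt ℝ 2 φ p ∧ fderiv ℝ φ p ≠ 0 ∧
    ∀ᶠ z in 𝓝 p, (z ∈ U ↔ φ z < 0)

/-- The interface `Γ`, which is the boundary of `U`, crosses `K` once: `Γ ∩ K̄` is a simple arc
whose interior lies in `K` and whose end points lie on `∂K`, but not on one common closed side, and
the two parts into which the end points divide `∂K` lie on different sides of `Γ` (that is, `∂K`
meets both `U` and the exterior of `U`). -/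
def CrossedOnce (U : Set Pt) (K : Cell) : Prop :=
  ∃ γ : ℝ → Pt, ContinuousOn γ (Icc 0 1) ∧ InjOn γ (Icc 0 1) ∧
    γ '' Icc 0 1 = K.closed ∩ frontier U ∧
    (∀ t ∈ Ioo (0 : ℝ) 1, γ t ∈ K.toSet) ∧ γ 0 ∈ K.bdry ∧ γ 1 ∈ K.bdry ∧
    (∀ u ∈ dirs, ¬ (γ 0 ∈ K.side u ∧ γ 1 ∈ K.side u)) ∧
    (K.bdry ∩ U).Nonempty ∧ (K.bdry \ closure U).Nonempty

/-- A Cartesian mesh `T` (hanging nodes are allowed) of the domain `Ω = meshDomain T`, and a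
subdomain `Ω₁` with `closure Ω₁ ⊆ Ω` and `C²`-smooth boundary, the interface `Γ`, which crosses
every mesh element that it meets just once. -/
structure InterfaceMesh where
  T : Finset Cell
  Ω₁ : Set Pt
  disjoint : ∀ K ∈ T, ∀ K' ∈ T, K ≠ K' → Disjoint K.toSet K'.toSet
  isOpen_Ω₁ : IsOpen Ω₁
  closure_Ω₁ : closure Ω₁ ⊆ meshDomain T
  smooth : HasC2Boundary Ω₁
  crossed : ∀ K ∈ T, (K.toSet ∩ frontier Ω₁).Nonempty → CrossedOnce Ω₁ K

namespace InterfaceMesh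

variable (M : InterfaceMesh)

/-- The interface. -/
def Γ : Set Pt := frontier M.Ω₁

/-- The subdomain `Ω₂ = Ω \ closure Ω₁`. -/
def Ω₂ : Set Pt := meshDomain M.T \ closure M.Ω₁

/-- The two subdomains `Ω₁`, `Ω₂`, as an indexed family. -/
def sub : Fin 2 → Set Pt := ![M.Ω₁, M.Ω₂]

/-- `K ∈ 𝒯^Γ`: interface elements. -/
def IsInterface (K : Cell) : Prop := K ∈ M.T ∧ (K.toSet ∩ M.Γ).Nonempty

/-! ### Large elements -/

/-- For a rectangle `K` that meets `Γ`: every side `e` of `K` that meets `Ωᵢ` satisfies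
`|e ∩ Ωᵢ| ≥ δ |e|`. -/
def IsLargeFor (δ : ℝ) (i : Fin 2) (K : Cell) : Prop :=
  ∀ u ∈ dirs, (K.side u ∩ M.sub i).Nonempty → δ ≤ K.sideFrac u (M.sub i)

/-- `K` is a large element: it meets `Γ` and is large with respect to both subdomains. -/
def IsLarge (δ : ℝ) (K : Cell) : Prop :=
  (K.toSet ∩ M.Γ).Nonempty ∧ ∀ i, M.IsLargeFor δ i K

/-! ### Types of interface elements -/

/-- `Γ` cuts off a corner of `K`: it meets `∂K` in one inner point of each of two adjacent
sides. -/
def IsT1 (K : Cell) : Prop :=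
  M.IsInterface K ∧ ∃ u v, Perp u v ∧ ∃ A ∈ K.openSide u, ∃ B ∈ K.openSide v,
    K.bdry ∩ M.Γ = {A, B}

/-- `Γ` joins two opposite sides of `K`: it meets `∂K` in an inner point of the side `u` and in a
point, possibly a vertex, of the side `-u`. -/
def IsT2Along (K : Cell) (u : ℤ × ℤ) : Prop :=
  M.IsInterface K ∧ u ∈ dirs ∧ ∃ A ∈ K.openSide u, ∃ B ∈ K.side (-u), K.bdry ∩ M.Γ = {A, B}

def IsT2 (K : Cell) : Prop := ∃ u, M.IsT2Along K u

/-- `Γ` joins two opposite vertices of `K`. -/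
def IsT3 (K : Cell) : Prop :=
  M.IsInterface K ∧ ∃ u v, Perp u v ∧ K.bdry ∩ M.Γ = {K.vertex (u + v), K.vertex (-u - v)}

/-! ### Admissible chains -/

/-- `Γ̄_G ∪ Γ̄_{G'}` is a continuous curve, where `Γ_G = Γ ∩ G`. -/
def Linked (G G' : Cell) : Prop :=
  ∃ γ : ℝ → Pt, ContinuousOn γ (Icc 0 1) ∧
    γ '' Icc 0 1 = closure (M.Γ ∩ G.toSet) ∪ closure (M.Γ ∩ G'.toSet)

/-- The list `G₁, …, Gₙ` is closed: `G₁ = Gₙ` and `G₂, …, Gₙ` are at least three distinct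
elements. -/
def IsClosedList (C : List Cell) : Prop :=
  4 ≤ C.length ∧ C.head? = C.getLast? ∧ C.tail.Nodup

/-- A chain of interface elements `G₁ → ⋯ → Gₙ`.  The elements are distinct, except that the
chain may be closed. -/
def IsChain (C : List Cell) : Prop :=
  (∀ G ∈ C, M.IsInterface G) ∧ C.IsChain M.Linked ∧ (C.Nodup ∨ IsClosedList C)

/-- `S(K)_j`: the elements of the first `j` layers around `K`. -/
def layer (K : Cell) : ℕ → Set Cell
  | 0 => {K}
  | j + 1 => {K'' | K'' ∈ M.T ∧ ∃ K' ∈ layer K j, (K''.closed ∩ K'.closed).Nonempty}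

/-- `N` is the neighboring element of `K` that has the side of `K` in direction `u` as a common
side with `K`. -/
def NeighborAcross (K : Cell) (u : ℤ × ℤ) (N : Cell) : Prop :=
  N ∈ M.T ∧ N.side (-u) = K.side u

/-- The side `u` of `K` is a side of a neighboring element contained in `Ωᵢ`. -/
def HasNeighborIn (K : Cell) (u : ℤ × ℤ) (i : Fin 2) : Prop :=
  ∃ N, M.NeighborAcross K u N ∧ N.toSet ⊆ M.sub i

/-- All elements in `S(K)_2` have the size of `K`, and they form the full `5 × 5` block around
`K`. -/
def Rule1 (C : List Cell) : Prop :=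
  ∀ K ∈ C, M.layer K 2 = {K' | ∃ i j : ℤ, |i| ≤ 2 ∧ |j| ≤ 2 ∧ K' = K.shift (i, j)}

/-- Each closed side of a chain element `K` which lies in `Ωᵢ` is a side of a neighbor contained in
`Ωᵢ`.  For elements with a vertex on `Γ`: the same holds for the two (then open) sides of an
element of type 2 that join the two opposite sides met by `Γ`, and, for `i = 1, 2`, for at least
one of the two open sides in `Ωᵢ` of an element of type 3. -/
def Rule2 (C : List Cell) : Prop :=
  ∀ K ∈ C,
    (∀ u ∈ dirs, ∀ i, K.side u ⊆ M.sub i → M.HasNeighborIn K u i) ∧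
    (∀ u v, Perp u v → M.IsT2Along K u → ∀ i, K.openSide v ⊆ M.sub i → M.HasNeighborIn K v i) ∧
    (M.IsT3 K → ∀ i, ∃ u ∈ dirs, K.openSide u ⊆ M.sub i ∧ M.HasNeighborIn K u i)

/-- A non-interface element is neighboring at most two elements of the chain. -/
def Rule3 (C : List Cell) : Prop :=
  ∀ K ∈ M.T, ¬ M.IsInterface K →
    {G | G ∈ C ∧ ∃ u ∈ dirs, M.NeighborAcross K u G}.encard ≤ 2

/-- For each element `K ⊆ Ωᵢ` and `j = 1, 2`, the interface elements in `S(K)_j` are connected: the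
interior of the union of their closures is connected (or empty). -/
def Rule4 : Prop :=
  ∀ K ∈ M.T, ∀ i, K.toSet ⊆ M.sub i → ∀ j : ℕ, j = 1 ∨ j = 2 →
    IsPreconnected (interior (⋃ G ∈ {G | G ∈ M.layer K j ∧ M.IsInterface G}, G.closed))

/-- Admissible chains of interface elements. -/
def IsAdmissible (C : List Cell) : Prop :=
  M.IsChain C ∧ M.Rule1 C ∧ M.Rule2 C ∧ M.Rule3 C ∧ M.Rule4

/-- No interface element outside the chain follows `Gₙ` and precedes `G₁` along `Γ`. -/
def NoSingleGap (C : List Cell) : Prop :=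
  ∀ A ∈ C.head?, ∀ B ∈ C.getLast?, ∀ G, M.IsInterface G → G ∉ C →
    ¬ ((closure (M.Γ ∩ G.toSet) ∩ closure (M.Γ ∩ A.toSet)).Nonempty ∧
       (closure (M.Γ ∩ G.toSet) ∩ closure (M.Γ ∩ B.toSet)).Nonempty)

/-! ### The five patterns

The merging algorithm of each pattern returns `none` if all its interface elements are large and
are left as they are, and otherwise `some E`, where `E` lists the elements with which the interface
elements of the pattern are merged into one macro-element. -/

/-- The quotient `|e| / |s|`, where `s` is the side of `K` in direction `u` and `e ⊆ s` is the part
of `s` between its end `u + v` and `Γ`; here `v` is perpendicular to `u`. -/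
def part (K : Cell) (u v : ℤ × ℤ) : ℝ :=
  sInf {t : ℝ | t ∈ Icc (0 : ℝ) 1 ∧ K.sidePt u v t ∈ M.Γ}

open Classical in
/-- Pattern 1: `K` of type 1, `N₁ = K.shift u` and `N₂ = K.shift v` of type 2. -/
def merge1 (δ : ℝ) (K : Cell) (u v : ℤ × ℤ) : Option (List Cell) :=
  let N₁ := K.shift u
  let N₂ := K.shift v
  let D := K.shift (u + v)
  let G₁ := K.shift (u - v)
  let G₂ := K.shift (-v)
  let G₃ := K.shift (-u - v)
  let G₄ := K.shift (-u)
  let G₅ := K.shift (v - u)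
  let r₁ := M.part N₁ u (-v)
  let r₂ := M.part N₂ v (-u)
  if M.IsLarge δ N₁ ∧ M.IsLarge δ K ∧ M.IsLarge δ N₂ then none
  else if 2 * δ ≤ r₁ ∧ 2 * δ ≤ r₂ then some [D]
  else if 2 * δ ≤ r₁ ∧ r₂ < 2 * δ then some [D, G₄, G₅]
  else if r₁ < 2 * δ ∧ 2 * δ ≤ r₂ then some [D, G₁, G₂]
  else some [D, G₁, G₂, G₃, G₄, G₅]

open Classical in
/-- Pattern 2: `K`, `N₁ = K.shift u` and `N₂ = K.shift v` of type 1, where `Γ` leaves `N₁` through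
its side `-v` and `N₂` through its side `-u`. -/
def merge2 (δ : ℝ) (K : Cell) (u v : ℤ × ℤ) : Option (List Cell) :=
  let N₁ := K.shift u
  let N₂ := K.shift v
  let D := K.shift (u + v)
  let G₁ := K.shift (2 * u)
  let G₂ := K.shift (2 * u + v)
  let G₃ := K.shift (2 * u + 2 * v)
  let G₄ := K.shift (u + 2 * v)
  let G₅ := K.shift (2 * v)
  let r₁ := M.part N₁ (-v) u
  let r₂ := M.part N₂ (-u) v
  if M.IsLarge δ N₁ ∧ M.IsLarge δ K ∧ M.IsLarge δ N₂ then none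
  else if 2 * δ ≤ r₁ ∧ 2 * δ ≤ r₂ then some [D]
  else if 2 * δ ≤ r₁ ∧ r₂ < 2 * δ then some [D, G₄, G₅]
  else if r₁ < 2 * δ ∧ 2 * δ ≤ r₂ then some [D, G₁, G₂]
  else some [D, G₁, G₂, G₃, G₄, G₅]

open Classical in
/-- Pattern 3: `K` and `N = K.shift u` of type 1, where `Γ` leaves `K` through its side `w` and `N`
through its side `w'`, both perpendicular to `u`. -/
def merge3 (δ : ℝ) (K : Cell) (u w w' : ℤ × ℤ) : Option (List Cell) :=
  let N := K.shift u
  let G₁ := K.shift (2 * u)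
  let G₂ := K.shift (-u)
  let r₁ := M.part K w (-u)
  let r₂ := M.part N w' u
  if M.IsLarge δ K ∧ M.IsLarge δ N then none
  else if 2 * δ ≤ r₁ ∧ 2 * δ ≤ r₂ then some []
  else if 3 * δ ≤ r₁ then some [G₁]
  else if 3 * δ ≤ r₂ then some [G₂]
  else some [G₁, G₂]

open Classical in
/-- Pattern 4: `K` of type 2, `N₁ = K.shift (-u)` and `N₂ = K.shift u` of type 1, where `Γ` leaves
`N₁` through its side `w₁` and `N₂` through its side `w₂`, both perpendicular to `u`. -/
def merge4 (δ : ℝ) (K : Cell) (u w₁ w₂ : ℤ × ℤ) : Option (List Cell) :=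
  let N₁ := K.shift (-u)
  let N₂ := K.shift u
  let G₁ := K.shift (-(2 * u))
  let G₂ := K.shift (2 * u)
  let r₁ := M.part N₁ w₁ (-u)
  let r₂ := M.part N₂ w₂ u
  if M.IsLarge δ N₁ ∧ M.IsLarge δ K ∧ M.IsLarge δ N₂ then none
  else if 3 * δ ≤ r₁ ∧ 3 * δ ≤ r₂ then some []
  else if 4 * δ ≤ r₂ then some [G₁]
  else if 4 * δ ≤ r₁ then some [G₂]
  else some [G₁, G₂]

open Classical in
/-- Pattern 5: `K` of type 2, where `Γ` joins the sides `w` and `-w`, and `u` is one of the two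
directions perpendicular to `w`. -/
def merge5 (δ : ℝ) (K : Cell) (w u : ℤ × ℤ) : Option (List Cell) :=
  let G₁ := K.shift u
  let G₂ := K.shift (-u)
  let r₁ := M.part K w u
  let r₂ := M.part K (-w) u
  if M.IsLarge δ K then none
  else if r₁ < 1 - 2 * δ ∧ r₂ < 1 - 2 * δ then some [G₁]
  else if 2 * δ ≤ r₁ ∧ 2 * δ ≤ r₂ then some [G₂]
  else some [G₁, G₂]

/-- `E` is a possible result of the algorithm of pattern 1 for the input `(N₁, K, N₂)`. -/
def Alg1 (δ : ℝ) (N₁ K N₂ : Cell) (E : Option (List Cell)) : Prop :=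
  M.IsT2 N₁ ∧ M.IsT1 K ∧ M.IsT2 N₂ ∧ ∃ u v, Perp u v ∧ N₁ = K.shift u ∧ N₂ = K.shift v ∧
    E = M.merge1 δ K u v

/-- The same for pattern 2. -/
def Alg2 (δ : ℝ) (N₁ K N₂ : Cell) (E : Option (List Cell)) : Prop :=
  M.IsT1 N₁ ∧ M.IsT1 K ∧ M.IsT1 N₂ ∧ ∃ u v, Perp u v ∧ N₁ = K.shift u ∧ N₂ = K.shift v ∧
    (N₁.openSide (-v) ∩ M.Γ).Nonempty ∧ (N₂.openSide (-u) ∩ M.Γ).Nonempty ∧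
    E = M.merge2 δ K u v

/-- The same for pattern 3 and the input `(K, N)`. -/
def Alg3 (δ : ℝ) (K N : Cell) (E : Option (List Cell)) : Prop :=
  M.IsT1 K ∧ M.IsT1 N ∧ ∃ u w w', Perp u w ∧ Perp u w' ∧ N = K.shift u ∧
    (K.openSide w ∩ M.Γ).Nonempty ∧ (N.openSide w' ∩ M.Γ).Nonempty ∧
    E = M.merge3 δ K u w w'

/-- The same for pattern 4. -/
def Alg4 (δ : ℝ) (N₁ K N₂ : Cell) (E : Option (List Cell)) : Prop :=
  M.IsT1 N₁ ∧ M.IsT2 K ∧ M.IsT1 N₂ ∧ ∃ u w₁ w₂, Perp u w₁ ∧ Perp u w₂ ∧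
    N₁ = K.shift (-u) ∧ N₂ = K.shift u ∧
    (N₁.openSide w₁ ∩ M.Γ).Nonempty ∧ (N₂.openSide w₂ ∩ M.Γ).Nonempty ∧
    E = M.merge4 δ K u w₁ w₂

/-- The same for pattern 5 and the input `K`. -/
def Alg5 (δ : ℝ) (K : Cell) (E : Option (List Cell)) : Prop :=
  ∃ w u, Perp w u ∧ M.IsT2Along K w ∧ E = M.merge5 δ K w u

end InterfaceMesh

/-! ### The merging algorithm for a chain -/

/-- A call of one of the algorithms of the five patterns: its input and its result. -/
structure Call where
  inputs : List Cell
  result : Option (List Cell)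

namespace Call

/-- The elements that the call merges with its interface elements. -/
def used (c : Call) : List Cell := c.result.getD []

/-- The macro-element `M(K)` for an interface element `K` of the input. -/
def output (c : Call) (K : Cell) : Set Pt :=
  match c.result with
  | none => K.toSet
  | some E => macroElem (c.inputs ++ E)

end Call

/-- `K → L` are consecutive elements of the chain `C`. -/
def Consecutive (C : List Cell) (K L : Cell) : Prop := [K, L] <:+: C

/-- A subchain of `C`.  If `C` is closed, it may pass through the common first and last element
of `C`. -/
def IsSubchain (C S : List Cell) : Prop := S.Nodup ∧ S.IsChain (Consecutive C)

/-- An element that has not been an input of a call in `σ`. -/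
def Remaining (σ : List Call) (K : Cell) : Prop := ∀ c ∈ σ, K ∉ c.inputs

/-- The pairs `(S₁, S₂), (S₃, S₄), …` of a list; if the length is odd, the last three elements
form a triple. -/
def groups : List Cell → List (List Cell)
  | [a, b, c] => [[a, b, c]]
  | a :: b :: l => [a, b] :: groups l
  | _ => []

namespace InterfaceMesh

variable (M : InterfaceMesh)

/-- A maximal subchain of length at least two of elements of type 1. -/
def IsT1Run (C S : List Cell) : Prop :=
  IsSubchain C S ∧ 2 ≤ S.length ∧ (∀ K ∈ S, M.IsT1 K) ∧
    (∀ L ∈ S.head?, ∀ K, Consecutive C K L → ¬ M.IsT1 K) ∧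
    (∀ L ∈ S.getLast?, ∀ K, Consecutive C L K → ¬ M.IsT1 K)

/-- The call `c` can be made in step `k` of the merging algorithm for the chain `C`, after the
calls in `σ` have been made. -/
def Available (δ : ℝ) (C : List Cell) (σ : List Call) (c : Call) : ℕ → Prop
  | 1 => (∀ K ∈ c.inputs, Remaining σ K) ∧ (∃ S, M.IsT1Run C S ∧ c.inputs ∈ groups S) ∧
      ((∃ N₁ K N₂, c.inputs = [N₁, K, N₂] ∧ M.Alg2 δ N₁ K N₂ c.result) ∨
       (∃ K N, c.inputs = [K, N] ∧ M.Alg3 δ K N c.result))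
  | 2 => (∀ K ∈ c.inputs, Remaining σ K) ∧ IsSubchain C c.inputs ∧
      ∃ N₁ K N₂, c.inputs = [N₁, K, N₂] ∧ M.Alg4 δ N₁ K N₂ c.result
  | 3 => (∀ K ∈ c.inputs, Remaining σ K) ∧ IsSubchain C c.inputs ∧
      ∃ N₁ K N₂, c.inputs = [N₁, K, N₂] ∧ M.Alg1 δ N₁ K N₂ c.result
  | 4 => (∀ K ∈ c.inputs, Remaining σ K) ∧ ∃ K ∈ C, c.inputs = [K] ∧ M.Alg5 δ K c.result
  | _ => False

/-- One step of an execution of the merging algorithm: a call is made which is available in step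
`k`, while none is available in an earlier step.  The order of the calls within a step and the
choice of overlapping subchains are left open.  A state is the list of the calls made so far. -/
def Step (δ : ℝ) (C : List Cell) (σ σ' : List Call) : Prop :=
  ∃ c k, M.Available δ C σ c k ∧ (∀ j < k, ∀ c', ¬ M.Available δ C σ c' j) ∧ σ' = c :: σ

/-- `σ` is the list of all calls of an execution that has come to its end. -/
def IsFinal (δ : ℝ) (C : List Cell) (σ : List Call) : Prop :=
  Relation.ReflTransGen (M.Step δ C) [] σ ∧ ∀ σ', ¬ M.Step δ C σ σ'

end InterfaceMesh

/-- The locally induced mesh: the elements `M(K)` for `K` in the chain, where `M(K) = K` if `K`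
was not an input of a call. -/
def induced (C : List Cell) (σ : List Call) : Set (Set Pt) :=
  {U | (∃ c ∈ σ, ∃ K ∈ c.inputs, U = c.output K) ∨ (∃ K ∈ C, Remaining σ K ∧ U = K.toSet)}

end Merging

end

noncomputable section

namespace Merging

/-! ### Frames -/

/-! The proof separates the geometry of `Γ` near the chain from the bookkeeping of the algorithm.

Geometry. `Γ` meets the boundary of an interface element in two points, so an element of type 1 or 2
is described by the places where it is crossed (`T1Data`, `T2Data`). Smoothness enters through
`vertex_notMem`: at a vertex on `Γ` that belongs to three interface elements, the level function of
`Γ` would have a local maximum along one mesh line and a local minimum along the other, so its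
derivative would vanish. Hence an inner element of the chain touches no interface elements but its
two neighbours in the chain (`chainNbr_of_touch`). With Rule 2, a chain element with interface
neighbours in two perpendicular directions is of type 1 (`turn`). Rule 4, read as an induction over
elements with common sides (`ring_of_rule4`), and Rule 3 show that a non-interface element never has
two opposite neighbours in the chain (`false_of_opposite`), and that two adjacent ones are joined by
an element of type 1 (`corner`).

No double use. An element `G` used by a call is in one of three positions: all interface elements of
its first or second layer are inputs; two inputs are neighbours of `G`; or one input is, with a
condition on the inputs next to it (`SideUse`). The first position excludes any use by a call with
disjoint inputs, the second one does so by Rule 3. If two calls use `G` in the third position, then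
`corner` gives an element of type 1 between their inputs; some call treats it together with one of
its chain neighbours, which are inputs of the two calls, so it is an input of one of them, and
`SideUse` makes both its chain neighbours inputs of the same call (`not_usable_twice`).

Algorithm. The calls have disjoint nonempty inputs in the chain, hence there are finitely many. That
nothing of type 1 or 2 is left over rests on `Invariant`: the groups of a run are treated as a
whole, and an element of type 1 without neighbours of type 1 keeps its chain neighbours untreated
until its own turn, since a call that takes one of them away would come too early in the order of
the steps.

Largeness. A side of a macro-element made of `n ≤ 5` element sides is large for `Ωᵢ` if `Ωᵢ`
contains a whole element side (as `n δ ≤ 1`) or the fraction `n δ` of one. Where `Γ` crosses an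
element side, the part on either hand either continues into an element side that `Γ` does not cross,
or it ends at a corner of the macro-element, and there the thresholds of the patterns demand `n δ`
(`le_sideFrac_box`). Elements that are never an input are of type 3, and each of their open sides
lies in one subdomain. -/

theorem Perp.cases {u v : ℤ × ℤ} (h : Perp u v) :
    (u = (1, 0) ∧ v = (0, 1)) ∨ (u = (1, 0) ∧ v = (0, -1)) ∨ (u = (0, 1) ∧ v = (1, 0)) ∨
    (u = (0, 1) ∧ v = (-1, 0)) ∨ (u = (-1, 0) ∧ v = (0, 1)) ∨ (u = (-1, 0) ∧ v = (0, -1)) ∨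
    (u = (0, -1) ∧ v = (1, 0)) ∨ (u = (0, -1) ∧ v = (-1, 0)) := by
  obtain ⟨hu, hv, h⟩ := h
  simp only [dirs, Finset.mem_insert, Finset.mem_singleton] at hu
  rcases hu with rfl | rfl | rfl | rfl <;> rcases h with rfl | rfl <;> simp [rot]

theorem Perp.of_rot {u : ℤ × ℤ} (h : u ∈ dirs) : Perp u (rot u) := by
  refine ⟨h, ?_, Or.inl rfl⟩
  simp only [dirs, Finset.mem_insert, Finset.mem_singleton] at h ⊢
  rcases h with rfl | rfl | rfl | rfl <;> simp [rot]

theorem Perp.symm {u v : ℤ × ℤ} (h : Perp u v) : Perp v u := by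
  rcases h.cases with ⟨rfl, rfl⟩ | ⟨rfl, rfl⟩ | ⟨rfl, rfl⟩ | ⟨rfl, rfl⟩ | ⟨rfl, rfl⟩ | ⟨rfl, rfl⟩ |
    ⟨rfl, rfl⟩ | ⟨rfl, rfl⟩ <;> simp [Perp, dirs, rot]

theorem Perp.neg_left {u v : ℤ × ℤ} (h : Perp u v) : Perp (-u) v := by
  rcases h.cases with ⟨rfl, rfl⟩ | ⟨rfl, rfl⟩ | ⟨rfl, rfl⟩ | ⟨rfl, rfl⟩ | ⟨rfl, rfl⟩ | ⟨rfl, rfl⟩ |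
    ⟨rfl, rfl⟩ | ⟨rfl, rfl⟩ <;> simp [Perp, dirs, rot]

theorem Perp.neg_right {u v : ℤ × ℤ} (h : Perp u v) : Perp u (-v) := h.symm.neg_left.symm

theorem Perp.mem_dirs_iff {u v : ℤ × ℤ} (h : Perp u v) (d : ℤ × ℤ) :
    d ∈ dirs ↔ d = u ∨ d = v ∨ d = -u ∨ d = -v := by
  rcases h.cases with ⟨rfl, rfl⟩ | ⟨rfl, rfl⟩ | ⟨rfl, rfl⟩ | ⟨rfl, rfl⟩ | ⟨rfl, rfl⟩ | ⟨rfl, rfl⟩ |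
    ⟨rfl, rfl⟩ | ⟨rfl, rfl⟩ <;> simp [dirs] <;> tauto

theorem neg_mem_dirs {u : ℤ × ℤ} (h : u ∈ dirs) : -u ∈ dirs := (Perp.of_rot h).neg_left.1

theorem Perp.eq_or_of_perp {u v w : ℤ × ℤ} (h : Perp u v) (h' : Perp u w) : w = v ∨ w = -v := by
  rcases h.2.2 with rfl | rfl <;> rcases h'.2.2 with rfl | rfl <;> simp

namespace Cell

/-- The point with coordinates `s`, `t` with respect to the directions `u`, `v`, the centre of `K`
being the origin and half the lengths of the sides the units. -/
def uv (K : Cell) (u v : ℤ × ℤ) (s t : ℝ) : Pt :=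
  (K.x + (1 + (s * u.1 + t * v.1)) / 2 * K.w, K.y + (1 + (s * u.2 + t * v.2)) / 2 * K.h)

/-- The translate of `K` by `a` lengths in direction `u` and `b` lengths in direction `v`. -/
def cell (K : Cell) (u v : ℤ × ℤ) (a b : ℤ) : Cell := K.shift (a • u + b • v)

variable (K : Cell) {u v : ℤ × ℤ}

@[simp] theorem shift_w (a : ℤ × ℤ) : (K.shift a).w = K.w := rfl
@[simp] theorem shift_h (a : ℤ × ℤ) : (K.shift a).h = K.h := rfl

theorem shift_shift (a b : ℤ × ℤ) : (K.shift a).shift b = K.shift (a + b) := by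
  ext <;> simp [shift] <;> ring

@[simp] theorem shift_zero : K.shift 0 = K := by
  ext <;> simp [shift]

theorem shift_inj {a b : ℤ × ℤ} : K.shift a = K.shift b ↔ a = b := by
  refine ⟨fun h => ?_, fun h => h ▸ rfl⟩
  have h1 := congrArg Cell.x h
  have h2 := congrArg Cell.y h
  have hw := K.w_pos
  have hh := K.h_pos
  simp only [shift, add_right_inj, mul_eq_mul_right_iff, hw.ne', hh.ne', or_false,
    Int.cast_inj] at h1 h2
  exact Prod.ext h1 h2

theorem cell_cell (a b a' b' : ℤ) :
    (K.cell u v a b).cell u v a' b' = K.cell u v (a + a') (b + b') := by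
  rw [cell, cell, shift_shift, cell]; congr 1; module

theorem cell_inj (h : Perp u v) {a b a' b' : ℤ} :
    K.cell u v a b = K.cell u v a' b' ↔ a = a' ∧ b = b' := by
  rw [cell, cell, shift_inj]
  rcases h.cases with ⟨rfl, rfl⟩ | ⟨rfl, rfl⟩ | ⟨rfl, rfl⟩ | ⟨rfl, rfl⟩ | ⟨rfl, rfl⟩ | ⟨rfl, rfl⟩ |
    ⟨rfl, rfl⟩ | ⟨rfl, rfl⟩ <;> simp [and_comm]

@[simp] theorem cell_zero : K.cell u v 0 0 = K := by simp [cell]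

theorem shift_left : K.shift u = K.cell u v 1 0 := by simp [cell]
theorem shift_right : K.shift v = K.cell u v 0 1 := by simp [cell]
theorem shift_neg_left : K.shift (-u) = K.cell u v (-1) 0 := by simp [cell]
theorem shift_neg_right : K.shift (-v) = K.cell u v 0 (-1) := by simp [cell]

theorem cell_comm (a b : ℤ) : K.cell v u b a = K.cell u v a b := by
  rw [cell, cell, add_comm]

theorem cell_neg (a b : ℤ) : K.cell (-u) v a b = K.cell u v (-a) b := by
  simp [cell]

theorem exists_cell (h : Perp u v) (x : ℤ × ℤ) : ∃ a b : ℤ, x = a • u + b • v := by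
  obtain ⟨m, n⟩ := x
  rcases h.cases with ⟨rfl, rfl⟩ | ⟨rfl, rfl⟩ | ⟨rfl, rfl⟩ | ⟨rfl, rfl⟩ | ⟨rfl, rfl⟩ | ⟨rfl, rfl⟩ |
    ⟨rfl, rfl⟩ | ⟨rfl, rfl⟩
  · exact ⟨m, n, by simp⟩
  · exact ⟨m, -n, by simp⟩
  · exact ⟨n, m, by simp⟩
  · exact ⟨n, -m, by simp⟩
  · exact ⟨-m, n, by simp⟩
  · exact ⟨-m, -n, by simp⟩
  · exact ⟨-n, m, by simp⟩
  · exact ⟨-n, -m, by simp⟩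

theorem frame_abs (h : Perp u v) (a b : ℤ) (n : ℤ) :
    (|(a • u + b • v).1| ≤ n ∧ |(a • u + b • v).2| ≤ n) ↔ |a| ≤ n ∧ |b| ≤ n := by
  rcases h.cases with ⟨rfl, rfl⟩ | ⟨rfl, rfl⟩ | ⟨rfl, rfl⟩ | ⟨rfl, rfl⟩ | ⟨rfl, rfl⟩ | ⟨rfl, rfl⟩ |
    ⟨rfl, rfl⟩ | ⟨rfl, rfl⟩ <;> simp [and_comm]

theorem sidePt_eq (t : ℝ) : K.sidePt u v t = K.uv u v 1 (1 - 2 * t) := by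
  ext <;> simp [sidePt, vertex, uv, AffineMap.lineMap_apply] <;> ring

theorem vertex_eq (a b : ℤ) : K.vertex (a • u + b • v) = K.uv u v a b := by
  ext <;> simp [vertex, uv]

theorem vertex_add : K.vertex (u + v) = K.uv u v 1 1 := by
  simpa using K.vertex_eq (u := u) (v := v) 1 1

theorem vertex_neg : K.vertex (-u - v) = K.uv u v (-1) (-1) := by
  have := K.vertex_eq (u := u) (v := v) (-1) (-1)
  rw [← show (-1 : ℤ) • u + (-1 : ℤ) • v = -u - v by module]
  simpa using this

theorem uv_cell (a b : ℤ) (s t : ℝ) :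
    (K.cell u v a b).uv u v s t = K.uv u v (s + 2 * a) (t + 2 * b) := by
  ext <;> simp [uv, cell, shift] <;> ring

theorem uv_comm (s t : ℝ) : K.uv v u t s = K.uv u v s t := by
  ext <;> simp only [uv] <;> ring

theorem uv_neg_left (s t : ℝ) : K.uv (-u) v s t = K.uv u v (-s) t := by
  ext <;> simp [uv]

theorem uv_neg_right (s t : ℝ) : K.uv u (-v) s t = K.uv u v s (-t) := by
  ext <;> simp [uv]

theorem continuous_uv : Continuous fun q : ℝ × ℝ => K.uv u v q.1 q.2 := by
  unfold uv; fun_prop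

theorem uv_surj (h : Perp u v) (p : Pt) : ∃ s t, K.uv u v s t = p := by
  have hw := K.w_pos.ne'
  have hh := K.h_pos.ne'
  obtain ⟨p1, p2⟩ := p
  rcases h.cases with ⟨rfl, rfl⟩ | ⟨rfl, rfl⟩ | ⟨rfl, rfl⟩ | ⟨rfl, rfl⟩ | ⟨rfl, rfl⟩ | ⟨rfl, rfl⟩ |
    ⟨rfl, rfl⟩ | ⟨rfl, rfl⟩
  · exact ⟨(p1 - K.x) / K.w * 2 - 1, (p2 - K.y) / K.h * 2 - 1, by ext <;> simp [uv] <;> field_simp <;> ring⟩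
  · exact ⟨(p1 - K.x) / K.w * 2 - 1, -((p2 - K.y) / K.h * 2 - 1), by ext <;> simp [uv] <;> field_simp <;> ring⟩
  · exact ⟨(p2 - K.y) / K.h * 2 - 1, (p1 - K.x) / K.w * 2 - 1, by ext <;> simp [uv] <;> field_simp <;> ring⟩
  · exact ⟨(p2 - K.y) / K.h * 2 - 1, -((p1 - K.x) / K.w * 2 - 1), by ext <;> simp [uv] <;> field_simp <;> ring⟩
  · exact ⟨-((p1 - K.x) / K.w * 2 - 1), (p2 - K.y) / K.h * 2 - 1, by ext <;> simp [uv] <;> field_simp <;> ring⟩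
  · exact ⟨-((p1 - K.x) / K.w * 2 - 1), -((p2 - K.y) / K.h * 2 - 1), by ext <;> simp [uv] <;> field_simp <;> ring⟩
  · exact ⟨-((p2 - K.y) / K.h * 2 - 1), (p1 - K.x) / K.w * 2 - 1, by ext <;> simp [uv] <;> field_simp <;> ring⟩
  · exact ⟨-((p2 - K.y) / K.h * 2 - 1), -((p1 - K.x) / K.w * 2 - 1), by ext <;> simp [uv] <;> field_simp <;> ring⟩

theorem le_aux {c w s : ℝ} (hw : 0 < w) :
    (c ≤ c + (1 + s) / 2 * w ↔ -1 ≤ s) ∧ (c + (1 + s) / 2 * w ≤ c + w ↔ s ≤ 1) ∧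
    (c < c + (1 + s) / 2 * w ↔ -1 < s) ∧ (c + (1 + s) / 2 * w < c + w ↔ s < 1) := by
  refine ⟨⟨fun h => ?_, fun h => ?_⟩, ⟨fun h => ?_, fun h => ?_⟩, ⟨fun h => ?_, fun h => ?_⟩,
    ⟨fun h => ?_, fun h => ?_⟩⟩ <;> nlinarith

/-- A frame only permutes the two coordinates and changes their signs, so a condition that is even
and imposed on both coordinates looks the same in all eight frames. -/
theorem frame_even (h : Perp u v) {P : ℝ → Prop} (hP : ∀ x, P (-x) ↔ P x) (s t : ℝ) :
    P (s * u.1 + t * v.1) ∧ P (s * u.2 + t * v.2) ↔ P s ∧ P t := by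
  rcases h.cases with ⟨rfl, rfl⟩ | ⟨rfl, rfl⟩ | ⟨rfl, rfl⟩ | ⟨rfl, rfl⟩ | ⟨rfl, rfl⟩ | ⟨rfl, rfl⟩ |
    ⟨rfl, rfl⟩ | ⟨rfl, rfl⟩ <;> simp [hP, and_comm]

theorem uv_mem_closed (h : Perp u v) {s t : ℝ} :
    K.uv u v s t ∈ K.closed ↔ (-1 ≤ s ∧ s ≤ 1) ∧ (-1 ≤ t ∧ t ≤ 1) := by
  have e (c w : ℝ) (s : ℝ) (hw : 0 < w) := @le_aux c w s hw
  have h1 := fun s => e K.x K.w s K.w_pos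
  have h2 := fun s => e K.y K.h s K.h_pos
  simp only [uv, closed, mem_prod, mem_Icc, (h1 _).1, (h1 _).2.1, (h2 _).1, (h2 _).2.1]
  exact frame_even h (P := fun x => -1 ≤ x ∧ x ≤ 1)
    (fun x => ⟨fun h => ⟨by linarith [h.2], by linarith [h.1]⟩,
      fun h => ⟨by linarith [h.2], by linarith [h.1]⟩⟩) s t

theorem uv_mem_toSet (h : Perp u v) {s t : ℝ} :
    K.uv u v s t ∈ K.toSet ↔ (-1 < s ∧ s < 1) ∧ (-1 < t ∧ t < 1) := by
  have e (c w : ℝ) (s : ℝ) (hw : 0 < w) := @le_aux c w s hw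
  have h1 := fun s => e K.x K.w s K.w_pos
  have h2 := fun s => e K.y K.h s K.h_pos
  simp only [uv, toSet, mem_prod, mem_Ioo, (h1 _).2.2, (h2 _).2.2]
  exact frame_even h (P := fun x => -1 < x ∧ x < 1)
    (fun x => ⟨fun h => ⟨by linarith [h.2], by linarith [h.1]⟩,
      fun h => ⟨by linarith [h.2], by linarith [h.1]⟩⟩) s t

theorem uv_inj (h : Perp u v) {s t s' t' : ℝ} :
    K.uv u v s t = K.uv u v s' t' ↔ s = s' ∧ t = t' := by
  refine ⟨fun e => ?_, fun ⟨e, e'⟩ => by rw [e, e']⟩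
  have h1 := congrArg Prod.fst e
  have h2 := congrArg Prod.snd e
  simp only [uv, add_right_inj, mul_eq_mul_right_iff, K.w_pos.ne', K.h_pos.ne', or_false] at h1 h2
  rcases h.cases with ⟨rfl, rfl⟩ | ⟨rfl, rfl⟩ | ⟨rfl, rfl⟩ | ⟨rfl, rfl⟩ | ⟨rfl, rfl⟩ | ⟨rfl, rfl⟩ |
    ⟨rfl, rfl⟩ | ⟨rfl, rfl⟩ <;> norm_num at * <;> constructor <;> linarith

theorem uv_mem_cell_closed (h : Perp u v) {s t : ℝ} (a b : ℤ) :
    K.uv u v s t ∈ (K.cell u v a b).closed ↔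
      (2 * a - 1 ≤ s ∧ s ≤ 2 * a + 1) ∧ (2 * b - 1 ≤ t ∧ t ≤ 2 * b + 1) := by
  have := (K.cell u v a b).uv_mem_closed h (s := s - 2 * a) (t := t - 2 * b)
  rw [uv_cell] at this
  simp only [sub_add_cancel] at this
  rw [this]
  constructor <;> rintro ⟨⟨_, _⟩, ⟨_, _⟩⟩ <;> refine ⟨⟨?_, ?_⟩, ⟨?_, ?_⟩⟩ <;> linarith

theorem uv_mem_bdry (h : Perp u v) {s t : ℝ} :
    K.uv u v s t ∈ K.bdry ↔ ((-1 ≤ s ∧ s ≤ 1) ∧ (-1 ≤ t ∧ t ≤ 1)) ∧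
      (s = 1 ∨ s = -1 ∨ t = 1 ∨ t = -1) := by
  rw [bdry, mem_sdiff, K.uv_mem_closed h, K.uv_mem_toSet h]
  refine and_congr_right fun ⟨⟨h1, h2⟩, ⟨h3, h4⟩⟩ => ?_
  constructor
  · intro hn
    by_contra! hc
    exact hn ⟨⟨lt_of_le_of_ne h1 (Ne.symm hc.2.1), lt_of_le_of_ne h2 hc.1⟩,
      ⟨lt_of_le_of_ne h3 (Ne.symm hc.2.2.2), lt_of_le_of_ne h4 hc.2.2.1⟩⟩
  · rintro (rfl | rfl | rfl | rfl) <;> norm_num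

theorem side_eq (h : Perp u v) : K.side u = {p | ∃ t, -1 ≤ t ∧ t ≤ 1 ∧ p = K.uv u v 1 t} := by
  ext p
  simp only [side, mem_image, mem_Icc, sidePt_eq, mem_ofPred_eq]
  rcases h.2.2 with e | e
  · rw [← e]
    exact ⟨fun ⟨t, ⟨h1, h2⟩, hp⟩ => ⟨1 - 2 * t, by linarith, by linarith, hp.symm⟩,
      fun ⟨t, h1, h2, hp⟩ => ⟨(1 - t) / 2, ⟨by linarith, by linarith⟩, by
        rw [hp]; congr 1; ring⟩⟩
  · rw [show rot u = -v by rw [e, neg_neg]]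
    simp only [uv_neg_right]
    exact ⟨fun ⟨t, ⟨h1, h2⟩, hp⟩ => ⟨-(1 - 2 * t), by linarith, by linarith, hp.symm⟩,
      fun ⟨t, h1, h2, hp⟩ => ⟨(1 + t) / 2, ⟨by linarith, by linarith⟩, by
        rw [hp]; congr 1; ring⟩⟩

theorem openSide_eq (h : Perp u v) :
    K.openSide u = {p | ∃ t, -1 < t ∧ t < 1 ∧ p = K.uv u v 1 t} := by
  ext p
  simp only [openSide, mem_image, mem_Ioo, sidePt_eq, mem_ofPred_eq]
  rcases h.2.2 with e | e
  · rw [← e]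
    exact ⟨fun ⟨t, ⟨h1, h2⟩, hp⟩ => ⟨1 - 2 * t, by linarith, by linarith, hp.symm⟩,
      fun ⟨t, h1, h2, hp⟩ => ⟨(1 - t) / 2, ⟨by linarith, by linarith⟩, by
        rw [hp]; congr 1; ring⟩⟩
  · rw [show rot u = -v by rw [e, neg_neg]]
    simp only [uv_neg_right]
    exact ⟨fun ⟨t, ⟨h1, h2⟩, hp⟩ => ⟨-(1 - 2 * t), by linarith, by linarith, hp.symm⟩,
      fun ⟨t, h1, h2, hp⟩ => ⟨(1 + t) / 2, ⟨by linarith, by linarith⟩, by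
        rw [hp]; congr 1; ring⟩⟩

theorem uv_mem_side (h : Perp u v) {s t : ℝ} :
    K.uv u v s t ∈ K.side u ↔ s = 1 ∧ -1 ≤ t ∧ t ≤ 1 := by
  simp only [K.side_eq h, mem_ofPred_eq, K.uv_inj h]
  exact ⟨fun ⟨t', h1, h2, h3, h4⟩ => ⟨h3, h4 ▸ h1, h4 ▸ h2⟩, fun ⟨h1, h2, h3⟩ => ⟨t, h2, h3, h1, rfl⟩⟩

theorem uv_mem_openSide (h : Perp u v) {s t : ℝ} :
    K.uv u v s t ∈ K.openSide u ↔ s = 1 ∧ -1 < t ∧ t < 1 := by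
  simp only [K.openSide_eq h, mem_ofPred_eq, K.uv_inj h]
  exact ⟨fun ⟨t', h1, h2, h3, h4⟩ => ⟨h3, h4 ▸ h1, h4 ▸ h2⟩, fun ⟨h1, h2, h3⟩ => ⟨t, h2, h3, h1, rfl⟩⟩

theorem uv_mem_side_neg (h : Perp u v) {s t : ℝ} :
    K.uv u v s t ∈ K.side (-u) ↔ s = -1 ∧ -1 ≤ t ∧ t ≤ 1 := by
  have := K.uv_mem_side h.neg_left (s := -s) (t := t)
  rw [uv_neg_left, neg_neg] at this
  rw [this, neg_eq_iff_eq_neg]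

theorem uv_mem_openSide_neg (h : Perp u v) {s t : ℝ} :
    K.uv u v s t ∈ K.openSide (-u) ↔ s = -1 ∧ -1 < t ∧ t < 1 := by
  have := K.uv_mem_openSide h.neg_left (s := -s) (t := t)
  rw [uv_neg_left, neg_neg] at this
  rw [this, neg_eq_iff_eq_neg]

theorem uv_mem_side' (h : Perp u v) {s t : ℝ} :
    K.uv u v s t ∈ K.side v ↔ t = 1 ∧ -1 ≤ s ∧ s ≤ 1 := by
  rw [← uv_comm, K.uv_mem_side h.symm]

theorem uv_mem_openSide' (h : Perp u v) {s t : ℝ} :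
    K.uv u v s t ∈ K.openSide v ↔ t = 1 ∧ -1 < s ∧ s < 1 := by
  rw [← uv_comm, K.uv_mem_openSide h.symm]

theorem uv_mem_side_neg' (h : Perp u v) {s t : ℝ} :
    K.uv u v s t ∈ K.side (-v) ↔ t = -1 ∧ -1 ≤ s ∧ s ≤ 1 := by
  rw [← uv_comm, K.uv_mem_side_neg h.symm]

theorem uv_mem_openSide_neg' (h : Perp u v) {s t : ℝ} :
    K.uv u v s t ∈ K.openSide (-v) ↔ t = -1 ∧ -1 < s ∧ s < 1 := by
  rw [← uv_comm, K.uv_mem_openSide_neg h.symm]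

theorem side_subset_bdry {d : ℤ × ℤ} (hd : d ∈ dirs) : K.side d ⊆ K.bdry := by
  have h := Perp.of_rot hd
  rw [K.side_eq h]
  rintro _ ⟨t, h1, h2, rfl⟩
  rw [K.uv_mem_bdry h]
  exact ⟨⟨by norm_num, h1, h2⟩, by simp⟩

theorem bdry_subset_closed : K.bdry ⊆ K.closed := sdiff_subset

theorem openSide_subset_side (d : ℤ × ℤ) : K.openSide d ⊆ K.side d :=
  image_mono Ioo_subset_Icc_self

theorem side_subset_closed {d : ℤ × ℤ} (hd : d ∈ dirs) : K.side d ⊆ K.closed :=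
  (K.side_subset_bdry hd).trans K.bdry_subset_closed

theorem exists_side_of_mem_bdry (h : Perp u v) {p : Pt} (hp : p ∈ K.bdry) :
    p ∈ K.side u ∨ p ∈ K.side v ∨ p ∈ K.side (-u) ∨ p ∈ K.side (-v) := by
  obtain ⟨s, t, rfl⟩ := K.uv_surj h p
  rw [K.uv_mem_bdry h] at hp
  rw [K.uv_mem_side h, K.uv_mem_side' h, K.uv_mem_side_neg h, K.uv_mem_side_neg' h]
  tauto

theorem side_shift {d : ℤ × ℤ} (hd : d ∈ dirs) : (K.shift d).side (-d) = K.side d := by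
  have h := Perp.of_rot hd
  have hs (N : Cell) : N.side (-d) = {p | ∃ t, -1 ≤ t ∧ t ≤ 1 ∧ p = N.uv d (rot d) (-1) t} := by
    rw [N.side_eq h.neg_left]; simp only [uv_neg_left]
  rw [hs, K.side_eq h, shift_left (v := rot d)]
  simp only [uv_cell]
  norm_num

theorem openSide_shift {d : ℤ × ℤ} (hd : d ∈ dirs) :
    (K.shift d).openSide (-d) = K.openSide d := by
  have h := Perp.of_rot hd
  have hs (N : Cell) :
      N.openSide (-d) = {p | ∃ t, -1 < t ∧ t < 1 ∧ p = N.uv d (rot d) (-1) t} := by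
    rw [N.openSide_eq h.neg_left]; simp only [uv_neg_left]
  rw [hs, K.openSide_eq h, shift_left (v := rot d)]
  simp only [uv_cell]
  norm_num

/-! ### Topology of cells -/

theorem isOpen_toSet : IsOpen K.toSet := isOpen_Ioo.prod isOpen_Ioo

theorem isClosed_closed : IsClosed K.closed := isClosed_Icc.prod isClosed_Icc

theorem closure_toSet : closure K.toSet = K.closed := by
  rw [toSet, closure_prod_eq, closure_Ioo (by linarith [K.w_pos] : K.x ≠ K.x + K.w),
    closure_Ioo (by linarith [K.h_pos] : K.y ≠ K.y + K.h), closed]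

theorem interior_closed : interior K.closed = K.toSet := by
  rw [closed, interior_prod_eq, interior_Icc, interior_Icc, toSet]

theorem toSet_subset_closed : K.toSet ⊆ K.closed := K.closure_toSet ▸ subset_closure

theorem isPreconnected_toSet : IsPreconnected K.toSet :=
  isPreconnected_Ioo.prod isPreconnected_Ioo

theorem toSet_nonempty : K.toSet.Nonempty :=
  ⟨K.uv (1, 0) (0, 1) 0 0, (K.uv_mem_toSet (by simp [Perp, dirs, rot])).2 (by norm_num)⟩

theorem continuous_sidePt (u v : ℤ × ℤ) : Continuous (K.sidePt u v) := by
  have : K.sidePt u v = fun t => K.uv u v 1 (1 - 2 * t) := funext fun t => K.sidePt_eq t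
  rw [this]
  exact K.continuous_uv.comp (by fun_prop : Continuous fun t : ℝ => ((1 : ℝ), 1 - 2 * t))

theorem isPreconnected_side (d : ℤ × ℤ) : IsPreconnected (K.side d) :=
  isPreconnected_Icc.image _ (K.continuous_sidePt _ _).continuousOn

theorem side_subset_closure_openSide (d : ℤ × ℤ) : K.side d ⊆ closure (K.openSide d) := by
  rw [side, openSide, ← closure_Ioo (zero_ne_one' ℝ)]
  exact image_closure_subset_closure_image (K.continuous_sidePt _ _)

/-- The open block made of `K` and the `n` layers of translates around it. -/
def openBlock (n : ℕ) : Set Pt :=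
  Ioo (K.x - n * K.w) (K.x + (n + 1) * K.w) ×ˢ Ioo (K.y - n * K.h) (K.y + (n + 1) * K.h)

theorem isOpen_openBlock (n : ℕ) : IsOpen (K.openBlock n) := isOpen_Ioo.prod isOpen_Ioo

theorem exists_index {x w p : ℝ} (hw : 0 < w) {n : ℕ} (h1 : x - n * w < p)
    (h2 : p < x + (n + 1) * w) : ∃ i : ℤ, |i| ≤ n ∧ x + i * w ≤ p ∧ p ≤ x + i * w + w := by
  refine ⟨⌊(p - x) / w⌋, ?_, ?_, ?_⟩
  · rw [abs_le]
    constructor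
    · rw [Int.le_floor, le_div_iff₀ hw]; push_cast; linarith
    · rw [← Int.lt_add_one_iff, Int.floor_lt, div_lt_iff₀ hw]; push_cast; linarith
  · have := Int.floor_le ((p - x) / w)
    rw [le_div_iff₀ hw] at this; linarith
  · have := Int.lt_floor_add_one ((p - x) / w)
    rw [div_lt_iff₀ hw] at this; linarith

theorem exists_shift_of_mem_openBlock {n : ℕ} {p : Pt} (hp : p ∈ K.openBlock n) :
    ∃ i j : ℤ, |i| ≤ n ∧ |j| ≤ n ∧ p ∈ (K.shift (i, j)).closed := by
  obtain ⟨⟨h1, h2⟩, ⟨h3, h4⟩⟩ := hp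
  obtain ⟨i, hi, hi1, hi2⟩ := exists_index K.w_pos h1 h2
  obtain ⟨j, hj, hj1, hj2⟩ := exists_index K.h_pos h3 h4
  exact ⟨i, j, hi, hj, ⟨⟨hi1, hi2⟩, ⟨hj1, hj2⟩⟩⟩

theorem closed_subset_openBlock {n : ℕ} (hn : 1 ≤ n) : K.closed ⊆ K.openBlock n := by
  rintro p ⟨⟨h1, h2⟩, ⟨h3, h4⟩⟩
  have hn' : (1 : ℝ) ≤ n := by exact_mod_cast hn
  have hw := K.w_pos
  have hh := K.h_pos
  refine ⟨⟨?_, ?_⟩, ⟨?_, ?_⟩⟩ <;> nlinarith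

theorem uv_mem_openBlock (h : Perp u v) {n : ℕ} {s t : ℝ} :
    K.uv u v s t ∈ K.openBlock n ↔
      (-(2 * n + 1) < s ∧ s < 2 * n + 1) ∧ (-(2 * n + 1) < t ∧ t < 2 * n + 1) := by
  have e (c w s : ℝ) (hw : 0 < w) : (c - n * w < c + (1 + s) / 2 * w ↔ -(2 * n + 1) < s) ∧
      (c + (1 + s) / 2 * w < c + (n + 1) * w ↔ s < 2 * n + 1) := by
    refine ⟨⟨fun h => ?_, fun h => ?_⟩, ⟨fun h => ?_, fun h => ?_⟩⟩ <;> nlinarith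
  have h1 := fun s => e K.x K.w s K.w_pos
  have h2 := fun s => e K.y K.h s K.h_pos
  simp only [uv, openBlock, mem_prod, mem_Ioo, (h1 _).1, (h1 _).2, (h2 _).1, (h2 _).2]
  exact frame_even h (P := fun x => -(2 * (n : ℝ) + 1) < x ∧ x < 2 * n + 1)
    (fun x => ⟨fun h => ⟨by linarith [h.2], by linarith [h.1]⟩,
      fun h => ⟨by linarith [h.2], by linarith [h.1]⟩⟩) s t

end Cell

end Merging

namespace Merging

namespace Cell

variable (K : Cell) {u v : ℤ × ℤ}

/-! ### Blocks of translates -/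

/-- The squares of the components of `u` and `v` are 0 or 1 and select which of the two extents is
horizontal. Thus `box` needs one formula only for all frames. -/
theorem box_pos (h : Perp u v) {A B : ℝ} (hA : 0 < A) (hB : 0 < B) :
    0 < (u.1 : ℝ) ^ 2 * A + (v.1 : ℝ) ^ 2 * B ∧ 0 < (u.2 : ℝ) ^ 2 * A + (v.2 : ℝ) ^ 2 * B := by
  rcases h.cases with ⟨rfl, rfl⟩ | ⟨rfl, rfl⟩ | ⟨rfl, rfl⟩ | ⟨rfl, rfl⟩ | ⟨rfl, rfl⟩ | ⟨rfl, rfl⟩ |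
    ⟨rfl, rfl⟩ | ⟨rfl, rfl⟩ <;> simp [hA, hB]

theorem length_pos {a b : ℤ} (h : a ≤ b) : (0 : ℝ) < b - a + 1 := by
  have : (a : ℝ) ≤ b := by exact_mod_cast h
  linarith

/-- The rectangle made of the translates `K.cell u v a b` with `a₀ ≤ a ≤ a₁` and `b₀ ≤ b ≤ b₁`. -/
def box (K : Cell) (h : Perp u v) {a₀ a₁ b₀ b₁ : ℤ} (ha : a₀ ≤ a₁) (hb : b₀ ≤ b₁) : Cell where
  x := K.x + (1 + ((a₀ + a₁) * u.1 + (b₀ + b₁) * v.1)) / 2 * K.w -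
    (u.1 ^ 2 * ((a₁ : ℝ) - a₀ + 1) + v.1 ^ 2 * ((b₁ : ℝ) - b₀ + 1)) * K.w / 2
  y := K.y + (1 + ((a₀ + a₁) * u.2 + (b₀ + b₁) * v.2)) / 2 * K.h -
    (u.2 ^ 2 * ((a₁ : ℝ) - a₀ + 1) + v.2 ^ 2 * ((b₁ : ℝ) - b₀ + 1)) * K.h / 2
  w := (u.1 ^ 2 * ((a₁ : ℝ) - a₀ + 1) + v.1 ^ 2 * ((b₁ : ℝ) - b₀ + 1)) * K.w
  h := (u.2 ^ 2 * ((a₁ : ℝ) - a₀ + 1) + v.2 ^ 2 * ((b₁ : ℝ) - b₀ + 1)) * K.h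
  w_pos := mul_pos (box_pos h (length_pos ha) (length_pos hb)).1 K.w_pos
  h_pos := mul_pos (box_pos h (length_pos ha) (length_pos hb)).2 K.h_pos

variable {a₀ a₁ b₀ b₁ : ℤ} (ha : a₀ ≤ a₁) (hb : b₀ ≤ b₁)

theorem uv_box (h : Perp u v) (s t : ℝ) :
    (K.box h ha hb).uv u v s t =
      K.uv u v (a₀ + a₁ + (a₁ - a₀ + 1) * s) (b₀ + b₁ + (b₁ - b₀ + 1) * t) := by
  rcases h.cases with ⟨rfl, rfl⟩ | ⟨rfl, rfl⟩ | ⟨rfl, rfl⟩ | ⟨rfl, rfl⟩ | ⟨rfl, rfl⟩ | ⟨rfl, rfl⟩ |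
    ⟨rfl, rfl⟩ | ⟨rfl, rfl⟩ <;> ext <;> simp [uv, box] <;> ring

theorem box_comm (h : Perp u v) : K.box h.symm hb ha = K.box h ha hb := by
  ext <;> simp only [box] <;> ring

theorem box_neg_left (h : Perp u v) :
    K.box h.neg_left (neg_le_neg ha) hb = K.box h ha hb := by
  ext <;> simp only [box, Prod.fst_neg, Prod.snd_neg] <;> push_cast <;> ring

theorem exists_uv_box (s t : ℝ) (h : Perp u v) : ∃ s' t' : ℝ,
    K.uv u v s t = (K.box h ha hb).uv u v s' t' ∧
      s = a₀ + a₁ + (a₁ - a₀ + 1) * s' ∧ t = b₀ + b₁ + (b₁ - b₀ + 1) * t' := by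
  have hA := length_pos ha
  have hB := length_pos hb
  refine ⟨(s - (a₀ + a₁)) / (a₁ - a₀ + 1), (t - (b₀ + b₁)) / (b₁ - b₀ + 1), ?_, ?_, ?_⟩
  · rw [uv_box]; congr 1 <;> field_simp <;> ring
  · field_simp; ring
  · field_simp; ring

theorem uv_mem_box_toSet (h : Perp u v) {s t : ℝ} :
    K.uv u v s t ∈ (K.box h ha hb).toSet ↔
      (2 * a₀ - 1 < s ∧ s < 2 * a₁ + 1) ∧ (2 * b₀ - 1 < t ∧ t < 2 * b₁ + 1) := by
  have hA := length_pos ha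
  have hB := length_pos hb
  obtain ⟨s', t', e, rfl, rfl⟩ := K.exists_uv_box ha hb s t h
  rw [e, uv_mem_toSet _ h]
  constructor <;> rintro ⟨⟨_, _⟩, ⟨_, _⟩⟩ <;> refine ⟨⟨?_, ?_⟩, ⟨?_, ?_⟩⟩ <;> nlinarith

theorem uv_mem_box_closed (h : Perp u v) {s t : ℝ} :
    K.uv u v s t ∈ (K.box h ha hb).closed ↔
      (2 * a₀ - 1 ≤ s ∧ s ≤ 2 * a₁ + 1) ∧ (2 * b₀ - 1 ≤ t ∧ t ≤ 2 * b₁ + 1) := by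
  have hA := length_pos ha
  have hB := length_pos hb
  obtain ⟨s', t', e, rfl, rfl⟩ := K.exists_uv_box ha hb s t h
  rw [e, uv_mem_closed _ h]
  constructor <;> rintro ⟨⟨_, _⟩, ⟨_, _⟩⟩ <;> refine ⟨⟨?_, ?_⟩, ⟨?_, ?_⟩⟩ <;> nlinarith

theorem exists_index' {a b : ℤ} (h : a ≤ b) {s : ℝ} (h1 : 2 * a - 1 ≤ s) (h2 : s ≤ 2 * b + 1) :
    ∃ c : ℤ, a ≤ c ∧ c ≤ b ∧ 2 * c - 1 ≤ s ∧ s ≤ 2 * c + 1 := by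
  rcases lt_or_ge s (2 * b + 1) with h3 | h3
  · refine ⟨⌊(s + 1) / 2⌋, ?_, ?_, ?_, ?_⟩
    · rw [Int.le_floor]; linarith
    · rw [← Int.lt_add_one_iff, Int.floor_lt]; push_cast; linarith
    · linarith [Int.floor_le ((s + 1) / 2)]
    · linarith [Int.lt_floor_add_one ((s + 1) / 2)]
  -- At the far end the floor would give the index `b + 1`.
  · exact ⟨b, h, le_rfl, by linarith, h2⟩

theorem box_closed_eq (h : Perp u v) {P : List Cell}
    (hP : ∀ c, c ∈ P ↔ ∃ a b, (a₀ ≤ a ∧ a ≤ a₁) ∧ (b₀ ≤ b ∧ b ≤ b₁) ∧ c = K.cell u v a b) :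
    ⋃ c ∈ P, c.closed = (K.box h ha hb).closed := by
  ext p
  obtain ⟨s, t, rfl⟩ := K.uv_surj h p
  simp only [mem_iUnion, hP, K.uv_mem_box_closed ha hb h, exists_prop]
  constructor
  · rintro ⟨_, ⟨a, b, ⟨h1, h2⟩, ⟨h3, h4⟩, rfl⟩, hp⟩
    rw [K.uv_mem_cell_closed h] at hp
    have h1 : (a₀ : ℝ) ≤ a := by exact_mod_cast h1
    have h2 : (a : ℝ) ≤ a₁ := by exact_mod_cast h2
    have h3 : (b₀ : ℝ) ≤ b := by exact_mod_cast h3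
    have h4 : (b : ℝ) ≤ b₁ := by exact_mod_cast h4
    refine ⟨⟨?_, ?_⟩, ⟨?_, ?_⟩⟩ <;> linarith [hp.1.1, hp.1.2, hp.2.1, hp.2.2]
  · rintro ⟨⟨h1, h2⟩, ⟨h3, h4⟩⟩
    obtain ⟨a, ha1, ha2, ha3, ha4⟩ := exists_index' ha h1 h2
    obtain ⟨b, hb1, hb2, hb3, hb4⟩ := exists_index' hb h3 h4
    exact ⟨_, ⟨a, b, ⟨ha1, ha2⟩, ⟨hb1, hb2⟩, rfl⟩,
      (K.uv_mem_cell_closed h a b).2 ⟨⟨ha3, ha4⟩, ⟨hb3, hb4⟩⟩⟩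

theorem macroElem_eq_box (h : Perp u v) {P : List Cell}
    (hP : ∀ c, c ∈ P ↔ ∃ a b, (a₀ ≤ a ∧ a ≤ a₁) ∧ (b₀ ≤ b ∧ b ≤ b₁) ∧ c = K.cell u v a b) :
    macroElem P = (K.box h ha hb).toSet := by
  rw [macroElem, K.box_closed_eq ha hb h hP, interior_closed]

/-! ### Fractions of sides -/

theorem volume_affine (c : ℝ) {a : ℝ} (h : a ≠ 0) (s : Set ℝ) :
    volume.real {t : ℝ | c + a * t ∈ s} = |a|⁻¹ * volume.real s := by
  have e : {t : ℝ | c + a * t ∈ s} = (fun t => a * t) ⁻¹' ((fun t => c + t) ⁻¹' s) := rfl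
  rw [Measure.real, e, Real.volume_preimage_mul_left h, measure_preimage_add, ENNReal.toReal_mul,
    ENNReal.toReal_ofReal (abs_nonneg _), abs_inv, Measure.real]

/-- In frame coordinates a side has length 2, and the two possible `v` differ only by the
orientation of the side, which does not change the measure. -/
theorem sideFrac_eq (h : Perp u v) (S : Set Pt) :
    K.sideFrac u S = volume.real {t : ℝ | t ∈ Icc (-1 : ℝ) 1 ∧ K.uv u v 1 t ∈ S} / 2 := by
  rcases h.2.2 with e | e
  · have := volume_affine 1 (a := -2) (by norm_num) {t : ℝ | t ∈ Icc (-1 : ℝ) 1 ∧ K.uv u v 1 t ∈ S}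
    rw [sideFrac, ← e]
    rw [show ∀ x : ℝ, x / 2 = |(-2 : ℝ)|⁻¹ * x from fun x => by norm_num; ring, ← this]
    congr 1; ext t
    simp only [mem_Icc, mem_ofPred_eq, sidePt_eq, show (1 : ℝ) - 2 * t = 1 + -2 * t by ring]
    refine and_congr_left fun _ => ⟨fun h => ?_, fun h => ?_⟩ <;> constructor <;> linarith [h.1, h.2]
  · have := volume_affine (-1) (a := 2) (by norm_num)
      {t : ℝ | t ∈ Icc (-1 : ℝ) 1 ∧ K.uv u v 1 t ∈ S}
    rw [sideFrac, show rot u = -v by rw [e, neg_neg]]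
    rw [show ∀ x : ℝ, x / 2 = |(2 : ℝ)|⁻¹ * x from fun x => by norm_num; ring, ← this]
    congr 1; ext t
    simp only [mem_Icc, mem_ofPred_eq, sidePt_eq, uv_neg_right,
      show -((1 : ℝ) - 2 * t) = -1 + 2 * t by ring]
    refine and_congr_left fun _ => ⟨fun h => ?_, fun h => ?_⟩ <;> constructor <;> linarith [h.1, h.2]

theorem volume_Icc_inter_ne_top (P : ℝ → Prop) :
    volume {t : ℝ | t ∈ Icc (-1 : ℝ) 1 ∧ P t} ≠ ⊤ :=
  measure_ne_top_of_subset (fun _ h => h.1) (by simp)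

/-- A part of a side of the cell contributes to the side of the box. -/
theorem sideFrac_cell_le_box (h : Perp u v) {b : ℤ} (hb₀ : b₀ ≤ b) (hb₁ : b ≤ b₁) (S : Set Pt) :
    (K.cell u v a₁ b).sideFrac u S ≤ (b₁ - b₀ + 1) * (K.box h ha hb).sideFrac u S := by
  have hB := length_pos hb
  have h0 : (b₀ : ℝ) ≤ b := by exact_mod_cast hb₀
  have h1 : (b : ℝ) ≤ b₁ := by exact_mod_cast hb₁
  rw [sideFrac_eq _ h, sideFrac_eq _ h]
  have := volume_affine (b₀ + b₁ - 2 * b) hB.ne'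
    {t : ℝ | t ∈ Icc (-1 : ℝ) 1 ∧ (K.cell u v a₁ b).uv u v 1 t ∈ S}
  rw [abs_of_pos hB] at this
  rw [mul_div_assoc', div_le_div_iff_of_pos_right two_pos, ← inv_mul_le_iff₀ hB, ← this]
  refine measureReal_mono ?_ (volume_Icc_inter_ne_top _)
  rintro t ⟨⟨ht1, ht2⟩, ht3⟩
  refine ⟨⟨by nlinarith, by nlinarith⟩, ?_⟩
  rw [uv_cell] at ht3
  rw [uv_box]
  convert ht3 using 2 <;> ring

theorem exists_mem_side_cell (h : Perp u v) {S : Set Pt}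
    (hS : ((K.box h ha hb).side u ∩ S).Nonempty) :
    ∃ b, (b₀ ≤ b ∧ b ≤ b₁) ∧ ((K.cell u v a₁ b).side u ∩ S).Nonempty := by
  have hB := length_pos hb
  obtain ⟨p, hp, hpS⟩ := hS
  rw [side_eq _ h] at hp
  obtain ⟨t, h1, h2, rfl⟩ := hp
  rw [uv_box] at hpS
  obtain ⟨b, hb1, hb2, hb3, hb4⟩ := exists_index' hb (s := b₀ + b₁ + (b₁ - b₀ + 1) * t)
    (by nlinarith) (by nlinarith)
  refine ⟨b, ⟨hb1, hb2⟩, _, ?_, hpS⟩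
  rw [side_eq _ h]
  refine ⟨b₀ + b₁ + (b₁ - b₀ + 1) * t - 2 * b, by linarith, by linarith, ?_⟩
  rw [uv_cell]; congr 1 <;> ring

theorem sideFrac_eq_one {d : ℤ × ℤ} (hd : d ∈ dirs) {S : Set Pt} (hS : K.openSide d ⊆ S) :
    K.sideFrac d S = 1 := by
  have h := Perp.of_rot hd
  rw [K.sideFrac_eq h]
  have h2 : volume.real (Icc (-1 : ℝ) 1) = 2 := by
    rw [Real.volume_real_Icc]; norm_num
  have h3 : volume.real (Ioo (-1 : ℝ) 1) = 2 := by
    rw [Real.volume_real_Ioo]; norm_num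
  have : volume.real {t : ℝ | t ∈ Icc (-1 : ℝ) 1 ∧ K.uv d (rot d) 1 t ∈ S} = 2 := by
    refine le_antisymm ?_ ?_
    · rw [← h2]
      exact measureReal_mono (fun t ht => ht.1) (by simp)
    · rw [← h3]
      refine measureReal_mono (fun t ht => ⟨⟨ht.1.le, ht.2.le⟩, hS ?_⟩) (volume_Icc_inter_ne_top _)
      rw [K.uv_mem_openSide h]
      exact ⟨rfl, ht.1, ht.2⟩
  rw [this]; norm_num

/-- Lower bound for the fraction of a side, one part of which lies in `S`. -/
theorem le_sideFrac (h : Perp u v) {S : Set Pt} {r : ℝ} (h0 : 0 ≤ r) (h1 : r ≤ 1)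
    (hS : ∀ t ∈ Ioo 0 r, K.sidePt u v t ∈ S) : r ≤ K.sideFrac u S := by
  rw [K.sideFrac_eq h]
  have h3 : volume.real (Ioo (1 - 2 * r) 1) = 2 * r := by
    rw [Real.volume_real_Ioo]; rw [max_eq_left (by linarith)]; ring
  rw [le_div_iff₀ two_pos, mul_comm, ← h3]
  refine measureReal_mono (fun t ht => ⟨⟨by linarith [ht.1], ht.2.le⟩, ?_⟩)
    (volume_Icc_inter_ne_top _)
  have := hS ((1 - t) / 2) ⟨by linarith [ht.2], by linarith [ht.1]⟩
  rw [sidePt_eq] at this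
  convert this using 2; ring

end Cell

/-! ### The mesh -/

theorem rev_of_ne {i j : Fin 2} (h : i ≠ j) : j = i.rev := by
  revert i j; decide

theorem ne_rev (i : Fin 2) : i ≠ i.rev := by
  revert i; decide

theorem eq_or_rev (i j : Fin 2) : j = i ∨ j = i.rev := by
  revert i j; decide

namespace InterfaceMesh

variable (M : InterfaceMesh)

/-- The two sides of the interface in the plane. -/
def sgn (i : Fin 2) : Set Pt := (![M.Ω₁, (closure M.Ω₁)ᶜ] : Fin 2 → Set Pt) i

theorem isOpen_sgn (i : Fin 2) : IsOpen (M.sgn i) := by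
  fin_cases i
  · exact M.isOpen_Ω₁
  · exact isClosed_closure.isOpen_compl

/-- The sets `sgn i` are open and cover the complement of `Γ` in the whole plane, so arguments by
connectedness can ignore the domain, which is put back at the end by this identity. -/
theorem sub_eq (i : Fin 2) : M.sub i = M.sgn i ∩ meshDomain M.T := by
  fin_cases i
  · exact (inter_eq_left.2 (subset_closure.trans M.closure_Ω₁)).symm
  · change meshDomain M.T \ closure M.Ω₁ = (closure M.Ω₁)ᶜ ∩ meshDomain M.T
    rw [sdiff_eq, inter_comm]

variable {M}

theorem sub_subset_sgn (i : Fin 2) : M.sub i ⊆ M.sgn i := by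
  rw [sub_eq]; exact inter_subset_left

theorem sgn_unique {p : Pt} {i j : Fin 2} (hi : p ∈ M.sgn i) (hj : p ∈ M.sgn j) : i = j := by
  have key : ∀ p, p ∈ M.Ω₁ → p ∉ (closure M.Ω₁)ᶜ := fun p h h' => h' (subset_closure h)
  fin_cases i <;> fin_cases j
  · rfl
  · exact absurd hj (key p hi)
  · exact absurd hi (key p hj)
  · rfl

theorem notMem_Γ_of_sgn {p : Pt} {i : Fin 2} (hi : p ∈ M.sgn i) : p ∉ M.Γ := by
  intro h
  rw [Γ, frontier, M.isOpen_Ω₁.interior_eq] at h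
  fin_cases i
  · exact h.2 hi
  · exact hi h.1

theorem exists_sgn {p : Pt} (h : p ∉ M.Γ) : ∃ i, p ∈ M.sgn i := by
  by_cases h1 : p ∈ M.Ω₁
  · exact ⟨0, h1⟩
  · refine ⟨1, fun h2 => h ?_⟩
    rw [Γ, frontier, M.isOpen_Ω₁.interior_eq]
    exact ⟨h2, h1⟩

theorem closure_sgn {S : Set Pt} {i : Fin 2} (hS : S ⊆ M.sgn i) {p : Pt} (hp : p ∈ closure S) :
    p ∉ M.sgn i.rev := by
  intro h
  obtain ⟨q, hq, hq'⟩ := mem_closure_iff.1 hp _ (M.isOpen_sgn _) h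
  exact ne_rev i (sgn_unique (hS hq') hq)

theorem exists_sgn_of_isPreconnected {S : Set Pt} (hS : IsPreconnected S)
    (h : ∀ p ∈ S, p ∉ M.Γ) : ∃ i, S ⊆ M.sgn i := by
  have hd : Disjoint (M.sgn 0) (M.sgn 1) :=
    disjoint_left.2 fun p h0 h1 => absurd (sgn_unique h0 h1) (by decide)
  have hc : S ⊆ M.sgn 0 ∪ M.sgn 1 := fun p hp => by
    obtain ⟨i, hi⟩ := exists_sgn (h p hp)
    fin_cases i
    · exact Or.inl hi
    · exact Or.inr hi
  exact (hS.subset_or_subset (M.isOpen_sgn 0) (M.isOpen_sgn 1) hd hc).elim (fun h => ⟨0, h⟩)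
    fun h => ⟨1, h⟩

variable (M) in
/-- The `n` layers of translates around `K` belong to the mesh. -/
def Block (n : ℕ) (K : Cell) : Prop := ∀ i j : ℤ, |i| ≤ n → |j| ≤ n → K.shift (i, j) ∈ M.T

variable {u v : ℤ × ℤ} {K : Cell}

theorem Block.cell {n : ℕ} (hK : M.Block n K) (h : Perp u v) {a b : ℤ} (ha : |a| ≤ n)
    (hb : |b| ≤ n) : K.cell u v a b ∈ M.T := by
  obtain ⟨h1, h2⟩ := (Cell.frame_abs h a b n).2 ⟨ha, hb⟩
  exact hK _ _ h1 h2

theorem Block.sub {n m : ℕ} (hK : M.Block n K) (h : Perp u v) {a b : ℤ} (ha : |a| + m ≤ n)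
    (hb : |b| + m ≤ n) : M.Block m (K.cell u v a b) := by
  intro i j hi hj
  obtain ⟨h1, h2⟩ := (Cell.frame_abs h a b (n - m)).2 ⟨by omega, by omega⟩
  rw [Cell.cell, Cell.shift_shift]
  exact hK _ _ ((abs_add_le _ _).trans (by linarith)) ((abs_add_le _ _).trans (by linarith))

theorem Block.mono {n m : ℕ} (hK : M.Block n K) (h : m ≤ n) : M.Block m K := fun i j hi hj =>
  hK i j (hi.trans (by exact_mod_cast h)) (hj.trans (by exact_mod_cast h))

theorem Block.mem {n : ℕ} (hK : M.Block n K) : K ∈ M.T := by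
  simpa [← Prod.zero_eq_mk] using hK 0 0 (by simp) (by simp)

/-- The closed rectangle is the closure of the open one, so an open set that meets the former meets
the latter, and distinct elements are disjoint. -/
theorem eq_of_inter_closed {N L : Cell} (hN : N ∈ M.T) (hL : L ∈ M.T)
    (h : (N.toSet ∩ L.closed).Nonempty) : N = L := by
  by_contra hne
  obtain ⟨p, hp, hp'⟩ := h
  rw [← Cell.closure_toSet] at hp'
  obtain ⟨q, hq, hq'⟩ := mem_closure_iff.1 hp' _ N.isOpen_toSet hp
  exact disjoint_left.1 (M.disjoint N hN L hL hne) hq hq'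

/-- This is how Rule 1 is used: an element that reaches into the open block has interior points
there, and each of them lies in a closed translate that belongs to the mesh. Hence no other sizes
occur inside the block. -/
theorem Block.eq_shift {n : ℕ} (hK : M.Block n K) {N : Cell} (hN : N ∈ M.T) {p : Pt}
    (hp : p ∈ N.closed) (hp' : p ∈ K.openBlock n) :
    ∃ i j : ℤ, |i| ≤ n ∧ |j| ≤ n ∧ N = K.shift (i, j) := by
  rw [← Cell.closure_toSet] at hp
  obtain ⟨q, hq, hq'⟩ := mem_closure_iff.1 hp _ (K.isOpen_openBlock n) hp'
  obtain ⟨i, j, hi, hj, hij⟩ := K.exists_shift_of_mem_openBlock hq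
  exact ⟨i, j, hi, hj, eq_of_inter_closed hN (hK i j hi hj) ⟨q, hq', hij⟩⟩

theorem Block.eq_cell {n : ℕ} (hK : M.Block n K) (h : Perp u v) {N : Cell} (hN : N ∈ M.T)
    {s t : ℝ} (hp : K.uv u v s t ∈ N.closed) (hp' : K.uv u v s t ∈ K.openBlock n) :
    ∃ a b : ℤ, |a| ≤ n ∧ |b| ≤ n ∧ N = K.cell u v a b ∧
      (2 * a - 1 ≤ s ∧ s ≤ 2 * a + 1) ∧ (2 * b - 1 ≤ t ∧ t ≤ 2 * b + 1) := by
  obtain ⟨i, j, hi, hj, rfl⟩ := hK.eq_shift hN hp hp'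
  obtain ⟨a, b, e⟩ := Cell.exists_cell h (i, j)
  rw [e] at hp ⊢
  obtain ⟨h1, h2⟩ := (Cell.frame_abs h a b n).1 (by rw [← e]; exact ⟨hi, hj⟩)
  exact ⟨a, b, h1, h2, rfl, (K.uv_mem_cell_closed h a b).1 hp⟩

theorem toSet_subset_meshDomain (hK : K ∈ M.T) : K.toSet ⊆ meshDomain M.T :=
  interior_maximal (K.toSet_subset_closed.trans (subset_iUnion₂_of_subset K hK subset_rfl))
    K.isOpen_toSet

theorem Block.openBlock_subset {n : ℕ} (hK : M.Block n K) : K.openBlock n ⊆ meshDomain M.T :=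
  interior_maximal (fun p hp => by
    obtain ⟨i, j, hi, hj, hij⟩ := K.exists_shift_of_mem_openBlock hp
    exact mem_iUnion₂.2 ⟨_, hK i j hi hj, hij⟩) (K.isOpen_openBlock n)

theorem Block.closed_subset {n : ℕ} (hK : M.Block n K) (hn : 1 ≤ n) :
    K.closed ⊆ meshDomain M.T := (K.closed_subset_openBlock hn).trans hK.openBlock_subset

/-- Both elements together form a rectangle with the open side in its interior. The end points of
the side may lie on the boundary of the domain. -/
theorem openSide_subset_meshDomain {d : ℤ × ℤ} (hd : d ∈ dirs) (hK : K ∈ M.T)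
    (hKd : K.shift d ∈ M.T) : K.openSide d ⊆ meshDomain M.T := by
  have h := Perp.of_rot hd
  have h01 : (0 : ℤ) ≤ 1 := by norm_num
  have hsub : (K.box h h01 (le_refl 0)).toSet ⊆ meshDomain M.T := by
    rw [← K.macroElem_eq_box h01 (le_refl 0) h (P := [K, K.shift d])]
    · refine interior_mono (iUnion₂_subset fun c hc => subset_iUnion₂_of_subset c ?_ subset_rfl)
      simp only [List.mem_cons, List.not_mem_nil, or_false] at hc
      rcases hc with rfl | rfl <;> assumption
    · intro c
      simp only [List.mem_cons, List.not_mem_nil, or_false]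
      constructor
      · rintro (rfl | rfl)
        · exact ⟨0, 0, by simp, by simp, by simp⟩
        · exact ⟨1, 0, by simp, by simp, by simp [Cell.cell]⟩
      · rintro ⟨a, b, ⟨h1, h2⟩, ⟨h3, h4⟩, rfl⟩
        obtain rfl : b = 0 := by omega
        obtain rfl | rfl : a = 0 ∨ a = 1 := by omega
        · simp
        · simp [Cell.cell]
  refine Subset.trans (fun p hp => ?_) hsub
  rw [K.openSide_eq h] at hp
  obtain ⟨t, h1, h2, rfl⟩ := hp
  rw [K.uv_mem_box_toSet _ _ h]
  norm_num; exact ⟨h1, h2⟩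

/-! ### Cells that the interface does not meet -/

theorem exists_sgn_of_not_isInterface (hK : K ∈ M.T) (h : ¬ M.IsInterface K) :
    ∃ i, K.toSet ⊆ M.sgn i :=
  exists_sgn_of_isPreconnected K.isPreconnected_toSet fun p hp hp' => h ⟨hK, p, hp, hp'⟩

theorem subset_sub_of_sgn {i : Fin 2} (hK : K ∈ M.T) (h : K.toSet ⊆ M.sgn i) :
    K.toSet ⊆ M.sub i := by
  rw [sub_eq]; exact subset_inter h (toSet_subset_meshDomain hK)

theorem not_isInterface_of_sub {i : Fin 2} (h : K.toSet ⊆ M.sub i) : ¬ M.IsInterface K :=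
  fun ⟨_, _, hp, hp'⟩ => notMem_Γ_of_sgn (sub_subset_sgn i (h hp)) hp'

theorem closed_disjoint_sgn_rev {i : Fin 2} (h : K.toSet ⊆ M.sgn i) {p : Pt} (hp : p ∈ K.closed) :
    p ∉ M.sgn i.rev := by
  rw [← Cell.closure_toSet] at hp
  exact closure_sgn h hp

end InterfaceMesh

end Merging

namespace Merging

namespace InterfaceMesh

variable {M : InterfaceMesh} {u v : ℤ × ℤ} {K : Cell}

/-! ### The course of the interface through an element -/

theorem IsInterface.bdry_inter (hK : M.IsInterface K) : ∃ A B : Pt, K.bdry ∩ M.Γ = {A, B} ∧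
    (∀ d ∈ dirs, ¬ (A ∈ K.side d ∧ B ∈ K.side d)) ∧ ∀ i, (K.bdry ∩ M.sgn i).Nonempty := by
  obtain ⟨γ, -, -, him, hin, h0, h1, hs, hU, hE⟩ := M.crossed K hK.1 hK.2
  refine ⟨γ 0, γ 1, ?_, hs, ?_⟩
  · have e : K.closed ∩ M.Γ = γ '' Icc 0 1 := him.symm
    ext p
    constructor
    · rintro ⟨hp, hpΓ⟩
      have : p ∈ γ '' Icc 0 1 := e ▸ ⟨K.bdry_subset_closed hp, hpΓ⟩
      obtain ⟨t, ht, rfl⟩ := this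
      by_contra hne
      simp only [mem_insert_iff, mem_singleton_iff, not_or] at hne
      exact hp.2 (hin t ⟨lt_of_le_of_ne ht.1 fun h => hne.1 (by rw [h]),
        lt_of_le_of_ne ht.2 fun h => hne.2 (by rw [h])⟩)
    · have h0' : γ 0 ∈ K.closed ∩ M.Γ := e ▸ mem_image_of_mem γ (by simp)
      have h1' : γ 1 ∈ K.closed ∩ M.Γ := e ▸ mem_image_of_mem γ (by simp)
      rintro (rfl | rfl)
      exacts [⟨h0, h0'.2⟩, ⟨h1, h1'.2⟩]
  · intro i
    fin_cases i
    · exact hU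
    · exact hE

/-- The inner points of the arc are dense in it. So the closures in the definition of a chain
contain the end points of the arcs and nothing else on the boundary. -/
theorem IsInterface.closure_inter (hK : M.IsInterface K) :
    closure (M.Γ ∩ K.toSet) = K.closed ∩ M.Γ := by
  obtain ⟨γ, hc, -, him, hin, -⟩ := M.crossed K hK.1 hK.2
  have e : K.closed ∩ M.Γ = γ '' Icc 0 1 := him.symm
  refine Subset.antisymm (closure_minimal (fun p hp => ⟨K.toSet_subset_closed hp.2, hp.1⟩)
    (K.isClosed_closed.inter isClosed_frontier)) ?_
  rw [e]
  rw [← closure_Ioo (zero_ne_one' ℝ)] at hc ⊢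
  refine hc.image_closure.trans (closure_mono ?_)
  rintro _ ⟨t, ht, rfl⟩
  have : γ t ∈ K.closed ∩ M.Γ := e ▸ mem_image_of_mem γ ⟨ht.1.le, ht.2.le⟩
  exact ⟨this.2, hin t ht⟩

theorem exists_sgn_line {I : Set ℝ} (hI : I.OrdConnected) {s : ℝ}
    (h : ∀ t ∈ I, K.uv u v s t ∉ M.Γ) : ∃ i, ∀ t ∈ I, K.uv u v s t ∈ M.sgn i := by
  have hp : IsPreconnected ((fun t => K.uv u v s t) '' I) :=
    hI.isPreconnected.image _
      (K.continuous_uv.comp (by fun_prop : Continuous fun t : ℝ => (s, t))).continuousOn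
  obtain ⟨i, hi⟩ := exists_sgn_of_isPreconnected hp (by rintro _ ⟨t, ht, rfl⟩; exact h t ht)
  exact ⟨i, fun t ht => hi (mem_image_of_mem _ ht)⟩

theorem exists_sgn_line' {I : Set ℝ} (hI : I.OrdConnected) {t : ℝ}
    (h : ∀ s ∈ I, K.uv u v s t ∉ M.Γ) : ∃ i, ∀ s ∈ I, K.uv u v s t ∈ M.sgn i := by
  simp only [← K.uv_comm (u := u) (v := v)] at h ⊢
  exact exists_sgn_line hI h

variable (M) in
/-- The interface meets the side `u` of `K` in the point with parameter `r` only.  The part of the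
side towards the end `u + v` lies on the side `i` of the interface, the rest on the other side. -/
structure Split (K : Cell) (u v : ℤ × ℤ) (r : ℝ) (i : Fin 2) : Prop where
  nonneg : 0 ≤ r
  le_one : r ≤ 1
  mem : K.sidePt u v r ∈ M.Γ
  lt : ∀ t, 0 ≤ t → t < r → K.sidePt u v t ∈ M.sgn i
  gt : ∀ t, r < t → t ≤ 1 → K.sidePt u v t ∈ M.sgn i.rev

variable (M) in
structure T1Data (K : Cell) (u v : ℤ × ℤ) (i : Fin 2) (r₁ r₂ : ℝ) : Prop where
  perp : Perp u v
  pos₁ : 0 < r₁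
  lt₁ : r₁ < 1
  pos₂ : 0 < r₂
  lt₂ : r₂ < 1
  split₁ : M.Split K u v r₁ i
  split₂ : M.Split K v u r₂ i
  side₁ : K.side (-u) ⊆ M.sgn i.rev
  side₂ : K.side (-v) ⊆ M.sgn i.rev

variable (M) in
structure T2Data (K : Cell) (u v : ℤ × ℤ) (i : Fin 2) (r₁ r₂ : ℝ) : Prop where
  perp : Perp u v
  pos₁ : 0 < r₁
  lt₁ : r₁ < 1
  split₁ : M.Split K u v r₁ i
  split₂ : M.Split K (-u) v r₂ i
  side₁ : K.openSide v ⊆ M.sgn i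
  side₂ : K.openSide (-v) ⊆ M.sgn i.rev

variable (M) in
structure T3Data (K : Cell) (u v : ℤ × ℤ) (i : Fin 2) : Prop where
  perp : Perp u v
  bdry : K.bdry ∩ M.Γ = {K.vertex (u + v), K.vertex (-u - v)}
  side₁ : K.openSide u ⊆ M.sgn i
  side₂ : K.openSide (-v) ⊆ M.sgn i
  side₃ : K.openSide v ⊆ M.sgn i.rev
  side₄ : K.openSide (-u) ⊆ M.sgn i.rev

theorem Split.symm {r : ℝ} {i : Fin 2} (h : M.Split K u v r i) :
    M.Split K u (-v) (1 - r) i.rev := by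
  have e (t : ℝ) : K.sidePt u (-v) t = K.sidePt u v (1 - t) := by
    simp only [Cell.sidePt_eq, Cell.uv_neg_right]; congr 1; ring
  refine ⟨by linarith [h.le_one], by linarith [h.nonneg], ?_, fun t h0 h1 => ?_, fun t h0 h1 => ?_⟩
  · rw [e, sub_sub_cancel]; exact h.mem
  · rw [e]; exact h.gt _ (by linarith) (by linarith)
  · rw [e, Fin.rev_rev]; exact h.lt _ (by linarith) (by linarith)

theorem Split.part_eq {r : ℝ} {i : Fin 2} (h : M.Split K u v r i) : M.part K u v = r := by
  have : {t : ℝ | t ∈ Icc (0 : ℝ) 1 ∧ K.sidePt u v t ∈ M.Γ} = {r} := by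
    ext t
    simp only [mem_ofPred_eq, mem_singleton_iff]
    constructor
    · rintro ⟨⟨h0, h1⟩, ht⟩
      rcases lt_trichotomy t r with h2 | h2 | h2
      · exact absurd ht (notMem_Γ_of_sgn (h.lt t h0 h2))
      · exact h2
      · exact absurd ht (notMem_Γ_of_sgn (h.gt t h2 h1))
    · rintro rfl; exact ⟨⟨h.nonneg, h.le_one⟩, h.mem⟩
  rw [part, this, csInf_singleton]

/-- The interface does not separate the boundary if all of it lies on one side. -/
theorem ne_of_bdry {i j : Fin 2} (h : ∀ i, (K.bdry ∩ M.sgn i).Nonempty)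
    (hij : ∀ p ∈ K.bdry, p ∉ M.Γ → p ∈ M.sgn i ∨ p ∈ M.sgn j) : j = i.rev := by
  refine rev_of_ne fun e => ?_
  subst e
  obtain ⟨p, hp, hp'⟩ := h i.rev
  exact ne_rev i (sgn_unique (by simpa using hij p hp (notMem_Γ_of_sgn hp')) hp')

/-- The two points cut the boundary into two arcs. The straight pieces of an arc avoid `Γ`, so each
has a constant sign, and pieces with a common vertex have the same one. The two arcs carry different
signs because the boundary meets both sides of `Γ`. -/
theorem t1Data_of_bdry (hp : Perp u v) (hs : ∀ i, (K.bdry ∩ M.sgn i).Nonempty) {α β : ℝ}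
    (hα : -1 < α) (hα' : α < 1) (hβ : -1 < β) (hβ' : β < 1)
    (h : K.bdry ∩ M.Γ = {K.uv u v 1 α, K.uv u v β 1}) :
    ∃ i, M.T1Data K u v i ((1 - α) / 2) ((1 - β) / 2) := by
  have hΓ {s t : ℝ} (hb : ((-1 ≤ s ∧ s ≤ 1) ∧ (-1 ≤ t ∧ t ≤ 1)) ∧ (s = 1 ∨ s = -1 ∨ t = 1 ∨ t = -1))
      (hst : K.uv u v s t ∈ M.Γ) : (s = 1 ∧ t = α) ∨ (s = β ∧ t = 1) := by
    have : K.uv u v s t ∈ K.bdry ∩ M.Γ := ⟨(K.uv_mem_bdry hp).2 hb, hst⟩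
    rw [h] at this
    simpa only [mem_insert_iff, mem_singleton_iff, K.uv_inj hp] using this
  obtain ⟨i, hi1⟩ := exists_sgn_line (M := M) (K := K) (u := u) (v := v) (s := 1) (ordConnected_Ioc : (Ioc (α : ℝ) 1).OrdConnected)
    fun t ht hst => by
      rcases hΓ ⟨⟨by norm_num, by linarith [ht.1], ht.2⟩, by simp⟩ hst with h | h <;> linarith [ht.1]
  obtain ⟨i2, hi2⟩ := exists_sgn_line' (M := M) (K := K) (u := u) (v := v) (t := 1) (ordConnected_Ioc : (Ioc (β : ℝ) 1).OrdConnected)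
    fun t ht hst => by
      rcases hΓ ⟨⟨⟨by linarith [ht.1], ht.2⟩, by norm_num⟩, by simp⟩ hst with h | h <;> linarith [ht.1]
  obtain ⟨j, hj1⟩ := exists_sgn_line (M := M) (K := K) (u := u) (v := v) (s := 1) (ordConnected_Ico : (Ico (-1 : ℝ) α).OrdConnected)
    fun t ht hst => by
      rcases hΓ ⟨⟨by norm_num, ht.1, by linarith [ht.2]⟩, by simp⟩ hst with h | h <;> linarith [ht.2]
  obtain ⟨j2, hj2⟩ := exists_sgn_line' (M := M) (K := K) (u := u) (v := v) (t := -1) (ordConnected_Icc : (Icc (-1 : ℝ) 1).OrdConnected)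
    fun t ht hst => by
      rcases hΓ ⟨⟨ht, by norm_num⟩, by simp⟩ hst with h | h <;> linarith [ht.2]
  obtain ⟨j3, hj3⟩ := exists_sgn_line (M := M) (K := K) (u := u) (v := v) (s := -1) (ordConnected_Icc : (Icc (-1 : ℝ) 1).OrdConnected)
    fun t ht hst => by
      rcases hΓ ⟨⟨by norm_num, ht⟩, by simp⟩ hst with h | h <;> linarith [ht.2]
  obtain ⟨j4, hj4⟩ := exists_sgn_line' (M := M) (K := K) (u := u) (v := v) (t := 1) (ordConnected_Ico : (Ico (-1 : ℝ) β).OrdConnected)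
    fun t ht hst => by
      rcases hΓ ⟨⟨⟨ht.1, by linarith [ht.2]⟩, by norm_num⟩, by simp⟩ hst with h | h <;> linarith [ht.2]
  -- The signs are compared at the four vertices of `K`: the cut-off vertex joins two pieces, the
  -- other three vertices join the remaining four.
  obtain rfl := sgn_unique (hi1 1 ⟨hα', le_rfl⟩) (hi2 1 ⟨hβ', le_rfl⟩)
  obtain rfl := sgn_unique (hj1 (-1) ⟨le_rfl, hα⟩) (hj2 1 (by simp))
  obtain rfl := sgn_unique (hj2 (-1) (by simp)) (hj3 (-1) (by simp))
  obtain rfl := sgn_unique (hj3 1 (by simp)) (hj4 (-1) ⟨le_rfl, hβ⟩)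
  have e : j = i.rev := ne_of_bdry hs fun p hpb hpΓ => by
    obtain ⟨s, t, rfl⟩ := K.uv_surj hp p
    obtain ⟨⟨⟨h1, h2⟩, ⟨h3, h4⟩⟩, rfl | rfl | rfl | rfl⟩ := (K.uv_mem_bdry hp).1 hpb
    · rcases lt_trichotomy t α with h5 | rfl | h5
      · exact Or.inr (hj1 t ⟨h3, h5⟩)
      · exact absurd (h.symm ▸ mem_insert _ _ : K.uv u v 1 t ∈ K.bdry ∩ M.Γ).2 hpΓ
      · exact Or.inl (hi1 t ⟨h5, h4⟩)
    · exact Or.inr (hj3 t ⟨h3, h4⟩)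
    · rcases lt_trichotomy s β with h5 | rfl | h5
      · exact Or.inr (hj4 s ⟨h1, h5⟩)
      · exact absurd (h.symm ▸ mem_insert_of_mem _ rfl : K.uv u v s 1 ∈ K.bdry ∩ M.Γ).2 hpΓ
      · exact Or.inl (hi2 s ⟨h5, h2⟩)
    · exact Or.inr (hj2 s ⟨h1, h2⟩)
  subst e
  have hA : K.uv u v 1 α ∈ K.bdry ∩ M.Γ := h.symm ▸ mem_insert _ _
  have hB : K.uv u v β 1 ∈ K.bdry ∩ M.Γ := h.symm ▸ mem_insert_of_mem _ rfl
  refine ⟨i, hp, by linarith, by linarith, by linarith, by linarith,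
    ⟨by linarith, by linarith, ?_, fun t h0 h1 => ?_, fun t h0 h1 => ?_⟩,
    ⟨by linarith, by linarith, ?_, fun t h0 h1 => ?_, fun t h0 h1 => ?_⟩, fun p hps => ?_,
    fun p hps => ?_⟩
  · rw [Cell.sidePt_eq]; convert hA.2 using 2; ring
  · rw [Cell.sidePt_eq]; exact hi1 _ ⟨by linarith, by linarith⟩
  · rw [Cell.sidePt_eq]; exact hj1 _ ⟨by linarith, by linarith⟩
  · rw [Cell.sidePt_eq, Cell.uv_comm]; convert hB.2 using 2; ring
  · rw [Cell.sidePt_eq, Cell.uv_comm]; exact hi2 _ ⟨by linarith, by linarith⟩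
  · rw [Cell.sidePt_eq, Cell.uv_comm]; exact hj4 _ ⟨by linarith, by linarith⟩
  · obtain ⟨s, t, rfl⟩ := K.uv_surj hp p
    obtain ⟨rfl, h1⟩ := (K.uv_mem_side_neg hp).1 hps
    exact hj3 t h1
  · obtain ⟨s, t, rfl⟩ := K.uv_surj hp p
    obtain ⟨rfl, h1⟩ := (K.uv_mem_side_neg' hp).1 hps
    exact hj2 s h1

/-- This is one of the two arcs; the other one comes from replacing `v` by `-v`. If `β = 1`, the arc
ends in a vertex and its third piece is empty. -/
theorem sgn_of_opposite {α β : ℝ} (hα : -1 < α) (hα' : α < 1) (hβ : -1 ≤ β)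
    (hΓ : ∀ {s t : ℝ}, ((-1 ≤ s ∧ s ≤ 1) ∧ (-1 ≤ t ∧ t ≤ 1)) ∧ (s = 1 ∨ s = -1 ∨ t = 1 ∨ t = -1) →
      K.uv u v s t ∈ M.Γ → (s = 1 ∧ t = α) ∨ (s = -1 ∧ t = β)) :
    ∃ i, (∀ t ∈ Ioc α 1, K.uv u v 1 t ∈ M.sgn i) ∧ (∀ s ∈ Ioc (-1) 1, K.uv u v s 1 ∈ M.sgn i) ∧
      (∀ t ∈ Ioc β 1, K.uv u v (-1) t ∈ M.sgn i) := by
  obtain ⟨i, hi1⟩ := exists_sgn_line (M := M) (K := K) (u := u) (v := v) (s := 1) (ordConnected_Ioc : (Ioc (α : ℝ) 1).OrdConnected)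
    fun t ht hst => by
      rcases hΓ ⟨⟨by norm_num, by linarith [ht.1], ht.2⟩, by simp⟩ hst with h | h <;> linarith [ht.1]
  obtain ⟨i2, hi2⟩ := exists_sgn_line' (M := M) (K := K) (u := u) (v := v) (t := 1) (ordConnected_Ioc : (Ioc (-1 : ℝ) 1).OrdConnected)
    fun t ht hst => by
      rcases hΓ ⟨⟨⟨by linarith [ht.1], ht.2⟩, by norm_num⟩, by simp⟩ hst with h | h <;> linarith [ht.1]
  obtain rfl := sgn_unique (hi1 1 ⟨hα', le_rfl⟩) (hi2 1 (by simp))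
  refine ⟨i, hi1, hi2, ?_⟩
  rcases lt_or_ge β 1 with hβ' | hβ'
  · obtain ⟨i3, hi3⟩ := exists_sgn_line (M := M) (K := K) (u := u) (v := v) (s := -1) (ordConnected_Ioc : (Ioc (β : ℝ) 1).OrdConnected)
      fun t ht hst => by
        rcases hΓ ⟨⟨by norm_num, by linarith [ht.1], ht.2⟩, by simp⟩ hst with h | h <;> linarith [ht.1]
    obtain ⟨i4, hi4⟩ := exists_sgn_line' (M := M) (K := K) (u := u) (v := v) (t := 1) (ordConnected_Icc : (Icc (-1 : ℝ) 1).OrdConnected)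
      fun t ht hst => by
        rcases hΓ ⟨⟨ht, by norm_num⟩, by simp⟩ hst with h | h <;> linarith [ht.1]
    obtain rfl := sgn_unique (hi2 1 (by simp)) (hi4 1 (by simp))
    obtain rfl := sgn_unique (hi4 (-1) (by simp)) (hi3 1 ⟨hβ', le_rfl⟩)
    exact hi3
  · intro t ht
    linarith [ht.1, ht.2]

theorem t2Data_of_bdry (hp : Perp u v) (hs : ∀ i, (K.bdry ∩ M.sgn i).Nonempty) {α β : ℝ}
    (hα : -1 < α) (hα' : α < 1) (hβ : -1 ≤ β) (hβ' : β ≤ 1)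
    (h : K.bdry ∩ M.Γ = {K.uv u v 1 α, K.uv u v (-1) β}) :
    ∃ i, M.T2Data K u v i ((1 - α) / 2) ((1 - β) / 2) := by
  have hΓ {s t : ℝ} (hb : ((-1 ≤ s ∧ s ≤ 1) ∧ (-1 ≤ t ∧ t ≤ 1)) ∧ (s = 1 ∨ s = -1 ∨ t = 1 ∨ t = -1))
      (hst : K.uv u v s t ∈ M.Γ) : (s = 1 ∧ t = α) ∨ (s = -1 ∧ t = β) := by
    have : K.uv u v s t ∈ K.bdry ∩ M.Γ := ⟨(K.uv_mem_bdry hp).2 hb, hst⟩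
    rw [h] at this
    simpa only [mem_insert_iff, mem_singleton_iff, K.uv_inj hp] using this
  obtain ⟨i, hi1, hi2, hi3⟩ := sgn_of_opposite hα hα' hβ hΓ
  obtain ⟨j, hj1, hj2, hj3⟩ := sgn_of_opposite (M := M) (K := K) (u := u) (v := -v) (α := -α) (β := -β)
    (by linarith) (by linarith) (by linarith) (fun {s t} hb hst => by
      rw [Cell.uv_neg_right] at hst
      have := hΓ ⟨⟨hb.1.1, by linarith [hb.1.2.2], by linarith [hb.1.2.1]⟩, by
        rcases hb.2 with h | h | h | h <;> simp [h]⟩ hst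
      simpa only [neg_eq_iff_eq_neg] using this)
  simp only [Cell.uv_neg_right] at hj1 hj2 hj3
  have hA : K.uv u v 1 α ∈ K.bdry ∩ M.Γ := h.symm ▸ mem_insert _ _
  have hB : K.uv u v (-1) β ∈ K.bdry ∩ M.Γ := h.symm ▸ mem_insert_of_mem _ rfl
  have hj1' : ∀ t, -1 ≤ t → t < α → K.uv u v 1 t ∈ M.sgn j := fun t h0 h1 => by
    simpa using hj1 (-t) ⟨by linarith, by linarith⟩
  have hj3' : ∀ t, -1 ≤ t → t < β → K.uv u v (-1) t ∈ M.sgn j := fun t h0 h1 => by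
    simpa using hj3 (-t) ⟨by linarith, by linarith⟩
  have e : j = i.rev := ne_of_bdry hs fun p hpb hpΓ => by
    obtain ⟨s, t, rfl⟩ := K.uv_surj hp p
    have key : ∀ t, (-1 ≤ t ∧ t ≤ 1) → K.uv u v (-1) t ∉ M.Γ →
        K.uv u v (-1) t ∈ M.sgn i ∨ K.uv u v (-1) t ∈ M.sgn j := by
      rintro t ⟨h3, h4⟩ hpΓ
      rcases lt_trichotomy t β with h5 | rfl | h5
      · exact Or.inr (hj3' t h3 h5)
      · exact absurd hB.2 hpΓ
      · exact Or.inl (hi3 t ⟨h5, h4⟩)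
    obtain ⟨⟨⟨h1, h2⟩, ⟨h3, h4⟩⟩, rfl | rfl | rfl | rfl⟩ := (K.uv_mem_bdry hp).1 hpb
    · rcases lt_trichotomy t α with h5 | rfl | h5
      · exact Or.inr (hj1' t h3 h5)
      · exact absurd hA.2 hpΓ
      · exact Or.inl (hi1 t ⟨h5, h4⟩)
    · exact key t ⟨h3, h4⟩ hpΓ
    · rcases h1.lt_or_eq with h5 | rfl
      · exact Or.inl (hi2 s ⟨h5, h2⟩)
      · exact key 1 (by norm_num) hpΓ
    · rcases h1.lt_or_eq with h5 | rfl
      · exact Or.inr (hj2 s ⟨h5, h2⟩)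
      · exact key (-1) (by norm_num) hpΓ
  subst e
  refine ⟨i, hp, by linarith, by linarith,
    ⟨by linarith, by linarith, ?_, fun t h0 h1 => ?_, fun t h0 h1 => ?_⟩,
    ⟨by linarith, by linarith, ?_, fun t h0 h1 => ?_, fun t h0 h1 => ?_⟩, fun p hps => ?_,
    fun p hps => ?_⟩
  · rw [Cell.sidePt_eq]; convert hA.2 using 2; ring
  · rw [Cell.sidePt_eq]; exact hi1 _ ⟨by linarith, by linarith⟩
  · rw [Cell.sidePt_eq]; exact hj1' _ (by linarith) (by linarith)
  · rw [Cell.sidePt_eq, Cell.uv_neg_left]; convert hB.2 using 2; ring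
  · rw [Cell.sidePt_eq, Cell.uv_neg_left]; exact hi3 _ ⟨by linarith, by linarith⟩
  · rw [Cell.sidePt_eq, Cell.uv_neg_left]; exact hj3' _ (by linarith) (by linarith)
  · obtain ⟨s, t, rfl⟩ := K.uv_surj hp p
    obtain ⟨rfl, h1, h2⟩ := (K.uv_mem_openSide' hp).1 hps
    exact hi2 s ⟨h1, h2.le⟩
  · obtain ⟨s, t, rfl⟩ := K.uv_surj hp p
    obtain ⟨rfl, h1, h2⟩ := (K.uv_mem_openSide_neg' hp).1 hps
    exact hj2 s ⟨h1, h2.le⟩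

theorem t3Data_of_bdry (hp : Perp u v) (hs : ∀ i, (K.bdry ∩ M.sgn i).Nonempty)
    (h : K.bdry ∩ M.Γ = {K.vertex (u + v), K.vertex (-u - v)}) : ∃ i, M.T3Data K u v i := by
  have hb := h
  rw [Cell.vertex_add, Cell.vertex_neg] at h
  have hΓ {s t : ℝ} (hb : ((-1 ≤ s ∧ s ≤ 1) ∧ (-1 ≤ t ∧ t ≤ 1)) ∧ (s = 1 ∨ s = -1 ∨ t = 1 ∨ t = -1))
      (hst : K.uv u v s t ∈ M.Γ) : (s = 1 ∧ t = 1) ∨ (s = -1 ∧ t = -1) := by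
    have : K.uv u v s t ∈ K.bdry ∩ M.Γ := ⟨(K.uv_mem_bdry hp).2 hb, hst⟩
    rw [h] at this
    simpa only [mem_insert_iff, mem_singleton_iff, K.uv_inj hp] using this
  obtain ⟨i, hi1⟩ := exists_sgn_line (M := M) (K := K) (u := u) (v := v) (s := 1) (ordConnected_Ico : (Ico (-1 : ℝ) 1).OrdConnected)
    fun t ht hst => by
      rcases hΓ ⟨⟨by norm_num, ht.1, ht.2.le⟩, by simp⟩ hst with h | h <;> linarith [ht.2]
  obtain ⟨i2, hi2⟩ := exists_sgn_line' (M := M) (K := K) (u := u) (v := v) (t := -1) (ordConnected_Ioc : (Ioc (-1 : ℝ) 1).OrdConnected)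
    fun t ht hst => by
      rcases hΓ ⟨⟨⟨ht.1.le, ht.2⟩, by norm_num⟩, by simp⟩ hst with h | h <;> linarith [ht.1]
  obtain ⟨j, hj1⟩ := exists_sgn_line (M := M) (K := K) (u := u) (v := v) (s := -1) (ordConnected_Ioc : (Ioc (-1 : ℝ) 1).OrdConnected)
    fun t ht hst => by
      rcases hΓ ⟨⟨by norm_num, ht.1.le, ht.2⟩, by simp⟩ hst with h | h <;> linarith [ht.1]
  obtain ⟨j2, hj2⟩ := exists_sgn_line' (M := M) (K := K) (u := u) (v := v) (t := 1) (ordConnected_Ico : (Ico (-1 : ℝ) 1).OrdConnected)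
    fun t ht hst => by
      rcases hΓ ⟨⟨⟨ht.1, ht.2.le⟩, by norm_num⟩, by simp⟩ hst with h | h <;> linarith [ht.2]
  obtain rfl := sgn_unique (hi1 (-1) (by simp)) (hi2 1 (by simp))
  obtain rfl := sgn_unique (hj1 1 (by simp)) (hj2 (-1) (by simp))
  have hA : K.uv u v 1 1 ∈ K.bdry ∩ M.Γ := h.symm ▸ mem_insert _ _
  have hB : K.uv u v (-1) (-1) ∈ K.bdry ∩ M.Γ := h.symm ▸ mem_insert_of_mem _ rfl
  have e : j = i.rev := ne_of_bdry hs fun p hpb hpΓ => by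
    obtain ⟨s, t, rfl⟩ := K.uv_surj hp p
    obtain ⟨⟨⟨h1, h2⟩, ⟨h3, h4⟩⟩, rfl | rfl | rfl | rfl⟩ := (K.uv_mem_bdry hp).1 hpb
    · rcases h4.lt_or_eq with h5 | rfl
      · exact Or.inl (hi1 t ⟨h3, h5⟩)
      · exact absurd hA.2 hpΓ
    · rcases h3.lt_or_eq with h5 | rfl
      · exact Or.inr (hj1 t ⟨h5, h4⟩)
      · exact absurd hB.2 hpΓ
    · rcases h2.lt_or_eq with h5 | rfl
      · exact Or.inr (hj2 s ⟨h1, h5⟩)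
      · exact absurd hA.2 hpΓ
    · rcases h1.lt_or_eq with h5 | rfl
      · exact Or.inl (hi2 s ⟨h5, h2⟩)
      · exact absurd hB.2 hpΓ
  subst e
  refine ⟨i, hp, hb, fun p hps => ?_, fun p hps => ?_, fun p hps => ?_, fun p hps => ?_⟩ <;>
    obtain ⟨s, t, rfl⟩ := K.uv_surj hp p
  · obtain ⟨rfl, h1, h2⟩ := (K.uv_mem_openSide hp).1 hps
    exact hi1 t ⟨h1.le, h2⟩
  · obtain ⟨rfl, h1, h2⟩ := (K.uv_mem_openSide_neg' hp).1 hps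
    exact hi2 s ⟨h1, h2.le⟩
  · obtain ⟨rfl, h1, h2⟩ := (K.uv_mem_openSide' hp).1 hps
    exact hj2 s ⟨h1.le, h2⟩
  · obtain ⟨rfl, h1, h2⟩ := (K.uv_mem_openSide_neg hp).1 hps
    exact hj1 t ⟨h1, h2.le⟩

theorem IsInterface.meets (hK : M.IsInterface K) (i : Fin 2) : (K.bdry ∩ M.sgn i).Nonempty := by
  obtain ⟨_, _, _, _, h⟩ := hK.bdry_inter
  exact h i

theorem IsT1.data (hK : M.IsT1 K) : ∃ u v i r₁ r₂, M.T1Data K u v i r₁ r₂ := by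
  obtain ⟨hI, u, v, hp, A, hA, B, hB, h⟩ := hK
  rw [K.openSide_eq hp] at hA
  rw [K.openSide_eq hp.symm] at hB
  obtain ⟨α, h1, h2, rfl⟩ := hA
  obtain ⟨β, h3, h4, rfl⟩ := hB
  rw [K.uv_comm (u := u) (v := v) β 1] at h
  obtain ⟨i, hi⟩ := t1Data_of_bdry hp hI.meets h1 h2 h3 h4 h
  exact ⟨_, _, _, _, _, hi⟩

theorem IsT2Along.data (hK : M.IsT2Along K u) (hp : Perp u v) :
    ∃ i r₁ r₂, M.T2Data K u v i r₁ r₂ := by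
  obtain ⟨hI, -, A, hA, B, hB, h⟩ := hK
  rw [K.openSide_eq hp] at hA
  rw [K.side_eq hp.neg_left] at hB
  obtain ⟨α, h1, h2, rfl⟩ := hA
  obtain ⟨β, h3, h4, rfl⟩ := hB
  rw [Cell.uv_neg_left] at h
  obtain ⟨i, hi⟩ := t2Data_of_bdry hp hI.meets h1 h2 h3 h4 h
  exact ⟨_, _, _, hi⟩

theorem IsT3.data (hK : M.IsT3 K) : ∃ u v i, M.T3Data K u v i := by
  obtain ⟨hI, u, v, hp, h⟩ := hK
  obtain ⟨i, hi⟩ := t3Data_of_bdry hp hI.meets h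
  exact ⟨_, _, _, hi⟩

theorem isT1_or_isT2_of_openSide (hK : M.IsInterface K) (hp : Perp u v) {A B : Pt}
    (h : K.bdry ∩ M.Γ = {A, B}) (hs : ∀ d ∈ dirs, ¬ (A ∈ K.side d ∧ B ∈ K.side d))
    (hA : A ∈ K.openSide u) : M.IsT1 K ∨ M.IsT2 K := by
  have hB : B ∈ K.bdry := (h.symm ▸ mem_insert_of_mem _ rfl : B ∈ K.bdry ∩ M.Γ).1
  have hBu : B ∉ K.side u := fun h' => hs u hp.1 ⟨K.openSide_subset_side u hA, h'⟩
  by_cases hBu' : B ∈ K.side (-u)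
  · exact Or.inr ⟨u, hK, hp.1, A, hA, B, hBu', h⟩
  left
  obtain ⟨s, t, rfl⟩ := K.uv_surj hp B
  have hb := (K.uv_mem_bdry hp).1 hB
  rw [K.uv_mem_side hp] at hBu
  rw [K.uv_mem_side_neg hp] at hBu'
  have hs1 : s ≠ 1 := fun e => hBu ⟨e, hb.1.2⟩
  have hs2 : s ≠ -1 := fun e => hBu' ⟨e, hb.1.2⟩
  have hs3 : -1 < s := lt_of_le_of_ne hb.1.1.1 (Ne.symm hs2)
  have hs4 : s < 1 := lt_of_le_of_ne hb.1.1.2 hs1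
  rcases hb.2 with e | e | e | e
  · exact absurd e hs1
  · exact absurd e hs2
  · exact ⟨hK, u, v, hp, A, hA, _, (K.uv_mem_openSide' hp).2 ⟨e, hs3, hs4⟩, h⟩
  · exact ⟨hK, u, -v, hp.neg_right, A, hA, _, (K.uv_mem_openSide_neg' hp).2 ⟨e, hs3, hs4⟩, h⟩

theorem isT3_or_isT2_of_vertex (hK : M.IsInterface K) (hp : Perp u v) {B : Pt}
    (h : K.bdry ∩ M.Γ = {K.uv u v 1 1, B})
    (hs : ∀ d ∈ dirs, ¬ (K.uv u v 1 1 ∈ K.side d ∧ B ∈ K.side d)) : M.IsT2 K ∨ M.IsT3 K := by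
  have hB : B ∈ K.bdry := (h.symm ▸ mem_insert_of_mem _ rfl : B ∈ K.bdry ∩ M.Γ).1
  have hBu : B ∉ K.side u := fun h' => hs u hp.1 ⟨(K.uv_mem_side hp).2 (by norm_num), h'⟩
  have hBv : B ∉ K.side v := fun h' => hs v hp.symm.1 ⟨(K.uv_mem_side' hp).2 (by norm_num), h'⟩
  obtain ⟨s, t, rfl⟩ := K.uv_surj hp B
  have hb := (K.uv_mem_bdry hp).1 hB
  rw [K.uv_mem_side hp] at hBu
  rw [K.uv_mem_side' hp] at hBv
  have hs1 : s < 1 := lt_of_le_of_ne hb.1.1.2 fun e => hBu ⟨e, hb.1.2⟩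
  have ht1 : t < 1 := lt_of_le_of_ne hb.1.2.2 fun e => hBv ⟨e, hb.1.1⟩
  by_cases hs2 : s = -1
  · subst hs2
    by_cases ht2 : t = -1
    · subst ht2
      exact Or.inr ⟨hK, u, v, hp, by rw [Cell.vertex_add, Cell.vertex_neg, h]⟩
    · refine Or.inl ⟨-u, hK, hp.neg_left.1, _, (K.uv_mem_openSide_neg hp).2
        ⟨rfl, lt_of_le_of_ne hb.1.2.1 (Ne.symm ht2), ht1⟩, K.uv u v 1 1, ?_, ?_⟩
      · rw [neg_neg, K.uv_mem_side hp]; norm_num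
      · rw [h, pair_comm]
  · have ht2 : t = -1 := by
      rcases hb.2 with e | e | e | e
      · linarith
      · exact absurd e hs2
      · linarith
      · exact e
    subst ht2
    refine Or.inl ⟨-v, hK, hp.symm.neg_left.1, _, (K.uv_mem_openSide_neg' hp).2
      ⟨rfl, lt_of_le_of_ne hb.1.1.1 (Ne.symm hs2), hs1⟩, K.uv u v 1 1, ?_, ?_⟩
    · rw [neg_neg, K.uv_mem_side' hp]; norm_num
    · rw [h, pair_comm]

/-- The end point `A` is an inner point of a side or a vertex. As the other end point lies on no
common closed side with it, the remaining positions are those of the three types. -/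
theorem IsInterface.type (hK : M.IsInterface K) : M.IsT1 K ∨ M.IsT2 K ∨ M.IsT3 K := by
  obtain ⟨A, B, h, hs, -⟩ := hK.bdry_inter
  have hA : A ∈ K.bdry := (h.symm ▸ mem_insert _ _ : A ∈ K.bdry ∩ M.Γ).1
  have key : ∀ u v : ℤ × ℤ, Perp u v → A ∈ K.side u → M.IsT1 K ∨ M.IsT2 K ∨ M.IsT3 K := by
    intro u v hp hAu
    obtain ⟨s, t, rfl⟩ := K.uv_surj hp A
    obtain ⟨rfl, h1, h2⟩ := (K.uv_mem_side hp).1 hAu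
    rcases h2.lt_or_eq with h2 | rfl
    · rcases h1.lt_or_eq with h1 | rfl
      · rcases isT1_or_isT2_of_openSide hK hp h hs ((K.uv_mem_openSide hp).2 ⟨rfl, h1, h2⟩) with h | h
        · exact Or.inl h
        · exact Or.inr (Or.inl h)
      · have e : K.uv u v 1 (-1) = K.uv u (-v) 1 1 := by rw [Cell.uv_neg_right]
        rw [e] at h hs
        exact Or.inr (isT3_or_isT2_of_vertex hK hp.neg_right h hs)
    · exact Or.inr (isT3_or_isT2_of_vertex hK hp h hs)
  have hp : Perp (1, 0) (0, 1) := by simp [Perp, dirs, rot]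
  rcases K.exists_side_of_mem_bdry hp hA with h | h | h | h
  · exact key _ _ hp h
  · exact key _ _ hp.symm h
  · exact key _ _ hp.neg_left h
  · exact key _ _ hp.symm.neg_left h

end InterfaceMesh

end Merging

namespace Merging

theorem Perp.ne {u v : ℤ × ℤ} (h : Perp u v) :
    u ≠ v ∧ u ≠ -v ∧ v ≠ -u ∧ u ≠ -u ∧ v ≠ -v ∧ -u ≠ -v := by
  rcases h.cases with ⟨rfl, rfl⟩ | ⟨rfl, rfl⟩ | ⟨rfl, rfl⟩ | ⟨rfl, rfl⟩ | ⟨rfl, rfl⟩ | ⟨rfl, rfl⟩ |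
    ⟨rfl, rfl⟩ | ⟨rfl, rfl⟩ <;> simp

theorem Perp.eq_of_add_eq {u v a b : ℤ × ℤ} (h : Perp u v) (h' : Perp a b) (e : u + v = a + b) :
    (a = u ∧ b = v) ∨ (a = v ∧ b = u) := by
  rcases h.cases with ⟨rfl, rfl⟩ | ⟨rfl, rfl⟩ | ⟨rfl, rfl⟩ | ⟨rfl, rfl⟩ | ⟨rfl, rfl⟩ | ⟨rfl, rfl⟩ |
    ⟨rfl, rfl⟩ | ⟨rfl, rfl⟩ <;>
  rcases h'.cases with ⟨rfl, rfl⟩ | ⟨rfl, rfl⟩ | ⟨rfl, rfl⟩ | ⟨rfl, rfl⟩ | ⟨rfl, rfl⟩ | ⟨rfl, rfl⟩ |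
    ⟨rfl, rfl⟩ | ⟨rfl, rfl⟩ <;> simp at e ⊢

theorem Cell.vertex_inj (K : Cell) {a b : ℤ × ℤ} (h : K.vertex a = K.vertex b) : a = b := by
  have h1 := congrArg Prod.fst h
  have h2 := congrArg Prod.snd h
  simp only [Cell.vertex, add_right_inj, mul_eq_mul_right_iff, K.w_pos.ne', K.h_pos.ne',
    or_false] at h1 h2
  have h1 : (a.1 : ℝ) = b.1 := by linarith
  have h2 : (a.2 : ℝ) = b.2 := by linarith
  exact Prod.ext (by exact_mod_cast h1) (by exact_mod_cast h2)

namespace InterfaceMesh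

variable {M : InterfaceMesh} {u v : ℤ × ℤ} {K : Cell}

/-! ### Sides that the interface crosses, and which types allow it. -/

theorem Split.mem_openSide {r : ℝ} {i : Fin 2} (h : M.Split K u v r i) (hp : Perp u v)
    (h0 : 0 < r) (h1 : r < 1) : (K.openSide u ∩ M.Γ).Nonempty := by
  refine ⟨_, ?_, h.mem⟩
  rw [Cell.sidePt_eq, K.uv_mem_openSide hp]
  exact ⟨rfl, by linarith, by linarith⟩

theorem T1Data.symm {i : Fin 2} {r₁ r₂ : ℝ} (h : M.T1Data K u v i r₁ r₂) :
    M.T1Data K v u i r₂ r₁ :=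
  ⟨h.perp.symm, h.pos₂, h.lt₂, h.pos₁, h.lt₁, h.split₂, h.split₁, h.side₂, h.side₁⟩

theorem T1Data.eq_of_meets {i : Fin 2} {r₁ r₂ : ℝ} (h : M.T1Data K u v i r₁ r₂) {d : ℤ × ℤ}
    (hd : d ∈ dirs) (hm : (K.side d ∩ M.Γ).Nonempty) : d = u ∨ d = v := by
  obtain ⟨p, hp, hpΓ⟩ := hm
  rcases (h.perp.mem_dirs_iff d).1 hd with e | e | rfl | rfl
  · exact Or.inl e
  · exact Or.inr e
  · exact absurd hpΓ (notMem_Γ_of_sgn (h.side₁ hp))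
  · exact absurd hpΓ (notMem_Γ_of_sgn (h.side₂ hp))

theorem T1Data.crosses₁ {i : Fin 2} {r₁ r₂ : ℝ} (h : M.T1Data K u v i r₁ r₂) :
    (K.openSide u ∩ M.Γ).Nonempty := h.split₁.mem_openSide h.perp h.pos₁ h.lt₁

theorem T1Data.crosses₂ {i : Fin 2} {r₁ r₂ : ℝ} (h : M.T1Data K u v i r₁ r₂) :
    (K.openSide v ∩ M.Γ).Nonempty := h.symm.crosses₁

theorem meets_of_crosses {d : ℤ × ℤ} (h : (K.openSide d ∩ M.Γ).Nonempty) :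
    (K.side d ∩ M.Γ).Nonempty := h.mono (inter_subset_inter_left _ (K.openSide_subset_side d))

theorem IsT2Along.crosses (h : M.IsT2Along K u) : (K.openSide u ∩ M.Γ).Nonempty := by
  obtain ⟨-, -, A, hA, B, -, e⟩ := h
  exact ⟨A, hA, (e.symm ▸ mem_insert _ _ : A ∈ K.bdry ∩ M.Γ).2⟩

theorem IsT2Along.meets_neg (h : M.IsT2Along K u) : (K.side (-u) ∩ M.Γ).Nonempty := by
  obtain ⟨-, -, A, -, B, hB, e⟩ := h
  exact ⟨B, hB, (e.symm ▸ mem_insert_of_mem _ rfl : B ∈ K.bdry ∩ M.Γ).2⟩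

theorem IsT1.not_isT2 (h : M.IsT1 K) : ¬ M.IsT2 K := by
  rintro ⟨d, hd⟩
  obtain ⟨u, v, i, r₁, r₂, D⟩ := h.data
  have hn := D.perp.ne
  rcases D.eq_of_meets hd.2.1 (meets_of_crosses hd.crosses) with rfl | rfl <;>
    rcases D.eq_of_meets (neg_mem_dirs hd.2.1) hd.meets_neg with e | e <;> tauto

theorem IsT3.not_crosses (h : M.IsT3 K) {d : ℤ × ℤ} (hd : d ∈ dirs) :
    ¬ (K.openSide d ∩ M.Γ).Nonempty := by
  rintro ⟨p, hp, hpΓ⟩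
  obtain ⟨u, v, i, D⟩ := h.data
  rcases (D.perp.mem_dirs_iff d).1 hd with rfl | rfl | rfl | rfl
  · exact notMem_Γ_of_sgn (D.side₁ hp) hpΓ
  · exact notMem_Γ_of_sgn (D.side₃ hp) hpΓ
  · exact notMem_Γ_of_sgn (D.side₄ hp) hpΓ
  · exact notMem_Γ_of_sgn (D.side₂ hp) hpΓ

theorem split_of_split {d : ℤ × ℤ} (hp : Perp u v) (hp' : Perp u d) {r : ℝ} {i : Fin 2}
    (h : M.Split K u v r i) : ∃ i' r', M.Split K u d r' i' ∧ (r' = r ∨ r' = 1 - r) := by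
  rcases hp.eq_or_of_perp hp' with rfl | rfl
  · exact ⟨i, r, h, Or.inl rfl⟩
  · exact ⟨_, _, h.symm, Or.inr rfl⟩

theorem IsInterface.split_of_crosses (hK : M.IsInterface K) (hp : Perp u v)
    (h : (K.openSide u ∩ M.Γ).Nonempty) : ∃ i r, 0 < r ∧ r < 1 ∧ M.Split K u v r i := by
  rcases hK.type with h1 | ⟨w, h2⟩ | h3
  · obtain ⟨a, b, i, r₁, r₂, D⟩ := h1.data
    have key : ∀ a b i r₁ r₂, M.T1Data K a b i r₁ r₂ → u = a →
        ∃ i r, 0 < r ∧ r < 1 ∧ M.Split K u v r i := by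
      rintro a b i r₁ r₂ D rfl
      obtain ⟨i', r', hs, h'⟩ := split_of_split D.perp hp D.split₁
      have := D.pos₁
      have := D.lt₁
      exact ⟨i', r', by rcases h' with rfl | rfl <;> linarith,
        by rcases h' with rfl | rfl <;> linarith, hs⟩
    rcases D.eq_of_meets hp.1 (meets_of_crosses h) with e | e
    · exact key _ _ _ _ _ D e
    · exact key _ _ _ _ _ D.symm e
  · obtain ⟨p, hpu, hpΓ⟩ := h
    rcases (hp.mem_dirs_iff w).1 h2.2.1 with rfl | rfl | rfl | rfl
    · obtain ⟨i, r₁, r₂, D⟩ := h2.data hp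
      exact ⟨i, r₁, D.pos₁, D.lt₁, D.split₁⟩
    · obtain ⟨i, r₁, r₂, D⟩ := h2.data hp.symm
      exact absurd hpΓ (notMem_Γ_of_sgn (D.side₁ hpu))
    · obtain ⟨i, r₁, r₂, D⟩ := h2.data hp.neg_left
      have hs := D.split₂
      rw [neg_neg] at hs
      -- If the interface ended in a vertex, the rest of this side would lie off `Γ`, but `p` is an
      -- inner point of the side and lies on `Γ`.
      refine ⟨i, r₂, hs.nonneg.lt_of_ne ?_, hs.le_one.lt_of_ne ?_, hs⟩
      all_goals
        rintro rfl
        obtain ⟨s, t, rfl⟩ := K.uv_surj hp p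
        obtain ⟨rfl, h1, h2⟩ := (K.uv_mem_openSide hp).1 hpu
      · have := hs.gt ((1 - t) / 2) (by linarith) (by linarith)
        rw [Cell.sidePt_eq, show 1 - 2 * ((1 - t) / 2) = t by ring] at this
        exact notMem_Γ_of_sgn this hpΓ
      · have := hs.lt ((1 - t) / 2) (by linarith) (by linarith)
        rw [Cell.sidePt_eq, show 1 - 2 * ((1 - t) / 2) = t by ring] at this
        exact notMem_Γ_of_sgn this hpΓ
    · obtain ⟨i, r₁, r₂, D⟩ := h2.data hp.symm.neg_left
      exact absurd hpΓ (notMem_Γ_of_sgn (D.side₁ hpu))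
  · exact absurd h (h3.not_crosses hp.1)

theorem Split.exists_both {r : ℝ} {i : Fin 2} (h : M.Split K u v r i) (hp : Perp u v)
    (h0 : 0 < r) (h1 : r < 1) (j : Fin 2) : (K.openSide u ∩ M.sgn j).Nonempty := by
  have key (t : ℝ) (ht0 : 0 < t) (ht1 : t < 1) : K.sidePt u v t ∈ K.openSide u := by
    rw [Cell.sidePt_eq, K.uv_mem_openSide hp]
    exact ⟨rfl, by linarith, by linarith⟩
  rcases eq_or_rev i j with rfl | rfl
  · exact ⟨_, key (r / 2) (by linarith) (by linarith), h.lt _ (by linarith) (by linarith)⟩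
  · exact ⟨_, key ((r + 1) / 2) (by linarith) (by linarith), h.gt _ (by linarith) (by linarith)⟩

/-! ### Elements across a side -/

/-- An inner crossing leaves points of both signs on the common side, while the closure of a
non-interface element avoids one of the signs. -/
theorem IsInterface.shift_of_crosses (hK : M.IsInterface K) {d : ℤ × ℤ} (hd : d ∈ dirs)
    (hT : K.shift d ∈ M.T) (h : (K.openSide d ∩ M.Γ).Nonempty) : M.IsInterface (K.shift d) := by
  by_contra hn
  obtain ⟨i, hi⟩ := exists_sgn_of_not_isInterface hT hn
  obtain ⟨j, r, h0, h1, hs⟩ := hK.split_of_crosses (Perp.of_rot hd) h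
  obtain ⟨p, hp, hp'⟩ := hs.exists_both (Perp.of_rot hd) h0 h1 i.rev
  rw [← K.openSide_shift hd] at hp
  exact closed_disjoint_sgn_rev hi
    (Cell.side_subset_closed _ (neg_mem_dirs hd) (Cell.openSide_subset_side _ _ hp)) hp'

/-- The sublevel function near a point of the interface. -/
theorem exists_level {p : Pt} (hp : p ∈ M.Γ) : ∃ φ : Pt → ℝ, ContDiffAt ℝ 2 φ p ∧
    fderiv ℝ φ p ≠ 0 ∧ (∀ᶠ z in 𝓝 p, (z ∈ M.Ω₁ ↔ φ z < 0)) ∧ φ p = 0 := by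
  obtain ⟨φ, h1, h2, h3⟩ := M.smooth p hp
  refine ⟨φ, h1, h2, h3, le_antisymm ?_ ?_⟩
  · by_contra! hpos
    have h4 : ∀ᶠ z in 𝓝 p, 0 < φ z := h1.continuousAt.eventually (lt_mem_nhds hpos)
    obtain ⟨z, ⟨hz1, hz2⟩, hz3⟩ := (mem_closure_iff_frequently.1 hp.1).and_eventually (h3.and h4)
      |>.exists.imp fun z hz => (⟨hz.2, hz.1⟩ : ((z ∈ M.Ω₁ ↔ φ z < 0) ∧ 0 < φ z) ∧ z ∈ M.Ω₁)
    linarith [hz1.1 hz3]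
  · by_contra! hneg
    have := h3.self_of_nhds.2 hneg
    exact hp.2 (M.isOpen_Ω₁.interior_eq.symm ▸ this)

/-- Otherwise `closure Ω₁` would be a neighbourhood of `p` and the level function would be
nonpositive near its zero `p`: a local maximum with a nonvanishing derivative. So `Γ` has no slits
with `Ω₁` on both sides. -/
theorem mem_closure_sgn_one {p : Pt} (hp : p ∈ M.Γ) : p ∈ closure (M.sgn 1) := by
  by_contra hn
  obtain ⟨φ, h1, h2, h3, h4⟩ := exists_level hp
  refine h2 (IsLocalMax.fderiv_eq_zero ?_)
  have hc : ∀ᶠ z in 𝓝 p, ContinuousAt φ z :=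
    (h1.eventually (by simp)).mono fun z hz => hz.continuousAt
  have hn' : ∀ᶠ z in 𝓝 p, z ∈ closure M.Ω₁ := by
    filter_upwards [isClosed_closure.isOpen_compl.mem_nhds hn] with z hz
    by_contra h
    exact hz (subset_closure h)
  filter_upwards [hc, hn', eventually_eventually_nhds.2 h3] with z hz1 hz2 hz3
  rw [h4]
  by_contra! hpos
  obtain ⟨y, hy1, hy2, hy3⟩ := ((mem_closure_iff_frequently.1 hz2).and_eventually
    (hz3.and (hz1.eventually (lt_mem_nhds hpos)))).exists
  linarith [hy2.1 hy1]

/-- Three cases for the element across the side. An interface element that `Γ` enters through the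
side would show both signs there. A non-interface element of the same sign leaves no room for the
other sign, although every point of `Γ` is a limit of both. If the signs differ, no sign is possible
on the side, so `Γ` runs along it. -/
theorem side_of_not_isInterface {G : Cell} {i : Fin 2} (hi : G.toSet ⊆ M.sgn i)
    {d : ℤ × ℤ} (hd : d ∈ dirs) (hN : G.shift d ∈ M.T) :
    G.openSide d ⊆ M.sgn i ∨ G.side d ⊆ M.Γ := by
  have hp := Perp.of_rot hd
  have hcl : ∀ p ∈ G.side d, p ∉ M.sgn i.rev := fun p h =>
    closed_disjoint_sgn_rev hi (G.side_subset_closed hd h)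
  have key : (∀ p ∈ G.openSide d, p ∉ M.Γ) → G.openSide d ⊆ M.sgn i := fun h p hps => by
    obtain ⟨j, hj⟩ := exists_sgn (h p hps)
    rcases eq_or_rev i j with rfl | rfl
    · exact hj
    · exact absurd hj (hcl p (G.openSide_subset_side d hps))
  by_cases hNI : M.IsInterface (G.shift d)
  · refine Or.inl (key fun p hps hpΓ => ?_)
    rw [← G.openSide_shift hd] at hps
    obtain ⟨j, r, h0, h1, hs⟩ := hNI.split_of_crosses hp.neg_left ⟨p, hps, hpΓ⟩
    obtain ⟨q, hq, hq'⟩ := hs.exists_both hp.neg_left h0 h1 i.rev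
    rw [G.openSide_shift hd] at hq
    exact hcl q (G.openSide_subset_side d hq) hq'
  · obtain ⟨k, hk⟩ := exists_sgn_of_not_isInterface hN hNI
    rcases eq_or_rev i k with rfl | rfl
    · refine Or.inl (key fun p hps hpΓ => ?_)
      have h01 : (0 : ℤ) ≤ 1 := by norm_num
      have hR : p ∈ (G.box hp h01 (le_refl 0)).toSet := by
        rw [G.openSide_eq hp] at hps
        obtain ⟨t, h1, h2, rfl⟩ := hps
        rw [G.uv_mem_box_toSet _ _ hp]
        norm_num; exact ⟨h1, h2⟩
      have hcov : ∀ q ∈ (G.box hp h01 (le_refl 0)).toSet, q ∉ M.sgn k.rev := by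
        intro q hq
        obtain ⟨s, t, rfl⟩ := G.uv_surj hp q
        rw [G.uv_mem_box_toSet _ _ hp] at hq
        norm_num at hq
        rcases le_total s 1 with h | h
        · exact closed_disjoint_sgn_rev hi
            ((G.uv_mem_closed hp).2 ⟨⟨by linarith [hq.1.1], h⟩, hq.2.1.le, hq.2.2.le⟩)
        · refine closed_disjoint_sgn_rev hk ?_
          rw [Cell.shift_left (v := rot d), G.uv_mem_cell_closed hp]
          norm_num
          exact ⟨⟨h, by linarith [hq.1.2]⟩, hq.2.1.le, hq.2.2.le⟩
      have hcl' : ∀ j, p ∈ closure (M.sgn j) := fun j => by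
        fin_cases j
        · exact hpΓ.1
        · exact mem_closure_sgn_one hpΓ
      obtain ⟨q, hq, hq'⟩ := mem_closure_iff.1 (hcl' k.rev) _ (Cell.isOpen_toSet _) hR
      exact hcov q hq hq'
    · refine Or.inr fun p hps => ?_
      by_contra hpΓ
      obtain ⟨j, hj⟩ := exists_sgn hpΓ
      rcases eq_or_rev i.rev j with rfl | rfl
      · exact hcl p hps hj
      · rw [← G.side_shift hd] at hps
        exact closed_disjoint_sgn_rev hk (Cell.side_subset_closed _ (neg_mem_dirs hd) hps) hj

/-! ### Vertices on the interface -/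

/-- A vertex on `Γ` is an end point of the arc in `K`, and the end points separate the boundary into
parts of different sign; the two sides that meet in the vertex start these two parts. -/
theorem IsInterface.sgn_of_vertex (hK : M.IsInterface K) (hp : Perp u v)
    (hv : K.uv u v 1 1 ∈ M.Γ) : ∃ i, K.openSide u ⊆ M.sgn i ∧ K.openSide v ⊆ M.sgn i.rev := by
  have hmu : (K.side u ∩ M.Γ).Nonempty := ⟨_, (K.uv_mem_side hp).2 (by norm_num), hv⟩
  have hmv : (K.side v ∩ M.Γ).Nonempty := ⟨_, (K.uv_mem_side' hp).2 (by norm_num), hv⟩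
  have hno : ∀ {r i}, M.Split K u v r i → r ≤ 0 := fun {r i} hs => by
    by_contra! h
    have := hs.lt 0 le_rfl h
    rw [Cell.sidePt_eq] at this
    norm_num at this
    exact notMem_Γ_of_sgn this hv
  have hno' : ∀ {r i}, M.Split K v u r i → r ≤ 0 := fun {r i} hs => by
    by_contra! h
    have := hs.lt 0 le_rfl h
    rw [Cell.sidePt_eq, Cell.uv_comm] at this
    norm_num at this
    exact notMem_Γ_of_sgn this hv
  rcases hK.type with h1 | ⟨w, h2⟩ | h3
  · obtain ⟨a, b, i, r₁, r₂, D⟩ := h1.data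
    have hne := hp.ne.1
    rcases D.eq_of_meets hp.1 hmu with rfl | rfl <;>
      rcases D.eq_of_meets hp.symm.1 hmv with rfl | rfl
    · exact absurd rfl hne
    · exact absurd (hno D.split₁) (not_le.2 D.pos₁)
    · exact absurd (hno D.split₂) (not_le.2 D.pos₂)
    · exact absurd rfl hne
  · rcases (hp.mem_dirs_iff w).1 h2.2.1 with rfl | rfl | rfl | rfl
    · obtain ⟨i, r₁, r₂, D⟩ := h2.data hp
      exact absurd (hno D.split₁) (not_le.2 D.pos₁)
    · obtain ⟨i, r₁, r₂, D⟩ := h2.data hp.symm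
      exact absurd (hno' D.split₁) (not_le.2 D.pos₁)
    · obtain ⟨i, r₁, r₂, D⟩ := h2.data hp.neg_left
      have hs := D.split₂
      rw [neg_neg] at hs
      obtain rfl := le_antisymm (hno hs) hs.nonneg
      refine ⟨i.rev, fun p hps => ?_, by rw [Fin.rev_rev]; exact D.side₁⟩
      rw [K.openSide_eq hp] at hps
      obtain ⟨t, h1, h2, rfl⟩ := hps
      have := hs.gt ((1 - t) / 2) (by linarith) (by linarith)
      rwa [Cell.sidePt_eq, show 1 - 2 * ((1 - t) / 2) = t by ring] at this
    · obtain ⟨i, r₁, r₂, D⟩ := h2.data hp.symm.neg_left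
      have hs := D.split₂
      rw [neg_neg] at hs
      obtain rfl := le_antisymm (hno' hs) hs.nonneg
      refine ⟨i, D.side₁, fun p hps => ?_⟩
      rw [K.openSide_eq hp.symm] at hps
      obtain ⟨t, h1, h2, rfl⟩ := hps
      have := hs.gt ((1 - t) / 2) (by linarith) (by linarith)
      rwa [Cell.sidePt_eq, show 1 - 2 * ((1 - t) / 2) = t by ring] at this
  · obtain ⟨a, b, i, D⟩ := h3.data
    have hb : K.vertex (u + v) ∈ K.bdry ∩ M.Γ := by
      rw [Cell.vertex_add]
      exact ⟨K.side_subset_bdry hp.1 ((K.uv_mem_side hp).2 (by norm_num)), hv⟩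
    rw [D.bdry] at hb
    rcases hb with hb | hb
    · rcases hp.eq_of_add_eq D.perp (K.vertex_inj hb) with ⟨rfl, rfl⟩ | ⟨rfl, rfl⟩
      · exact ⟨i, D.side₁, D.side₃⟩
      · exact ⟨i.rev, D.side₃, by rw [Fin.rev_rev]; exact D.side₁⟩
    · have e : u + v = -a + -b := by rw [K.vertex_inj hb]; abel
      rcases hp.eq_of_add_eq D.perp.neg_left.neg_right e with ⟨rfl, rfl⟩ | ⟨rfl, rfl⟩
      · exact ⟨i.rev, D.side₄, by rw [Fin.rev_rev]; exact D.side₂⟩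
      · exact ⟨i, D.side₂, D.side₄⟩

/-- Along the line in direction `v` the level function is negative except at the vertex, where it is
0; along the other line it is nonnegative. So both directional derivatives vanish, hence the whole
derivative. -/
theorem not_cross_at_vertex (hp : Perp u v) (hv : K.uv u v 1 1 ∈ M.Γ)
    (h0 : ∀ t, |t - 1| < 2 → t ≠ 1 → K.uv u v 1 t ∈ M.sgn 0)
    (h1 : ∀ s, |s - 1| < 2 → s ≠ 1 → K.uv u v s 1 ∈ M.sgn 1) : False := by
  obtain ⟨φ, hφ, hne, hlev, hzero⟩ := exists_level hv
  have hdiff := (hφ.differentiableAt (by norm_num)).hasFDerivAt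
  set Q := K.uv u v 1 1 with hQ
  have line (e : Pt) : HasDerivAt (fun t : ℝ => φ (Q + t • e)) (fderiv ℝ φ Q e) 0 := by
    have h : HasDerivAt (fun t : ℝ => Q + t • e) e 0 := by
      simpa using ((hasDerivAt_id (0 : ℝ)).smul_const e).const_add Q
    have hd : HasFDerivAt φ (fderiv ℝ φ Q) (Q + (0 : ℝ) • e) := by simpa using hdiff
    exact hd.comp_hasDerivAt (0 : ℝ) h
  have hcont (e : Pt) : Filter.Tendsto (fun t : ℝ => Q + t • e) (𝓝 0) (𝓝 Q) := by
    have : Continuous fun t : ℝ => Q + t • e := by fun_prop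
    simpa using this.tendsto 0
  have hsmall : ∀ᶠ t : ℝ in 𝓝 0, |t| < 2 := by
    have := (continuous_abs : Continuous fun t : ℝ => |t|).tendsto 0
    rw [abs_zero] at this
    exact this.eventually (gt_mem_nhds two_pos)
  let ev : Pt := (v.1 / 2 * K.w, v.2 / 2 * K.h)
  let eu : Pt := (u.1 / 2 * K.w, u.2 / 2 * K.h)
  have hev (t : ℝ) : Q + t • ev = K.uv u v 1 (1 + t) := by
    ext <;> simp [hQ, ev, Cell.uv] <;> ring
  have heu (t : ℝ) : Q + t • eu = K.uv u v (1 + t) 1 := by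
    ext <;> simp [hQ, eu, Cell.uv] <;> ring
  have dv : fderiv ℝ φ Q ev = 0 := by
    refine IsLocalMax.hasDerivAt_eq_zero ?_ (line ev)
    filter_upwards [(hcont ev).eventually hlev, hsmall] with t ht hs
    simp only [zero_smul, add_zero, hzero]
    by_cases h : t = 0
    · subst h; simp [hzero]
    · refine (ht.1 ?_).le
      rw [hev]
      exact h0 _ (by simpa using hs) (by simpa using h)
  have du : fderiv ℝ φ Q eu = 0 := by
    refine IsLocalMin.hasDerivAt_eq_zero ?_ (line eu)
    filter_upwards [(hcont eu).eventually hlev, hsmall] with t ht hs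
    simp only [zero_smul, add_zero, hzero]
    by_cases h : t = 0
    · subst h; simp [hzero]
    · by_contra! hneg
      have h2 : Q + t • eu ∈ M.sgn 0 := ht.2 hneg
      rw [heu] at h2
      exact absurd (sgn_unique h2 (h1 _ (by simpa using hs) (by simpa using h))) (by decide)
  refine hne (ContinuousLinearMap.ext fun p => ?_)
  obtain ⟨s, t, e⟩ := K.uv_surj hp (Q + p)
  have hpe : p = (s - 1) • eu + (t - 1) • ev := by
    have h2 : p = K.uv u v s t - Q := by rw [e]; simp
    rw [h2]
    ext <;> simp [hQ, eu, ev, Cell.uv] <;> ring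
  rw [hpe, map_add, map_smul, map_smul, dv, du]
  simp

/-- A vertex on the interface does not belong to three interface elements. -/
theorem vertex_notMem (hp : Perp u v) (hK : M.IsInterface K) (hu : M.IsInterface (K.shift u))
    (hv : M.IsInterface (K.shift v)) : K.uv u v 1 1 ∉ M.Γ := by
  intro hΓ
  obtain ⟨a, ha1, ha2⟩ := hK.sgn_of_vertex hp hΓ
  obtain ⟨b, hb1, hb2⟩ := hu.sgn_of_vertex hp.neg_left (by
    rw [Cell.uv_neg_left, Cell.shift_left (v := v), Cell.uv_cell]; norm_num; exact hΓ)
  obtain ⟨c, hc1, hc2⟩ := hv.sgn_of_vertex hp.neg_right (by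
    rw [Cell.uv_neg_right, Cell.shift_right (u := u), Cell.uv_cell]; norm_num; exact hΓ)
  rw [Cell.openSide_shift _ hp.1] at hb1
  rw [Cell.openSide_shift _ hp.symm.1] at hc2
  have hmu : K.uv u v 1 0 ∈ K.openSide u := (K.uv_mem_openSide hp).2 (by norm_num)
  have hmv : K.uv u v 0 1 ∈ K.openSide v := (K.uv_mem_openSide' hp).2 (by norm_num)
  -- Neighbouring elements share a side at the vertex, so their signs match: all of the mesh line in
  -- direction `v` near the vertex has the sign `a`, and all of the line in direction `u` the
  -- opposite one.
  obtain rfl := sgn_unique (ha1 hmu) (hb1 hmu)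
  obtain rfl := Fin.rev_injective (sgn_unique (ha2 hmv) (hc2 hmv))
  have ht : ∀ t, |t - 1| < 2 → t ≠ 1 → K.uv u v 1 t ∈ M.sgn a := by
    intro t h2 hne
    rw [abs_lt] at h2
    rcases lt_or_gt_of_ne hne with h | h
    · exact ha1 ((K.uv_mem_openSide hp).2 ⟨rfl, by linarith, h⟩)
    · have := hc1 ((Cell.uv_mem_openSide _ hp (s := 1) (t := t - 2)).2 ⟨rfl, by linarith, by linarith⟩)
      rw [Cell.shift_right (u := u), Cell.uv_cell] at this
      simpa using this
  have hs : ∀ s, |s - 1| < 2 → s ≠ 1 → K.uv u v s 1 ∈ M.sgn a.rev := by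
    intro s h2 hne
    rw [abs_lt] at h2
    rcases lt_or_gt_of_ne hne with h | h
    · exact ha2 ((K.uv_mem_openSide' hp).2 ⟨rfl, by linarith, h⟩)
    · have := hb2 ((Cell.uv_mem_openSide' _ hp (s := s - 2) (t := 1)).2 ⟨rfl, by linarith, by linarith⟩)
      rw [Cell.shift_left (v := v), Cell.uv_cell] at this
      simpa using this
  rcases eq_or_rev 0 a with rfl | rfl
  · exact not_cross_at_vertex hp hΓ ht hs
  · refine not_cross_at_vertex hp.symm (by rwa [Cell.uv_comm]) (fun t h hne => ?_) fun t h hne => ?_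
    · rw [Cell.uv_comm]; exact hs t h hne
    · rw [Cell.uv_comm]; exact ht t h hne

end InterfaceMesh

end Merging

namespace Merging

open InterfaceMesh

/-! ### Combinatorics of chains -/

theorem consecutive_iff {C : List Cell} {K L : Cell} :
    Consecutive C K L ↔ ∃ i, C[i]? = some K ∧ C[i + 1]? = some L := by
  unfold Consecutive
  rw [List.infix_iff_getElem?]
  constructor
  · rintro ⟨k, hk, h⟩
    refine ⟨k, ?_, ?_⟩
    · have := h 0 (by simp)
      simpa using this
    · have := h 1 (by simp)
      simpa [add_comm] using this
  · rintro ⟨i, h0, h1⟩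
    have hl := (List.getElem?_eq_some_iff.1 h1).1
    refine ⟨i, by simp; omega, ?_⟩
    intro j hj
    simp at hj
    interval_cases j
    · simpa using h0
    · simpa [add_comm] using h1

theorem InterfaceMesh.IsClosedList.getElem?_last {C : List Cell} (h : IsClosedList C) :
    C[C.length - 1]? = C[0]? := by
  rw [← List.getLast?_eq_getElem?, ← h.2.1, List.head?_eq_getElem?]

theorem index_eq {C : List Cell} (hC : C.Nodup ∨ IsClosedList C) {K : Cell} {i j : ℕ}
    (hi : C[i]? = some K) (hj : C[j]? = some K) :
    i = j ∨ (4 ≤ C.length ∧ (i = 0 ∧ j + 1 = C.length ∨ j = 0 ∧ i + 1 = C.length)) := by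
  have hil := (List.getElem?_eq_some_iff.1 hi).1
  have hjl := (List.getElem?_eq_some_iff.1 hj).1
  rcases hC with hC | hC
  · exact Or.inl ((List.getElem?_inj hil hC).1 (hi.trans hj.symm))
  have hlast := IsClosedList.getElem?_last hC
  obtain ⟨h4, -, hnd⟩ := hC
  have key : ∀ i j, C[i + 1]? = some K → C[j + 1]? = some K → i = j := by
    intro i j hi hj
    have hil := (List.getElem?_eq_some_iff.1 hi).1
    refine (List.getElem?_inj (l := C.tail) (by simp; omega) hnd).1 ?_
    simp [hi, hj]
  have e : C.length - 1 = C.length - 2 + 1 := by omega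
  rcases i with _ | i <;> rcases j with _ | j
  · exact Or.inl rfl
  · have := key j (C.length - 2) hj (by rw [← e, hlast, hi])
    omega
  · have := key i (C.length - 2) hi (by rw [← e, hlast, hj])
    omega
  · exact Or.inl (by rw [key i j hi hj])

section Chain

variable {C : List Cell} (hC : C.Nodup ∨ IsClosedList C)

theorem Consecutive.mem_left {K L : Cell} (h : Consecutive C K L) : K ∈ C := h.subset (by simp)

theorem Consecutive.mem_right {K L : Cell} (h : Consecutive C K L) : L ∈ C := h.subset (by simp)

include hC

theorem Consecutive.succ_unique {K L L' : Cell} (h : Consecutive C K L)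
    (h' : Consecutive C K L') : L = L' := by
  obtain ⟨i, hi, hi'⟩ := consecutive_iff.1 h
  obtain ⟨j, hj, hj'⟩ := consecutive_iff.1 h'
  have hil := (List.getElem?_eq_some_iff.1 hi').1
  have hjl := (List.getElem?_eq_some_iff.1 hj').1
  rcases index_eq hC hi hj with rfl | h
  · simpa [hi'] using hj'
  · omega

theorem Consecutive.pred_unique {K K' L : Cell} (h : Consecutive C K L)
    (h' : Consecutive C K' L) : K = K' := by
  obtain ⟨i, hi, hi'⟩ := consecutive_iff.1 h
  obtain ⟨j, hj, hj'⟩ := consecutive_iff.1 h'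
  rcases index_eq hC hi' hj' with h | h
  · obtain rfl : i = j := by omega
    simpa [hi] using hj
  · omega

theorem Consecutive.ne {K L : Cell} (h : Consecutive C K L) : K ≠ L := by
  rintro rfl
  obtain ⟨i, hi, hi'⟩ := consecutive_iff.1 h
  rcases index_eq hC hi hi' with h | h <;> omega

/-- Here the length at least 4 of a closed chain matters: `G₁ → G₂ → G₁` would be a counterexample.
-/
theorem Consecutive.ne_of_consecutive {K L K' : Cell} (h : Consecutive C K L)
    (h' : Consecutive C L K') : K ≠ K' := by
  rintro rfl
  obtain ⟨i, hi, hi'⟩ := consecutive_iff.1 h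
  obtain ⟨j, hj, hj'⟩ := consecutive_iff.1 h'
  rcases index_eq hC hi' hj with h | h <;> rcases index_eq hC hi hj' with h' | h' <;> omega

end Chain

/-- `K` and `L` follow each other in the chain, in one of the two orders. -/
def ChainNbr (C : List Cell) (K L : Cell) : Prop := Consecutive C K L ∨ Consecutive C L K

/-- `K` has a predecessor and a successor in the chain. -/
def IsInner (C : List Cell) (K : Cell) : Prop := ∃ X Y, Consecutive C X K ∧ Consecutive C K Y

theorem ChainNbr.symm {C : List Cell} {K L : Cell} (h : ChainNbr C K L) : ChainNbr C L K :=
  Or.symm h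

theorem ChainNbr.mem_left {C : List Cell} {K L : Cell} (h : ChainNbr C K L) : K ∈ C :=
  h.elim (fun h => h.mem_left) fun h => h.mem_right

theorem ChainNbr.mem_right {C : List Cell} {K L : Cell} (h : ChainNbr C K L) : L ∈ C :=
  h.symm.mem_left

section Chain

variable {C : List Cell} (hC : C.Nodup ∨ IsClosedList C)

include hC

theorem ChainNbr.ne {K L : Cell} (h : ChainNbr C K L) : K ≠ L :=
  h.elim (fun h => h.ne hC) fun h => (h.ne hC).symm

theorem ChainNbr.eq_or {K L L' L'' : Cell} (h : ChainNbr C K L) (h' : ChainNbr C K L')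
    (hne : L ≠ L') (h'' : ChainNbr C K L'') : L'' = L ∨ L'' = L' := by
  rcases h with h | h <;> rcases h' with h' | h' <;> rcases h'' with h'' | h''
  · exact Or.inl (h''.succ_unique hC h)
  · exact absurd (h.succ_unique hC h') hne
  · exact Or.inl (h''.succ_unique hC h)
  · exact Or.inr (h''.pred_unique hC h')
  · exact Or.inr (h''.succ_unique hC h')
  · exact Or.inl (h''.pred_unique hC h)
  · exact absurd (h.pred_unique hC h') hne
  · exact Or.inl (h''.pred_unique hC h)

theorem IsInner.exists_ne {K : Cell} (h : IsInner C K) :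
    ∃ X Y, X ≠ Y ∧ ChainNbr C K X ∧ ChainNbr C K Y := by
  obtain ⟨X, Y, h, h'⟩ := h
  exact ⟨X, Y, h.ne_of_consecutive hC h', Or.inr h, Or.inl h'⟩

theorem isInner_or_end {K : Cell} (hK : K ∈ C) :
    IsInner C K ∨ (C.Nodup ∧ (C.head? = some K ∨ C.getLast? = some K)) := by
  obtain ⟨i, hil, hi⟩ := List.getElem_of_mem hK
  have hi : C[i]? = some K := by rw [List.getElem?_eq_getElem hil, hi]
  rcases hC with hC | hC
  · by_cases h0 : i = 0
    · subst h0; right; exact ⟨hC, Or.inl (by rw [List.head?_eq_getElem?, hi])⟩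
    by_cases h1 : i + 1 = C.length
    · right
      refine ⟨hC, Or.inr ?_⟩
      rw [List.getLast?_eq_getElem?, ← h1]; simpa using hi
    left
    refine ⟨C[i - 1], C[i + 1], consecutive_iff.2 ⟨i - 1, ?_, ?_⟩, consecutive_iff.2 ⟨i, hi, ?_⟩⟩
    · exact List.getElem?_eq_getElem _
    · rwa [Nat.sub_add_cancel (by omega)]
    · exact List.getElem?_eq_getElem _
  · left
    have hlast := IsClosedList.getElem?_last hC
    have h4 := hC.1
    obtain ⟨j, k, hj, hj', hk, hk'⟩ : ∃ j k, j + 1 < C.length ∧ C[j + 1]? = some K ∧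
        k + 1 < C.length ∧ C[k]? = some K := by
      by_cases h0 : i = 0
      · subst h0
        refine ⟨C.length - 2, 0, by omega, ?_, by omega, hi⟩
        rw [show C.length - 2 + 1 = C.length - 1 by omega, hlast, hi]
      by_cases h1 : i + 1 = C.length
      · refine ⟨i - 1, 0, by omega, ?_, by omega, ?_⟩
        · rwa [Nat.sub_add_cancel (by omega)]
        · rw [← hlast, ← h1]; simpa using hi
      refine ⟨i - 1, i, by omega, ?_, by omega, hi⟩
      rwa [Nat.sub_add_cancel (by omega)]
    exact ⟨C[j], C[k + 1], consecutive_iff.2 ⟨j, List.getElem?_eq_getElem _, hj'⟩,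
      consecutive_iff.2 ⟨k, hk', List.getElem?_eq_getElem _⟩⟩

omit hC in
theorem exists_chainNbr (hn : 2 ≤ C.length) {K : Cell} (hK : K ∈ C) : ∃ L, ChainNbr C K L := by
  obtain ⟨i, hil, hi⟩ := List.getElem_of_mem hK
  have hi : C[i]? = some K := by rw [List.getElem?_eq_getElem hil, hi]
  by_cases h1 : i + 1 < C.length
  · exact ⟨C[i + 1], Or.inl (consecutive_iff.2 ⟨i, hi, List.getElem?_eq_getElem _⟩)⟩
  · refine ⟨C[i - 1], Or.inr (consecutive_iff.2 ⟨i - 1, List.getElem?_eq_getElem _, ?_⟩)⟩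
    rwa [Nat.sub_add_cancel (by omega)]

omit hC in
-- Used to identify the whole chain with a set of elements which is closed under passing to
-- neighbours in the chain.
theorem forall_of_consecutive {P : Cell → Prop} (h : ∃ K ∈ C, P K)
    (hP : ∀ K L, Consecutive C K L → (P K ↔ P L)) : ∀ K ∈ C, P K := by
  have key : ∀ i (hi : i < C.length), P C[i] ↔ P (C[0]'(by omega)) := by
    intro i
    induction i with
    | zero => intro; rfl
    | succ i ih =>
      intro hi
      rw [← ih (by omega)]
      exact (hP _ _ (consecutive_iff.2
        ⟨i, List.getElem?_eq_getElem _, List.getElem?_eq_getElem _⟩)).symm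
  obtain ⟨K, hK, hPK⟩ := h
  obtain ⟨i, hi, rfl⟩ := List.getElem_of_mem hK
  intro L hL
  obtain ⟨j, hj, rfl⟩ := List.getElem_of_mem hL
  rw [key j hj, ← key i hi]
  exact hPK

omit hC in
theorem two_ends {K₁ K₂ K₃ : Cell} (h₁ : C.head? = some K₁ ∨ C.getLast? = some K₁)
    (h₂ : C.head? = some K₂ ∨ C.getLast? = some K₂)
    (h₃ : C.head? = some K₃ ∨ C.getLast? = some K₃) (h₁₂ : K₁ ≠ K₂) (h₁₃ : K₁ ≠ K₃) :
    K₂ = K₃ := by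
  rcases h₁ with h₁ | h₁ <;> rcases h₂ with h₂ | h₂ <;> rcases h₃ with h₃ | h₃ <;>
    rw [h₁] at * <;> simp_all

end Chain

/-! ### Maximal subchains of elements of type 1 -/

/-- With unique successors there is only one way to continue a list, and maximality decides where it
stops. -/
theorem tail_unique {R : Cell → Cell → Prop} (hR : ∀ a b c, R a b → R a c → b = c)
    {P : Cell → Prop} : ∀ (B B' : List Cell) (K : Cell), (K :: B).IsChain R →
    (K :: B').IsChain R → (∀ X ∈ B, P X) → (∀ X ∈ B', P X) →
    (∀ L ∈ (K :: B).getLast?, ∀ X, R L X → ¬ P X) →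
    (∀ L ∈ (K :: B').getLast?, ∀ X, R L X → ¬ P X) → B = B'
  | [], [], _, _, _, _, _, _, _ => rfl
  | [], b :: B', K, _, h', _, hP', hl, _ =>
    absurd (hP' b (by simp)) (hl K (by simp) b (List.isChain_cons_cons.1 h').1)
  | b :: B, [], K, h, _, hP, _, _, hl =>
    absurd (hP b (by simp)) (hl K (by simp) b (List.isChain_cons_cons.1 h).1)
  | b :: B, b' :: B', K, h, h', hP, hP', hl, hl' => by
    obtain ⟨h1, h2⟩ := List.isChain_cons_cons.1 h
    obtain ⟨h1', h2'⟩ := List.isChain_cons_cons.1 h'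
    obtain rfl := hR _ _ _ h1 h1'
    rw [tail_unique hR B B' b h2 h2' (fun X hX => hP X (by simp [hX]))
      (fun X hX => hP' X (by simp [hX])) (by simpa [List.getLast?_cons_cons] using hl)
      (by simpa [List.getLast?_cons_cons] using hl')]

theorem IsSubchain.consecutive {C S : List Cell} (h : IsSubchain C S) {i : ℕ} {K L : Cell}
    (hK : S[i]? = some K) (hL : S[i + 1]? = some L) : Consecutive C K L := by
  obtain ⟨h1, rfl⟩ := List.getElem?_eq_some_iff.1 hK
  obtain ⟨h2, rfl⟩ := List.getElem?_eq_some_iff.1 hL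
  exact List.isChain_iff_getElem.1 h.2 i h2

theorem IsSubchain.mem {C S : List Cell} (h : IsSubchain C S) (hS : 2 ≤ S.length) {K : Cell}
    (hK : K ∈ S) : K ∈ C := by
  obtain ⟨i, hi, rfl⟩ := List.getElem_of_mem hK
  by_cases h1 : i + 1 < S.length
  · exact (h.consecutive (List.getElem?_eq_getElem hi) (List.getElem?_eq_getElem h1)).mem_left
  · have h2 : i - 1 + 1 = i := Nat.sub_add_cancel (by omega)
    exact (h.consecutive (i := i - 1) (List.getElem?_eq_getElem (by omega))
      (by rw [h2]; exact List.getElem?_eq_getElem hi)).mem_right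

theorem isSubchain_pair {C : List Cell} (hC : C.Nodup ∨ IsClosedList C) {K L : Cell}
    (h : Consecutive C K L) : IsSubchain C [K, L] :=
  ⟨by simp [h.ne hC], by simp [h]⟩

theorem isSubchain_triple {C : List Cell} (hC : C.Nodup ∨ IsClosedList C) {X K Y : Cell}
    (h : Consecutive C X K) (h' : Consecutive C K Y) : IsSubchain C [X, K, Y] :=
  ⟨by simp [h.ne hC, h'.ne hC, h.ne_of_consecutive hC h'], by simp [h, h']⟩

theorem IsSubchain.triple {C : List Cell} {X K Y : Cell} (h : IsSubchain C [X, K, Y]) :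
    Consecutive C X K ∧ Consecutive C K Y := by
  simpa using h.2

/-- A subchain whose last element precedes its first element is the whole chain. -/
theorem IsSubchain.mem_of_cyclic {C S : List Cell} (hC : C.Nodup ∨ IsClosedList C)
    (h : IsSubchain C S) {a b : Cell} (ha : S.head? = some a) (hb : S.getLast? = some b)
    (hba : Consecutive C b a) : ∀ K ∈ C, K ∈ S := by
  rw [List.head?_eq_getElem?] at ha
  rw [List.getLast?_eq_getElem?] at hb
  have key : ∀ K L, Consecutive C K L → (K ∈ S ↔ L ∈ S) := by
    intro K L hKL
    constructor
    · intro hK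
      obtain ⟨i, hi, rfl⟩ := List.getElem_of_mem hK
      by_cases h1 : i + 1 < S.length
      · have := h.consecutive (List.getElem?_eq_getElem hi) (List.getElem?_eq_getElem h1)
        rw [hKL.succ_unique hC this]; exact List.getElem_mem _
      · have h2 : i = S.length - 1 := by omega
        have h3 : S[i]? = some b := by rw [h2, hb]
        obtain ⟨h3, rfl⟩ := List.getElem?_eq_some_iff.1 h3
        rw [hKL.succ_unique hC hba]
        exact List.mem_of_getElem? ha
    · intro hL
      obtain ⟨i, hi, rfl⟩ := List.getElem_of_mem hL
      rcases i with _ | i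
      · have h3 := ha
        obtain ⟨h3, rfl⟩ := List.getElem?_eq_some_iff.1 h3
        rw [hKL.pred_unique hC hba]
        exact List.mem_of_getElem? hb
      · have := h.consecutive (List.getElem?_eq_getElem (i := i) (by omega))
          (List.getElem?_eq_getElem hi)
        rw [hKL.pred_unique hC this]; exact List.getElem_mem _
  exact forall_of_consecutive ⟨b, hba.mem_left, List.mem_of_getElem? hb⟩ key

variable {M : InterfaceMesh}

/-- From the common element `K`, the parts after it agree by `tail_unique` for successors, the
reversed parts before it by `tail_unique` for predecessors. -/
theorem InterfaceMesh.IsT1Run.eq {C S S' : List Cell} (hC : C.Nodup ∨ IsClosedList C)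
    (h : M.IsT1Run C S) (h' : M.IsT1Run C S') {K : Cell} (hK : K ∈ S) (hK' : K ∈ S') :
    S = S' := by
  obtain ⟨A, B, rfl⟩ := List.append_of_mem hK
  obtain ⟨A', B', rfl⟩ := List.append_of_mem hK'
  obtain ⟨⟨-, c⟩, -, t, hd, ls⟩ := h
  obtain ⟨⟨-, c'⟩, -, t', hd', ls'⟩ := h'
  have e : B = B' := by
    refine tail_unique (R := Consecutive C) (fun a b c h h' => h.succ_unique hC h') (P := M.IsT1)
      B B' K c.right_of_append c'.right_of_append (fun X hX => t X (by simp [hX]))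
      (fun X hX => t' X (by simp [hX])) ?_ ?_
    · intro L hL; exact ls L (by rw [List.getLast?_append, Option.mem_def.1 hL]; rfl)
    · intro L hL; exact ls' L (by rw [List.getLast?_append, Option.mem_def.1 hL]; rfl)
  have cr : ∀ A B : List Cell, (A ++ K :: B).IsChain (Consecutive C) →
      (K :: A.reverse).IsChain fun a b => Consecutive C b a := by
    intro A B c
    rw [show A ++ K :: B = (A ++ [K]) ++ B by simp] at c
    have := List.isChain_reverse.2 c.left_of_append
    simpa [flip] using this
  have hr : ∀ A B : List Cell, ∀ L ∈ (K :: A.reverse).getLast?, L ∈ (A ++ K :: B).head? := by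
    intro A B L hL
    rw [show K :: A.reverse = (A ++ [K]).reverse by simp, List.getLast?_reverse] at hL
    rw [show A ++ K :: B = (A ++ [K]) ++ B by simp, List.head?_append, Option.mem_def.1 hL]
    rfl
  have e' : A.reverse = A'.reverse := by
    refine tail_unique (R := fun a b => Consecutive C b a)
      (fun a b c h h' => h.pred_unique hC h') (P := M.IsT1)
      _ _ K (cr _ _ c) (cr _ _ c') (fun X hX => t X ?_)
      (fun X hX => t' X ?_) ?_ ?_
    · rw [List.mem_reverse] at hX; simp [hX]
    · rw [List.mem_reverse] at hX; simp [hX]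
    · intro L hL; exact hd L (hr _ _ L hL)
    · intro L hL; exact hd' L (hr _ _ L hL)
  rw [e, List.reverse_injective e']

/-- A longest subchain of elements of type 1 through `K` and `L` is maximal at both ends: a further
element would prolong it, unless it already belongs to it. Then the subchain closes up and is the
whole chain, against `hall`. -/
theorem exists_isT1Run {C : List Cell} (hC : C.Nodup ∨ IsClosedList C)
    (hall : ∃ K ∈ C, ¬ M.IsT1 K) {K L : Cell} (hKL : Consecutive C K L) (hK : M.IsT1 K)
    (hL : M.IsT1 L) : ∃ S, M.IsT1Run C S ∧ K ∈ S ∧ L ∈ S := by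
  let Q : ℕ → Prop := fun n => ∃ S : List Cell, IsSubchain C S ∧ (∀ X ∈ S, M.IsT1 X) ∧
    2 ≤ S.length ∧ K ∈ S ∧ L ∈ S ∧ S.length = n
  have hbd : ∀ n, Q n → n ≤ C.length := by
    rintro n ⟨S, hS, -, h2, -, -, rfl⟩
    exact hS.1.length_le_of_subset fun X hX => hS.mem h2 hX
  have h0 : Q 2 := ⟨[K, L], isSubchain_pair hC hKL, by simp [hK, hL], by simp, by simp, by simp,
    rfl⟩
  classical
  obtain ⟨S, hS, hT, h2, hKS, hLS, hlen⟩ := Nat.findGreatest_spec (P := Q) (hbd 2 h0) h0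
  have hmax : ∀ n, Q n → n ≤ S.length := by
    intro n hn
    rw [hlen]
    exact Nat.le_findGreatest (hbd n hn) hn
  have hcyc : ∀ a b, S.head? = some a → S.getLast? = some b → ¬ Consecutive C b a := by
    intro a b ha hb hba
    obtain ⟨X, hX, hX'⟩ := hall
    exact hX' (hT X (hS.mem_of_cyclic hC ha hb hba X hX))
  refine ⟨S, ⟨hS, h2, hT, ?_, ?_⟩, hKS, hLS⟩
  · intro a ha X hX hX1
    have ha : S.head? = some a := ha
    by_cases hXS : X ∈ S
    · obtain ⟨i, hi, rfl⟩ := List.getElem_of_mem hXS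
      by_cases h1 : i + 1 < S.length
      · have := hS.consecutive (List.getElem?_eq_getElem hi) (List.getElem?_eq_getElem h1)
        have e := hX.succ_unique hC this
        rw [List.head?_eq_getElem?, e, ← List.getElem?_eq_getElem h1] at ha
        have := (List.getElem?_inj (by omega) hS.1).1 ha
        omega
      · refine hcyc a _ ha ?_ hX
        rw [List.getLast?_eq_getElem?, show S.length - 1 = i by omega]
        exact List.getElem?_eq_getElem hi
    · have := hmax (S.length + 1) ⟨X :: S, ⟨List.nodup_cons.2 ⟨hXS, hS.1⟩, ?_⟩, ?_, by simp; omega,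
        by simp [hKS], by simp [hLS], by simp⟩
      · omega
      · refine List.isChain_cons.2 ⟨?_, hS.2⟩
        intro y hy
        rw [ha] at hy
        obtain rfl : a = y := by simpa using hy
        exact hX
      · intro Y hY
        rcases List.mem_cons.1 hY with rfl | hY
        · exact hX1
        · exact hT Y hY
  · intro b hb X hX hX1
    have hb : S.getLast? = some b := hb
    by_cases hXS : X ∈ S
    · obtain ⟨i, hi, rfl⟩ := List.getElem_of_mem hXS
      rcases i with _ | i
      · refine hcyc _ b ?_ hb hX
        rw [List.head?_eq_getElem?]
        exact List.getElem?_eq_getElem hi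
      · have := hS.consecutive (List.getElem?_eq_getElem (i := i) (by omega))
          (List.getElem?_eq_getElem hi)
        have e := hX.pred_unique hC this
        rw [List.getLast?_eq_getElem?, e, ← List.getElem?_eq_getElem (by omega)] at hb
        have := (List.getElem?_inj (by omega) hS.1).1 hb
        omega
    · have := hmax (S.length + 1) ⟨S ++ [X], ⟨?_, ?_⟩, ?_, by simp; omega,
        by simp [hKS], by simp [hLS], by simp⟩
      · omega
      · rw [List.nodup_append]
        refine ⟨hS.1, by simp, ?_⟩
        intro a ha c hc
        rw [List.mem_singleton.1 hc]
        rintro rfl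
        exact hXS ha
      · rw [List.isChain_append]
        refine ⟨hS.2, by simp, ?_⟩
        intro x hx y hy
        rw [hb] at hx
        obtain rfl : b = x := by simpa using hx
        obtain rfl : X = y := by simpa using hy
        exact hX
      · intro Y hY
        rcases List.mem_append.1 hY with hY | hY
        · exact hT Y hY
        · rw [List.mem_singleton.1 hY]; exact hX1

/-! ### Groups of a run -/

theorem groups_spec (S : List Cell) : ∀ g ∈ groups S, g <:+: S ∧
    ((∃ a b, g = [a, b]) ∨ ∃ a b c, g = [a, b, c]) := by
  induction S using groups.induct with
  | case1 a b c =>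
    intro g hg
    simp only [groups, List.mem_singleton] at hg
    subst hg
    exact ⟨List.infix_rfl, Or.inr ⟨_, _, _, rfl⟩⟩
  | case2 a b l h ih =>
    intro g hg
    rw [groups] at hg
    · rcases List.mem_cons.1 hg with rfl | hg
      · exact ⟨⟨[], l, rfl⟩, Or.inl ⟨_, _, rfl⟩⟩
      · obtain ⟨⟨s, t, e⟩, h2⟩ := ih g hg
        exact ⟨⟨a :: b :: s, t, by simp [← e]⟩, h2⟩
    · exact h
  | case3 l h1 h2 =>
    intro g hg
    rw [groups] at hg
    · simp at hg
    · exact h1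
    · exact h2

theorem exists_mem_groups (S : List Cell) (hS : 2 ≤ S.length) : ∀ K ∈ S, ∃ g ∈ groups S, K ∈ g := by
  induction S using groups.induct with
  | case1 a b c =>
    intro K hK
    exact ⟨_, by simp [groups], hK⟩
  | case2 a b l h ih =>
    intro K hK
    rw [groups]
    · by_cases hl : 2 ≤ l.length
      · by_cases hKl : K ∈ l
        · obtain ⟨g, hg, hKg⟩ := ih hl K hKl
          exact ⟨g, List.mem_cons_of_mem _ hg, hKg⟩
        · refine ⟨[a, b], by simp, ?_⟩
          simp only [List.mem_cons] at hK ⊢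
          tauto
      · rcases l with _ | ⟨c, _ | ⟨d, l⟩⟩
        · exact ⟨[a, b], by simp, hK⟩
        · exact absurd rfl (h c)
        · simp at hl
    · exact h
  | case3 l h1 h2 =>
    rcases l with _ | ⟨a, _ | ⟨b, l⟩⟩
    · simp at hS
    · simp at hS
    · exact absurd rfl (h2 a b l)

theorem groups_eq (S : List Cell) (hS : S.Nodup) : ∀ g ∈ groups S, ∀ g' ∈ groups S, ∀ K ∈ g, K ∈ g' →
    g = g' := by
  induction S using groups.induct with
  | case1 a b c =>
    intro g hg g' hg' _ _ _
    simp only [groups, List.mem_singleton] at hg hg'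
    rw [hg, hg']
  | case2 a b l h ih =>
    intro g hg g' hg' K hK hK'
    have key : ∀ g ∈ groups l, ∀ K ∈ g, K ∉ [a, b] := by
      intro g hg K hK hab
      have := ((groups_spec l g hg).1).subset hK
      simp only [List.nodup_cons, List.mem_cons, not_or] at hS hab
      rcases hab with rfl | rfl | hab
      · exact hS.1.2 this
      · exact hS.2.1 this
      · simp at hab
    rw [groups] at hg hg'
    · rcases List.mem_cons.1 hg with rfl | hg <;> rcases List.mem_cons.1 hg' with rfl | hg'
      · rfl
      · exact absurd hK (key _ hg' K hK')
      · exact absurd hK' (key _ hg K hK)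
      · exact ih (by simp only [List.nodup_cons] at hS; exact hS.2.2) g hg g' hg' K hK hK'
    all_goals exact h
  | case3 l h1 h2 =>
    intro g hg
    rw [groups] at hg
    · simp at hg
    · exact h1
    · exact h2

end Merging

namespace Merging

/-! ### Contacts of elements, and connected layers as an induction principle. -/

theorem Perp.axes : Perp (1, 0) (0, 1) := ⟨by decide, by decide, Or.inl rfl⟩

namespace Cell

variable (K : Cell) {u v : ℤ × ℤ}

theorem cell_shift_left (a b : ℤ) : (K.cell u v a b).shift u = K.cell u v (a + 1) b := by
  rw [shift_left, cell_cell, add_zero]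

theorem cell_shift_right (a b : ℤ) : (K.cell u v a b).shift v = K.cell u v a (b + 1) := by
  rw [shift_right, cell_cell, add_zero]

theorem cell_shift_neg_left (a b : ℤ) : (K.cell u v a b).shift (-u) = K.cell u v (a - 1) b := by
  rw [shift_neg_left, cell_cell, add_zero, sub_eq_add_neg]

theorem cell_shift_neg_right (a b : ℤ) : (K.cell u v a b).shift (-v) = K.cell u v a (b - 1) := by
  rw [shift_neg_right, cell_cell, add_zero, sub_eq_add_neg]

theorem shift_shift_neg (d : ℤ × ℤ) : (K.shift d).shift (-d) = K := by
  rw [shift_shift, add_neg_cancel, shift_zero]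

theorem shift_neg_shift (d : ℤ × ℤ) : (K.shift (-d)).shift d = K := by
  rw [shift_shift, neg_add_cancel, shift_zero]

theorem shift_shift_comm (a b : ℤ × ℤ) : (K.shift a).shift b = (K.shift b).shift a := by
  rw [shift_shift, shift_shift, add_comm]

end Cell

namespace InterfaceMesh

variable {M : InterfaceMesh} {K L : Cell} {u v : ℤ × ℤ}

/-- Another mesh element that touches `K` in an inner point of a side is the translate of `K`
across this side. -/
theorem Block.eq_shift_of_openSide (hK : M.Block 1 K) {d : ℤ × ℤ} (hd : d ∈ dirs) {p : Pt}
    (hp : p ∈ K.openSide d) (hL : L ∈ M.T) (hpL : p ∈ L.closed) (hne : L ≠ K) :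
    L = K.shift d := by
  have h := Perp.of_rot hd
  rw [K.openSide_eq h] at hp
  obtain ⟨t, h1, h2, rfl⟩ := hp
  obtain ⟨a, b, -, -, rfl, ⟨h3, h4⟩, h5, h6⟩ := hK.eq_cell h hL hpL
    ((K.uv_mem_openBlock h).2 (by constructor <;> constructor <;> push_cast <;> linarith))
  have ha : a = 0 ∨ a = 1 := by
    have h3' : (2 : ℝ) * a - 1 ≤ 1 := h3
    have h7 : a ≤ 1 := by exact_mod_cast (by linarith : (a : ℝ) ≤ 1)
    have h8 : 0 ≤ a := by exact_mod_cast (by linarith : (0 : ℝ) ≤ a)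
    omega
  have hb : b = 0 := by
    have h7 : b < 1 := by exact_mod_cast (by linarith : (b : ℝ) < 1)
    have h8 : -1 < b := by exact_mod_cast (by linarith : (-1 : ℝ) < b)
    omega
  subst hb
  rcases ha with rfl | rfl
  · exact absurd (Cell.cell_zero K) hne
  · rw [K.shift_left (u := d) (v := rot d)]

theorem Block.openSide_subset (hK : M.Block 1 K) {d : ℤ × ℤ} (hd : d ∈ dirs) :
    K.shift d ∈ M.T := by
  have h := Perp.of_rot hd
  rw [K.shift_left (v := rot d)]
  exact hK.cell h (by norm_num) (by norm_num)

theorem Block.mem_layer_one {G X : Cell} (hG : M.Block 1 G) (h : Perp u v) :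
    X ∈ M.layer G 1 ↔ ∃ a b : ℤ, |a| ≤ 1 ∧ |b| ≤ 1 ∧ X = G.cell u v a b := by
  constructor
  · rintro ⟨hX, K', rfl, p, hp, hp'⟩
    obtain ⟨i, j, hi, hj, rfl⟩ := hG.eq_shift hX hp (K'.closed_subset_openBlock le_rfl hp')
    obtain ⟨a, b, e⟩ := Cell.exists_cell h (i, j)
    have := (Cell.frame_abs h a b 1).1 (by rw [← e]; exact ⟨by exact_mod_cast hi, by exact_mod_cast hj⟩)
    exact ⟨a, b, this.1, this.2, by rw [Cell.cell, e]⟩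
  · rintro ⟨a, b, ha, hb, rfl⟩
    refine ⟨hG.cell h (by exact_mod_cast ha) (by exact_mod_cast hb), G, rfl,
      G.uv u v a b, ?_, ?_⟩
    · rw [Cell.uv_mem_cell_closed _ h]
      have h1 := abs_le.1 ha
      have h2 := abs_le.1 hb
      have h1' : (-1 : ℝ) ≤ a ∧ (a : ℝ) ≤ 1 := by exact_mod_cast h1
      have h2' : (-1 : ℝ) ≤ b ∧ (b : ℝ) ≤ 1 := by exact_mod_cast h2
      constructor <;> constructor <;> linarith
    · rw [Cell.uv_mem_closed _ h]
      have h1 := abs_le.1 ha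
      have h2 := abs_le.1 hb
      exact ⟨by exact_mod_cast h1, by exact_mod_cast h2⟩

/-- Three elements with a common point on the interface do not exist, if two of them touch the
third one in the vertex `u + v` only. -/
theorem vertex_triple (hp : Perp u v) {X Y : Cell} (hK : M.IsInterface K)
    (hX : M.IsInterface X) (hY : M.IsInterface Y) (hXY : X ≠ Y)
    (hX' : X = K.shift u ∨ X = K.shift v ∨ X = (K.shift u).shift v)
    (hY' : Y = K.shift u ∨ Y = K.shift v ∨ Y = (K.shift u).shift v) : K.uv u v 1 1 ∉ M.Γ := by
  -- If the diagonal element is one of the two, then `K.shift a` is the element in the middle of the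
  -- three, and `vertex_notMem` is applied to it.
  have key : ∀ a b, Perp a b → M.IsInterface (K.shift a) → M.IsInterface ((K.shift a).shift b) →
      K.uv a b 1 1 ∉ M.Γ := by
    intro a b hp h1 h2
    have := vertex_notMem (K := K.shift a) hp.neg_left h1 (by rwa [Cell.shift_shift_neg]) h2
    rw [Cell.uv_neg_left, K.shift_left (v := b), Cell.uv_cell] at this
    norm_num at this
    exact this
  have k1 := vertex_notMem (K := K) hp hK
  have k2 := key u v hp
  have k3 := key v u hp.symm
  rw [Cell.uv_comm, Cell.shift_shift_comm] at k3
  rcases hX' with rfl | rfl | rfl <;> rcases hY' with rfl | rfl | rfl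
  · exact absurd rfl hXY
  · exact k1 hX hY
  · exact k2 hX hY
  · exact k1 hY hX
  · exact absurd rfl hXY
  · exact k3 hX hY
  · exact k2 hY hX
  · exact k3 hY hX
  · exact absurd rfl hXY

/-- No point of the interface belongs to three interface elements. -/
theorem Block.notMem_of_triple (hK : M.Block 1 K) {X Y : Cell} (hi : M.IsInterface K)
    (hX : M.IsInterface X) (hY : M.IsInterface Y) (hXK : X ≠ K) (hYK : Y ≠ K) (hXY : X ≠ Y)
    {p : Pt} (hp : p ∈ K.closed) (hpX : p ∈ X.closed) (hpY : p ∈ Y.closed) : p ∉ M.Γ := by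
  have key : ∀ a b, Perp a b → p = K.uv a b 1 1 → p ∉ M.Γ := by
    rintro a b hab rfl
    have aux : ∀ Z : Cell, M.IsInterface Z → Z ≠ K → K.uv a b 1 1 ∈ Z.closed →
        Z = K.shift a ∨ Z = K.shift b ∨ Z = (K.shift a).shift b := by
      intro Z hZ hne hpZ
      obtain ⟨m, n, -, -, rfl, ⟨h3, h4⟩, h5, h6⟩ := hK.eq_cell hab hZ.1 hpZ
        ((K.uv_mem_openBlock hab).2 (by norm_num))
      have hm : m = 0 ∨ m = 1 := by
        have h7 : m ≤ 1 := by exact_mod_cast (by linarith : (m : ℝ) ≤ 1)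
        have h8 : 0 ≤ m := by exact_mod_cast (by linarith : (0 : ℝ) ≤ m)
        omega
      have hn : n = 0 ∨ n = 1 := by
        have h7 : n ≤ 1 := by exact_mod_cast (by linarith : (n : ℝ) ≤ 1)
        have h8 : 0 ≤ n := by exact_mod_cast (by linarith : (0 : ℝ) ≤ n)
        omega
      rw [K.shift_left (v := b), Cell.cell_shift_right, K.shift_right (u := a)]
      rcases hm with rfl | rfl <;> rcases hn with rfl | rfl
      · exact absurd (Cell.cell_zero K) hne
      · exact Or.inr (Or.inl rfl)
      · exact Or.inl rfl
      · exact Or.inr (Or.inr rfl)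
    exact vertex_triple hab hi hX hY hXY (aux X hX hXK hpX) (aux Y hY hYK hpY)
  have hb : p ∈ K.bdry := ⟨hp, fun h => hXK (eq_of_inter_closed hi.1 hX.1 ⟨p, h, hpX⟩).symm⟩
  have h := Perp.axes
  obtain ⟨s, t, rfl⟩ := K.uv_surj h p
  -- At an inner point of a side there is only one further element, so `p` has to be a vertex.
  by_cases hd : ∃ d ∈ dirs, K.uv (1, 0) (0, 1) s t ∈ K.openSide d
  · obtain ⟨d, hd, hpd⟩ := hd
    exact absurd ((hK.eq_shift_of_openSide hd hpd hX.1 hpX hXK).trans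
      (hK.eq_shift_of_openSide hd hpd hY.1 hpY hYK).symm) hXY
  have hd' : ∀ d ∈ dirs, K.uv (1, 0) (0, 1) s t ∉ K.openSide d := fun d h h' => hd ⟨d, h, h'⟩
  have d1 := hd' _ h.1
  have d2 := hd' _ h.symm.1
  have d3 := hd' _ h.neg_left.1
  have d4 := hd' _ h.neg_right.2.1
  rw [K.uv_mem_openSide h] at d1
  rw [K.uv_mem_openSide' h] at d2
  rw [K.uv_mem_openSide_neg h] at d3
  rw [K.uv_mem_openSide_neg' h] at d4
  obtain ⟨⟨⟨h1, h2⟩, h3, h4⟩, h5⟩ := (K.uv_mem_bdry h).1 hb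
  have hs : s = 1 ∨ s = -1 := by
    by_contra! hs
    have h6 := lt_of_le_of_ne h1 (Ne.symm hs.2)
    have h7 := lt_of_le_of_ne h2 hs.1
    rcases h5 with h5 | h5 | h5 | h5
    · exact hs.1 h5
    · exact hs.2 h5
    · exact d2 ⟨h5, h6, h7⟩
    · exact d4 ⟨h5, h6, h7⟩
  have ht : t = 1 ∨ t = -1 := by
    by_contra! ht
    have h6 := lt_of_le_of_ne h3 (Ne.symm ht.2)
    have h7 := lt_of_le_of_ne h4 ht.1
    rcases hs with hs | hs
    · exact d1 ⟨hs, h6, h7⟩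
    · exact d3 ⟨hs, h6, h7⟩
  rcases hs with rfl | rfl <;> rcases ht with rfl | rfl
  · exact key _ _ h rfl
  · exact key _ _ h.neg_right (by rw [Cell.uv_neg_right])
  · exact key _ _ h.neg_left (by rw [Cell.uv_neg_left])
  · exact key _ _ h.neg_left.neg_right (by rw [Cell.uv_neg_right, Cell.uv_neg_left])

/-- Connectedness of the interface elements in a layer, in the form of an induction principle. -/
theorem layer_subset_of_rule4 (h4 : M.Rule4) {G : Cell} (hG : G ∈ M.T) (hGn : ¬ M.IsInterface G)
    {j : ℕ} (hj : j = 1 ∨ j = 2) (A : Set Cell)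
    (h0 : ∃ X ∈ A, X ∈ M.layer G j ∧ M.IsInterface X)
    (hA : ∀ X ∈ A, X ∈ M.layer G j → M.IsInterface X → M.Block 1 X ∧
      ∀ d ∈ dirs, X.shift d ∈ M.layer G j → M.IsInterface (X.shift d) → X.shift d ∈ A) :
    ∀ X ∈ M.layer G j, M.IsInterface X → X ∈ A := by
  obtain ⟨i, hi⟩ := exists_sgn_of_not_isInterface hG hGn
  have hpre := h4 G hG i (subset_sub_of_sgn hG hi) j hj
  set F : Set Cell := {X | X ∈ M.layer G j ∧ M.IsInterface X} with hF
  have hfin : F.Finite := M.T.finite_toSet.subset fun X hX => hX.2.1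
  have hcl : ∀ F' ⊆ F, IsClosed (⋃ X ∈ F', X.closed) := fun F' h =>
    (hfin.subset h).isClosed_biUnion fun X _ => X.isClosed_closed
  have hsub : ∀ X ∈ F, X.toSet ⊆ interior (⋃ X ∈ F, X.closed) := fun X hX =>
    interior_maximal (X.toSet_subset_closed.trans (subset_biUnion_of_mem (u := Cell.closed) hX))
      X.isOpen_toSet
  by_contra! hcon
  obtain ⟨Y, hY1, hY2, hYA⟩ := hcon
  obtain ⟨X, hXA, hX⟩ := h0
  -- The connected interior is covered by the closed unions over `F ∩ A` and `F \ A`; both meet it,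
  -- so they have a common point in it. This gives `f` in `A` and `g` outside of `A` that touch.
  obtain ⟨p, hpU, hp1, hp2⟩ := isPreconnected_closed_iff.1 hpre (⋃ X ∈ F ∩ A, X.closed)
    (⋃ X ∈ F \ A, X.closed) (hcl _ inter_subset_left) (hcl _ sdiff_subset)
    (by
      refine interior_subset.trans ?_
      rw [← biUnion_union, inter_union_sdiff])
    (by
      obtain ⟨q, hq⟩ := X.toSet_nonempty
      exact ⟨q, hsub X hX hq, mem_biUnion (x := X) ⟨hX, hXA⟩ (X.toSet_subset_closed hq)⟩)
    (by
      obtain ⟨q, hq⟩ := Y.toSet_nonempty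
      exact ⟨q, hsub Y ⟨hY1, hY2⟩ hq,
        mem_biUnion (x := Y) ⟨⟨hY1, hY2⟩, hYA⟩ (Y.toSet_subset_closed hq)⟩)
  simp only [mem_iUnion] at hp1 hp2
  obtain ⟨f, ⟨hfF, hfA⟩, hpf⟩ := hp1
  obtain ⟨g, ⟨hgF, hgA⟩, hpg⟩ := hp2
  have hB := (hA f hfA hfF.1 hfF.2).1
  have hne : g ≠ f := fun e => hgA (e ▸ hfA)
  obtain ⟨a, b, ha, hb, e⟩ := hB.eq_shift hgF.2.1 hpg (f.closed_subset_openBlock le_rfl hpf)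
  have step : ∀ X ∈ F ∩ A, ∀ d ∈ dirs, X.shift d ∈ F → X.shift d ∈ A := fun X hX d hd hXd =>
    (hA X hX.2 hX.1.1 hX.1.2).2 d hd hXd.1 hXd.2
  -- Elements that touch only in a vertex cannot be separated: `p` is an interior point of the
  -- union, and the element between them contains `p` in its closure, so it belongs to `F` and
  -- provides two steps across sides.
  have corner : ∀ u v : ℤ × ℤ, Perp u v → g ≠ (f.shift u).shift v := by
    intro u v hp e
    have hpu : p ∈ (f.shift u).closed := by
      obtain ⟨s, t, rfl⟩ := f.uv_surj hp p
      rw [e, f.shift_left (v := v), Cell.cell_shift_right, Cell.uv_mem_cell_closed _ hp] at hpg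
      rw [f.uv_mem_closed hp] at hpf
      rw [f.shift_left (v := v), Cell.uv_mem_cell_closed _ hp]
      push_cast at *
      constructor <;> constructor <;> linarith
    have huF : f.shift u ∈ F := by
      rw [← Cell.closure_toSet] at hpu
      obtain ⟨q, hq, hq'⟩ := mem_closure_iff.1 hpu _ isOpen_interior hpU
      have := interior_subset hq
      simp only [mem_iUnion] at this
      obtain ⟨Z, hZ, hqZ⟩ := this
      rwa [eq_of_inter_closed (hB.openSide_subset hp.1) hZ.2.1 ⟨q, hq', hqZ⟩]
    have huA := step f ⟨hfF, hfA⟩ u hp.1 huF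
    exact hgA (e ▸ step _ ⟨huF, huA⟩ v hp.2.1 (e ▸ hgF))
  have side : ∀ d ∈ dirs, g ≠ f.shift d := fun d hd e =>
    hgA (e ▸ step f ⟨hfF, hfA⟩ d hd (e ▸ hgF))
  rw [abs_le] at ha hb
  obtain ⟨ha1, ha2⟩ := ha
  obtain ⟨hb1, hb2⟩ := hb
  have h := Perp.axes
  push_cast at ha1 ha2 hb1 hb2
  interval_cases a <;> interval_cases b
  · exact corner _ _ h.neg_left.neg_right (by rw [e, Cell.shift_shift]; rfl)
  · exact side (-1, 0) (by decide) e
  · exact corner _ _ h.neg_left (by rw [e, Cell.shift_shift]; rfl)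
  · exact side (0, -1) (by decide) e
  · exact hne (by rw [e]; exact Cell.shift_zero f)
  · exact side (0, 1) (by decide) e
  · exact corner _ _ h.neg_right (by rw [e, Cell.shift_shift]; rfl)
  · exact side (1, 0) (by decide) e
  · exact corner _ _ h (by rw [e, Cell.shift_shift]; rfl)

/-- The same for the first layer, in coordinates. -/
theorem ring_of_rule4 (h4 : M.Rule4) {G : Cell} (hG : M.Block 1 G) (hGn : ¬ M.IsInterface G)
    (hp : Perp u v) (P : ℤ → ℤ → Prop)
    (h0 : ∃ a b, |a| ≤ 1 ∧ |b| ≤ 1 ∧ P a b ∧ M.IsInterface (G.cell u v a b))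
    (hP : ∀ a b, |a| ≤ 1 → |b| ≤ 1 → P a b → M.IsInterface (G.cell u v a b) →
      M.Block 1 (G.cell u v a b) ∧
      ∀ a' b', |a'| ≤ 1 → |b'| ≤ 1 → (a' = a ∧ (b' = b + 1 ∨ b' = b - 1)) ∨
        (b' = b ∧ (a' = a + 1 ∨ a' = a - 1)) → M.IsInterface (G.cell u v a' b') → P a' b') :
    ∀ a b, |a| ≤ 1 → |b| ≤ 1 → M.IsInterface (G.cell u v a b) → P a b := by
  intro a b ha hb hab
  have := layer_subset_of_rule4 h4 hG.mem hGn (Or.inl rfl)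
    {X | ∃ a b, |a| ≤ 1 ∧ |b| ≤ 1 ∧ P a b ∧ X = G.cell u v a b} ?_ ?_ (G.cell u v a b)
    ((hG.mem_layer_one hp).2 ⟨a, b, ha, hb, rfl⟩) hab
  · obtain ⟨a', b', -, -, hP', e⟩ := this
    obtain ⟨rfl, rfl⟩ := (G.cell_inj hp).1 e
    exact hP'
  · obtain ⟨a, b, ha, hb, hab, hi⟩ := h0
    exact ⟨_, ⟨a, b, ha, hb, hab, rfl⟩, (hG.mem_layer_one hp).2 ⟨a, b, ha, hb, rfl⟩, hi⟩
  · rintro X ⟨a, b, ha, hb, hab, rfl⟩ - hi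
    obtain ⟨h1, h2⟩ := hP a b ha hb hab hi
    refine ⟨h1, fun d hd hdl hdi => ?_⟩
    obtain ⟨a', b', ha', hb', e⟩ := (hG.mem_layer_one hp).1 hdl
    rw [e] at hdi
    refine ⟨a', b', ha', hb', h2 a' b' ha' hb' ?_ hdi, e⟩
    rcases (hp.mem_dirs_iff d).1 hd with rfl | rfl | rfl | rfl
    · rw [Cell.cell_shift_left, Cell.cell_inj _ hp] at e; omega
    · rw [Cell.cell_shift_right, Cell.cell_inj _ hp] at e; omega
    · rw [Cell.cell_shift_neg_left, Cell.cell_inj _ hp] at e; omega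
    · rw [Cell.cell_shift_neg_right, Cell.cell_inj _ hp] at e; omega

end InterfaceMesh

end Merging

/-! ### The interface along a mergeable chain: contacts, turns, bends. -/

namespace Merging

namespace InterfaceMesh

variable {M : InterfaceMesh} {K L G : Cell} {u v : ℤ × ℤ} {C : List Cell}

variable (M) in
/-- The hypotheses under which a chain is merged. -/
structure Mergeable (C : List Cell) : Prop where
  adm : M.IsAdmissible C
  two_le : 2 ≤ C.length
  ends : (C.Nodup ∧ (∀ K ∈ C.head?, M.IsT2 K) ∧ (∀ K ∈ C.getLast?, M.IsT2 K) ∧ M.NoSingleGap C) ∨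
    (IsClosedList C ∧ ∃ K ∈ C, ¬ M.IsT1 K)

theorem HasNeighborIn.subset (hK : M.Block 1 K) (hi : M.IsInterface K) {d : ℤ × ℤ}
    (hd : d ∈ dirs) {i : Fin 2} (h : M.HasNeighborIn K d i) : (K.shift d).toSet ⊆ M.sub i := by
  obtain ⟨N, ⟨hN, hs⟩, hsub⟩ := h
  have hp := Perp.of_rot hd
  have hne : N ≠ K := fun e => not_isInterface_of_sub (e ▸ hsub) hi
  have hm : K.uv d (rot d) 1 0 ∈ K.openSide d := (K.uv_mem_openSide hp).2 (by norm_num)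
  have := hK.eq_shift_of_openSide hd hm hN
    (N.side_subset_closed (neg_mem_dirs hd) (hs ▸ K.openSide_subset_side d hm)) hne
  rwa [← this]

namespace Mergeable

variable (H : M.Mergeable C)

include H

theorem dup : C.Nodup ∨ IsClosedList C := H.adm.1.2.2

theorem isInterface (hK : K ∈ C) : M.IsInterface K := H.adm.1.1 K hK

theorem rule4 : M.Rule4 := H.adm.2.2.2.2

theorem block (hK : K ∈ C) : M.Block 2 K := fun i j hi hj => by
  have h := H.adm.2.1 K hK
  have : K.shift (i, j) ∈ M.layer K 2 := by
    rw [h]; exact ⟨i, j, by exact_mod_cast hi, by exact_mod_cast hj, rfl⟩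
  exact this.1

theorem block1 (hK : K ∈ C) : M.Block 1 K := (H.block hK).mono (by norm_num)

/-- A continuous curve is connected, so the two nonempty closed arcs that make it up have a common
point. -/
theorem touch_of_consecutive (h : Consecutive C K L) :
    ∃ p ∈ M.Γ, p ∈ K.closed ∧ p ∈ L.closed := by
  have hl : M.Linked K L := by simpa using H.adm.1.2.1.infix h
  obtain ⟨γ, hc, him⟩ := hl
  have hK := H.isInterface h.mem_left
  have hL := H.isInterface h.mem_right
  have hpre : IsPreconnected (closure (M.Γ ∩ K.toSet) ∪ closure (M.Γ ∩ L.toSet)) :=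
    him ▸ isPreconnected_Icc.image _ hc
  have hne : ∀ K, M.IsInterface K → (closure (M.Γ ∩ K.toSet)).Nonempty := fun K hK =>
    (inter_comm K.toSet M.Γ ▸ hK.2).closure
  obtain ⟨p, -, h1, h2⟩ := isPreconnected_closed_iff.1 hpre _ _ isClosed_closure isClosed_closure
    Subset.rfl ((hne K hK).mono fun x hx => ⟨Or.inl hx, hx⟩)
    ((hne L hL).mono fun x hx => ⟨Or.inr hx, hx⟩)
  rw [hK.closure_inter] at h1
  rw [hL.closure_inter] at h2
  exact ⟨p, h1.2, h1.1, h2.1⟩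

theorem touch (h : ChainNbr C K L) : ∃ p ∈ M.Γ, p ∈ K.closed ∧ p ∈ L.closed := by
  rcases h with h | h
  · exact H.touch_of_consecutive h
  · obtain ⟨p, h1, h2, h3⟩ := H.touch_of_consecutive h
    exact ⟨p, h1, h3, h2⟩

theorem not_isInterface_of_neighbor (hK : K ∈ C) {d : ℤ × ℤ} (hd : d ∈ dirs) {i : Fin 2}
    (h : M.HasNeighborIn K d i) : ¬ M.IsInterface (K.shift d) :=
  not_isInterface_of_sub (h.subset (H.block1 hK) (H.isInterface hK) hd)

/-- Rule 2 is used backwards: a side off `Γ` lies in one subdomain, and then the element across it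
is contained in this subdomain. -/
theorem meets_of_shift (hK : K ∈ C) {d : ℤ × ℤ} (hd : d ∈ dirs)
    (h : M.IsInterface (K.shift d)) : (K.side d ∩ M.Γ).Nonempty := by
  by_contra hcon
  obtain ⟨i, hi⟩ := exists_sgn_of_isPreconnected (K.isPreconnected_side d)
    fun p hp hpΓ => hcon ⟨p, hp, hpΓ⟩
  refine H.not_isInterface_of_neighbor hK hd ((H.adm.2.2.1 K hK).1 d hd i fun p hp => ?_) h
  rw [sub_eq]
  exact ⟨hi hp, (H.block1 hK).closed_subset le_rfl (K.side_subset_closed hd hp)⟩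

theorem openSide_subset_sub (hK : K ∈ C) {d : ℤ × ℤ} (hd : d ∈ dirs) {i : Fin 2}
    (h : K.openSide d ⊆ M.sgn i) : K.openSide d ⊆ M.sub i := by
  rw [sub_eq]
  exact subset_inter h (openSide_subset_meshDomain hd (H.isInterface hK).1
    ((H.block1 hK).openSide_subset hd))

theorem not_isInterface_of_isT2Along (hK : K ∈ C) (h : M.IsT2Along K u) (hp : Perp u v) :
    ¬ M.IsInterface (K.shift v) := by
  obtain ⟨i, r₁, r₂, D⟩ := h.data hp
  exact H.not_isInterface_of_neighbor hK hp.2.1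
    ((H.adm.2.2.1 K hK).2.1 u v hp h i (H.openSide_subset_sub hK hp.2.1 D.side₁))

theorem shift_of_crosses (hK : K ∈ C) {d : ℤ × ℤ} (hd : d ∈ dirs)
    (h : (K.openSide d ∩ M.Γ).Nonempty) : M.IsInterface (K.shift d) :=
  (H.isInterface hK).shift_of_crosses hd ((H.block1 hK).openSide_subset hd) h

variable {i : Fin 2} {r₁ r₂ : ℝ}

theorem shift_of_T1 (hK : K ∈ C) (D : M.T1Data K u v i r₁ r₂) :
    M.IsInterface (K.shift u) ∧ M.IsInterface (K.shift v) ∧ ¬ M.IsInterface (K.shift (-u)) ∧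
      ¬ M.IsInterface (K.shift (-v)) := by
  have hp := D.perp
  refine ⟨H.shift_of_crosses hK hp.1 D.crosses₁, H.shift_of_crosses hK hp.2.1 D.crosses₂,
    fun h => ?_, fun h => ?_⟩
  · have := D.eq_of_meets hp.neg_left.1 (H.meets_of_shift hK hp.neg_left.1 h)
    rcases this with e | e
    · exact hp.ne.2.2.2.1 e.symm
    · exact hp.ne.2.2.1 e.symm
  · have := D.eq_of_meets hp.neg_right.2.1 (H.meets_of_shift hK hp.neg_right.2.1 h)
    rcases this with e | e
    · exact hp.ne.2.1 e.symm
    · exact hp.ne.2.2.2.2.1 e.symm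

theorem exists_not_T1 : ∃ K ∈ C, ¬ M.IsT1 K := by
  rcases H.ends with ⟨-, h, -⟩ | ⟨-, h⟩
  · have hl := H.two_le
    rcases hc : C with _ | ⟨a, l⟩
    · rw [hc] at hl; simp at hl
    · exact ⟨a, by simp, fun h1 => h1.not_isT2 (h a (by simp [hc]))⟩
  · exact h

theorem isT2_of_not_isInner (hK : K ∈ C) (h : ¬ IsInner C K) :
    (C.head? = some K ∨ C.getLast? = some K) ∧ M.IsT2 K := by
  rcases isInner_or_end H.dup hK with h' | ⟨hd, h'⟩
  · exact absurd h' h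
  refine ⟨h', ?_⟩
  rcases H.ends with ⟨-, e1, e2, -⟩ | ⟨hcl, -⟩
  · exact h'.elim (e1 K) (e2 K)
  · exfalso
    obtain ⟨h4, hh, -⟩ := hcl
    rw [List.head?_eq_getElem?, List.getLast?_eq_getElem?] at hh
    have := (List.getElem?_inj (by omega) hd).1 hh
    omega

theorem isInner_of_T1 (hK : K ∈ C) (h : M.IsT1 K) : IsInner C K := by
  by_contra hcon
  exact h.not_isT2 (H.isT2_of_not_isInner hK hcon).2

/-- An interface element that touches an inner element of the chain is one of its neighbours in
the chain. -/
theorem chainNbr_of_touch (hL : L ∈ C) (hin : IsInner C L) {Z : Cell} (hZ : M.IsInterface Z)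
    (hne : Z ≠ L) {q : Pt} (hq : q ∈ M.Γ) (hqL : q ∈ L.closed) (hqZ : q ∈ Z.closed) :
    ChainNbr C L Z := by
  by_contra hcon
  obtain ⟨X, Y, hXY, hX, hY⟩ := hin.exists_ne H.dup
  have hLi := H.isInterface hL
  have hXi := H.isInterface hX.mem_right
  have hYi := H.isInterface hY.mem_right
  have hB := H.block1 hL
  obtain ⟨p, hp, hpL, hpX⟩ := H.touch hX
  obtain ⟨p', hp', hpL', hpY⟩ := H.touch hY
  have bd : ∀ {Z : Cell}, M.IsInterface Z → Z ≠ L → ∀ {q}, q ∈ L.closed → q ∈ Z.closed →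
      q ∈ L.bdry := fun hZ hne q h1 h2 =>
    ⟨h1, fun h => hne (eq_of_inter_closed hLi.1 hZ.1 ⟨q, h, h2⟩).symm⟩
  have hpb := bd hXi (hX.ne H.dup).symm hpL hpX
  have hpb' := bd hYi (hY.ne H.dup).symm hpL' hpY
  have hqb := bd hZ hne hqL hqZ
  have hXZ : X ≠ Z := fun e => hcon (e ▸ hX)
  have hYZ : Y ≠ Z := fun e => hcon (e ▸ hY)
  obtain ⟨A, B, hAB, -⟩ := hLi.bdry_inter
  have mm : ∀ {x}, x ∈ L.bdry → x ∈ M.Γ → x = A ∨ x = B := fun h1 h2 => by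
    have : _ ∈ L.bdry ∩ M.Γ := ⟨h1, h2⟩
    rw [hAB] at this
    simpa using this
  -- The contact points with `X`, `Y` and `Z` are distinct, since no point of `Γ` lies in three
  -- interface elements. But `Γ` has only two points on the boundary of `L`.
  have n1 : p ≠ q := by
    rintro rfl
    exact hB.notMem_of_triple hLi hXi hZ (hX.ne H.dup).symm hne hXZ hpL hpX hqZ hp
  have n2 : p' ≠ q := by
    rintro rfl
    exact hB.notMem_of_triple hLi hYi hZ (hY.ne H.dup).symm hne hYZ hpL' hpY hqZ hp'
  have n3 : p ≠ p' := by
    rintro rfl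
    exact hB.notMem_of_triple hLi hXi hYi (hX.ne H.dup).symm (hY.ne H.dup).symm hXY hpL hpX hpY hp
  rcases mm hpb hp with e1 | e1 <;> rcases mm hpb' hp' with e2 | e2 <;>
    rcases mm hqb hq with e3 | e3 <;> simp_all

theorem chainNbr_of_shift (hL : L ∈ C) (hin : IsInner C L) {d : ℤ × ℤ} (hd : d ∈ dirs)
    (h : M.IsInterface (L.shift d)) : ChainNbr C L (L.shift d) := by
  obtain ⟨q, hq, hqΓ⟩ := H.meets_of_shift hL hd h
  refine H.chainNbr_of_touch hL hin h ?_ hqΓ (L.side_subset_closed hd hq)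
    ((L.shift d).side_subset_closed (neg_mem_dirs hd) ((L.side_shift hd).symm ▸ hq))
  intro e
  have := (L.shift_inj (a := d) (b := 0)).1 (by rw [e, L.shift_zero])
  rw [this] at hd
  revert hd; decide

theorem chainNbr_of_T1 (hK : K ∈ C) (D : M.T1Data K u v i r₁ r₂) (hT : M.IsT1 K) :
    ChainNbr C K (K.shift u) ∧ ChainNbr C K (K.shift v) ∧
      ∀ L, ChainNbr C K L → L = K.shift u ∨ L = K.shift v := by
  have hin := H.isInner_of_T1 hK hT
  obtain ⟨h1, h2, -⟩ := H.shift_of_T1 hK D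
  have n1 := H.chainNbr_of_shift hK hin D.perp.1 h1
  have n2 := H.chainNbr_of_shift hK hin D.perp.2.1 h2
  refine ⟨n1, n2, fun L hL => n1.eq_or H.dup n2 ?_ hL⟩
  rw [Ne, K.shift_inj]
  exact D.perp.ne.1

/-- If the interface continues in two perpendicular directions, then `X` is of type 1. -/
theorem turn {X : Cell} (hX : X ∈ C) (hp : Perp u v) (hu : M.IsInterface (X.shift u))
    (hv : M.IsInterface (X.shift v)) : M.IsT1 X ∧ ∃ i r₁ r₂, M.T1Data X u v i r₁ r₂ := by
  rcases (H.isInterface hX).type with h | h | h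
  · refine ⟨h, ?_⟩
    obtain ⟨a, b, i, r₁, r₂, D⟩ := h.data
    have e1 := D.eq_of_meets hp.1 (H.meets_of_shift hX hp.1 hu)
    have e2 := D.eq_of_meets hp.2.1 (H.meets_of_shift hX hp.2.1 hv)
    have := hp.ne.1
    rcases e1 with rfl | rfl <;> rcases e2 with rfl | rfl
    · exact absurd rfl this
    · exact ⟨_, _, _, D⟩
    · exact ⟨_, _, _, D.symm⟩
    · exact absurd rfl this
  · exfalso
    obtain ⟨w, h⟩ := h
    have key : ∀ x y, Perp x y → w = x → M.IsInterface (X.shift y) → False := by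
      rintro x y hxy rfl hy
      exact H.not_isInterface_of_isT2Along hX h hxy hy
    rcases (hp.mem_dirs_iff w).1 h.2.1 with e | e | e | e
    · exact key _ _ hp e hv
    · exact key _ _ hp.symm e hu
    · exact key _ _ hp.neg_left e hv
    · exact key _ _ hp.symm.neg_left e hu
  · exfalso
    obtain ⟨a, b, j, D⟩ := h.data
    have hn := vertex_notMem hp (H.isInterface hX) hu hv
    have hR := (H.adm.2.2.1 X hX).2.2 h
    have hvu : ∀ w, w = a + b ∨ w = -a - b → X.vertex w ∈ M.Γ := by
      intro w hw
      have : X.vertex w ∈ X.bdry ∩ M.Γ := by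
        rw [D.bdry]; rcases hw with rfl | rfl <;> simp
      exact this.2
    rw [← X.vertex_add] at hn
    have hne1 : u + v ≠ a + b := fun e => hn (hvu _ (Or.inl e))
    have hne2 : u + v ≠ -a - b := fun e => hn (hvu _ (Or.inr e))
    have hdisj : ∀ d, X.openSide d ⊆ M.sgn j → X.openSide d ⊆ M.sgn j.rev → d ∈ dirs → False := by
      intro d h1 h2 hd
      have hpd := Perp.of_rot hd
      have hm : X.uv d (rot d) 1 0 ∈ X.openSide d := (X.uv_mem_openSide hpd).2 (by norm_num)
      exact ne_rev j (sgn_unique (h1 hm) (h2 hm))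
    have h1 : ∀ d ∈ dirs, X.openSide d ⊆ M.sgn j → d = a ∨ d = -b := by
      intro d hd hs
      rcases (D.perp.mem_dirs_iff d).1 hd with rfl | rfl | rfl | rfl
      · exact Or.inl rfl
      · exact (hdisj _ hs D.side₃ hd).elim
      · exact (hdisj _ hs D.side₄ hd).elim
      · exact Or.inr rfl
    have h2 : ∀ d ∈ dirs, X.openSide d ⊆ M.sgn j.rev → d = b ∨ d = -a := by
      intro d hd hs
      rcases (D.perp.mem_dirs_iff d).1 hd with rfl | rfl | rfl | rfl
      · exact (hdisj _ D.side₁ hs hd).elim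
      · exact Or.inl rfl
      · exact Or.inr rfl
      · exact (hdisj _ D.side₂ hs hd).elim
    obtain ⟨d, hd, hds, hdn⟩ := hR j
    have hdn := H.not_isInterface_of_neighbor hX hd hdn
    obtain ⟨d', hd', hds', hdn'⟩ := hR j.rev
    have hdn' := H.not_isInterface_of_neighbor hX hd' hdn'
    have h1 := h1 d hd (hds.trans (sub_subset_sgn j))
    have h2 := h2 d' hd' (hds'.trans (sub_subset_sgn _))
    -- The vertex `u + v` is not on `Γ`, so it is one of the two other vertices. Hence the sides `u`
    -- and `v` are exactly the two sides of `X` in one subdomain, and Rule 2 makes one of the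
    -- elements across them a non-interface element.
    have key : (u = a ∧ v = -b) ∨ (v = a ∧ u = -b) ∨ (u = b ∧ v = -a) ∨ (v = b ∧ u = -a) := by
      rcases hp.cases with ⟨rfl, rfl⟩ | ⟨rfl, rfl⟩ | ⟨rfl, rfl⟩ | ⟨rfl, rfl⟩ | ⟨rfl, rfl⟩ |
        ⟨rfl, rfl⟩ | ⟨rfl, rfl⟩ | ⟨rfl, rfl⟩ <;>
      rcases D.perp.cases with ⟨rfl, rfl⟩ | ⟨rfl, rfl⟩ | ⟨rfl, rfl⟩ | ⟨rfl, rfl⟩ | ⟨rfl, rfl⟩ |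
        ⟨rfl, rfl⟩ | ⟨rfl, rfl⟩ | ⟨rfl, rfl⟩ <;> revert hne1 hne2 <;> decide
    rcases key with ⟨rfl, rfl⟩ | ⟨rfl, rfl⟩ | ⟨rfl, rfl⟩ | ⟨rfl, rfl⟩
    · rcases h1 with rfl | rfl
      exacts [hdn hu, hdn hv]
    · rcases h1 with rfl | rfl
      exacts [hdn hv, hdn hu]
    · rcases h2 with rfl | rfl
      exacts [hdn' hu, hdn' hv]
    · rcases h2 with rfl | rfl
      exacts [hdn' hv, hdn' hu]

theorem rule3 (hG : G ∈ M.T) (hGn : ¬ M.IsInterface G) {d₁ d₂ d₃ : ℤ × ℤ} (h₁ : d₁ ∈ dirs)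
    (h₂ : d₂ ∈ dirs) (h₃ : d₃ ∈ dirs) (h₁₂ : d₁ ≠ d₂) (h₁₃ : d₁ ≠ d₃) (h₂₃ : d₂ ≠ d₃)
    (m₁ : G.shift d₁ ∈ C) (m₂ : G.shift d₂ ∈ C) (m₃ : G.shift d₃ ∈ C) : False := by
  have h := H.adm.2.2.2.1 G hG hGn
  have hsub : ({G.shift d₁, G.shift d₂, G.shift d₃} : Set Cell) ⊆
      {N | N ∈ C ∧ ∃ u ∈ dirs, M.NeighborAcross G u N} := by
    have : ∀ d ∈ dirs, G.shift d ∈ C → G.shift d ∈ {N | N ∈ C ∧ ∃ u ∈ dirs, M.NeighborAcross G u N} :=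
      fun d hd hm => ⟨hm, d, hd, (H.isInterface hm).1, G.side_shift hd⟩
    rintro X (rfl | rfl | rfl)
    exacts [this _ h₁ m₁, this _ h₂ m₂, this _ h₃ m₃]
  have h3 : ({G.shift d₁, G.shift d₂, G.shift d₃} : Set Cell).encard = 3 := by
    rw [encard_eq_three]
    exact ⟨_, _, _, by rwa [Ne, G.shift_inj], by rwa [Ne, G.shift_inj], by rwa [Ne, G.shift_inj],
      rfl⟩
  have := (encard_le_encard hsub).trans h
  rw [h3] at this
  exact absurd this (by decide)

/-- The inner corner next to an element of type 1 is not an interface element. -/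
theorem not_isInterface_diag (hK : K ∈ C) (hT : M.IsT1 K) (D : M.T1Data K u v i r₁ r₂) :
    ¬ M.IsInterface (K.shift (u + v)) := by
  intro hD
  have hp := D.perp
  obtain ⟨n1, n2, n3⟩ := H.chainNbr_of_T1 hK D hT
  have e1 : (K.shift u).shift v = K.shift (u + v) := K.shift_shift u v
  have e2 : (K.shift v).shift u = K.shift (u + v) := by rw [K.shift_shift, add_comm]
  have hi := H.isInterface hK
  obtain ⟨t1, _, _, _, D1⟩ := H.turn n1.mem_right hp.neg_left (by rwa [K.shift_shift_neg])
    (by rwa [e1])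
  obtain ⟨t2, _, _, _, D2⟩ := H.turn n2.mem_right hp.neg_right (by rwa [e2])
    (by rwa [K.shift_shift_neg])
  obtain ⟨m1, m2, m3⟩ := H.chainNbr_of_T1 n1.mem_right D1 t1
  obtain ⟨k1, k2, k3⟩ := H.chainNbr_of_T1 n2.mem_right D2 t2
  rw [K.shift_shift_neg] at m1 m3 k2 k3
  rw [e1] at m2 m3
  rw [e2] at k1 k3
  have f1 : (K.shift (u + v)).shift (-u) = K.shift v := by rw [← e2, Cell.shift_shift_neg]
  have f2 : (K.shift (u + v)).shift (-v) = K.shift u := by rw [← e1, Cell.shift_shift_neg]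
  obtain ⟨t3, _, _, _, D3⟩ := H.turn m2.mem_right hp.neg_left.neg_right
    (by rw [f1]; exact H.isInterface n2.mem_right) (by rw [f2]; exact H.isInterface n1.mem_right)
  obtain ⟨l1, l2, l3⟩ := H.chainNbr_of_T1 m2.mem_right D3 t3
  rw [f1] at l1 l3
  rw [f2] at l2 l3
  -- All four elements around the vertex are of type 1, and their neighbours in the chain are among
  -- them. So they are the whole chain, which was to contain an element of another type.
  let P : Cell → Prop := fun X => X = K ∨ X = K.shift u ∨ X = K.shift v ∨ X = K.shift (u + v)
  have cl : ∀ X Y, ChainNbr C X Y → P X → P Y := by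
    rintro X Y hXY (rfl | rfl | rfl | rfl)
    · rcases n3 Y hXY with rfl | rfl <;> simp [P]
    · rcases m3 Y hXY with rfl | rfl <;> simp [P]
    · rcases k3 Y hXY with rfl | rfl <;> simp [P]
    · rcases l3 Y hXY with rfl | rfl <;> simp [P]
  have all : ∀ X ∈ C, P X := forall_of_consecutive ⟨K, hK, Or.inl rfl⟩ fun X Y h =>
    ⟨cl X Y (Or.inl h), cl Y X (Or.inr h)⟩
  obtain ⟨X, hX, hX1⟩ := H.exists_not_T1
  rcases all X hX with rfl | rfl | rfl | rfl
  exacts [hX1 hT, hX1 t1, hX1 t2, hX1 t3]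

/-- If the element of type 1 is followed by another one, then the interface bends back. -/
theorem T1Data_next (hK : K ∈ C) (hT : M.IsT1 K) (D : M.T1Data K u v i r₁ r₂)
    (hN : M.IsT1 (K.shift u)) : ∃ i' r r', M.T1Data (K.shift u) (-u) (-v) i' r r' := by
  have hp := D.perp
  obtain ⟨n1, -⟩ := H.chainNbr_of_T1 hK D hT
  obtain ⟨a, b, j, s₁, s₂, D'⟩ := hN.data
  have hmem : M.IsInterface ((K.shift u).shift (-u)) := by
    rw [K.shift_shift_neg]; exact H.isInterface hK
  have hm := D'.eq_of_meets hp.neg_left.1 (H.meets_of_shift n1.mem_right hp.neg_left.1 hmem)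
  have key : ∀ {b j s₁ s₂}, M.T1Data (K.shift u) (-u) b j s₁ s₂ →
      ∃ i' r r', M.T1Data (K.shift u) (-u) (-v) i' r r' := by
    intro b j s₁ s₂ D'
    rcases hp.neg_left.eq_or_of_perp D'.perp with rfl | rfl
    -- The interface cannot leave through the side `v`, since it would enter the diagonal element.
    · have := (H.shift_of_T1 n1.mem_right D').2.1
      rw [K.shift_shift] at this
      exact absurd this (H.not_isInterface_diag hK hT D)
    · exact ⟨_, _, _, D'⟩
  rcases hm with rfl | rfl
  · exact key D'
  · exact key D'.symm

end Mergeable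

end InterfaceMesh

end Merging

/-! ### Non-interface elements with two neighbours in the chain. -/

namespace Merging

theorem Cell.cell_neg_right (K : Cell) {u v : ℤ × ℤ} (a b : ℤ) :
    K.cell u (-v) a b = K.cell u v a (-b) := by
  rw [← K.cell_comm, Cell.cell_neg, K.cell_comm]

namespace InterfaceMesh.Mergeable

variable {M : InterfaceMesh} {K L G : Cell} {d e : ℤ × ℤ} {C : List Cell} (H : M.Mergeable C)

include H

theorem rule3_cell (h : Perp d e) (hG : G ∈ M.T) (hGn : ¬ M.IsInterface G)
    (m₁ : G.cell d e (-1) 0 ∈ C) (m₂ : G.cell d e 1 0 ∈ C) (m₃ : G.cell d e 0 1 ∈ C) : False := by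
  rw [← G.shift_neg_left] at m₁
  rw [← G.shift_left] at m₂
  rw [← G.shift_right] at m₃
  exact H.rule3 hG hGn h.neg_left.1 h.1 h.2.1 h.ne.2.2.2.1.symm h.ne.2.2.1.symm h.ne.1 m₁ m₂ m₃

theorem rule3_cell' (h : Perp d e) (hG : G ∈ M.T) (hGn : ¬ M.IsInterface G)
    (m₁ : G.cell d e (-1) 0 ∈ C) (m₂ : G.cell d e 0 (-1) ∈ C) (m₃ : G.cell d e 0 1 ∈ C) : False :=
  H.rule3_cell (d := e) (e := -d) h.symm.neg_right hG hGn
    (by simpa [Cell.cell_neg_right, Cell.cell_comm] using m₂)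
    (by simpa [Cell.cell_neg_right, Cell.cell_comm] using m₃)
    (by simpa [Cell.cell_neg_right, Cell.cell_comm] using m₁)

theorem block_of_left (h : Perp d e) (hL : G.cell d e (-1) 0 ∈ C) {a b : ℤ}
    (ha : -2 ≤ a ∧ a ≤ 0) (hb : -1 ≤ b ∧ b ≤ 1) : M.Block 1 (G.cell d e a b) := by
  have := (H.block hL).sub (m := 1) h (a := a + 1) (b := b)
    (by have := abs_le.2 (show -1 ≤ a + 1 ∧ a + 1 ≤ 1 by omega); push_cast; omega)
    (by have := abs_le.2 hb; push_cast; omega)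
  rw [Cell.cell_cell] at this
  simpa using this

theorem block_center (h : Perp d e) (hL : G.cell d e (-1) 0 ∈ C) : M.Block 1 G := by
  have := H.block_of_left h hL (a := 0) (b := 0) (by omega) (by omega)
  rwa [Cell.cell_zero] at this

/-- Two opposite neighbours in the chain of a non-interface element are connected by interface
elements on one side of it. -/
theorem exists_path_of_opposite (h : Perp d e) (hG : ¬ M.IsInterface G)
    (hL : G.cell d e (-1) 0 ∈ C) (hL' : G.cell d e 1 0 ∈ C) :
    (M.IsInterface (G.cell d e (-1) 1) ∧ M.IsInterface (G.cell d e 0 1) ∧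
      M.IsInterface (G.cell d e 1 1)) ∨
    (M.IsInterface (G.cell d e (-1) (-1)) ∧ M.IsInterface (G.cell d e 0 (-1)) ∧
      M.IsInterface (G.cell d e 1 (-1))) := by
  by_contra hcon
  -- The predicate collects what can be reached from the left column of the ring. If neither row is
  -- complete, the right column is out of reach, although it contains `G.cell d e 1 0`.
  have := ring_of_rule4 H.rule4 (H.block_center h hL) hG h
    (fun a b => (a = -1) ∨ (a = 0 ∧ b = 1 ∧ M.IsInterface (G.cell d e (-1) 1)) ∨
      (a = 0 ∧ b = -1 ∧ M.IsInterface (G.cell d e (-1) (-1))))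
    ⟨-1, 0, by norm_num, by norm_num, Or.inl rfl, H.isInterface hL⟩ ?_ 1 0 (by norm_num)
    (by norm_num) (H.isInterface hL')
  · omega
  · intro a b ha hb hP hi
    rw [abs_le] at ha hb
    refine ⟨H.block_of_left h hL (by omega) hb, ?_⟩
    intro a' b' ha' hb' hn hi'
    rw [abs_le] at ha' hb'
    have h00 : ¬ (a' = 0 ∧ b' = 0) := by
      rintro ⟨rfl, rfl⟩; rw [Cell.cell_zero] at hi'; exact hG hi'
    rcases hP with rfl | ⟨rfl, rfl, hi2⟩ | ⟨rfl, rfl, hi2⟩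
    · by_cases h1 : a' = -1
      · exact Or.inl h1
      obtain rfl : a' = 0 := by omega
      obtain rfl : b' = b := by omega
      have : b' = 1 ∨ b' = -1 := by omega
      rcases this with rfl | rfl
      · exact Or.inr (Or.inl ⟨rfl, rfl, hi⟩)
      · exact Or.inr (Or.inr ⟨rfl, rfl, hi⟩)
    · by_cases h1 : a' = -1
      · exact Or.inl h1
      obtain rfl : a' = 1 := by omega
      obtain rfl : b' = 1 := by omega
      exact absurd (Or.inl ⟨hi2, hi, hi'⟩) hcon
    · by_cases h1 : a' = -1
      · exact Or.inl h1
      obtain rfl : a' = 1 := by omega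
      obtain rfl : b' = -1 := by omega
      exact absurd (Or.inr ⟨hi2, hi, hi'⟩) hcon

/-- The chain element in the corner has interface neighbours to the right and below, so it is of
type 1 and the chain continues to `G.cell d e 0 1`. This is a third neighbour of `G` in the chain.
-/
theorem false_of_opposite_of_mem (h : Perp d e) (hG : ¬ M.IsInterface G)
    (hL : G.cell d e (-1) 0 ∈ C) (hL' : G.cell d e 1 0 ∈ C) (hX : G.cell d e (-1) 1 ∈ C)
    (hi : M.IsInterface (G.cell d e 0 1)) : False := by
  have e1 : (G.cell d e (-1) 1).shift d = G.cell d e 0 1 := by rw [Cell.cell_shift_left]; rfl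
  obtain ⟨hT, i, r₁, r₂, D⟩ := H.turn hX h.neg_right (by rwa [e1])
    (by rw [Cell.cell_shift_neg_right]; exact H.isInterface hL)
  have := (H.chainNbr_of_T1 hX D hT).1.mem_right
  rw [e1] at this
  exact H.rule3_cell h (H.block_center h hL).mem hG hL hL' this

/-- Meant for the ends of the chain, which have one chain neighbour `X` only. The two points of `Γ`
on the boundary of `L` lie on the sides `e` and `-e`; the contact with `X` is one of them, and as
triple points are excluded, `X` is the element across that side. -/
theorem chainNbr_neg_of_notMem (hL : L ∈ C) (he : e ∈ dirs) (h1 : M.IsInterface (L.shift e))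
    (h2 : L.shift e ∉ C) (h3 : M.IsInterface (L.shift (-e))) : ChainNbr C L (L.shift (-e)) := by
  obtain ⟨X, hX⟩ := exists_chainNbr H.two_le hL
  obtain ⟨p, hp, hpL, hpX⟩ := H.touch hX
  obtain ⟨q₁, hq₁, hq₁'⟩ := H.meets_of_shift hL he h1
  obtain ⟨q₂, hq₂, hq₂'⟩ := H.meets_of_shift hL (neg_mem_dirs he) h3
  have hLi := H.isInterface hL
  have hXi := H.isInterface hX.mem_right
  obtain ⟨A, B, hAB, -⟩ := hLi.bdry_inter
  have mm : ∀ {x}, x ∈ L.bdry → x ∈ M.Γ → x = A ∨ x = B := fun h1 h2 => by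
    have : _ ∈ L.bdry ∩ M.Γ := ⟨h1, h2⟩
    rw [hAB] at this
    simpa using this
  have hpe := Perp.of_rot he
  have hne : q₁ ≠ q₂ := by
    rintro rfl
    obtain ⟨s, t, rfl⟩ := L.uv_surj hpe q₁
    rw [L.uv_mem_side hpe] at hq₁
    rw [L.uv_mem_side_neg hpe] at hq₂
    linarith [hq₁.1, hq₂.1]
  have ns : ∀ d ∈ dirs, L.shift d ≠ L := fun d hd e => by
    have := (L.shift_inj (a := d) (b := 0)).1 (by rw [e, L.shift_zero])
    rw [this] at hd
    revert hd; decide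
  have hcl : ∀ d ∈ dirs, ∀ q ∈ L.side d, q ∈ (L.shift d).closed := fun d hd q hq =>
    (L.shift d).side_subset_closed (neg_mem_dirs hd) ((L.side_shift hd).symm ▸ hq)
  have hpb : p ∈ L.bdry := ⟨hpL, fun h => hX.ne H.dup (eq_of_inter_closed hLi.1 hXi.1 ⟨p, h, hpX⟩)⟩
  have hpq : p = q₁ ∨ p = q₂ := by
    rcases mm hpb hp with e1 | e1 <;> rcases mm (L.side_subset_bdry he hq₁) hq₁' with e2 | e2 <;>
      rcases mm (L.side_subset_bdry (neg_mem_dirs he) hq₂) hq₂' with e3 | e3 <;> simp_all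
  by_contra hcon
  rcases hpq with rfl | rfl
  · refine (H.block1 hL).notMem_of_triple hLi hXi h1 (hX.ne H.dup).symm (ns e he) ?_ hpL hpX
      (hcl e he _ hq₁) hp
    rintro rfl
    exact h2 hX.mem_right
  · refine (H.block1 hL).notMem_of_triple hLi hXi h3 (hX.ne H.dup).symm (ns _ (neg_mem_dirs he)) ?_
      hpL hpX (hcl _ (neg_mem_dirs he) _ hq₂) hp
    rintro rfl
    exact hcon hX

/-- An inner element would have the interface element above it as a chain neighbour, and
`false_of_opposite_of_mem` forbids this. -/
theorem not_isInner_of_opposite (h : Perp d e) (hG : ¬ M.IsInterface G)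
    (hL : G.cell d e (-1) 0 ∈ C) (hL' : G.cell d e 1 0 ∈ C)
    (h1 : M.IsInterface (G.cell d e (-1) 1)) (h2 : M.IsInterface (G.cell d e 0 1)) :
    ¬ IsInner C (G.cell d e (-1) 0) ∧ G.cell d e (-1) 1 ∉ C := by
  have hn : G.cell d e (-1) 1 ∉ C := fun hX => H.false_of_opposite_of_mem h hG hL hL' hX h2
  refine ⟨fun hin => hn ?_, hn⟩
  have := H.chainNbr_of_shift hL hin h.2.1 (by rw [Cell.cell_shift_right]; exact h1)
  rw [Cell.cell_shift_right] at this
  exact this.mem_right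

/-- In the ring around the element below `G`, both chain elements are corners of the top row. Since
`G` blocks the way between them, the left one can be connected to the right one only through the
element below it. -/
theorem isInterface_below_of_opposite (h : Perp d e)
    (hL : G.cell d e (-1) 0 ∈ C) (hL' : G.cell d e 1 0 ∈ C) (hG : ¬ M.IsInterface G)
    (hW : ¬ M.IsInterface (G.cell d e 0 (-1))) : M.IsInterface (G.cell d e (-1) (-1)) := by
  by_contra hcon
  have hB := H.block_of_left h hL (a := 0) (b := -1) (by omega) (by omega)
  have := ring_of_rule4 H.rule4 hB hW h (fun a b => a = -1 ∧ b = 1)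
    ⟨-1, 1, by norm_num, by norm_num, ⟨rfl, rfl⟩, by
      rw [Cell.cell_cell]; exact H.isInterface hL⟩ ?_ 1 1 (by norm_num) (by norm_num)
    (by rw [Cell.cell_cell]; exact H.isInterface hL')
  · omega
  · rintro a b - - ⟨rfl, rfl⟩ hi
    rw [Cell.cell_cell] at hi
    refine ⟨by rw [Cell.cell_cell]; exact H.block_of_left h hL (by omega) (by omega), ?_⟩
    intro a' b' ha' hb' hn hi'
    rw [abs_le] at ha' hb'
    exfalso
    rcases hn with ⟨rfl, hn⟩ | ⟨rfl, hn⟩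
    · obtain rfl : b' = 0 := by omega
      rw [Cell.cell_cell] at hi'
      exact hcon hi'
    · obtain rfl : a' = 0 := by omega
      rw [Cell.cell_cell] at hi'
      exact hG (by simpa [Cell.cell_zero] using hi')

/-- A path above `G` makes both its chain neighbours ends of the chain, so they continue only
downwards. If the element `W` below `G` is an interface element, then it is isolated in the ring
around `G`. Otherwise `W` has two opposite chain neighbours as well, and the same argument is
repeated for `W`, where the path has to run below; but the chain has no third end. -/
theorem false_of_path (h : Perp d e) (hG : ¬ M.IsInterface G)
    (hL : G.cell d e (-1) 0 ∈ C) (hL' : G.cell d e 1 0 ∈ C)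
    (h1 : M.IsInterface (G.cell d e (-1) 1)) (h2 : M.IsInterface (G.cell d e 0 1))
    (h3 : M.IsInterface (G.cell d e 1 1)) : False := by
  have hm : ∀ {a b : ℤ}, G.cell (-d) e a b = G.cell d e (-a) b := fun {a b} => G.cell_neg a b
  obtain ⟨nL, nL1⟩ := H.not_isInner_of_opposite h hG hL hL' h1 h2
  obtain ⟨nL', nL1'⟩ := H.not_isInner_of_opposite h.neg_left hG (by rw [hm]; exact hL')
    (by rw [hm]; exact hL) (by rw [hm]; exact h3) (by rw [hm]; exact h2)
  rw [hm] at nL' nL1'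
  -- an interface element below an end of the chain belongs to the chain
  have below : M.IsInterface (G.cell d e (-1) (-1)) → G.cell d e (-1) (-1) ∈ C := by
    intro hi
    have := H.chainNbr_neg_of_notMem hL h.2.1 (by rw [Cell.cell_shift_right]; exact h1)
      (by rw [Cell.cell_shift_right]; exact nL1) (by rw [Cell.cell_shift_neg_right]; exact hi)
    rw [Cell.cell_shift_neg_right] at this
    exact this.mem_right
  have below' : M.IsInterface (G.cell d e 1 (-1)) → G.cell d e 1 (-1) ∈ C := by
    intro hi
    have := H.chainNbr_neg_of_notMem hL' h.2.1 (by rw [Cell.cell_shift_right]; exact h3)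
      (by rw [Cell.cell_shift_right]; exact nL1') (by rw [Cell.cell_shift_neg_right]; exact hi)
    rw [Cell.cell_shift_neg_right] at this
    exact this.mem_right
  by_cases hW : M.IsInterface (G.cell d e 0 (-1))
  · have no1 : ¬ M.IsInterface (G.cell d e (-1) (-1)) := fun hi =>
      H.false_of_opposite_of_mem h.neg_right hG (by rwa [Cell.cell_neg_right])
        (by rwa [Cell.cell_neg_right]) (by rw [Cell.cell_neg_right]; exact below hi)
        (by rwa [Cell.cell_neg_right])
    have no2 : ¬ M.IsInterface (G.cell d e 1 (-1)) := fun hi =>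
      H.false_of_opposite_of_mem h.neg_left.neg_right hG (by rw [Cell.cell_neg_right, hm]; exact hL')
        (by rw [Cell.cell_neg_right, hm]; exact hL)
        (by rw [Cell.cell_neg_right, hm]; exact below' hi)
        (by rw [Cell.cell_neg_right, hm]; exact hW)
    have := ring_of_rule4 H.rule4 (H.block_center h hL) hG h (fun a b => a = 0 ∧ b = -1)
      ⟨0, -1, by norm_num, by norm_num, ⟨rfl, rfl⟩, hW⟩ ?_ 1 0 (by norm_num) (by norm_num)
      (H.isInterface hL')
    · omega
    · rintro a b - - ⟨rfl, rfl⟩ -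
      refine ⟨H.block_of_left h hL (by omega) (by omega), ?_⟩
      intro a' b' ha' hb' hn hi'
      rw [abs_le] at ha' hb'
      exfalso
      rcases hn with ⟨rfl, hn⟩ | ⟨rfl, rfl | rfl⟩
      · obtain rfl : b' = 0 := by omega
        exact hG (by rwa [Cell.cell_zero] at hi')
      · exact no2 hi'
      · exact no1 hi'
  · have hb := below (H.isInterface_below_of_opposite h hL hL' hG hW)
    have hb' : G.cell d e 1 (-1) ∈ C := by
      refine below' ?_
      have := H.isInterface_below_of_opposite h.neg_left (by rw [hm]; exact hL')
        (by rw [hm]; exact hL) hG (by rw [hm]; exact hW)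
      rwa [hm] at this
    set W := G.cell d e 0 (-1) with hWdef
    have c1 : W.cell d e (-1) 0 = G.cell d e (-1) (-1) := by rw [hWdef, Cell.cell_cell]; rfl
    have c2 : W.cell d e 1 0 = G.cell d e 1 (-1) := by rw [hWdef, Cell.cell_cell]; rfl
    have c3 : W.cell d e 0 1 = G := by rw [hWdef, Cell.cell_cell]; exact Cell.cell_zero G
    rw [← c1] at hb
    rw [← c2] at hb'
    rcases H.exists_path_of_opposite h hW hb hb' with ⟨-, hp, -⟩ | ⟨p1, p2, -⟩
    · exact hG (by rwa [c3] at hp)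
    -- Both ends of the chain are already known: they are the two neighbours of `G`.
    have hin : IsInner C (W.cell d e (-1) 0) := by
      by_contra hcon
      have k1 := (H.isT2_of_not_isInner hL nL).1
      have k2 := (H.isT2_of_not_isInner hL' nL').1
      have k3 := (H.isT2_of_not_isInner hb hcon).1
      have := two_ends k1 k2 k3 (by rw [Ne, G.cell_inj h]; omega)
        (by rw [c1, Ne, G.cell_inj h]; omega)
      rw [c1, G.cell_inj h] at this
      omega
    have := H.chainNbr_of_shift hb hin h.neg_right.2.1
      (by rw [Cell.cell_shift_neg_right]; exact p1)
    rw [Cell.cell_shift_neg_right] at this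
    exact H.false_of_opposite_of_mem h.neg_right hW (by rwa [Cell.cell_neg_right])
      (by rwa [Cell.cell_neg_right]) (by rw [Cell.cell_neg_right]; exact this.mem_right)
      (by rwa [Cell.cell_neg_right])

/-- A non-interface element has no two opposite neighbours in the chain. -/
theorem false_of_opposite (h : Perp d e) (hG : ¬ M.IsInterface G)
    (hL : G.cell d e (-1) 0 ∈ C) (hL' : G.cell d e 1 0 ∈ C) : False := by
  rcases H.exists_path_of_opposite h hG hL hL' with ⟨h1, h2, h3⟩ | ⟨h1, h2, h3⟩
  · exact H.false_of_path h hG hL hL' h1 h2 h3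
  · exact H.false_of_path h.neg_right hG (by rwa [Cell.cell_neg_right])
      (by rwa [Cell.cell_neg_right]) (by rwa [Cell.cell_neg_right])
      (by rwa [Cell.cell_neg_right]) (by rwa [Cell.cell_neg_right])

/-- If a non-interface element has two adjacent neighbours in the chain, then the chain runs from
one to the other through the element of type 1 between them. -/
theorem corner (h : Perp d e) (hG : ¬ M.IsInterface G)
    (hL : G.cell d e (-1) 0 ∈ C) (hL' : G.cell d e 0 (-1) ∈ C) :
    G.cell d e (-1) (-1) ∈ C ∧ M.IsT1 (G.cell d e (-1) (-1)) ∧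
      ∃ i r₁ r₂, M.T1Data (G.cell d e (-1) (-1)) d e i r₁ r₂ := by
  have hB := H.block_center h hL
  have hLi := H.isInterface hL
  have hLi' := H.isInterface hL'
  have s1 : (G.cell d e (-1) 0).shift (-e) = G.cell d e (-1) (-1) := by
    rw [Cell.cell_shift_neg_right]; rfl
  have s2 : (G.cell d e 0 (-1)).shift (-d) = G.cell d e (-1) (-1) := by
    rw [Cell.cell_shift_neg_left]; rfl
  have s3 : (G.cell d e (-1) (-1)).shift d = G.cell d e 0 (-1) := by
    rw [Cell.cell_shift_left]; rfl
  have s4 : (G.cell d e (-1) (-1)).shift e = G.cell d e (-1) 0 := by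
    rw [Cell.cell_shift_right]; rfl
  have h00 : ¬ M.IsInterface (G.cell d e 0 0) := by rwa [Cell.cell_zero]
  by_cases hZ : M.IsInterface (G.cell d e (-1) (-1))
  · suffices hZC : G.cell d e (-1) (-1) ∈ C from
      ⟨hZC, H.turn hZC h (by rwa [s3]) (by rwa [s4])⟩
    -- Then both neighbours of `G` are ends of the chain, and the element between them is a gap of
    -- length one, which is excluded.
    by_contra hZC
    have nL : ¬ IsInner C (G.cell d e (-1) 0) := fun hin => hZC (by
      have := (H.chainNbr_of_shift hL hin h.neg_right.2.1 (by rwa [s1])).mem_right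
      rwa [s1] at this)
    have nL' : ¬ IsInner C (G.cell d e 0 (-1)) := fun hin => hZC (by
      have := (H.chainNbr_of_shift hL' hin h.neg_left.1 (by rwa [s2])).mem_right
      rwa [s2] at this)
    have k1 := (H.isT2_of_not_isInner hL nL).1
    have k2 := (H.isT2_of_not_isInner hL' nL').1
    have hne : G.cell d e (-1) 0 ≠ G.cell d e 0 (-1) := by rw [Ne, G.cell_inj h]; omega
    rcases H.ends with ⟨-, -, -, hgap⟩ | ⟨hcl, -⟩
    · have touch : ∀ {X : Cell} {f : ℤ × ℤ}, X ∈ C → f ∈ dirs → M.IsInterface (X.shift f) →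
          (closure (M.Γ ∩ (X.shift f).toSet) ∩ closure (M.Γ ∩ X.toSet)).Nonempty := by
        intro X f hX hf hi
        obtain ⟨q, hq, hqΓ⟩ := H.meets_of_shift hX hf hi
        refine ⟨q, ?_, ?_⟩
        · rw [hi.closure_inter]
          exact ⟨(X.shift f).side_subset_closed (neg_mem_dirs hf) ((X.side_shift hf).symm ▸ hq),
            hqΓ⟩
        · rw [(H.isInterface hX).closure_inter]
          exact ⟨X.side_subset_closed hf hq, hqΓ⟩
      have t1 := touch hL h.neg_right.2.1 (by rwa [s1])
      have t2 := touch hL' h.neg_left.1 (by rwa [s2])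
      rw [s1] at t1
      rw [s2] at t2
      rcases k1 with k1 | k1 <;> rcases k2 with k2 | k2
      · exact hne (Option.some.inj (k1.symm.trans k2))
      · exact hgap _ k1 _ k2 _ hZ hZC ⟨t1, t2⟩
      · exact hgap _ k2 _ k1 _ hZ hZC ⟨t2, t1⟩
      · exact hne (Option.some.inj (k1.symm.trans k2))
    · obtain ⟨h4, hh, -⟩ := hcl
      rcases k1 with k1 | k1 <;> rcases k2 with k2 | k2 <;> rw [hh] at * <;>
        exact hne (Option.some.inj (k1.symm.trans k2))
  · exfalso
    -- Without the element in the corner, the ring around `G` connects its two chain neighbours only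
    -- the long way round; the elements of this way are found one by one.
    have i1 : M.IsInterface (G.cell d e (-1) 1) := by
      by_contra hcon
      have := ring_of_rule4 H.rule4 hB hG h (fun a b => a = -1 ∧ b = 0)
        ⟨-1, 0, by norm_num, by norm_num, ⟨rfl, rfl⟩, hLi⟩ ?_ 0 (-1) (by norm_num) (by norm_num)
        hLi'
      · omega
      · rintro a b - - ⟨rfl, rfl⟩ -
        refine ⟨H.block1 hL, ?_⟩
        intro a' b' ha' hb' hn hi'
        rw [abs_le] at ha' hb'
        exfalso
        rcases hn with ⟨rfl, rfl | rfl⟩ | ⟨rfl, hn⟩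
        · exact hcon hi'
        · exact hZ hi'
        · obtain rfl : a' = 0 := by omega
          exact h00 hi'
    have i2 : M.IsInterface (G.cell d e 0 1) := by
      by_contra hcon
      have := ring_of_rule4 H.rule4 hB hG h (fun a b => a = -1 ∧ (b = 0 ∨ b = 1))
        ⟨-1, 0, by norm_num, by norm_num, ⟨rfl, Or.inl rfl⟩, hLi⟩ ?_ 0 (-1) (by norm_num)
        (by norm_num) hLi'
      · omega
      · rintro a b - hb ⟨rfl, hb2⟩ -
        rw [abs_le] at hb
        refine ⟨H.block_of_left h hL (by omega) hb, ?_⟩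
        intro a' b' ha' hb' hn hi'
        rw [abs_le] at ha' hb'
        rcases hn with ⟨rfl, hn⟩ | ⟨rfl, hn⟩
        · by_cases hb1 : b' = -1
          · subst hb1; exact absurd hi' hZ
          · omega
        · exfalso
          obtain rfl : a' = 0 := by omega
          rcases hb2 with rfl | rfl
          · exact h00 hi'
          · exact hcon hi'
    -- In the ring around the non-interface corner element, `G` blocks the short way, so this is the
    -- only exit from the left neighbour of `G`.
    have i3 : M.IsInterface (G.cell d e (-2) 0) := by
      by_contra hcon
      have hB' := H.block_of_left h hL (a := -1) (b := -1) (by omega) (by omega)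
      have := ring_of_rule4 H.rule4 hB' hZ h (fun a b => a = 0 ∧ b = 1)
        ⟨0, 1, by norm_num, by norm_num, ⟨rfl, rfl⟩, by rw [Cell.cell_cell]; exact hLi⟩ ?_ 1 0
        (by norm_num) (by norm_num) (by rw [Cell.cell_cell]; exact hLi')
      · omega
      · rintro a b - - ⟨rfl, rfl⟩ -
        refine ⟨by rw [Cell.cell_cell]; exact H.block1 hL, ?_⟩
        intro a' b' ha' hb' hn hi'
        rw [Cell.cell_cell] at hi'
        rw [abs_le] at ha' hb'
        exfalso
        rcases hn with ⟨rfl, hn⟩ | ⟨rfl, rfl | rfl⟩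
        · obtain rfl : b' = 0 := by omega
          exact hZ hi'
        · exact h00 hi'
        · exact hcon hi'
    -- The chain now turns twice and reaches a third neighbour of `G`.
    obtain ⟨hT, i, r₁, r₂, D⟩ := H.turn hL h.neg_left (by rw [Cell.cell_shift_neg_left]; exact i3)
      (by rw [Cell.cell_shift_right]; exact i1)
    have m1 := (H.chainNbr_of_T1 hL D hT).2.1.mem_right
    rw [Cell.cell_shift_right] at m1
    obtain ⟨hT', i', s₁, s₂, D'⟩ := H.turn m1 h.neg_right
      (by rw [Cell.cell_shift_left]; exact i2) (by rw [Cell.cell_shift_neg_right]; exact hLi)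
    have m2 := (H.chainNbr_of_T1 m1 D' hT').1.mem_right
    rw [Cell.cell_shift_left] at m2
    exact H.rule3_cell' h hB.mem hG hL hL' m2

end InterfaceMesh.Mergeable

end Merging

/-! ### The patterns, and the surroundings of the elements which they use. -/

namespace Merging

namespace Cell

variable (K : Cell) (u v : ℤ × ℤ)

theorem shift_uv : K.shift (u + v) = K.cell u v 1 1 := by simp [cell]

theorem shift_u_sub_v : K.shift (u - v) = K.cell u v 1 (-1) := by
  unfold cell; congr 1; ext <;> simp <;> ring

theorem shift_neg_sub : K.shift (-u - v) = K.cell u v (-1) (-1) := by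
  unfold cell; congr 1; ext <;> simp <;> ring

theorem shift_v_sub_u : K.shift (v - u) = K.cell u v (-1) 1 := by
  unfold cell; congr 1; ext <;> simp <;> ring

theorem shift_two_u : K.shift (2 * u) = K.cell u v 2 0 := by
  unfold cell; congr 1; ext <;> simp

theorem shift_two_u_add_v : K.shift (2 * u + v) = K.cell u v 2 1 := by
  unfold cell; congr 1; ext <;> simp

theorem shift_two_u_add_two_v : K.shift (2 * u + 2 * v) = K.cell u v 2 2 := by
  unfold cell; congr 1

theorem shift_u_add_two_v : K.shift (u + 2 * v) = K.cell u v 1 2 := by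
  unfold cell; congr 1; ext <;> simp

theorem shift_two_v : K.shift (2 * v) = K.cell u v 0 2 := by
  unfold cell; congr 1; ext <;> simp

theorem shift_neg_two_u : K.shift (-(2 * u)) = K.cell u v (-2) 0 := by
  unfold cell; congr 1; ext <;> simp

theorem shift_u_v : (K.shift u).shift v = K.cell u v 1 1 := by
  rw [K.shift_left (u := u) (v := v), cell_shift_right]; rfl

theorem shift_u_neg_v : (K.shift u).shift (-v) = K.cell u v 1 (-1) := by
  rw [K.shift_left (u := u) (v := v), cell_shift_neg_right]; rfl

theorem shift_u_u : (K.shift u).shift u = K.cell u v 2 0 := by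
  rw [K.shift_left (u := u) (v := v), cell_shift_left]; rfl

theorem shift_neg_u_v : (K.shift (-u)).shift v = K.cell u v (-1) 1 := by
  rw [K.shift_neg_left (u := u) (v := v), cell_shift_right]; rfl

theorem shift_neg_u_neg_v : (K.shift (-u)).shift (-v) = K.cell u v (-1) (-1) := by
  rw [K.shift_neg_left (u := u) (v := v), cell_shift_neg_right]; rfl

theorem shift_neg_u_neg_u : (K.shift (-u)).shift (-u) = K.cell u v (-2) 0 := by
  rw [K.shift_neg_left (u := u) (v := v), cell_shift_neg_left]; rfl

end Cell

namespace InterfaceMesh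

variable {M : InterfaceMesh} {K L G : Cell} {u v : ℤ × ℤ} {C : List Cell}

variable (M) in
/-- The inputs and results of the calls of the merging algorithm for the chain `C`. -/
inductive Pattern (δ : ℝ) (C : List Cell) : List Cell → Option (List Cell) → Prop
  | p1 {K u v i r₁ r₂} : K ∈ C → M.IsT1 K → M.T1Data K u v i r₁ r₂ → M.IsT2 (K.shift u) →
      M.IsT2 (K.shift v) → Pattern δ C [K.shift u, K, K.shift v] (M.merge1 δ K u v)
  | p2 {K u v i r₁ r₂} : K ∈ C → M.IsT1 K → M.T1Data K u v i r₁ r₂ → M.IsT1 (K.shift u) →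
      M.IsT1 (K.shift v) → Pattern δ C [K.shift u, K, K.shift v] (M.merge2 δ K u v)
  | p3 {K u w i r₁ r₂} : K ∈ C → M.IsT1 K → M.T1Data K u w i r₁ r₂ → M.IsT1 (K.shift u) →
      Pattern δ C [K, K.shift u] (M.merge3 δ K u w (-w))
  | p4 {K u w₁ w₂ i r₁ r₂ j s₁ s₂} : K ∈ C → M.IsT2 K → K.shift (-u) ∈ C → K.shift u ∈ C →
      M.IsT1 (K.shift (-u)) → M.IsT1 (K.shift u) →
      M.T1Data (K.shift (-u)) u w₁ i r₁ r₂ → M.T1Data (K.shift u) (-u) w₂ j s₁ s₂ →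
      Pattern δ C [K.shift (-u), K, K.shift u] (M.merge4 δ K u w₁ w₂)
  | p5 {K w u} : K ∈ C → Perp w u → M.IsT2Along K w → Pattern δ C [K] (M.merge5 δ K w u)

variable (M) in
/-- All interface elements of the layer `j` around `G` are among the inputs. -/
def Surrounded (I : List Cell) (G : Cell) (j : ℕ) : Prop :=
  (∃ X ∈ I, X ∈ M.layer G j ∧ M.IsInterface X) ∧ ∀ X ∈ M.layer G j, M.IsInterface X → X ∈ I

/-- Two inputs are neighbours of `G`. -/
def TwoNbrs (I : List Cell) (G : Cell) : Prop :=
  ∃ d ∈ dirs, ∃ d' ∈ dirs, d ≠ d' ∧ G.shift d ∈ I ∧ G.shift d' ∈ I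

variable (M) in
/-- The input `L = G.shift d` is a neighbour of `G`.  If the chain leaves `L` perpendicularly to
`d` to an input of type 1, then its neighbours in the chain are inputs, too. -/
def SideUse (C I : List Cell) (G : Cell) : Prop :=
  ∃ d ∈ dirs, G.shift d ∈ I ∧ ∀ e, Perp d e → M.IsT1 ((G.shift d).shift e) →
    (G.shift d).shift e ∈ I → ∀ Y, ChainNbr C ((G.shift d).shift e) Y → Y ∈ I

theorem sideUse_of {I : List Cell} {d e : ℤ × ℤ} (h : Perp d e) (hL : L ∈ I)
    (h1 : M.IsT1 (L.shift e) → L.shift e ∈ I → ∀ Y, ChainNbr C (L.shift e) Y → Y ∈ I)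
    (h2 : M.IsT1 (L.shift (-e)) → L.shift (-e) ∈ I → ∀ Y, ChainNbr C (L.shift (-e)) Y → Y ∈ I) :
    M.SideUse C I (L.shift d) := by
  refine ⟨-d, neg_mem_dirs h.1, by rwa [Cell.shift_shift_neg], fun e' he' => ?_⟩
  rw [Cell.shift_shift_neg]
  rcases h.neg_left.eq_or_of_perp he' with rfl | rfl
  exacts [h1, h2]

theorem shift_ne {d : ℤ × ℤ} (hd : d ∈ dirs) : K.shift d ≠ K := fun e => by
  have := (K.shift_inj (a := d) (b := 0)).1 (by rw [e, K.shift_zero])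
  rw [this] at hd
  revert hd; decide

namespace Mergeable

variable (H : M.Mergeable C)

include H

variable {i : Fin 2} {r₁ r₂ : ℝ}

theorem isT2Along_of_shift (hL : L ∈ C) (hT : M.IsT2 L) {d : ℤ × ℤ} (hd : d ∈ dirs)
    (h : M.IsInterface (L.shift d)) : M.IsT2Along L d ∨ M.IsT2Along L (-d) := by
  obtain ⟨w, hw⟩ := hT
  have hp := Perp.of_rot hw.2.1
  rcases (hp.mem_dirs_iff d).1 hd with rfl | rfl | rfl | rfl
  · exact Or.inl hw
  · exact absurd h (H.not_isInterface_of_isT2Along hL hw hp)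
  · rw [neg_neg]; exact Or.inr hw
  · exact absurd h (H.not_isInterface_of_isT2Along hL hw hp.neg_right)

theorem not_isInterface_perp_of_T2 (hL : L ∈ C) (hT : M.IsT2 L) (hp : Perp u v)
    (h : M.IsInterface (L.shift u)) : ¬ M.IsInterface (L.shift v) := by
  rcases H.isT2Along_of_shift hL hT hp.1 h with h' | h'
  · exact H.not_isInterface_of_isT2Along hL h' hp
  · exact H.not_isInterface_of_isT2Along hL h' hp.neg_left

theorem shift_mem_T (hK : K ∈ C) (hp : Perp u v) {a b : ℤ} (ha : |a| ≤ 2) (hb : |b| ≤ 2) :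
    K.cell u v a b ∈ M.T := (H.block hK).cell hp (by exact_mod_cast ha) (by exact_mod_cast hb)

theorem block_cell (hK : K ∈ C) (hp : Perp u v) {a b : ℤ} (ha : -1 ≤ a ∧ a ≤ 1)
    (hb : -1 ≤ b ∧ b ≤ 1) : M.Block 1 (K.cell u v a b) :=
  (H.block hK).sub hp (by have := abs_le.2 ha; push_cast; omega)
    (by have := abs_le.2 hb; push_cast; omega)

/-- A non-interface element diagonally adjacent to a chain element such that the common side
neighbours are non-interface elements, too, touches no other interface element. -/
theorem surrounded_of_diag (hK : K ∈ C) (hp : Perp u v) {I : List Cell} (hI : K ∈ I)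
    (h1 : ¬ M.IsInterface (K.cell u v 1 0)) (h2 : ¬ M.IsInterface (K.cell u v 0 1))
    (h3 : ¬ M.IsInterface (K.cell u v 1 1)) : M.Surrounded I (K.cell u v 1 1) 1 := by
  have hB := H.block_cell hK hp (a := 1) (b := 1) (by omega) (by omega)
  have hc : (K.cell u v 1 1).cell u v (-1) (-1) = K := by
    rw [Cell.cell_cell]; exact Cell.cell_zero K
  have hi := H.isInterface hK
  refine ⟨⟨K, hI, (hB.mem_layer_one hp).2 ⟨-1, -1, by norm_num, by norm_num, hc.symm⟩, hi⟩, ?_⟩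
  intro X hX hXi
  obtain ⟨a, b, ha, hb, rfl⟩ := (hB.mem_layer_one hp).1 hX
  have := ring_of_rule4 H.rule4 hB h3 hp (fun a b => a = -1 ∧ b = -1)
    ⟨-1, -1, by norm_num, by norm_num, ⟨rfl, rfl⟩, by rwa [hc]⟩ ?_ a b ha hb hXi
  · obtain ⟨rfl, rfl⟩ := this
    rwa [hc]
  · rintro a b - - ⟨rfl, rfl⟩ -
    refine ⟨by rw [hc]; exact H.block1 hK, ?_⟩
    intro a' b' ha' hb' hn hi'
    rw [abs_le] at ha' hb'
    rw [Cell.cell_cell] at hi'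
    exfalso
    rcases hn with ⟨rfl, hn⟩ | ⟨rfl, hn⟩
    · obtain rfl : b' = 0 := by omega
      exact h2 hi'
    · obtain rfl : a' = 0 := by omega
      exact h1 hi'

/-- The elements `K` and `K.shift u` form a component of the ring around `K.shift (-v)`: the way on
is blocked on the left because `K` is of type 1, on the right because the element of type 2 runs
straight on. Rule 4 leaves no other interface elements in this ring. -/
theorem not_isInterface_opposite_corner (hK : K ∈ C) (D : M.T1Data K u v i r₁ r₂)
    (h2 : M.IsT2 (K.shift u)) (hN : K.shift u ∈ C) :
    ¬ M.IsInterface (K.cell u v 1 (-1)) ∧ ¬ M.IsInterface (K.cell u v (-1) (-1)) := by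
  have hp := D.perp
  have hi := H.isInterface hK
  obtain ⟨-, -, n1, n2⟩ := H.shift_of_T1 hK D
  rw [K.shift_neg_left (v := v)] at n1
  rw [K.shift_neg_right (u := u)] at n2
  have n3 : ¬ M.IsInterface (K.cell u v 1 (-1)) := by
    have := H.not_isInterface_perp_of_T2 hN h2 hp.neg_left.neg_right
      (by rw [Cell.shift_shift_neg]; exact hi)
    rwa [K.shift_left (v := v), Cell.cell_shift_neg_right] at this
  refine ⟨n3, fun hcon => ?_⟩
  have hB := H.block_cell hK hp (a := 0) (b := -1) (by omega) (by omega)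
  have := ring_of_rule4 H.rule4 hB n2 hp (fun a b => (a = 0 ∨ a = 1) ∧ b = 1)
    ⟨0, 1, by norm_num, by norm_num, ⟨Or.inl rfl, rfl⟩, by
      rw [Cell.cell_cell]; exact (Cell.cell_zero K).symm ▸ hi⟩ ?_ (-1) 0 (by norm_num)
    (by norm_num) (by rw [Cell.cell_cell]; exact hcon)
  · omega
  · rintro a b - - ⟨ha, rfl⟩ -
    refine ⟨by rw [Cell.cell_cell]; exact H.block_cell hK hp (by omega) (by omega), ?_⟩
    intro a' b' ha' hb' hn hi'
    rw [abs_le] at ha' hb'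
    rw [Cell.cell_cell] at hi'
    rcases hn with ⟨rfl, hn⟩ | ⟨rfl, hn⟩
    · exfalso
      obtain rfl : b' = 0 := by omega
      rcases ha with rfl | rfl
      · exact n2 hi'
      · exact n3 hi'
    · by_cases h : a' = -1
      · subst h; exact absurd hi' n1
      · omega

/-- Both outer elements bend back and leave the square away from the diagonal element. So the three
inputs are a component of the ring around `K.shift (u + v)`, and Rule 4 excludes further interface
elements there. -/
theorem not_isInterface_ring_of_three (hK : K ∈ C) (hT : M.IsT1 K) (D : M.T1Data K u v i r₁ r₂)
    (h1 : M.IsT1 (K.shift u)) (h2 : M.IsT1 (K.shift v)) :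
    ∀ a b : ℤ, 0 ≤ a → a ≤ 2 → 0 ≤ b → b ≤ 2 → M.IsInterface (K.cell u v a b) →
      (a = 0 ∧ b = 0) ∨ (a = 1 ∧ b = 0) ∨ (a = 0 ∧ b = 1) := by
  have hp := D.perp
  have hi := H.isInterface hK
  have hD := H.not_isInterface_diag hK hT D
  rw [K.shift_uv] at hD
  obtain ⟨c1, c2, -⟩ := H.chainNbr_of_T1 hK D hT
  obtain ⟨_, _, _, D1⟩ := H.T1Data_next hK hT D h1
  obtain ⟨_, _, _, D2⟩ := H.T1Data_next hK hT D.symm h2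
  have n1 := (H.shift_of_T1 c1.mem_right D1).2.2.1
  have n2 := (H.shift_of_T1 c2.mem_right D2).2.2.1
  rw [neg_neg, K.shift_left (v := v), Cell.cell_shift_left] at n1
  rw [neg_neg, K.shift_right (u := u), Cell.cell_shift_right] at n2
  have hB := H.block_cell hK hp (a := 1) (b := 1) (by omega) (by omega)
  intro a b ha ha' hb hb' hab
  have := ring_of_rule4 H.rule4 hB hD hp
    (fun a b => (a = -1 ∧ b = -1) ∨ (a = 0 ∧ b = -1) ∨ (a = -1 ∧ b = 0))
    ⟨-1, -1, by norm_num, by norm_num, Or.inl ⟨rfl, rfl⟩, by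
      rw [Cell.cell_cell]; exact (Cell.cell_zero K).symm ▸ hi⟩ ?_ (a - 1) (b - 1)
      (abs_le.2 (by omega)) (abs_le.2 (by omega))
      (by rw [Cell.cell_cell]; ring_nf; exact hab)
  · omega
  · rintro a b - - hP -
    refine ⟨by rw [Cell.cell_cell]; exact H.block_cell hK hp (by omega) (by omega), ?_⟩
    intro a' b' ha' hb' hn hi'
    rw [abs_le] at ha' hb'
    rw [Cell.cell_cell] at hi'
    have m1 : ¬ (a' = 0 ∧ b' = 0) := by rintro ⟨rfl, rfl⟩; exact hD hi'
    have m2 : ¬ (a' = 1 ∧ b' = -1) := by rintro ⟨rfl, rfl⟩; exact n1 hi'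
    have m3 : ¬ (a' = -1 ∧ b' = 1) := by rintro ⟨rfl, rfl⟩; exact n2 hi'
    omega

/-- An element of the second layer around a cell is at most two rows away from it. -/
theorem notMem_layer_two (hK : K ∈ C) (hp : Perp u v) :
    K.cell u v 1 (-1) ∉ M.layer (K.cell u v 2 2) 2 := by
  rintro ⟨-, X, ⟨hX, Y, hY, p, hpX, hpY⟩, q, hq, hqX⟩
  obtain rfl : Y = K.cell u v 2 2 := hY
  obtain ⟨s, t, rfl⟩ := K.uv_surj hp p
  obtain ⟨s', t', rfl⟩ := K.uv_surj hp q
  rw [K.uv_mem_cell_closed hp] at hpY hq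
  obtain ⟨⟨h1, h2⟩, h3, h4⟩ := hpY
  obtain ⟨⟨h5, h6⟩, h7, h8⟩ := hq
  push_cast at h1 h2 h3 h4 h5 h6 h7 h8
  -- the point of the segment on the middle line of the row of `K`
  have hd : 0 < t - t' := by linarith
  obtain ⟨x, hx0, hx1, hx⟩ : ∃ x : ℝ, 0 ≤ x ∧ x ≤ 1 ∧ t' + x * (t - t') = 0 :=
    ⟨-t' / (t - t'), div_nonneg (by linarith) hd.le, (div_le_one hd).2 (by linarith), by
      rw [div_mul_cancel₀ _ hd.ne']; ring⟩
  -- Sizes of elements outside the block of `K` are unknown, so `X` is caught inside the block: by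
  -- convexity it contains a point of the row of `K`, and there it must be a translate.
  have hconv : Convex ℝ X.closed := (convex_Icc _ _).prod (convex_Icc _ _)
  have hm : K.uv u v (s' + x * (s - s')) 0 ∈ X.closed := by
    have := hconv hqX hpX (a := 1 - x) (b := x) (by linarith) hx0 (by ring)
    convert this using 1
    rw [← hx]
    simp only [Cell.uv]
    ext <;> simp <;> ring
  have hx2 : x < 1 := lt_of_le_of_ne hx1 fun e => by rw [e] at hx; linarith
  obtain ⟨a, b, -, -, rfl, -, h9, h10⟩ := (H.block hK).eq_cell hp hX hm
    ((K.uv_mem_openBlock hp).2 (by constructor <;> constructor <;> push_cast <;> nlinarith))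
  have hb : b ≤ 0 := by
    have h7 : b < 1 := by exact_mod_cast (by linarith : (b : ℝ) < 1)
    omega
  have hb' : (b : ℝ) ≤ 0 := by exact_mod_cast hb
  rw [K.uv_mem_cell_closed hp] at hpX
  linarith [hpX.2.2]

/-- The first layer around the far corner of the square contains no input, which is why the second
one is needed. A step from an input across a side leads to an input, to a non-interface element, or
out of the second layer, as for `K.cell u v 1 (-1)`. -/
theorem surrounded_two (hK : K ∈ C) (hT : M.IsT1 K) (D : M.T1Data K u v i r₁ r₂)
    (h1 : M.IsT1 (K.shift u)) (h2 : M.IsT1 (K.shift v)) :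
    M.Surrounded [K.shift u, K, K.shift v] (K.cell u v 2 2) 2 := by
  have hp := D.perp
  have hi := H.isInterface hK
  have hring := H.not_isInterface_ring_of_three hK hT D h1 h2
  obtain ⟨c1, c2, -⟩ := H.chainNbr_of_T1 hK D hT
  obtain ⟨-, -, n3, n4⟩ := H.shift_of_T1 hK D
  have hT2 := H.shift_mem_T hK hp (a := 2) (b := 2) (by norm_num) (by norm_num)
  have hTD := H.shift_mem_T hK hp (a := 1) (b := 1) (by norm_num) (by norm_num)
  have hlD : K.cell u v 1 1 ∈ M.layer (K.cell u v 2 2) 1 := by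
    refine ⟨hTD, _, rfl, K.uv u v 3 3, ?_, ?_⟩ <;> rw [K.uv_mem_cell_closed hp] <;> norm_num
  have hlK : K ∈ M.layer (K.cell u v 2 2) 2 := by
    refine ⟨hi.1, _, hlD, K.uv u v 1 1, ?_, ?_⟩
    · rw [K.uv_mem_closed hp]; norm_num
    · rw [K.uv_mem_cell_closed hp]; norm_num
  refine ⟨⟨K, by simp, hlK, hi⟩, ?_⟩
  refine layer_subset_of_rule4 H.rule4 hT2 (fun h => ?_) (Or.inr rfl)
    {X | X ∈ [K.shift u, K, K.shift v]} ⟨K, by simp, hlK, hi⟩ ?_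
  · have := hring 2 2 (by norm_num) (by norm_num) (by norm_num) (by norm_num) h
    omega
  · rintro X hX - -
    have hX : X = K.shift u ∨ X = K ∨ X = K.shift v := by simpa using hX
    have hXC : X ∈ C := by
      rcases hX with rfl | rfl | rfl
      exacts [c1.mem_right, hK, c2.mem_right]
    refine ⟨H.block1 hXC, fun d hd hl hdi => ?_⟩
    change X.shift d ∈ [K.shift u, K, K.shift v]
    have nD : ∀ a b : ℤ, 0 ≤ a → a ≤ 2 → 0 ≤ b → b ≤ 2 → 1 < a + b → ¬ M.IsInterface (K.cell u v a b) := by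
      intro a b ha ha' hb hb' hab h
      have := hring a b ha ha' hb hb' h
      omega
    rcases hX with rfl | rfl | rfl <;> rcases (hp.mem_dirs_iff d).1 hd with rfl | rfl | rfl | rfl
    · rw [K.shift_left (v := v), Cell.cell_shift_left] at hdi
      exact absurd hdi (nD _ _ (by norm_num) (by norm_num) (by norm_num) (by norm_num) (by norm_num))
    · rw [K.shift_left (v := d), Cell.cell_shift_right] at hdi
      exact absurd hdi (nD _ _ (by norm_num) (by norm_num) (by norm_num) (by norm_num) (by norm_num))
    · rw [Cell.shift_shift_neg]; simp
    · rw [K.shift_left (v := v), Cell.cell_shift_neg_right] at hl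
      exact absurd hl (H.notMem_layer_two hK hp)
    · simp
    · simp
    · exact absurd hdi n3
    · exact absurd hdi n4
    · rw [K.shift_right (u := d), Cell.cell_shift_left] at hdi
      exact absurd hdi (nD _ _ (by norm_num) (by norm_num) (by norm_num) (by norm_num) (by norm_num))
    · rw [K.shift_right (u := u), Cell.cell_shift_right] at hdi
      exact absurd hdi (nD _ _ (by norm_num) (by norm_num) (by norm_num) (by norm_num) (by norm_num))
    · rw [K.shift_right (u := u), Cell.cell_shift_neg_left] at hl
      have := H.notMem_layer_two hK hp.symm
      rw [K.cell_comm (-1) 1, K.cell_comm 2 2] at this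
      exact absurd hl this
    · rw [Cell.shift_shift_neg]; simp

end Mergeable

end InterfaceMesh

end Merging

/-! ### No non-interface element is used twice. -/

namespace Merging

namespace InterfaceMesh

variable {M : InterfaceMesh} {K L G : Cell} {u v w : ℤ × ℤ} {C I : List Cell}

variable (M) in
/-- `G` is a non-interface element, and its position with respect to the inputs `I` of a call that
uses it is one of those which exclude that another call uses it, too. -/
def Usable (C I : List Cell) (G : Cell) : Prop :=
  G ∈ M.T ∧ ¬ M.IsInterface G ∧
    (M.Surrounded I G 1 ∨ M.Surrounded I G 2 ∨ TwoNbrs I G ∨ M.SideUse C I G)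

theorem mem_merge1 {δ : ℝ} (h : G ∈ (M.merge1 δ K u v).getD []) :
    G = K.cell u v 1 1 ∨ (G = K.cell u v 1 (-1) ∨ G = K.cell u v 0 (-1) ∨
      G = K.cell u v (-1) (-1)) ∨ (G = K.cell u v (-1) 1 ∨ G = K.cell u v (-1) 0) := by
  rw [← K.shift_uv, ← K.shift_u_sub_v, ← K.shift_neg_right, ← K.shift_neg_sub, ← K.shift_v_sub_u,
    ← K.shift_neg_left]
  unfold merge1 at h
  dsimp only at h
  split_ifs at h <;>
    simp only [Option.getD_none, Option.getD_some, List.mem_cons, List.not_mem_nil, or_false] at h <;> tauto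

theorem mem_merge2 {δ : ℝ} (h : G ∈ (M.merge2 δ K u v).getD []) :
    G = K.cell u v 1 1 ∨ (G = K.cell u v 2 0 ∨ G = K.cell u v 2 1 ∨
      G = K.cell u v 2 2) ∨ (G = K.cell u v 1 2 ∨ G = K.cell u v 0 2) := by
  rw [← K.shift_uv, ← K.shift_two_u, ← K.shift_two_u_add_v, ← K.shift_two_u_add_two_v,
    ← K.shift_u_add_two_v, ← K.shift_two_v]
  unfold merge2 at h
  dsimp only at h
  split_ifs at h <;>
    simp only [Option.getD_none, Option.getD_some, List.mem_cons, List.not_mem_nil, or_false] at h <;> tauto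

theorem mem_merge3 {δ : ℝ} {w' : ℤ × ℤ} (h : G ∈ (M.merge3 δ K u w w').getD []) :
    G = K.cell u w 2 0 ∨ G = K.cell u w (-1) 0 := by
  rw [← K.shift_two_u, ← K.shift_neg_left]
  unfold merge3 at h
  dsimp only at h
  split_ifs at h <;>
    simp only [Option.getD_none, Option.getD_some, List.mem_cons, List.not_mem_nil, or_false] at h <;> tauto

theorem mem_merge4 {δ : ℝ} {w' : ℤ × ℤ} (h : G ∈ (M.merge4 δ K u w w').getD []) :
    G = K.cell u w 2 0 ∨ G = K.cell u w (-2) 0 := by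
  rw [← K.shift_two_u, ← K.shift_neg_two_u]
  unfold merge4 at h
  dsimp only at h
  split_ifs at h <;>
    simp only [Option.getD_none, Option.getD_some, List.mem_cons, List.not_mem_nil, or_false] at h <;> tauto

theorem mem_merge5 {δ : ℝ} (h : G ∈ (M.merge5 δ K w u).getD []) :
    G = K.shift u ∨ G = K.shift (-u) := by
  unfold merge5 at h
  dsimp only at h
  split_ifs at h <;>
    simp only [Option.getD_none, Option.getD_some, List.mem_cons, List.not_mem_nil, or_false] at h <;> tauto

namespace Mergeable

variable (H : M.Mergeable C)

include H

variable {i : Fin 2} {r₁ r₂ : ℝ}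

omit H in
theorem twoNbrs_diag (hp : Perp u v) (h1 : K.shift u ∈ I) (h2 : K.shift v ∈ I) :
    TwoNbrs I (K.cell u v 1 1) := by
  refine ⟨-v, hp.neg_right.2.1, -u, hp.neg_left.1, hp.ne.2.2.2.2.2.symm, ?_, ?_⟩
  · rw [Cell.cell_shift_neg_right]; rwa [K.shift_left (v := v)] at h1
  · rw [Cell.cell_shift_neg_left]; rwa [K.shift_right (u := u)] at h2

/-- The first element is next to `K.shift u`; the only input of type 1 beside that one is `K`, whose
chain neighbours are all inputs. The second is next to `K`, which has an element of type 2 and a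
non-interface element beside it. The third sees no interface element but `K`. -/
theorem usable_p1_side (hK : K ∈ C) (hT : M.IsT1 K) (D : M.T1Data K u v i r₁ r₂)
    (h1 : M.IsT2 (K.shift u)) (hI : ∀ X, X ∈ I ↔ X = K.shift u ∨ X = K ∨ X = K.shift v) :
    M.Usable C I (K.cell u v 1 (-1)) ∧ M.Usable C I (K.cell u v 0 (-1)) ∧
      M.Usable C I (K.cell u v (-1) (-1)) := by
  have hp := D.perp
  obtain ⟨c1, c2, c3⟩ := H.chainNbr_of_T1 hK D hT
  obtain ⟨-, -, n3, n4⟩ := H.shift_of_T1 hK D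
  obtain ⟨n5, n6⟩ := H.not_isInterface_opposite_corner hK D h1 c1.mem_right
  refine ⟨⟨H.shift_mem_T hK hp (by norm_num) (by norm_num), n5, Or.inr (Or.inr (Or.inr ?_))⟩,
    ⟨H.shift_mem_T hK hp (by norm_num) (by norm_num), ?_, Or.inr (Or.inr (Or.inr ?_))⟩,
    ⟨H.shift_mem_T hK hp (by norm_num) (by norm_num), n6, Or.inl ?_⟩⟩
  · have : K.cell u v 1 (-1) = (K.shift u).shift (-v) := by
      rw [K.shift_left (v := v), Cell.cell_shift_neg_right]; rfl
    rw [this]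
    refine sideUse_of hp.neg_right.symm ((hI _).2 (by simp)) (fun _ hm => ?_) fun _ _ Y hY => ?_
    · exfalso
      rw [hI, K.shift_left (v := v), K.shift_right (u := u), Cell.cell_shift_left,
        K.cell_inj hp, K.cell_inj hp] at hm
      rcases hm with h | h | h
      · omega
      · rw [← K.cell_zero, Cell.cell_cell, K.cell_inj hp] at h; omega
      · omega
    · rw [Cell.shift_shift_neg] at hY
      rw [hI]
      rcases c3 Y hY with rfl | rfl <;> simp
  · rwa [← K.shift_neg_right (u := u)]
  · rw [← K.shift_neg_right (u := u)]
    exact sideUse_of hp.neg_right.symm ((hI _).2 (by simp)) (fun h _ => absurd h1 h.not_isT2)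
      fun h _ => absurd h.1 n3
  · have := H.surrounded_of_diag (I := I) hK hp.neg_left.neg_right ((hI _).2 (by simp))
      (by rwa [← K.shift_left]) (by rwa [← K.shift_right])
      (by rwa [Cell.cell_neg_right, Cell.cell_neg])
    rwa [Cell.cell_neg_right, Cell.cell_neg] at this

/-- The first element is behind `K.shift u`, beside which there are no inputs in the perpendicular
directions; the second touches it diagonally and touches no other interface element. -/
theorem usable_p2_side (hK : K ∈ C) (hT : M.IsT1 K) (D : M.T1Data K u v i r₁ r₂)
    (h1 : M.IsT1 (K.shift u)) (h2 : M.IsT1 (K.shift v))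
    (hI : ∀ X, X ∈ I ↔ X = K.shift u ∨ X = K ∨ X = K.shift v) :
    M.Usable C I (K.cell u v 2 0) ∧ M.Usable C I (K.cell u v 2 1) := by
  have hp := D.perp
  have hring := H.not_isInterface_ring_of_three hK hT D h1 h2
  obtain ⟨c1, c2, c3⟩ := H.chainNbr_of_T1 hK D hT
  have n20 : ¬ M.IsInterface (K.cell u v 2 0) := fun h => by
    have := hring 2 0 (by norm_num) (by norm_num) (by norm_num) (by norm_num) h; omega
  have n21 : ¬ M.IsInterface (K.cell u v 2 1) := fun h => by
    have := hring 2 1 (by norm_num) (by norm_num) (by norm_num) (by norm_num) h; omega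
  have n11 : ¬ M.IsInterface (K.cell u v 1 1) := fun h => by
    have := hring 1 1 (by norm_num) (by norm_num) (by norm_num) (by norm_num) h; omega
  refine ⟨⟨H.shift_mem_T hK hp (by norm_num) (by norm_num), n20, Or.inr (Or.inr (Or.inr ?_))⟩,
    ⟨H.shift_mem_T hK hp (by norm_num) (by norm_num), n21, Or.inl ?_⟩⟩
  · have : K.cell u v 2 0 = (K.shift u).shift u := by
      rw [K.shift_left (v := v), Cell.cell_shift_left]; rfl
    rw [this]
    have key : ∀ b : ℤ, b = 1 ∨ b = -1 → K.cell u v 1 b ∉ I := by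
      intro b hb hm
      rw [hI, K.shift_left (v := v), K.shift_right (u := u), K.cell_inj hp, K.cell_inj hp] at hm
      rcases hm with h | h | h
      · omega
      · rw [← K.cell_zero, Cell.cell_cell, K.cell_inj hp] at h; omega
      · omega
    refine sideUse_of hp ((hI _).2 (by simp)) (fun _ hm => ?_) fun _ hm => ?_
    · rw [K.shift_left (v := v), Cell.cell_shift_right] at hm
      exact absurd hm (key _ (by norm_num))
    · rw [K.shift_left (v := v), Cell.cell_shift_neg_right] at hm
      exact absurd hm (key _ (by norm_num))
  · have := H.surrounded_of_diag (I := I) c1.mem_right hp ((hI _).2 (by simp))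
      (by rw [K.shift_left (v := v), Cell.cell_cell]; exact n20)
      (by rw [K.shift_left (v := v), Cell.cell_cell]; exact n11)
      (by rw [K.shift_left (v := v), Cell.cell_cell]; exact n21)
    rw [K.shift_left (v := v), Cell.cell_cell] at this
    exact this

/-- The element behind an element of type 1, as used in the patterns 3 and 4. -/
theorem usable_behind (hL : L ∈ C) (D : M.T1Data L u v i r₁ r₂) (hI : L ∈ I)
    (h1 : L.shift v ∉ I) (h2 : L.shift (-v) ∉ I) : M.Usable C I (L.shift (-u)) := by
  have hp := D.perp
  refine ⟨?_, (H.shift_of_T1 hL D).2.2.1, Or.inr (Or.inr (Or.inr ?_))⟩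
  · rw [L.shift_neg_left (v := v)]
    exact H.shift_mem_T hL hp (by norm_num) (by norm_num)
  · exact sideUse_of hp.neg_left hI (fun _ h => absurd h h1) fun _ h => absurd h h2

theorem usable_of_pattern {δ : ℝ} {E : Option (List Cell)} (h : M.Pattern δ C I E) :
    ∀ G ∈ E.getD [], M.Usable C I G := by
  intro G hG
  cases h with
  | @p1 K u v i r₁ r₂ hK hT D h1 h2 =>
    have hp := D.perp
    have k1 := H.usable_p1_side (I := [K.shift u, K, K.shift v]) hK hT D h1 (by simp)
    have k2 := H.usable_p1_side (I := [K.shift u, K, K.shift v]) hK hT D.symm h2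
      (by simp; tauto)
    simp only [K.cell_comm] at k2
    rcases mem_merge1 hG with rfl | (rfl | rfl | rfl) | (rfl | rfl)
    · refine ⟨H.shift_mem_T hK hp (by norm_num) (by norm_num), ?_,
        Or.inr (Or.inr (Or.inl (twoNbrs_diag hp (by simp) (by simp))))⟩
      rw [← K.shift_uv]
      exact H.not_isInterface_diag hK hT D
    exacts [k1.1, k1.2.1, k1.2.2, by simpa only [K.cell_comm] using k2.1,
      by simpa only [K.cell_comm] using k2.2.1]
  | @p2 K u v i r₁ r₂ hK hT D h1 h2 =>
    have hp := D.perp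
    have k1 := H.usable_p2_side (I := [K.shift u, K, K.shift v]) hK hT D h1 h2 (by simp)
    have k2 := H.usable_p2_side (I := [K.shift u, K, K.shift v]) hK hT D.symm h2 h1
      (by simp; tauto)
    have hring := H.not_isInterface_ring_of_three hK hT D h1 h2
    rcases mem_merge2 hG with rfl | (rfl | rfl | rfl) | (rfl | rfl)
    · refine ⟨H.shift_mem_T hK hp (by norm_num) (by norm_num), ?_,
        Or.inr (Or.inr (Or.inl (twoNbrs_diag hp (by simp) (by simp))))⟩
      rw [← K.shift_uv]
      exact H.not_isInterface_diag hK hT D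
    · exact k1.1
    · exact k1.2
    · refine ⟨H.shift_mem_T hK hp (by norm_num) (by norm_num), fun h => ?_,
        Or.inr (Or.inl (H.surrounded_two hK hT D h1 h2))⟩
      have := hring 2 2 (by norm_num) (by norm_num) (by norm_num) (by norm_num) h; omega
    · rw [← K.cell_comm]; exact k2.2
    · rw [← K.cell_comm]; exact k2.1
  | @p3 K u w i r₁ r₂ hK hT D h1 =>
    have hp := D.perp
    obtain ⟨c1, -⟩ := H.chainNbr_of_T1 hK D hT
    obtain ⟨_, _, _, D1⟩ := H.T1Data_next hK hT D h1
    have key : ∀ X a b, X = K.cell u w a b → b = 1 ∨ b = -1 → X ∉ [K, K.shift u] := by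
      rintro X a b rfl hb hm
      simp only [List.mem_cons, List.not_mem_nil, or_false] at hm
      rcases hm with h | h
      · nth_rw 2 [← K.cell_zero (u := u) (v := w)] at h
        rw [K.cell_inj hp] at h; omega
      · rw [K.shift_left (v := w), K.cell_inj hp] at h; omega
    rcases mem_merge3 hG with rfl | rfl
    · rw [← K.shift_u_u]
      have := H.usable_behind (I := [K, K.shift u]) c1.mem_right D1 (by simp)
        (key _ _ _ (K.shift_u_neg_v u w) (Or.inr rfl))
        (key _ _ _ (by rw [neg_neg]; exact K.shift_u_v u w) (Or.inl rfl))
      rwa [neg_neg] at this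
    · rw [← K.shift_neg_left]
      exact H.usable_behind (I := [K, K.shift u]) hK D (by simp)
        (key _ _ _ K.shift_right (Or.inl rfl)) (key _ _ _ K.shift_neg_right (Or.inr rfl))
  | @p4 K u w₁ w₂ i r₁ r₂ j s₁ s₂ hK hT m1 m2 h1 h2 D1 D2 =>
    have hp := D1.perp
    have hp2 : Perp u w₂ := by simpa using D2.perp.neg_left
    have key : ∀ w, Perp u w → ∀ X a b, X = K.cell u w a b → b = 1 ∨ b = -1 →
        X ∉ [K.shift (-u), K, K.shift u] := by
      rintro w hp X a b rfl hb hm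
      simp only [List.mem_cons, List.not_mem_nil, or_false] at hm
      rcases hm with h | h | h
      · rw [K.shift_neg_left (v := w), K.cell_inj hp] at h; omega
      · nth_rw 2 [← K.cell_zero (u := u) (v := w)] at h
        rw [K.cell_inj hp] at h; omega
      · rw [K.shift_left (v := w), K.cell_inj hp] at h; omega
    rcases mem_merge4 hG with rfl | rfl
    · rw [← K.shift_u_u]
      have := H.usable_behind (I := [K.shift (-u), K, K.shift u]) m2 D2 (by simp)
        (key _ hp2 _ _ _ (K.shift_u_v u w₂) (Or.inl rfl))
        (key _ hp2 _ _ _ (K.shift_u_neg_v u w₂) (Or.inr rfl))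
      rwa [neg_neg] at this
    · rw [← K.shift_neg_u_neg_u]
      exact H.usable_behind (I := [K.shift (-u), K, K.shift u]) m1 D1 (by simp)
        (key _ hp _ _ _ (K.shift_neg_u_v u w₁) (Or.inl rfl))
        (key _ hp _ _ _ (K.shift_neg_u_neg_v u w₁) (Or.inr rfl))
  | @p5 K w u hK hp hT =>
    have hn : ∀ d ∈ dirs, K.shift d ∉ [K] := fun d hd h => shift_ne hd (by simpa using h)
    have key : ∀ u, Perp w u → M.Usable C [K] (K.shift u) := by
      intro u hp
      refine ⟨?_, H.not_isInterface_of_isT2Along hK hT hp, Or.inr (Or.inr (Or.inr ?_))⟩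
      · rw [K.shift_right (u := w)]
        exact H.shift_mem_T hK hp (by norm_num) (by norm_num)
      · exact sideUse_of hp.symm (by simp) (fun _ h => absurd h (hn _ hp.1))
          fun _ h => absurd h (hn _ hp.neg_left.1)
    rcases mem_merge5 hG with rfl | rfl
    · exact key _ hp
    · exact key _ hp.neg_right

/-- The call that treats an element of type 1 of the chain treats one of its neighbours, too. -/
theorem exists_chainNbr_of_pattern {δ : ℝ} {E : Option (List Cell)} (h : M.Pattern δ C I E)
    {Z : Cell} (hZ : Z ∈ I) (hT : M.IsT1 Z) : ∃ L ∈ I, ChainNbr C Z L := by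
  cases h with
  | @p1 K u v i r₁ r₂ hK hT' D h1 h2 =>
    obtain ⟨c1, c2, -⟩ := H.chainNbr_of_T1 hK D hT'
    simp only [List.mem_cons, List.not_mem_nil, or_false] at hZ
    rcases hZ with rfl | rfl | rfl
    exacts [⟨K, by simp, c1.symm⟩, ⟨_, by simp, c1⟩, ⟨K, by simp, c2.symm⟩]
  | @p2 K u v i r₁ r₂ hK hT' D h1 h2 =>
    obtain ⟨c1, c2, -⟩ := H.chainNbr_of_T1 hK D hT'
    simp only [List.mem_cons, List.not_mem_nil, or_false] at hZ
    rcases hZ with rfl | rfl | rfl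
    exacts [⟨K, by simp, c1.symm⟩, ⟨_, by simp, c1⟩, ⟨K, by simp, c2.symm⟩]
  | @p3 K u w i r₁ r₂ hK hT' D h1 =>
    obtain ⟨c1, -⟩ := H.chainNbr_of_T1 hK D hT'
    simp only [List.mem_cons, List.not_mem_nil, or_false] at hZ
    rcases hZ with rfl | rfl
    exacts [⟨_, by simp, c1⟩, ⟨K, by simp, c1.symm⟩]
  | @p4 K u w₁ w₂ i r₁ r₂ j s₁ s₂ hK hT' m1 m2 h1 h2 D1 D2 =>
    have c1 := (H.chainNbr_of_T1 m1 D1 h1).1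
    rw [Cell.shift_neg_shift] at c1
    have c2 := (H.chainNbr_of_T1 m2 D2 h2).1
    rw [Cell.shift_shift_neg] at c2
    simp only [List.mem_cons, List.not_mem_nil, or_false] at hZ
    rcases hZ with rfl | rfl | rfl
    exacts [⟨K, by simp, c1⟩, ⟨_, by simp, c1.symm⟩, ⟨K, by simp, c2⟩]
  | @p5 K w u hK hp hT' =>
    simp only [List.mem_singleton] at hZ
    subst hZ
    exact absurd ⟨w, hT'⟩ hT.not_isT2

theorem mem_of_pattern {δ : ℝ} {E : Option (List Cell)} (h : M.Pattern δ C I E) :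
    I ≠ [] ∧ ∀ K ∈ I, K ∈ C := by
  cases h with
  | @p1 K u v i r₁ r₂ hK hT' D h1 h2 =>
    obtain ⟨c1, c2, -⟩ := H.chainNbr_of_T1 hK D hT'
    exact ⟨by simp, by simp [hK, c1.mem_right, c2.mem_right]⟩
  | @p2 K u v i r₁ r₂ hK hT' D h1 h2 =>
    obtain ⟨c1, c2, -⟩ := H.chainNbr_of_T1 hK D hT'
    exact ⟨by simp, by simp [hK, c1.mem_right, c2.mem_right]⟩
  | @p3 K u w i r₁ r₂ hK hT' D h1 =>
    obtain ⟨c1, -⟩ := H.chainNbr_of_T1 hK D hT'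
    exact ⟨by simp, by simp [hK, c1.mem_right]⟩
  | @p4 K u w₁ w₂ i r₁ r₂ j s₁ s₂ hK hT' m1 m2 h1 h2 D1 D2 =>
    exact ⟨by simp, by simp [hK, m1, m2]⟩
  | @p5 K w u hK hp hT' => exact ⟨by simp, by simp [hK]⟩

/-- No element is used by two calls with disjoint inputs, if all elements of type 1 are treated. -/
theorem not_usable_twice {σ : List Call} {δ : ℝ} {I I' : List Cell}
    (hσ : ∀ c ∈ σ, M.Pattern δ C c.inputs c.result)
    (hall : ∀ K ∈ C, M.IsT1 K → ∃ c ∈ σ, K ∈ c.inputs)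
    (hI : ∀ K ∈ I, K ∈ C) (hI' : ∀ K ∈ I', K ∈ C)
    (hdis : ∀ c ∈ σ, ∀ K ∈ c.inputs, (K ∈ I → ∀ X ∈ c.inputs, X ∈ I) ∧
      (K ∈ I' → ∀ X ∈ c.inputs, X ∈ I'))
    (hII' : ∀ K ∈ I, K ∉ I') (h : M.Usable C I G) (h' : M.Usable C I' G) : False := by
  obtain ⟨hG, hGn, h⟩ := h
  obtain ⟨-, -, h'⟩ := h'
  have layer_succ : ∀ X, X ∈ M.layer G 1 → X ∈ M.layer G 2 := fun X hX =>
    ⟨hX.1, X, hX, by obtain ⟨q, hq⟩ := X.toSet_nonempty; exact ⟨q, X.toSet_subset_closed hq, X.toSet_subset_closed hq⟩⟩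
  have nbr_layer : ∀ d ∈ dirs, G.shift d ∈ C → G.shift d ∈ M.layer G 1 := by
    intro d hd hm
    refine ⟨(H.isInterface hm).1, G, rfl, ?_⟩
    have hp := Perp.of_rot hd
    have h1 : G.uv d (rot d) 1 0 ∈ G.side d := (G.uv_mem_side hp).2 (by norm_num)
    exact ⟨_, (G.shift d).side_subset_closed (neg_mem_dirs hd) ((G.side_shift hd).symm ▸ h1),
      G.side_subset_closed hd h1⟩
  -- each use has an input in the second layer, and in the first one unless it is surrounded there
  have side : ∀ J, (∀ K ∈ J, K ∈ C) → (TwoNbrs J G ∨ M.SideUse C J G) →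
      ∃ X ∈ J, X ∈ M.layer G 1 ∧ M.IsInterface X := by
    rintro J hJ (⟨d, hd, -, -, -, hm, -⟩ | ⟨d, hd, hm, -⟩) <;>
      exact ⟨_, hm, nbr_layer d hd (hJ _ hm), H.isInterface (hJ _ hm)⟩
  have two : ∀ J, (∀ K ∈ J, K ∈ C) → (M.Surrounded J G 1 ∨ M.Surrounded J G 2 ∨ TwoNbrs J G ∨
      M.SideUse C J G) → ∃ X ∈ J, X ∈ M.layer G 2 ∧ M.IsInterface X := by
    rintro J hJ (⟨⟨X, h1, h2, h3⟩, -⟩ | ⟨h, -⟩ | h)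
    · exact ⟨X, h1, layer_succ X h2, h3⟩
    · exact h
    · obtain ⟨X, h1, h2, h3⟩ := side J hJ h
      exact ⟨X, h1, layer_succ X h2, h3⟩
  -- Every use has an input among the interface elements of the second layer. If the other call owns
  -- all of these, the inputs are not disjoint; a use surrounded in the first layer is compared in
  -- the layer where both statements apply.
  have excl : ∀ J J', (∀ K ∈ J, K ∈ C) → (∀ K ∈ J', K ∈ C) → (∀ K ∈ J, K ∉ J') →
      (M.Surrounded J G 1 ∨ M.Surrounded J G 2) → (M.Surrounded J' G 1 ∨ M.Surrounded J' G 2 ∨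
        TwoNbrs J' G ∨ M.SideUse C J' G) → False := by
    rintro J J' hJ hJ' hJJ (h | h) h'
    · rcases h' with h' | h' | h'
      · obtain ⟨X, h1, h2, h3⟩ := h'.1
        exact hJJ X (h.2 X h2 h3) h1
      · obtain ⟨X, h1, h2, h3⟩ := h.1
        exact hJJ X h1 (h'.2 X (layer_succ X h2) h3)
      · obtain ⟨X, h1, h2, h3⟩ := side J' hJ' h'
        exact hJJ X (h.2 X h2 h3) h1
    · obtain ⟨X, h1, h2, h3⟩ := two J' hJ' h'
      exact hJJ X (h.2 X h2 h3) h1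
  have h1 : TwoNbrs I G ∨ M.SideUse C I G := by
    by_contra hcon
    exact excl I I' hI hI' hII' (by tauto) h'
  have h1' : TwoNbrs I' G ∨ M.SideUse C I' G := by
    by_contra hcon
    exact excl I' I hI' hI (fun K h h' => hII' K h' h) (by tauto) h
  have ne : ∀ {d d'}, G.shift d ∈ I → G.shift d' ∈ I' → d ≠ d' := by
    rintro d d' h h' rfl
    exact hII' _ h h'
  have some1 : ∀ {J}, (TwoNbrs J G ∨ M.SideUse C J G) → ∃ d ∈ dirs, G.shift d ∈ J := by
    rintro J (⟨d, hd, -, -, -, hm, -⟩ | ⟨d, hd, hm, -⟩) <;> exact ⟨d, hd, hm⟩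
  -- Two inputs of one call and one of the other would be three chain neighbours, against Rule 3.
  have h2 : M.SideUse C I G := by
    refine h1.resolve_left fun ⟨d, hd, d', hd', hne, hm, hm'⟩ => ?_
    obtain ⟨f, hf, hmf⟩ := some1 h1'
    exact H.rule3 hG hGn hd hd' hf hne (ne hm hmf) (ne hm' hmf) (hI _ hm) (hI _ hm') (hI' _ hmf)
  have h2' : M.SideUse C I' G := by
    refine h1'.resolve_left fun ⟨d, hd, d', hd', hne, hm, hm'⟩ => ?_
    obtain ⟨f, hf, hmf⟩ := some1 h1
    exact H.rule3 hG hGn hf hd hd' (ne hmf hm) (ne hmf hm') hne (hI _ hmf) (hI' _ hm) (hI' _ hm')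
  obtain ⟨d, hd, hm, hs⟩ := h2
  obtain ⟨d', hd', hm', hs'⟩ := h2'
  have hopp : d' ≠ -d := by
    rintro rfl
    refine H.false_of_opposite (G := G) (Perp.of_rot hd) hGn ?_ ?_
    · rw [← G.shift_neg_left]; exact hI' _ hm'
    · rw [← G.shift_left]; exact hI _ hm
  have hpd : Perp d d' := by
    have hp := Perp.of_rot hd
    rcases (hp.mem_dirs_iff d').1 hd' with e | e | e | e
    · exact absurd e.symm (ne hm hm')
    · rw [e]; exact hp
    · exact absurd e hopp
    · rw [e]; exact hp.neg_right
  have e1 : G.cell (-d) (-d') (-1) 0 = G.shift d := by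
    rw [Cell.cell_neg_right, Cell.cell_neg]; exact (G.shift_left).symm
  have e2 : G.cell (-d) (-d') 0 (-1) = G.shift d' := by
    rw [Cell.cell_neg_right, Cell.cell_neg]; exact (G.shift_right).symm
  have e3 : G.cell (-d) (-d') (-1) (-1) = (G.shift d).shift d' := by
    rw [Cell.cell_neg_right, Cell.cell_neg, G.shift_left (v := d'), Cell.cell_shift_right]; rfl
  -- The two neighbours of `G` are perpendicular to each other. The frame is reversed so that
  -- `corner` yields the element between them.
  obtain ⟨hZ, hZT, i, r₁, r₂, D⟩ := H.corner hpd.neg_left.neg_right hGn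
    (by rw [e1]; exact hI _ hm) (by rw [e2]; exact hI' _ hm')
  rw [e3] at hZ hZT D
  have e4 : ((G.shift d).shift d').shift (-d) = G.shift d' := by
    rw [Cell.shift_shift_comm, Cell.shift_shift_comm (G.shift d), ← Cell.shift_shift_comm]
    rw [Cell.shift_shift_comm G d (-d), Cell.shift_neg_shift]
  have e5 : ((G.shift d).shift d').shift (-d') = G.shift d := Cell.shift_shift_neg _ _
  obtain ⟨c1, c2, c3⟩ := H.chainNbr_of_T1 hZ D hZT
  rw [e4] at c1 c3
  rw [e5] at c2 c3
  -- Were it an input of one call, `SideUse` would make its chain neighbour, an input of the other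
  -- call, an input of both.
  have nI : (G.shift d).shift d' ∉ I := fun h => hII' _ (hs d' hpd hZT h _ c1) hm'
  have nI' : (G.shift d).shift d' ∉ I' := fun h => by
    rw [Cell.shift_shift_comm] at h hZT c2
    exact hII' _ hm (hs' d hpd.symm hZT h _ c2)
  -- The call that treats the element in the corner contains one of its two chain neighbours, hence
  -- it is one of the two calls, contrary to what has just been shown.
  obtain ⟨c, hc, hZc⟩ := hall _ hZ hZT
  obtain ⟨Y, hY, hYn⟩ := H.exists_chainNbr_of_pattern (hσ c hc) hZc hZT
  rcases c3 Y hYn with rfl | rfl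
  · exact nI' ((hdis c hc _ hY).2 hm' _ hZc)
  · exact nI ((hdis c hc _ hY).1 hm _ hZc)

end Mergeable

end InterfaceMesh

end Merging

/-! ### The course of the algorithm. -/

namespace Merging

namespace InterfaceMesh

variable {M : InterfaceMesh} {K L Z : Cell} {u v : ℤ × ℤ} {C : List Cell} {σ : List Call}
  {c : Call} {δ : ℝ}

variable (M) in
/-- The list `I` is one of the groups into which a maximal subchain of elements of type 1 is
divided. -/
def IsGroup (C I : List Cell) : Prop := ∃ S, M.IsT1Run C S ∧ I ∈ groups S

theorem IsGroup.isT1 {I : List Cell} (h : M.IsGroup C I) (hK : K ∈ I) : M.IsT1 K := by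
  obtain ⟨S, hS, hI⟩ := h
  exact hS.2.2.1 K ((groups_spec S I hI).1.subset hK)

theorem IsGroup.isSubchain {I : List Cell} (h : M.IsGroup C I) : IsSubchain C I := by
  obtain ⟨S, hS, hI⟩ := h
  have := (groups_spec S I hI).1
  exact ⟨hS.1.1.sublist this.sublist, hS.1.2.infix this⟩

theorem IsGroup.two_le {I : List Cell} (h : M.IsGroup C I) : 2 ≤ I.length := by
  obtain ⟨S, hS, hI⟩ := h
  rcases (groups_spec S I hI).2 with ⟨a, b, rfl⟩ | ⟨a, b, c, rfl⟩ <;> simp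

theorem IsGroup.eq (hC : C.Nodup ∨ IsClosedList C) {I I' : List Cell} (h : M.IsGroup C I)
    (h' : M.IsGroup C I') (hK : K ∈ I) (hK' : K ∈ I') : I = I' := by
  obtain ⟨S, hS, hI⟩ := h
  obtain ⟨S', hS', hI'⟩ := h'
  obtain rfl := hS.eq hC hS' ((groups_spec S I hI).1.subset hK) ((groups_spec S' I' hI').1.subset hK')
  exact groups_eq S hS.1.1 I hI I' hI' K hK hK'

/-- Each element of a subchain of at least two elements has a neighbour in the subchain. -/
theorem _root_.Merging.IsSubchain.exists_chainNbr {I : List Cell} (h : IsSubchain C I)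
    (h2 : 2 ≤ I.length) (hK : K ∈ I) : ∃ L ∈ I, ChainNbr C K L := by
  obtain ⟨i, hi, rfl⟩ := List.getElem_of_mem hK
  by_cases h1 : i + 1 < I.length
  · exact ⟨I[i + 1], List.getElem_mem _,
      Or.inl (h.consecutive (List.getElem?_eq_getElem hi) (List.getElem?_eq_getElem h1))⟩
  · have h3 : i - 1 + 1 = i := Nat.sub_add_cancel (by omega)
    exact ⟨I[i - 1], List.getElem_mem _,
      Or.inr (h.consecutive (i := i - 1) (List.getElem?_eq_getElem (by omega))
        (by rw [h3]; exact List.getElem?_eq_getElem hi))⟩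

namespace Mergeable

variable (H : M.Mergeable C)

include H

theorem pattern_of_alg1 {N₁ N₂ : Cell} {E : Option (List Cell)} (h₁ : N₁ ∈ C) (hK : K ∈ C)
    (h₂ : N₂ ∈ C) (h : M.Alg1 δ N₁ K N₂ E) : M.Pattern δ C [N₁, K, N₂] E := by
  obtain ⟨t1, t, t2, u, v, hp, rfl, rfl, rfl⟩ := h
  obtain ⟨-, _, _, _, D⟩ := H.turn hK hp (H.isInterface h₁) (H.isInterface h₂)
  exact .p1 hK t D t1 t2

theorem pattern_of_alg2 {N₁ N₂ : Cell} {E : Option (List Cell)} (h₁ : N₁ ∈ C) (hK : K ∈ C)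
    (h₂ : N₂ ∈ C) (h : M.Alg2 δ N₁ K N₂ E) : M.Pattern δ C [N₁, K, N₂] E := by
  obtain ⟨t1, t, t2, u, v, hp, rfl, rfl, -, -, rfl⟩ := h
  obtain ⟨-, _, _, _, D⟩ := H.turn hK hp (H.isInterface h₁) (H.isInterface h₂)
  exact .p2 hK t D t1 t2

theorem pattern_of_alg3 {N : Cell} {E : Option (List Cell)} (hK : K ∈ C) (hN : N ∈ C)
    (h : M.Alg3 δ K N E) : M.Pattern δ C [K, N] E := by
  obtain ⟨t, t', u, w, w', hp, hp', rfl, hw, hw', rfl⟩ := h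
  obtain ⟨-, _, _, _, D⟩ := H.turn hK hp (H.isInterface hN) (H.shift_of_crosses hK hp.2.1 hw)
  obtain ⟨_, _, _, D'⟩ := H.T1Data_next hK t D t'
  -- The interface bends back in `N`, which forces `w' = -w`: the two elements are left through
  -- opposite sides.
  rcases D'.eq_of_meets hp'.2.1 (meets_of_crosses hw') with rfl | rfl
  · exact absurd rfl hp'.ne.2.2.1
  · exact .p3 hK t D t'

theorem pattern_of_alg4 {N₁ N₂ : Cell} {E : Option (List Cell)} (h₁ : N₁ ∈ C) (hK : K ∈ C)
    (h₂ : N₂ ∈ C) (h : M.Alg4 δ N₁ K N₂ E) : M.Pattern δ C [N₁, K, N₂] E := by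
  obtain ⟨t1, t, t2, u, w₁, w₂, hp, hp', rfl, rfl, hw₁, hw₂, rfl⟩ := h
  obtain ⟨-, _, _, _, D₁⟩ := H.turn h₁ hp (by rw [Cell.shift_neg_shift]; exact H.isInterface hK)
    (H.shift_of_crosses h₁ hp.2.1 hw₁)
  obtain ⟨-, _, _, _, D₂⟩ := H.turn h₂ hp'.neg_left
    (by rw [Cell.shift_shift_neg]; exact H.isInterface hK) (H.shift_of_crosses h₂ hp'.2.1 hw₂)
  exact .p4 hK t h₁ h₂ t1 t2 D₁ D₂

omit H in
theorem available_cases {k : ℕ} (h : M.Available δ C σ c k) :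
    k = 1 ∧ M.IsGroup C c.inputs ∧ ((∃ N₁ K N₂, c.inputs = [N₁, K, N₂] ∧ M.Alg2 δ N₁ K N₂ c.result) ∨
       (∃ K N, c.inputs = [K, N] ∧ M.Alg3 δ K N c.result)) ∨
    k = 2 ∧ IsSubchain C c.inputs ∧
      (∃ N₁ K N₂, c.inputs = [N₁, K, N₂] ∧ M.Alg4 δ N₁ K N₂ c.result) ∨
    k = 3 ∧ IsSubchain C c.inputs ∧
      (∃ N₁ K N₂, c.inputs = [N₁, K, N₂] ∧ M.Alg1 δ N₁ K N₂ c.result) ∨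
    k = 4 ∧ (∃ K ∈ C, c.inputs = [K] ∧ M.Alg5 δ K c.result) := by
  match k, h with
  | 1, h => exact Or.inl ⟨rfl, h.2⟩
  | 2, h => exact Or.inr (Or.inl ⟨rfl, h.2⟩)
  | 3, h => exact Or.inr (Or.inr (Or.inl ⟨rfl, h.2⟩))
  | 4, h => exact Or.inr (Or.inr (Or.inr ⟨rfl, h.2⟩))

omit H in
theorem remaining_of_available {k : ℕ} (h : M.Available δ C σ c k) :
    ∀ K ∈ c.inputs, Remaining σ K := by
  match k, h with
  | 1, h => exact h.1
  | 2, h => exact h.1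
  | 3, h => exact h.1
  | 4, h => exact h.1

theorem pattern_of_available {k : ℕ} (hav : M.Available δ C σ c k) :
    M.Pattern δ C c.inputs c.result := by
  obtain ⟨I, E⟩ := c
  dsimp only
  rcases available_cases hav with ⟨-, hg, h⟩ | ⟨-, hs, N₁, K, N₂, e, h⟩ | ⟨-, hs, N₁, K, N₂, e, h⟩ |
    ⟨-, K, hK, e, w, u, hp, hT, e'⟩
  · have hm : ∀ K ∈ I, K ∈ C := fun K hK => hg.isSubchain.mem hg.two_le hK
    rcases h with ⟨N₁, K, N₂, e, h⟩ | ⟨K, N, e, h⟩ <;> dsimp only at e h <;> subst e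
    · exact H.pattern_of_alg2 (hm _ (by simp)) (hm _ (by simp)) (hm _ (by simp)) h
    · exact H.pattern_of_alg3 (hm _ (by simp)) (hm _ (by simp)) h
  · dsimp only at e h hs
    subst e
    have hm := fun K hK => hs.mem (by simp) (K := K) hK
    exact H.pattern_of_alg4 (hm _ (by simp)) (hm _ (by simp)) (hm _ (by simp)) h
  · dsimp only at e h hs
    subst e
    have hm := fun K hK => hs.mem (by simp) (K := K) hK
    exact H.pattern_of_alg1 (hm _ (by simp)) (hm _ (by simp)) (hm _ (by simp)) h
  · dsimp only at e e'
    subst e e'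
    exact .p5 hK hp hT

/-- The two neighbours of an element of type 1. -/
theorem T1Data_of_chainNbr (hT : M.IsT1 K) {N₁ N₂ : Cell} (h₁ : ChainNbr C K N₁)
    (h₂ : ChainNbr C K N₂) (hne : N₁ ≠ N₂) : ∃ u v i r₁ r₂, M.T1Data K u v i r₁ r₂ ∧
      N₁ = K.shift u ∧ N₂ = K.shift v := by
  obtain ⟨u, v, i, r₁, r₂, D⟩ := hT.data
  obtain ⟨-, -, h⟩ := H.chainNbr_of_T1 h₁.mem_left D hT
  rcases h _ h₁ with rfl | rfl <;> rcases h _ h₂ with rfl | rfl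
  · exact absurd rfl hne
  · exact ⟨_, _, _, _, _, D, rfl, rfl⟩
  · exact ⟨_, _, _, _, _, D.symm, rfl, rfl⟩
  · exact absurd rfl hne

theorem exists_alg3 {N : Cell} (hT : M.IsT1 K) (hT' : M.IsT1 N) (h : ChainNbr C K N) :
    ∃ E, M.Alg3 δ K N E := by
  obtain ⟨X, Y, hXY, hX, hY⟩ := (H.isInner_of_T1 h.mem_left hT).exists_ne H.dup
  obtain ⟨Y, hY, hne⟩ : ∃ Y, ChainNbr C K Y ∧ N ≠ Y := by
    by_cases e : N = X
    · exact ⟨Y, hY, e ▸ hXY⟩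
    · exact ⟨X, hX, e⟩
  obtain ⟨u, w, i, r₁, r₂, D, rfl, -⟩ := H.T1Data_of_chainNbr hT h hY hne
  obtain ⟨_, _, _, D'⟩ := H.T1Data_next h.mem_left hT D hT'
  exact ⟨_, hT, hT', u, w, -w, D.perp, D.perp.neg_right, rfl, D.crosses₂, D'.crosses₂, rfl⟩

theorem exists_alg2 {N₁ N₂ : Cell} (hT : M.IsT1 K) (t1 : M.IsT1 N₁) (t2 : M.IsT1 N₂)
    (h₁ : ChainNbr C K N₁) (h₂ : ChainNbr C K N₂) (hne : N₁ ≠ N₂) :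
    ∃ E, M.Alg2 δ N₁ K N₂ E := by
  obtain ⟨u, v, i, r₁, r₂, D, rfl, rfl⟩ := H.T1Data_of_chainNbr hT h₁ h₂ hne
  obtain ⟨_, _, _, D'⟩ := H.T1Data_next h₁.mem_left hT D t1
  obtain ⟨_, _, _, D''⟩ := H.T1Data_next h₁.mem_left hT D.symm t2
  exact ⟨_, t1, hT, t2, u, v, D.perp, rfl, rfl, D'.crosses₂, D''.crosses₂, rfl⟩

theorem exists_alg1 {N₁ N₂ : Cell} (hT : M.IsT1 K) (t1 : M.IsT2 N₁) (t2 : M.IsT2 N₂)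
    (h₁ : ChainNbr C K N₁) (h₂ : ChainNbr C K N₂) (hne : N₁ ≠ N₂) :
    ∃ E, M.Alg1 δ N₁ K N₂ E := by
  obtain ⟨u, v, i, r₁, r₂, D, rfl, rfl⟩ := H.T1Data_of_chainNbr hT h₁ h₂ hne
  exact ⟨_, t1, hT, t2, u, v, D.perp, rfl, rfl, rfl⟩

theorem T1Data_of_chainNbr_left (hT : M.IsT1 K) {N : Cell} (h : ChainNbr C K N) :
    ∃ u v i r₁ r₂, M.T1Data K u v i r₁ r₂ ∧ N = K.shift u := by
  obtain ⟨u, v, i, r₁, r₂, D⟩ := hT.data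
  rcases (H.chainNbr_of_T1 h.mem_left D hT).2.2 _ h with rfl | rfl
  · exact ⟨_, _, _, _, _, D, rfl⟩
  · exact ⟨_, _, _, _, _, D.symm, rfl⟩

/-- An element of type 1 is left through inner points of its sides, and an element of type 3 is met
by `Γ` only in vertices of its boundary. -/
theorem isT2_of_chainNbr (hT : M.IsT1 K) {N : Cell} (h : ChainNbr C K N) (hN : ¬ M.IsT1 N) :
    M.IsT2 N := by
  obtain ⟨u, v, i, r₁, r₂, D, rfl⟩ := H.T1Data_of_chainNbr_left hT h
  rcases (H.isInterface h.mem_right).type with h' | h' | h'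
  · exact absurd h' hN
  · exact h'
  · refine absurd ?_ (h'.not_crosses D.perp.neg_left.1)
    rw [K.openSide_shift D.perp.1]
    exact D.crosses₁

theorem exists_alg4 {N₁ N₂ : Cell} (hT : M.IsT2 K) (t1 : M.IsT1 N₁) (t2 : M.IsT1 N₂)
    (h₁ : ChainNbr C N₁ K) (h₂ : ChainNbr C N₂ K) (hne : N₁ ≠ N₂) :
    ∃ E, M.Alg4 δ N₁ K N₂ E := by
  obtain ⟨a, w₁, _, _, _, D₁, e₁⟩ := H.T1Data_of_chainNbr_left t1 h₁
  obtain ⟨b, w₂, _, _, _, D₂, e₂⟩ := H.T1Data_of_chainNbr_left t2 h₂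
  have e₁' : N₁ = K.shift (-a) := by rw [e₁, Cell.shift_shift_neg]
  have e₂' : N₂ = K.shift (-b) := by rw [e₂, Cell.shift_shift_neg]
  have hi₁ := e₁' ▸ H.isInterface h₁.mem_left
  have hi₂ := e₂' ▸ H.isInterface h₂.mem_left
  have hK := h₁.mem_right
  -- An element of type 2 has no interface neighbours in two perpendicular directions, so the two
  -- elements of type 1 are opposite to each other.
  have hb : b = -a := by
    rcases (D₁.perp.mem_dirs_iff b).1 D₂.perp.1 with e | e | e | e
    · exact absurd (by rw [e₁', e₂', e]) hne
    · exact absurd hi₂ (H.not_isInterface_perp_of_T2 hK hT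
        (by rw [e]; exact D₁.perp.neg_left.neg_right) hi₁)
    · exact e
    · exact absurd hi₂ (H.not_isInterface_perp_of_T2 hK hT
        (by rw [e, neg_neg]; exact D₁.perp.neg_left) hi₁)
  subst hb
  rw [neg_neg] at e₂'
  exact ⟨_, t1, hT, t2, a, w₁, w₂, D₁.perp, by simpa using D₂.perp.neg_left, e₁', e₂',
    D₁.crosses₂, D₂.crosses₂, rfl⟩

theorem exists_available_two {N₁ N₂ : Cell} (hT : M.IsT2 K) (t1 : M.IsT1 N₁) (t2 : M.IsT1 N₂)
    (h₁ : Consecutive C N₁ K) (h₂ : Consecutive C K N₂) (r : Remaining σ K) (r₁ : Remaining σ N₁)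
    (r₂ : Remaining σ N₂) : ∃ c, M.Available δ C σ c 2 := by
  obtain ⟨E, hE⟩ := H.exists_alg4 (δ := δ) hT t1 t2 (Or.inl h₁) (Or.inr h₂)
    (h₁.ne_of_consecutive H.dup h₂)
  exact ⟨⟨[N₁, K, N₂], E⟩, by simp [r, r₁, r₂], isSubchain_triple H.dup h₁ h₂, N₁, K, N₂, rfl, hE⟩

theorem exists_available_three (hT : M.IsT1 K) (hK : K ∈ C)
    (t : ∀ N, ChainNbr C K N → ¬ M.IsT1 N) (r : Remaining σ K)
    (rN : ∀ N, ChainNbr C K N → Remaining σ N) : ∃ c, M.Available δ C σ c 3 := by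
  obtain ⟨N₁, N₂, h₁, h₂⟩ := H.isInner_of_T1 hK hT
  obtain ⟨E, hE⟩ := H.exists_alg1 (δ := δ) hT
    (H.isT2_of_chainNbr hT (Or.inr h₁) (t _ (Or.inr h₁)))
    (H.isT2_of_chainNbr hT (Or.inl h₂) (t _ (Or.inl h₂))) (Or.inr h₁) (Or.inl h₂)
    (h₁.ne_of_consecutive H.dup h₂)
  exact ⟨⟨[N₁, K, N₂], E⟩, by simp [r, rN _ (Or.inr h₁), rN _ (Or.inl h₂)],
    isSubchain_triple H.dup h₁ h₂, N₁, K, N₂, rfl, hE⟩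

omit H in
theorem exists_available_four (hT : M.IsT2 K) (hK : K ∈ C) (r : Remaining σ K) :
    ∃ c, M.Available δ C σ c 4 := by
  obtain ⟨w, hw⟩ := hT
  exact ⟨⟨[K], M.merge5 δ K w (rot w)⟩, by simp [r], K, hK, rfl, w, rot w, Perp.of_rot hw.2.1, hw,
    rfl⟩

/-- `K` and its neighbour lie in a run, and `K` in one of its groups. The whole group remains: an
earlier call with an element of it is either this group itself, which contains `K`, or by `hg` it
contains no element of type 1 with a neighbour of type 1. -/
theorem exists_available_one
    (hg : ∀ c ∈ σ, M.IsGroup C c.inputs ∨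
      ∀ W ∈ c.inputs, M.IsT1 W → ∀ Y, ChainNbr C W Y → ¬ M.IsT1 Y)
    (hT : M.IsT1 K) (r : Remaining σ K) (h : ChainNbr C K L) (hL : M.IsT1 L) :
    ∃ c, M.Available δ C σ c 1 := by
  obtain ⟨S, hS, hKS⟩ : ∃ S, M.IsT1Run C S ∧ K ∈ S := by
    rcases h with h | h
    · obtain ⟨S, hS, h1, -⟩ := exists_isT1Run H.dup H.exists_not_T1 h hT hL
      exact ⟨S, hS, h1⟩
    · obtain ⟨S, hS, -, h1⟩ := exists_isT1Run H.dup H.exists_not_T1 h hL hT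
      exact ⟨S, hS, h1⟩
  obtain ⟨g, hgS, hKg⟩ := exists_mem_groups S hS.2.1 K hKS
  have hG : M.IsGroup C g := ⟨S, hS, hgS⟩
  have hrem : ∀ X ∈ g, Remaining σ X := by
    intro X hX c hc hXc
    rcases hg c hc with hc' | hc'
    · exact r c hc (hc'.eq H.dup hG hXc hX ▸ hKg)
    · obtain ⟨Y, hY, hXY⟩ := hG.isSubchain.exists_chainNbr hG.two_le hX
      exact hc' X hXc (hG.isT1 hX) Y hXY (hG.isT1 hY)
  have t := fun X hX => hG.isT1 (K := X) hX
  have hs := hG.isSubchain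
  rcases (groups_spec S g hgS).2 with ⟨a, b, rfl⟩ | ⟨a, b, d, rfl⟩
  · obtain ⟨E, hE⟩ := H.exists_alg3 (δ := δ) (t a (by simp)) (t b (by simp))
      (Or.inl (by simpa using hs.2))
    exact ⟨⟨[a, b], E⟩, hrem, ⟨S, hS, hgS⟩, Or.inr ⟨a, b, rfl, hE⟩⟩
  · obtain ⟨h1, h2⟩ := hs.triple
    obtain ⟨E, hE⟩ := H.exists_alg2 (δ := δ) (t b (by simp)) (t a (by simp)) (t d (by simp))
      (Or.inr h1) (Or.inl h2) (h1.ne_of_consecutive H.dup h2)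
    exact ⟨⟨[a, b, d], E⟩, hrem, ⟨S, hS, hgS⟩, Or.inl ⟨a, b, d, rfl, hE⟩⟩

end Mergeable

variable (M) in
/-- What is true for the calls made in the course of the algorithm. -/
structure Invariant (δ : ℝ) (C : List Cell) (σ : List Call) : Prop where
  pattern : ∀ c ∈ σ, M.Pattern δ C c.inputs c.result
  disjoint : σ.Pairwise fun c c' => ∀ K ∈ c.inputs, K ∉ c'.inputs
  group : ∀ c ∈ σ, M.IsGroup C c.inputs ∨
      ∀ W ∈ c.inputs, M.IsT1 W → ∀ Y, ChainNbr C W Y → ¬ M.IsT1 Y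
  isolated : ∀ Z ∈ C, M.IsT1 Z → Remaining σ Z → (∀ Y, ChainNbr C Z Y → ¬ M.IsT1 Y) →
    ∀ Y, ChainNbr C Z Y → Remaining σ Y

namespace Mergeable

variable (H : M.Mergeable C)

include H

/-- The field `isolated` needs the order of the steps. A call that takes a chain neighbour `Y` of an
isolated, remaining element `Z` of type 1 has `Y` of type 2. In step 2 it would contain `Z`; in step
3 a call of step 2 with `Z` and `Y` would still be possible; in step 4 the call of step 3 with `Z`
in the middle would be. -/
theorem invariant_step {σ' : List Call} (h : M.Invariant δ C σ) (hs : M.Step δ C σ σ') :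
    M.Invariant δ C σ' := by
  obtain ⟨c, k, hav, hmin, rfl⟩ := hs
  have hrem := Mergeable.remaining_of_available hav
  refine ⟨?_, ?_, ?_, ?_⟩
  · intro c' hc'
    rcases List.mem_cons.1 hc' with rfl | hc'
    · exact H.pattern_of_available hav
    · exact h.pattern c' hc'
  · exact List.pairwise_cons.2 ⟨fun c' hc' K hK => hrem K hK c' hc', h.disjoint⟩
  · intro c' hc'
    rcases List.mem_cons.1 hc' with rfl | hc'
    · by_cases h1 : k ≤ 1
      · left
        rcases Mergeable.available_cases hav with ⟨-, hg, -⟩ | ⟨rfl, -⟩ | ⟨rfl, -⟩ | ⟨rfl, -⟩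
        · exact hg
        all_goals omega
      · right
        intro W hW hT Y hY hYT
        obtain ⟨c'', hc''⟩ := H.exists_available_one (δ := δ) h.group hT (hrem W hW) hY hYT
        exact hmin 1 (by omega) c'' hc''
    · exact h.group c' hc'
  · intro Z hZ hT hr hiso Y hY c' hc' hYc'
    have hr' : Remaining σ Z := fun c'' hc'' => hr c'' (List.mem_cons_of_mem _ hc'')
    have hZc : Z ∉ c.inputs := hr c (List.mem_cons_self ..)
    have hnb := h.isolated Z hZ hT hr' hiso
    rcases List.mem_cons.1 hc' with rfl | hc'
    swap
    · exact hnb Y hY c' hc' hYc'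
    have hY1 := hiso Y hY
    have hY2 := H.isT2_of_chainNbr hT hY hY1
    rcases Mergeable.available_cases hav with ⟨-, hg, -⟩ | ⟨-, hs, N₁, K, N₂, e, t1, t, t2, -⟩ |
      ⟨rfl, hs, N₁, K, N₂, e, t1, t, t2, -⟩ | ⟨rfl, -⟩
    · exact hY1 (hg.isT1 hYc')
    · rw [e] at hs hYc' hZc
      simp only [List.mem_cons, List.not_mem_nil, or_false, not_or] at hYc' hZc
      obtain ⟨h1, h2⟩ := hs.triple
      rcases hYc' with rfl | rfl | rfl
      · exact hY1 t1
      · rcases ChainNbr.eq_or H.dup (Or.inr h1) (Or.inl h2) (h1.ne_of_consecutive H.dup h2) hY.symm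
          with rfl | rfl
        exacts [hZc.1 rfl, hZc.2.2 rfl]
      · exact hY1 t2
    · rw [e] at hs hYc' hZc hrem
      simp only [List.mem_cons, List.not_mem_nil, or_false, not_or] at hYc' hZc
      obtain ⟨h1, h2⟩ := hs.triple
      have hrK : Remaining σ K := hrem K (by simp)
      have hrY := hnb Y hY
      rcases hYc' with rfl | rfl | rfl
      · rcases hY with hY | hY
        -- `Y` is an outer element of pattern 1 between `Z` and the element `K` of type 1. All three
        -- remain, so step 2 is not finished.
        · obtain ⟨c'', hc''⟩ := H.exists_available_two (δ := δ) t1 hT t hY h1 hrY hr' hrK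
          exact hmin 2 (by omega) c'' hc''
        · exact hZc.2.1 (hY.succ_unique H.dup h1)
      · exact hY1 t
      · rcases hY with hY | hY
        · exact hZc.2.1 (hY.pred_unique H.dup h2)
        · obtain ⟨c'', hc''⟩ := H.exists_available_two (δ := δ) t2 t hT h2 hY hrY hrK hr'
          exact hmin 2 (by omega) c'' hc''
    · obtain ⟨c'', hc''⟩ := H.exists_available_three (δ := δ) hT hZ hiso hr' hnb
      exact hmin 3 (by omega) c'' hc''

theorem invariant_of_reach (h : Relation.ReflTransGen (M.Step δ C) [] σ) :
    M.Invariant δ C σ := by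
  induction h with
  | refl => exact ⟨by simp, by simp, by simp, fun _ _ _ _ _ _ _ c hc => by simp at hc⟩
  | tail _ hs ih => exact H.invariant_step ih hs

/-- The first inputs of the calls are distinct elements of the chain; they serve as labels for
counting. -/
theorem length_le (h : M.Invariant δ C σ) : σ.length ≤ C.length := by
  have hnd : (σ.map fun c => c.inputs.head?).Nodup := by
    rw [List.Nodup, List.pairwise_map]
    refine h.disjoint.imp_of_mem ?_
    intro c c' hc hc' hd e
    have hne := (H.mem_of_pattern (h.pattern c hc)).1
    obtain ⟨a, l, e1⟩ := List.exists_cons_of_ne_nil hne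
    rw [e1] at e hd
    refine hd a (by simp) (List.mem_of_mem_head? ?_)
    rw [← e]; rfl
  have hsub : (σ.map fun c => c.inputs.head?) ⊆ C.map some := by
    intro x hx
    obtain ⟨c, hc, rfl⟩ := List.mem_map.1 hx
    obtain ⟨hne, hm⟩ := H.mem_of_pattern (h.pattern c hc)
    obtain ⟨a, l, e1⟩ := List.exists_cons_of_ne_nil hne
    rw [e1] at hm ⊢
    exact List.mem_map.2 ⟨a, hm a (by simp), rfl⟩
  simpa using hnd.length_le_of_subset hsub

theorem not_forever : ¬ ∃ f : ℕ → List Call, f 0 = [] ∧ ∀ m, M.Step δ C (f m) (f (m + 1)) := by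
  rintro ⟨f, h0, hf⟩
  have hr : ∀ m, Relation.ReflTransGen (M.Step δ C) [] (f m) ∧ (f m).length = m := by
    intro m
    induction m with
    | zero => rw [h0]; exact ⟨.refl, rfl⟩
    | succ m ih =>
      refine ⟨ih.1.tail (hf m), ?_⟩
      obtain ⟨c, k, -, -, e⟩ := hf m
      rw [e, List.length_cons, ih.2]
  have := H.length_le (H.invariant_of_reach (hr (C.length + 1)).1)
  rw [(hr _).2] at this
  omega

omit H in
-- If any call were available, one with the least possible step number could be made.
theorem not_available_of_isFinal (h : M.IsFinal δ C σ) (k : ℕ) (c : Call) :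
    ¬ M.Available δ C σ c k := by
  classical
  intro hav
  have hex : ∃ k, ∃ c, M.Available δ C σ c k := ⟨k, c, hav⟩
  obtain ⟨c, hc⟩ := Nat.find_spec hex
  exact h.2 _ ⟨c, _, hc, fun j hj c' hc' => Nat.find_min hex hj ⟨c', hc'⟩, rfl⟩

/-- An untreated element keeps a call available: step 1 if it is of type 1 with a neighbour of type
1, step 3 if it is of type 1 without one (by `isolated`), step 4 if it is of type 2. -/
theorem exists_call_of_isFinal (h : M.IsFinal δ C σ) (hK : K ∈ C) (hT : M.IsT1 K ∨ M.IsT2 K) :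
    ∃ c ∈ σ, K ∈ c.inputs := by
  by_contra! hcon
  have hr : Remaining σ K := hcon
  have hinv := H.invariant_of_reach h.1
  have hno := Mergeable.not_available_of_isFinal h
  rcases hT with hT | hT
  · by_cases hiso : ∀ Y, ChainNbr C K Y → ¬ M.IsT1 Y
    · obtain ⟨c, hc⟩ := H.exists_available_three (δ := δ) hT hK hiso hr
        (hinv.isolated K hK hT hr hiso)
      exact hno 3 c hc
    · push Not at hiso
      obtain ⟨Y, hY, hYT⟩ := hiso
      obtain ⟨c, hc⟩ := H.exists_available_one (δ := δ) hinv.group hT hr hY hYT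
      exact hno 1 c hc
  · obtain ⟨c, hc⟩ := Mergeable.exists_available_four (δ := δ) hT hK hr
    exact hno 4 c hc

theorem used_disjoint (h : M.IsFinal δ C σ) :
    σ.Pairwise fun c c' => ∀ K ∈ c.used, K ∉ c'.used := by
  have hinv := H.invariant_of_reach h.1
  have hd : ∀ c ∈ σ, ∀ c' ∈ σ, ∀ K, K ∈ c.inputs → K ∈ c'.inputs → c = c' := by
    intro c hc c' hc' K hK hK'
    by_contra hne
    have hsym : Std.Symm fun c c' : Call => ∀ K ∈ c.inputs, K ∉ c'.inputs :=
      ⟨fun a b hab K hb ha => hab K ha hb⟩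
    exact hinv.disjoint.forall hc hc' hne K hK hK'
  refine hinv.disjoint.imp_of_mem ?_
  intro c c' hc hc' hdis G hG hG'
  refine H.not_usable_twice (σ := σ) hinv.pattern
    (fun K hK hT => H.exists_call_of_isFinal h hK (Or.inl hT))
    (H.mem_of_pattern (hinv.pattern c hc)).2 (H.mem_of_pattern (hinv.pattern c' hc')).2
    (fun b hb K hK => ⟨fun hK' X hX => ?_, fun hK' X hX => ?_⟩) hdis
    (H.usable_of_pattern (hinv.pattern c hc) G hG) (H.usable_of_pattern (hinv.pattern c' hc') G hG')
  · rwa [hd b hb c hc K hK hK'] at hX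
  · rwa [hd b hb c' hc' K hK hK'] at hX

end Mergeable

end InterfaceMesh

end Merging

/-! ### A criterion for large rectangles made of several elements. -/

namespace Merging

namespace InterfaceMesh

variable {M : InterfaceMesh} {K X : Cell} {u v d e : ℤ × ℤ}

variable (M) in
/-- The side `d` of `X` lies, up to its end points, in one of the two subdomains or on the
interface. -/
def CleanSide (X : Cell) (d : ℤ × ℤ) : Prop :=
  X.openSide d ⊆ meshDomain M.T ∧ ((∃ j, X.openSide d ⊆ M.sgn j) ∨ X.side d ⊆ M.Γ)

theorem CleanSide.of_not_isInterface (hd : d ∈ dirs) (hX : X ∈ M.T) (hXd : X.shift d ∈ M.T)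
    (h : ¬ M.IsInterface X ∨ ¬ M.IsInterface (X.shift d)) : M.CleanSide X d := by
  refine ⟨openSide_subset_meshDomain hd hX hXd, ?_⟩
  rcases h with h | h
  · obtain ⟨i, hi⟩ := exists_sgn_of_not_isInterface hX h
    exact (side_of_not_isInterface hi hd hXd).imp_left fun h => ⟨i, h⟩
  · obtain ⟨i, hi⟩ := exists_sgn_of_not_isInterface hXd h
    have := side_of_not_isInterface hi (neg_mem_dirs hd) (by rwa [Cell.shift_shift_neg])
    rw [X.openSide_shift hd, X.side_shift hd] at this
    exact this.imp_left fun h => ⟨i, h⟩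

theorem CleanSide.dichotomy (h : M.CleanSide X d) (hd : d ∈ dirs) (k : Fin 2) :
    X.sideFrac d (M.sub k) = 1 ∨ X.side d ∩ M.sub k = ∅ := by
  obtain ⟨hm, ⟨j, hj⟩ | hΓ⟩ := h
  · rcases eq_or_rev j k with rfl | rfl
    · left
      refine Cell.sideFrac_eq_one _ hd ?_
      rw [sub_eq]
      exact subset_inter hj hm
    · right
      rw [eq_empty_iff_forall_notMem]
      rintro p ⟨hp, hpk⟩
      exact closure_sgn hj (X.side_subset_closure_openSide d hp) (sub_subset_sgn _ hpk)
  · right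
    rw [eq_empty_iff_forall_notMem]
    rintro p ⟨hp, hpk⟩
    exact notMem_Γ_of_sgn (sub_subset_sgn _ hpk) (hΓ hp)

theorem Split.le_sideFrac {r : ℝ} {i : Fin 2} (h : M.Split X d e r i) (hp : Perp d e)
    (hm : X.openSide d ⊆ meshDomain M.T) : r ≤ X.sideFrac d (M.sub i) := by
  refine Cell.le_sideFrac _ hp h.nonneg h.le_one fun t ht => ?_
  rw [sub_eq]
  refine ⟨h.lt t ht.1.le ht.2, hm ?_⟩
  rw [Cell.sidePt_eq]
  have := h.le_one
  exact (X.uv_mem_openSide hp).2 ⟨rfl, by linarith [ht.2], by linarith [ht.1]⟩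

/-- If the interface crosses the side `d` of `X`, and the adjacent side of the next element does
not, then the latter belongs to the subdomain of the adjacent part of the former. -/
theorem Split.next {r : ℝ} {i : Fin 2} (h : M.Split X d e r i) (hp : Perp d e)
    (hc : M.CleanSide (X.shift e) d) :
    (X.shift e).sideFrac d (M.sub i) = 1 ∨ X.side d ∩ M.sub i = ∅ := by
  -- For `r = 0` the part towards `u + v` is empty, so the subdomain does not meet the side; for `r
  -- > 0` the common end point of the two sides has the sign `i` and passes it on to the clean side.
  rcases h.nonneg.eq_or_lt with h0 | h0
  · right
    rw [eq_empty_iff_forall_notMem]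
    rintro p ⟨hps, hpi⟩
    have hpi := sub_subset_sgn _ hpi
    rw [X.side_eq hp] at hps
    obtain ⟨t, h1, h2, rfl⟩ := hps
    have e1 : X.sidePt d e ((1 - t) / 2) = X.uv d e 1 t := by
      rw [Cell.sidePt_eq]; congr 1; ring
    rcases h2.eq_or_lt with h3 | h3
    · have := h.mem
      rw [← h0, Cell.sidePt_eq] at this
      norm_num at this
      rw [h3] at hpi
      exact notMem_Γ_of_sgn hpi this
    · have := h.gt ((1 - t) / 2) (by linarith) (by linarith)
      rw [e1] at this
      exact ne_rev i (sgn_unique hpi this)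
  · left
    have h1 := h.lt 0 le_rfl h0
    have e1 : X.sidePt d e 0 = (X.shift e).uv d e 1 (-1) := by
      rw [Cell.sidePt_eq, X.shift_right (u := d), Cell.uv_cell]; norm_num
    rw [e1] at h1
    have hs : (X.shift e).uv d e 1 (-1) ∈ (X.shift e).side d :=
      ((X.shift e).uv_mem_side hp).2 (by norm_num)
    obtain ⟨hm, ⟨j, hj⟩ | hΓ⟩ := hc
    · refine Cell.sideFrac_eq_one _ hp.1 ?_
      rw [sub_eq]
      refine subset_inter ?_ hm
      rcases eq_or_rev j i with rfl | rfl
      · exact hj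
      · exact absurd h1 (closure_sgn hj (Cell.side_subset_closure_openSide _ d hs))
    · exact absurd (hΓ hs) (notMem_Γ_of_sgn h1)

variable (M) in
/-- The cell `(a, b)` of a macro-element which extends from row `b₀` to row `b₁` does not spoil its
side `u`, in the frame `(u, v)`. -/
def EdgeOK (δ : ℝ) (K : Cell) (u v : ℤ × ℤ) (a b₀ b₁ b : ℤ) : Prop :=
  (¬ M.IsInterface (K.cell u v a b) ∨ ¬ M.IsInterface (K.cell u v (a + 1) b)) ∨
  ∃ r i, M.Split (K.cell u v a b) u v r i ∧
    ((b < b₁ ∧ (¬ M.IsInterface (K.cell u v a (b + 1)) ∨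
      ¬ M.IsInterface (K.cell u v (a + 1) (b + 1)))) ∨ (b₁ - b₀ + 1 : ℝ) * δ ≤ r) ∧
    ((b₀ < b ∧ (¬ M.IsInterface (K.cell u v a (b - 1)) ∨
      ¬ M.IsInterface (K.cell u v (a + 1) (b - 1)))) ∨ (b₁ - b₀ + 1 : ℝ) * δ ≤ 1 - r)

/-- An element side is the fraction `1 / n` of the side of the box, where `n = b₁ - b₀ + 1`. So one
whole element side in the subdomain suffices by `hδ`, and so does the fraction `n δ` of one; this is
the origin of the factors in the thresholds of the patterns. If the subdomain meets a crossed
element side, its part of that side either continues into the next, clean side or reaches the end of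
the box, where the threshold applies. -/
theorem le_sideFrac_box {δ : ℝ} (h : Perp u v) {a₀ a₁ b₀ b₁ : ℤ}
    (ha : a₀ ≤ a₁) (hb : b₀ ≤ b₁) (hδ : (b₁ - b₀ + 1 : ℝ) * δ ≤ 1)
    (hT : ∀ b, b₀ ≤ b → b ≤ b₁ → K.cell u v a₁ b ∈ M.T ∧ K.cell u v (a₁ + 1) b ∈ M.T)
    (hE : ∀ b, b₀ ≤ b → b ≤ b₁ → M.EdgeOK δ K u v a₁ b₀ b₁ b) (k : Fin 2)
    (hne : ((K.box h ha hb).side u ∩ M.sub k).Nonempty) :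
    δ ≤ (K.box h ha hb).sideFrac u (M.sub k) := by
  have hn := Cell.length_pos hb
  have clean : ∀ b, b₀ ≤ b → b ≤ b₁ → (¬ M.IsInterface (K.cell u v a₁ b) ∨
      ¬ M.IsInterface (K.cell u v (a₁ + 1) b)) → M.CleanSide (K.cell u v a₁ b) u := by
    intro b h0 h1 h2
    exact .of_not_isInterface h.1 (hT b h0 h1).1 (by rw [Cell.cell_shift_left]; exact (hT b h0 h1).2)
      (by rwa [Cell.cell_shift_left])
  suffices ∃ b, b₀ ≤ b ∧ b ≤ b₁ ∧ (b₁ - b₀ + 1 : ℝ) * δ ≤ (K.cell u v a₁ b).sideFrac u (M.sub k) by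
    obtain ⟨b, h0, h1, h2⟩ := this
    have := h2.trans (K.sideFrac_cell_le_box (ha := ha) (hb := hb) h h0 h1 (M.sub k))
    exact le_of_mul_le_mul_left this hn
  obtain ⟨b, ⟨h0, h1⟩, hb'⟩ := K.exists_mem_side_cell (ha := ha) (hb := hb) h hne
  have full : ∀ c, b₀ ≤ c → c ≤ b₁ → (K.cell u v a₁ c).sideFrac u (M.sub k) = 1 →
      ∃ b, b₀ ≤ b ∧ b ≤ b₁ ∧ (b₁ - b₀ + 1 : ℝ) * δ ≤ (K.cell u v a₁ b).sideFrac u (M.sub k) :=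
    fun c h0 h1 h2 => ⟨c, h0, h1, by rw [h2]; exact hδ⟩
  rcases hE b h0 h1 with hc | ⟨r, i, hs, h2, h3⟩
  · rcases (clean b h0 h1 hc).dichotomy h.1 k with h2 | h2
    · exact full b h0 h1 h2
    · exact absurd h2 hb'.ne_empty
  · have hm : (K.cell u v a₁ b).openSide u ⊆ meshDomain M.T :=
      openSide_subset_meshDomain h.1 (hT b h0 h1).1
        (by rw [Cell.cell_shift_left]; exact (hT b h0 h1).2)
    rcases eq_or_rev i k with rfl | rfl
    · rcases h2 with ⟨h2, hc⟩ | h2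
      · have := hs.next h (by rw [Cell.cell_shift_right]; exact clean _ (by omega) (by omega) hc)
        rw [Cell.cell_shift_right] at this
        rcases this with h4 | h4
        · exact full _ (by omega) (by omega) h4
        · exact absurd h4 hb'.ne_empty
      · exact ⟨b, h0, h1, h2.trans (hs.le_sideFrac h hm)⟩
    · rcases h3 with ⟨h3, hc⟩ | h3
      · have := hs.symm.next h.neg_right
          (by rw [Cell.cell_shift_neg_right]; exact clean _ (by omega) (by omega) hc)
        rw [Cell.cell_shift_neg_right] at this
        rcases this with h4 | h4
        · exact full _ (by omega) (by omega) h4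
        · exact absurd h4 hb'.ne_empty
      · exact ⟨b, h0, h1, h3.trans (hs.symm.le_sideFrac h.neg_right hm)⟩

/-- A criterion for a macro-element to be a large rectangle. -/
theorem exists_isLarge {δ : ℝ} (h : Perp u v) {a₀ a₁ b₀ b₁ : ℤ} (ha : a₀ ≤ a₁) (hb : b₀ ≤ b₁)
    (hδa : (a₁ - a₀ + 1 : ℝ) * δ ≤ 1) (hδb : (b₁ - b₀ + 1 : ℝ) * δ ≤ 1) {P : List Cell}
    (hP : ∀ c, c ∈ P ↔ ∃ a b, (a₀ ≤ a ∧ a ≤ a₁) ∧ (b₀ ≤ b ∧ b ≤ b₁) ∧ c = K.cell u v a b)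
    (hK : M.IsInterface K) (hKP : K ∈ P)
    (hTa : ∀ a b, a₀ - 1 ≤ a → a ≤ a₁ + 1 → b₀ ≤ b → b ≤ b₁ → K.cell u v a b ∈ M.T)
    (hTb : ∀ a b, a₀ ≤ a → a ≤ a₁ → b₀ - 1 ≤ b → b ≤ b₁ + 1 → K.cell u v a b ∈ M.T)
    (h₁ : ∀ b, b₀ ≤ b → b ≤ b₁ → M.EdgeOK δ K u v a₁ b₀ b₁ b)
    (h₂ : ∀ b, b₀ ≤ b → b ≤ b₁ → M.EdgeOK δ K (-u) v (-a₀) b₀ b₁ b)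
    (h₃ : ∀ a, a₀ ≤ a → a ≤ a₁ → M.EdgeOK δ K v u b₁ a₀ a₁ a)
    (h₄ : ∀ a, a₀ ≤ a → a ≤ a₁ → M.EdgeOK δ K (-v) u (-b₀) a₀ a₁ a) :
    ∃ R : Cell, macroElem P = R.toSet ∧ M.IsLarge δ R := by
  have hmac := K.macroElem_eq_box (ha := ha) (hb := hb) h hP
  refine ⟨K.box h ha hb, hmac, ?_, fun k d hd hne => ?_⟩
  · obtain ⟨p, hp, hpΓ⟩ := hK.2
    refine ⟨p, hmac ▸ ?_, hpΓ⟩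
    have : K.toSet ⊆ macroElem P :=
      interior_maximal (K.toSet_subset_closed.trans
        (subset_biUnion_of_mem (s := {c | c ∈ P}) (u := Cell.closed) hKP)) K.isOpen_toSet
    exact this hp
  · rcases (h.mem_dirs_iff d).1 hd with rfl | rfl | rfl | rfl
    · exact le_sideFrac_box h ha hb hδb (fun b h0 h1 => ⟨hTa _ _ (by omega) (by omega) h0 h1,
        hTa _ _ (by omega) (by omega) h0 h1⟩) h₁ k hne
    · rw [← K.box_comm ha hb h] at hne ⊢
      refine le_sideFrac_box h.symm hb ha hδa (fun a h0 h1 => ?_) h₃ k hne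
      rw [K.cell_comm (u := u) (v := d) a b₁, K.cell_comm (u := u) (v := d) a (b₁ + 1)]
      exact ⟨hTb _ _ h0 h1 (by omega) (by omega), hTb _ _ h0 h1 (by omega) (by omega)⟩
    · have key := le_sideFrac_box (M := M) (K := K) h.neg_left (neg_le_neg ha) hb hδb
        (fun b h0 h1 => ?_) h₂ k
      · rw [K.box_neg_left ha hb h] at key
        exact key hne
      rw [Cell.cell_neg, Cell.cell_neg]
      exact ⟨hTa _ _ (by omega) (by omega) h0 h1, hTa _ _ (by omega) (by omega) h0 h1⟩
    · have key := le_sideFrac_box (M := M) (K := K) h.symm.neg_left (neg_le_neg hb) ha hδa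
        (fun a h0 h1 => ?_) h₄ k
      · rw [K.box_neg_left hb ha h.symm, K.box_comm ha hb h] at key
        exact key hne
      rw [Cell.cell_neg, Cell.cell_neg, K.cell_comm (u := u) (v := v) a (- -b₀),
        K.cell_comm (u := u) (v := v) a (-(-b₀ + 1))]
      exact ⟨hTb _ _ h0 h1 (by omega) (by omega), hTb _ _ h0 h1 (by omega) (by omega)⟩

/-- Elements of type 3 are large. -/
theorem IsT3.isLarge (h : M.IsT3 K) (hB : M.Block 1 K) {δ : ℝ} (hδ : δ ≤ 1) :
    M.IsLarge δ K := by
  obtain ⟨u, v, i, D⟩ := h.data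
  refine ⟨h.1.2, fun k d hd hne => ?_⟩
  -- `Γ` meets the boundary only in two vertices, so no side is divided.
  have hj : ∃ j, K.openSide d ⊆ M.sgn j := by
    rcases (D.perp.mem_dirs_iff d).1 hd with rfl | rfl | rfl | rfl
    exacts [⟨_, D.side₁⟩, ⟨_, D.side₃⟩, ⟨_, D.side₄⟩, ⟨_, D.side₂⟩]
  have hc : M.CleanSide K d :=
    ⟨openSide_subset_meshDomain hd h.1.1 (hB.openSide_subset hd), Or.inl hj⟩
  rcases hc.dichotomy hd k with h1 | h1
  · rw [h1]; exact hδ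
  · exact absurd h1 hne.ne_empty

end InterfaceMesh

end Merging

/-! ### The macro-elements of the five patterns. -/

namespace Merging

theorem Cell.mem_map_cell {K : Cell} {u v : ℤ × ℤ} {a₀ a₁ b₀ b₁ : ℤ} {l : List (ℤ × ℤ)}
    (h : ∀ a b, (a, b) ∈ l ↔ (a₀ ≤ a ∧ a ≤ a₁) ∧ (b₀ ≤ b ∧ b ≤ b₁)) {P : List Cell}
    (hP : P = l.map fun x => K.cell u v x.1 x.2) (c : Cell) :
    c ∈ P ↔ ∃ a b, (a₀ ≤ a ∧ a ≤ a₁) ∧ (b₀ ≤ b ∧ b ≤ b₁) ∧ c = K.cell u v a b := by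
  rw [hP, List.mem_map]
  constructor
  · rintro ⟨⟨a, b⟩, hab, rfl⟩
    obtain ⟨h1, h2⟩ := (h a b).1 hab
    exact ⟨a, b, h1, h2, rfl⟩
  · rintro ⟨a, b, h1, h2, rfl⟩
    exact ⟨(a, b), (h a b).2 ⟨h1, h2⟩, rfl⟩

namespace InterfaceMesh

variable {M : InterfaceMesh} {K L : Cell} {u v w : ℤ × ℤ} {C : List Cell} {δ : ℝ}

theorem edgeOK_of_column {n a b₀ b₁ b : ℤ} (h : ¬ M.IsInterface (K.cell u v n b))
    (ha : a = n ∨ a + 1 = n) : M.EdgeOK δ K u v a b₀ b₁ b := by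
  rcases ha with rfl | rfl
  exacts [Or.inl (Or.inl h), Or.inl (Or.inr h)]

theorem edgeOK_neg_of_column {n a b₀ b₁ b : ℤ} (h : ¬ M.IsInterface (K.cell u v n b))
    (ha : a = n ∨ a - 1 = n) : M.EdgeOK δ K (-u) v (-a) b₀ b₁ b := by
  refine edgeOK_of_column (n := -n) ?_ (by omega)
  rwa [Cell.cell_neg, neg_neg]

namespace Mergeable

variable (H : M.Mergeable C)

include H

variable {i j : Fin 2} {r₁ r₂ s₁ s₂ : ℝ}

theorem cell_mem_T_of_shift (hN : K.shift u ∈ C) (hp : Perp u v) {a b : ℤ} (ha : |a - 1| ≤ 2)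
    (hb : |b| ≤ 2) : K.cell u v a b ∈ M.T := by
  have := H.shift_mem_T hN hp ha hb
  rwa [K.shift_left (v := v), Cell.cell_cell, add_sub_cancel, zero_add] at this

theorem exists_split_of_T2 (hL : L ∈ C) (hT : M.IsT2 L) (hp : Perp u v)
    (h : M.IsInterface (L.shift (-u))) : ∃ r i, M.Split L u v r i := by
  rcases H.isT2Along_of_shift hL hT hp.neg_left.1 h with h' | h'
  · obtain ⟨i, r₁, r₂, D⟩ := h'.data hp.neg_left
    exact ⟨r₂, i, by simpa using D.split₂⟩
  · rw [neg_neg] at h'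
    obtain ⟨i, r₁, r₂, D⟩ := h'.data hp
    exact ⟨r₁, i, D.split₁⟩

/-! ### Pattern 1 -/

/-- On this side of the macro-element only `K.shift u` is crossed; the elements in the rows above
and below it are non-interface elements. If the row below is not used, the side consists of two
element sides, whence the bound `2 δ`. -/
theorem edgeOK_p1 (hK : K ∈ C) (hT : M.IsT1 K) (D : M.T1Data K u v i r₁ r₂)
    (h : M.IsT2 (K.shift u)) {b₀ b : ℤ}
    (hb₀ : b₀ = -1 ∨ b₀ = 0 ∧ 2 * δ ≤ M.part (K.shift u) u (-v)) (h0 : b₀ ≤ b) (h1 : b ≤ 1) :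
    M.EdgeOK δ K u v 1 b₀ 1 b := by
  have hN := (H.chainNbr_of_T1 hK D hT).1.mem_right
  have hd := H.not_isInterface_diag hK hT D
  rw [K.shift_uv] at hd
  obtain ⟨hc, -⟩ := H.not_isInterface_opposite_corner hK D h hN
  obtain rfl | rfl | rfl : b = -1 ∨ b = 0 ∨ b = 1 := by omega
  · exact edgeOK_of_column hc (by simp)
  · obtain ⟨r, k, hs⟩ := H.exists_split_of_T2 hN h D.perp
      (by rw [Cell.shift_shift_neg]; exact H.isInterface hK)
    refine Or.inr ⟨r, k, by rwa [← K.shift_left], Or.inl ⟨by norm_num, Or.inl hd⟩, ?_⟩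
    rcases hb₀ with rfl | ⟨rfl, hr⟩
    · exact Or.inl ⟨by norm_num, Or.inl hc⟩
    · rw [hs.symm.part_eq] at hr
      right; push_cast; linarith
  · exact edgeOK_of_column hd (by simp)

/-- The three elements of the column behind `K` are non-interface elements, so nothing is crossed
here, whether this column is merged or not. -/
theorem edgeOK_neg_p1 (hK : K ∈ C) (hT : M.IsT1 K) (D : M.T1Data K u v i r₁ r₂)
    (h : M.IsT2 (K.shift u)) (h' : M.IsT2 (K.shift v)) {a₀ b₀ b : ℤ} (ha₀ : a₀ = -1 ∨ a₀ = 0)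
    (h0 : -1 ≤ b) (h1 : b ≤ 1) : M.EdgeOK δ K (-u) v (-a₀) b₀ 1 b := by
  have hN := (H.chainNbr_of_T1 hK D hT).1.mem_right
  have hN' := (H.chainNbr_of_T1 hK D hT).2.1.mem_right
  have hn := (H.shift_of_T1 hK D).2.2.1
  rw [K.shift_neg_left (v := v)] at hn
  have hc := (H.not_isInterface_opposite_corner hK D h hN).2
  have hc' := (H.not_isInterface_opposite_corner hK D.symm h' hN').1
  rw [K.cell_comm] at hc'
  refine edgeOK_neg_of_column (n := -1) ?_ (by omega)
  obtain rfl | rfl | rfl : b = -1 ∨ b = 0 ∨ b = 1 := by omega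
  exacts [hc, hn, hc']

theorem isLarge_p1 (hδ : δ ≤ 1 / 5) (hK : K ∈ C) (hT : M.IsT1 K) (D : M.T1Data K u v i r₁ r₂)
    (h : M.IsT2 (K.shift u)) (h' : M.IsT2 (K.shift v)) {a₀ b₀ : ℤ}
    (ha₀ : a₀ = -1 ∨ a₀ = 0 ∧ 2 * δ ≤ M.part (K.shift v) v (-u))
    (hb₀ : b₀ = -1 ∨ b₀ = 0 ∧ 2 * δ ≤ M.part (K.shift u) u (-v)) {P : List Cell}
    (hP : ∀ c, c ∈ P ↔ ∃ a b, (a₀ ≤ a ∧ a ≤ 1) ∧ (b₀ ≤ b ∧ b ≤ 1) ∧ c = K.cell u v a b) :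
    ∃ R, macroElem P = R.toSet ∧ M.IsLarge δ R := by
  have hp := D.perp
  have ha : a₀ = -1 ∨ a₀ = 0 := by tauto
  have hb : b₀ = -1 ∨ b₀ = 0 := by tauto
  have hla : ((1 : ℤ) - a₀ + 1 : ℝ) * δ ≤ 1 := by
    rcases ha with rfl | rfl <;> push_cast <;> linarith
  have hlb : ((1 : ℤ) - b₀ + 1 : ℝ) * δ ≤ 1 := by
    rcases hb with rfl | rfl <;> push_cast <;> linarith
  refine exists_isLarge hp (by omega) (by omega) hla hlb hP (H.isInterface hK)
    ((hP K).2 ⟨0, 0, by omega, by omega, by simp⟩) ?_ ?_ ?_ ?_ ?_ ?_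
  · exact fun a b _ _ _ _ => H.shift_mem_T hK hp (abs_le.2 (by omega)) (abs_le.2 (by omega))
  · exact fun a b _ _ _ _ => H.shift_mem_T hK hp (abs_le.2 (by omega)) (abs_le.2 (by omega))
  · exact fun b h0 h1 => H.edgeOK_p1 hK hT D h hb₀ h0 h1
  · exact fun b h0 h1 => H.edgeOK_neg_p1 hK hT D h h' ha (by omega) h1
  · exact fun a h0 h1 => H.edgeOK_p1 hK hT D.symm h' ha₀ h0 h1
  · exact fun a h0 h1 => H.edgeOK_neg_p1 hK hT D.symm h' h hb (by omega) h1

/-! ### Pattern 2 -/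

/-- The column `2` is free of the interface and lies on one or the other side of the edge. -/
theorem edgeOK_p2 (hK : K ∈ C) (hT : M.IsT1 K) (D : M.T1Data K u v i r₁ r₂)
    (h : M.IsT1 (K.shift u)) (h' : M.IsT1 (K.shift v)) {a₁ b₁ b : ℤ} (ha₁ : a₁ = 1 ∨ a₁ = 2)
    (h0 : 0 ≤ b) (h1 : b ≤ 2) : M.EdgeOK δ K u v a₁ 0 b₁ b := by
  refine edgeOK_of_column (n := 2) (fun hcon => ?_) (by omega)
  have := H.not_isInterface_ring_of_three hK hT D h h' 2 b (by omega) (by omega) h0 h1 hcon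
  omega

/-- Only `K.shift v` is crossed on this side: since the interface bends back there, it leaves
through the side `-u`. Below it, `K` is clean on this side; above it there is either a non-interface
element of the macro-element or, if only two rows are used, the threshold `2 δ`. -/
theorem edgeOK_neg_p2 (hK : K ∈ C) (hT : M.IsT1 K) (D : M.T1Data K u v i r₁ r₂)
    (h : M.IsT1 (K.shift u)) (h' : M.IsT1 (K.shift v)) {b₁ b : ℤ}
    (hb₁ : b₁ = 2 ∨ b₁ = 1 ∧ 2 * δ ≤ M.part (K.shift v) (-u) v) (h0 : 0 ≤ b) (h1 : b ≤ b₁) :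
    M.EdgeOK δ K (-u) v (-0) 0 b₁ b := by
  have hn := (H.shift_of_T1 hK D).2.2.1
  rw [K.shift_neg_left (v := v)] at hn
  have h2 : ¬ M.IsInterface (K.cell u v 0 2) := fun hcon => by
    have := H.not_isInterface_ring_of_three hK hT D h h' 0 2 (by omega) (by omega) (by omega)
      (by omega) hcon
    omega
  obtain rfl | rfl | rfl : b = 0 ∨ b = 1 ∨ b = 2 := by omega
  · exact edgeOK_neg_of_column hn (by simp)
  · obtain ⟨k, s, s', D'⟩ := H.T1Data_next hK hT D.symm h'
    have hs := D'.split₂.symm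
    rw [neg_neg] at hs
    refine Or.inr ⟨_, _, by simpa [Cell.cell_neg, ← K.shift_right (u := u)] using hs, ?_,
      Or.inl ⟨by norm_num, Or.inr (by simpa [Cell.cell_neg] using hn)⟩⟩
    rcases hb₁ with rfl | ⟨rfl, hr⟩
    · exact Or.inl ⟨by norm_num, Or.inl (by simpa [Cell.cell_neg] using h2)⟩
    · rw [hs.part_eq] at hr
      right; push_cast; linarith
  · exact edgeOK_neg_of_column h2 (by simp)

theorem isLarge_p2 (hδ : δ ≤ 1 / 5) (hK : K ∈ C) (hT : M.IsT1 K) (D : M.T1Data K u v i r₁ r₂)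
    (h : M.IsT1 (K.shift u)) (h' : M.IsT1 (K.shift v)) {a₁ b₁ : ℤ}
    (ha₁ : a₁ = 2 ∨ a₁ = 1 ∧ 2 * δ ≤ M.part (K.shift u) (-v) u)
    (hb₁ : b₁ = 2 ∨ b₁ = 1 ∧ 2 * δ ≤ M.part (K.shift v) (-u) v) {P : List Cell}
    (hP : ∀ c, c ∈ P ↔ ∃ a b, (0 ≤ a ∧ a ≤ a₁) ∧ (0 ≤ b ∧ b ≤ b₁) ∧ c = K.cell u v a b) :
    ∃ R, macroElem P = R.toSet ∧ M.IsLarge δ R := by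
  have hp := D.perp
  have ha : a₁ = 1 ∨ a₁ = 2 := by tauto
  have hb : b₁ = 1 ∨ b₁ = 2 := by tauto
  have hla : (a₁ - (0 : ℤ) + 1 : ℝ) * δ ≤ 1 := by
    rcases ha with rfl | rfl <;> push_cast <;> linarith
  have hlb : (b₁ - (0 : ℤ) + 1 : ℝ) * δ ≤ 1 := by
    rcases hb with rfl | rfl <;> push_cast <;> linarith
  obtain ⟨c₁, c₂, -⟩ := H.chainNbr_of_T1 hK D hT
  refine exists_isLarge hp (by omega) (by omega) hla hlb hP (H.isInterface hK)
    ((hP K).2 ⟨0, 0, by omega, by omega, by simp⟩) ?_ ?_ ?_ ?_ ?_ ?_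
  · intro a b _ _ _ _
    rcases le_or_gt a 2 with h2 | h2
    · exact H.shift_mem_T hK hp (abs_le.2 (by omega)) (abs_le.2 (by omega))
    -- The column `3` is beyond the block of `K` but within that of `K.shift u`.
    · exact H.cell_mem_T_of_shift c₁.mem_right hp (abs_le.2 (by omega)) (abs_le.2 (by omega))
  · intro a b _ _ _ _
    rcases le_or_gt b 2 with h2 | h2
    · exact H.shift_mem_T hK hp (abs_le.2 (by omega)) (abs_le.2 (by omega))
    · rw [← K.cell_comm]
      exact H.cell_mem_T_of_shift c₂.mem_right hp.symm (abs_le.2 (by omega)) (abs_le.2 (by omega))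
  · exact fun b h0 h1 => H.edgeOK_p2 hK hT D h h' ha h0 (by omega)
  · exact fun b h0 h1 => H.edgeOK_neg_p2 hK hT D h h' hb₁ h0 h1
  · exact fun a h0 h1 => H.edgeOK_p2 hK hT D.symm h' h hb h0 (by omega)
  · exact fun a h0 h1 => H.edgeOK_neg_p2 hK hT D.symm h' h ha₁ h0 h1

/-! ### Patterns 3, 4 and 5 -/

omit H in
-- For a row of up to five elements only the long sides need care, since the short ones border on
-- non-interface elements. The length five is what requires `δ ≤ 1 / 5`.
theorem isLarge_row (hp : Perp u v) (hδ : δ ≤ 1 / 5) {a₀ a₁ : ℤ} (h₀ : a₀ ≤ 0) (h₁ : 0 ≤ a₁)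
    (hlen : a₁ - a₀ ≤ 4) (hδ0 : 0 < δ) (hK : M.IsInterface K)
    (hT : ∀ a b : ℤ, -3 ≤ a → a ≤ 3 → -1 ≤ b → b ≤ 1 → a₀ - 1 ≤ a → a ≤ a₁ + 1 →
      K.cell u v a b ∈ M.T) (h3 : -2 ≤ a₀) (h4 : a₁ ≤ 2)
    (hr : ∃ n, (a₁ = n ∨ a₁ + 1 = n) ∧ ¬ M.IsInterface (K.cell u v n 0))
    (hl : ∃ n, (a₀ = n ∨ a₀ - 1 = n) ∧ ¬ M.IsInterface (K.cell u v n 0))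
    (hv : ∀ a, a₀ ≤ a → a ≤ a₁ → M.EdgeOK δ K v u 0 a₀ a₁ a)
    (hv' : ∀ a, a₀ ≤ a → a ≤ a₁ → M.EdgeOK δ K (-v) u 0 a₀ a₁ a) {P : List Cell}
    (hP : ∀ c, c ∈ P ↔ ∃ a b, (a₀ ≤ a ∧ a ≤ a₁) ∧ ((0 : ℤ) ≤ b ∧ b ≤ 0) ∧ c = K.cell u v a b) :
    ∃ R, macroElem P = R.toSet ∧ M.IsLarge δ R := by
  have hl' : (a₁ - a₀ + 1 : ℝ) ≤ 5 := by exact_mod_cast (by omega : a₁ - a₀ + 1 ≤ 5)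
  refine exists_isLarge hp (by omega) le_rfl (by nlinarith) (by push_cast; linarith) hP hK
    ((hP K).2 ⟨0, 0, by omega, by omega, by simp⟩) ?_ ?_ ?_ ?_ hv hv'
  · exact fun a b _ _ _ _ => hT a b (by omega) (by omega) (by omega) (by omega) (by omega) (by omega)
  · exact fun a b _ _ _ _ => hT a b (by omega) (by omega) (by omega) (by omega) (by omega) (by omega)
  · intro b hb hb'
    obtain rfl : b = 0 := by omega
    obtain ⟨n, hn, h⟩ := hr
    exact edgeOK_of_column h hn
  · intro b hb hb'
    obtain rfl : b = 0 := by omega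
    obtain ⟨n, hn, h⟩ := hl
    exact edgeOK_neg_of_column h hn

/-- Each long side is crossed once: the side `w` in `K`, the side `-w` in `K.shift u`. The inner
part continues into the other input, the outer one needs an additional element or the threshold. The
latter is `2 δ` for two elements and `3 δ` for three, because an element added at one end lengthens
both long sides. -/
theorem isLarge_p3 (hδ0 : 0 < δ) (hδ : δ ≤ 1 / 5) (hK : K ∈ C) (hT : M.IsT1 K)
    (D : M.T1Data K u w i r₁ r₂) (h : M.IsT1 (K.shift u)) {a₀ a₁ : ℤ}
    (ha₀ : a₀ = -1 ∨ a₀ = 0 ∧ (a₁ - a₀ + 1) * δ ≤ M.part K w (-u))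
    (ha₁ : a₁ = 2 ∨ a₁ = 1 ∧ (a₁ - a₀ + 1) * δ ≤ M.part (K.shift u) (-w) u) {P : List Cell}
    (hP : ∀ c, c ∈ P ↔ ∃ a b, (a₀ ≤ a ∧ a ≤ a₁) ∧ ((0 : ℤ) ≤ b ∧ b ≤ 0) ∧ c = K.cell u w a b) :
    ∃ R, macroElem P = R.toSet ∧ M.IsLarge δ R := by
  have hp := D.perp
  have ha : a₀ = -1 ∨ a₀ = 0 := by tauto
  have hb : a₁ = 1 ∨ a₁ = 2 := by tauto
  obtain ⟨c₁, -⟩ := H.chainNbr_of_T1 hK D hT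
  obtain ⟨-, -, n1, n2⟩ := H.shift_of_T1 hK D
  rw [K.shift_neg_left (v := w)] at n1
  rw [K.shift_neg_right (u := u)] at n2
  obtain ⟨k, s, s', D'⟩ := H.T1Data_next hK hT D h
  obtain ⟨-, -, n3, -⟩ := H.shift_of_T1 c₁.mem_right D'
  rw [neg_neg, K.shift_u_u u w] at n3
  have n4 := H.not_isInterface_diag hK hT D
  rw [K.shift_uv] at n4
  have hs := D'.split₂.symm
  rw [neg_neg] at hs
  refine isLarge_row hp hδ (by omega) (by omega) (by omega) hδ0 (H.isInterface hK) ?_ (by omega)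
    (by omega) ⟨2, by omega, n3⟩ ⟨-1, by omega, n1⟩ ?_ ?_ hP
  · intro a b _ _ _ _ _ _
    rcases le_or_gt a 2 with h2 | h2
    · exact H.shift_mem_T hK hp (abs_le.2 (by omega)) (abs_le.2 (by omega))
    · exact H.cell_mem_T_of_shift c₁.mem_right hp (abs_le.2 (by omega)) (abs_le.2 (by omega))
  · intro a h0 h1
    obtain rfl | rfl | rfl | rfl : a = -1 ∨ a = 0 ∨ a = 1 ∨ a = 2 := by omega
    · exact edgeOK_of_column (n := 0) (by rwa [K.cell_comm]) (by simp)
    · refine Or.inr ⟨r₂, i, by simpa using D.split₂,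
        Or.inl ⟨by omega, Or.inr (by rw [K.cell_comm]; exact n4)⟩, ?_⟩
      rcases ha₀ with rfl | ⟨rfl, hr⟩
      · exact Or.inl ⟨by norm_num, Or.inl (by rw [K.cell_comm]; exact n1)⟩
      · rw [D.split₂.symm.part_eq] at hr
        exact Or.inr hr
    · exact edgeOK_of_column (n := 1) (by rwa [K.cell_comm]) (by simp)
    · exact edgeOK_of_column (n := 0) (by rwa [K.cell_comm]) (by simp)
  · intro a h0 h1
    rw [← neg_zero (G := ℤ)]
    obtain rfl | rfl | rfl | rfl : a = -1 ∨ a = 0 ∨ a = 1 ∨ a = 2 := by omega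
    · exact edgeOK_neg_of_column (n := 0) (by rwa [K.cell_comm]) (by simp)
    · exact edgeOK_neg_of_column (n := -1) (by rwa [K.cell_comm]) (by simp)
    · refine Or.inr ⟨_, _, by simpa [← K.shift_right (u := -w)] using hs, ?_,
        Or.inl ⟨by omega, Or.inr (by simpa [Cell.cell_neg, K.cell_comm (u := u) (v := w)] using n2)⟩⟩
      rcases ha₁ with rfl | ⟨rfl, hr⟩
      · exact Or.inl ⟨by norm_num, Or.inl
          (by simpa [Cell.cell_neg, K.cell_comm (u := u) (v := w)] using n3)⟩
      · rw [hs.part_eq] at hr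
        exact Or.inr hr
    · exact edgeOK_neg_of_column (n := 0) (by rwa [K.cell_comm]) (by simp)

omit H in
-- This serves both long sides. Either outer input may be left through the side considered or
-- through the opposite one; in the latter case its side is clean, as expressed by the alternatives
-- in `e1` and `e2`.
theorem edgeOK_p4 {a₀ a₁ a : ℤ} (ha₀ : a₀ = -2 ∨ a₀ = -1) (ha₁ : a₁ = 2 ∨ a₁ = 1)
    (n0 : ¬ M.IsInterface (K.cell v u 1 0)) (n1 : ¬ M.IsInterface (K.cell v u 0 (-2)))
    (n2 : ¬ M.IsInterface (K.cell v u 0 2))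
    (e1 : ¬ M.IsInterface (K.cell v u 1 (-1)) ∨
      ∃ r i, M.Split (K.cell v u 0 (-1)) v u r i ∧ (a₀ = -2 ∨ (a₁ - a₀ + 1) * δ ≤ 1 - r))
    (e2 : ¬ M.IsInterface (K.cell v u 1 1) ∨
      ∃ r i, M.Split (K.cell v u 0 1) v u r i ∧ (a₁ = 2 ∨ (a₁ - a₀ + 1) * δ ≤ r))
    (h0 : a₀ ≤ a) (h1 : a ≤ a₁) : M.EdgeOK δ K v u 0 a₀ a₁ a := by
  obtain rfl | rfl | rfl | rfl | rfl : a = -2 ∨ a = -1 ∨ a = 0 ∨ a = 1 ∨ a = 2 := by omega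
  · exact edgeOK_of_column n1 (by simp)
  · rcases e1 with e1 | ⟨r, i, hs, hr⟩
    · exact edgeOK_of_column e1 (by simp)
    · refine Or.inr ⟨r, i, hs, Or.inl ⟨by omega, Or.inr n0⟩, ?_⟩
      rcases hr with rfl | hr
      exacts [Or.inl ⟨by omega, Or.inl n1⟩, Or.inr hr]
  · exact edgeOK_of_column n0 (by simp)
  · rcases e2 with e2 | ⟨r, i, hs, hr⟩
    · exact edgeOK_of_column e2 (by simp)
    · refine Or.inr ⟨r, i, hs, ?_, Or.inl ⟨by omega, Or.inr n0⟩⟩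
      rcases hr with rfl | hr
      exacts [Or.inl ⟨by omega, Or.inl n2⟩, Or.inr hr]
  · exact edgeOK_of_column n2 (by simp)

theorem isLarge_p4 (hδ0 : 0 < δ) (hδ : δ ≤ 1 / 5) {w₁ w₂ : ℤ × ℤ} (hK : K ∈ C) (hT : M.IsT2 K)
    (m₁ : K.shift (-u) ∈ C) (m₂ : K.shift u ∈ C)
    (D₁ : M.T1Data (K.shift (-u)) u w₁ i r₁ r₂) (D₂ : M.T1Data (K.shift u) (-u) w₂ j s₁ s₂)
    {a₀ a₁ : ℤ}
    (ha₀ : a₀ = -2 ∨ a₀ = -1 ∧ (a₁ - a₀ + 1) * δ ≤ M.part (K.shift (-u)) w₁ (-u))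
    (ha₁ : a₁ = 2 ∨ a₁ = 1 ∧ (a₁ - a₀ + 1) * δ ≤ M.part (K.shift u) w₂ u) {P : List Cell}
    (hP : ∀ c, c ∈ P ↔ ∃ a b, (a₀ ≤ a ∧ a ≤ a₁) ∧ ((0 : ℤ) ≤ b ∧ b ≤ 0) ∧ c = K.cell u w₁ a b) :
    ∃ R, macroElem P = R.toSet ∧ M.IsLarge δ R := by
  have hp := D₁.perp
  have ha : a₀ = -2 ∨ a₀ = -1 := by tauto
  have hb : a₁ = 2 ∨ a₁ = 1 := by tauto
  have hu := H.isInterface m₂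
  have n0 := H.not_isInterface_perp_of_T2 hK hT hp hu
  have n0' := H.not_isInterface_perp_of_T2 hK hT hp.neg_right hu
  obtain ⟨-, -, n1, n2⟩ := H.shift_of_T1 m₁ D₁
  obtain ⟨-, -, n3, n4⟩ := H.shift_of_T1 m₂ D₂
  rw [K.shift_left (u := w₁) (v := u)] at n0
  rw [K.shift_left (u := -w₁) (v := u)] at n0'
  rw [K.shift_neg_u_neg_u u w₁] at n1
  rw [neg_neg, K.shift_u_u u w₁] at n3
  rw [K.shift_neg_u_neg_v u w₁] at n2
  have hs₁ := D₁.split₂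
  have hs₂ := D₂.split₂.symm
  rw [neg_neg] at hs₂
  rw [hs₁.symm.part_eq] at ha₀
  rw [hs₂.part_eq] at ha₁
  rw [K.shift_neg_left (v := w₁)] at hs₁
  rw [K.shift_left (v := w₁)] at hs₂
  have ha₀' : a₀ = -2 ∨ (a₁ - a₀ + 1) * δ ≤ 1 - r₂ := by tauto
  have ha₁' : a₁ = 2 ∨ (a₁ - a₀ + 1) * δ ≤ 1 - s₂ := by tauto
  have f (a b : ℤ) : K.cell (-w₁) u a b = K.cell u w₁ b (-a) := by
    rw [Cell.cell_neg, K.cell_comm]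
  have g (a b : ℤ) : K.cell w₁ u a b = K.cell u w₁ b a := K.cell_comm _ _
  have e2 : (¬ M.IsInterface (K.cell w₁ u 1 1) ∨
      ∃ r i, M.Split (K.cell w₁ u 0 1) w₁ u r i ∧ (a₁ = 2 ∨ (a₁ - a₀ + 1) * δ ≤ r)) ∧
      (¬ M.IsInterface (K.cell (-w₁) u 1 1) ∨
      ∃ r i, M.Split (K.cell (-w₁) u 0 1) (-w₁) u r i ∧ (a₁ = 2 ∨ (a₁ - a₀ + 1) * δ ≤ r)) := by
    -- The interface leaves the second outer element on the same long side as the first one, or on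
    -- the opposite one.
    rcases hp.neg_left.eq_or_of_perp D₂.perp with rfl | rfl
    · rw [K.shift_u_neg_v u w₂] at n4
      exact ⟨Or.inr ⟨_, _, by rwa [g], ha₁'⟩, Or.inl (by rwa [f])⟩
    · rw [neg_neg, K.shift_u_v u w₁] at n4
      exact ⟨Or.inl (by rwa [g]), Or.inr ⟨_, _, by rw [f]; exact hs₂, ha₁'⟩⟩
  refine isLarge_row hp hδ (by omega) (by omega) (by omega) hδ0 (H.isInterface hK) ?_ (by omega)
    (by omega) ⟨2, by omega, n3⟩ ⟨-2, by omega, n1⟩ (fun a h0 h1 => ?_) (fun a h0 h1 => ?_) hP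
  · intro a b _ _ _ _ _ _
    rcases le_or_gt a 1 with h2 | h2
    · rw [← neg_neg a, ← Cell.cell_neg]
      exact H.cell_mem_T_of_shift m₁ hp.neg_left (abs_le.2 (by omega)) (abs_le.2 (by omega))
    · exact H.cell_mem_T_of_shift m₂ hp (abs_le.2 (by omega)) (abs_le.2 (by omega))
  · exact edgeOK_p4 ha hb n0 (by rwa [g]) (by rwa [g])
      (Or.inr ⟨_, _, by rwa [g], ha₀'⟩) e2.1 h0 h1
  · exact edgeOK_p4 ha hb n0' (by rwa [f]) (by rwa [f])
      (Or.inl (by rwa [f])) e2.2 h0 h1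

/-- Both ratios are measured from the end `u`. Adding `K.shift u` provides for the part at this end,
so the bound `2 δ` is needed only for the complementary parts, and vice versa for `K.shift (-u)`. -/
theorem isLarge_p5 (hδ0 : 0 < δ) (hδ : δ ≤ 1 / 5) (hK : K ∈ C) (hp : Perp w u)
    (hT : M.IsT2Along K w) {a₀ a₁ : ℤ}
    (ha₀ : a₀ = -1 ∨ a₀ = 0 ∧ 2 * δ ≤ 1 - M.part K w u ∧ 2 * δ ≤ 1 - M.part K (-w) u)
    (ha₁ : a₁ = 1 ∨ a₁ = 0 ∧ 2 * δ ≤ M.part K w u ∧ 2 * δ ≤ M.part K (-w) u)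
    (hne : a₀ ≠ a₁) {P : List Cell}
    (hP : ∀ c, c ∈ P ↔ ∃ a b, (a₀ ≤ a ∧ a ≤ a₁) ∧ ((0 : ℤ) ≤ b ∧ b ≤ 0) ∧ c = K.cell u w a b) :
    ∃ R, macroElem P = R.toSet ∧ M.IsLarge δ R := by
  have ha : a₀ = -1 ∨ a₀ = 0 := by tauto
  have hb : a₁ = 1 ∨ a₁ = 0 := by tauto
  have n1 := H.not_isInterface_of_isT2Along hK hT hp
  have n2 := H.not_isInterface_of_isT2Along hK hT hp.neg_right
  rw [K.shift_left (v := w)] at n1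
  rw [K.shift_neg_left (v := w)] at n2
  obtain ⟨i, r₁, r₂, D⟩ := hT.data hp
  rw [D.split₁.part_eq, D.split₂.part_eq] at ha₀ ha₁
  have key : ∀ {d : ℤ × ℤ} {r : ℝ}, (∀ a b, K.cell d u a b = K.cell u d b a) →
      M.Split K d u r i → (a₀ = -1 ∨ a₀ = 0 ∧ 2 * δ ≤ 1 - r) → (a₁ = 1 ∨ a₁ = 0 ∧ 2 * δ ≤ r) →
      ∀ a, a₀ ≤ a → a ≤ a₁ → M.EdgeOK δ K d u 0 a₀ a₁ a := by
    intro d r hd hs h₀ h₁ a ha ha'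
    have e1 : K.cell d u 0 1 = K.cell u w 1 0 := by simp [Cell.cell]
    have e2 : K.cell d u 0 (-1) = K.cell u w (-1) 0 := by simp [Cell.cell]
    rw [← e1] at n1
    rw [← e2] at n2
    obtain rfl | rfl | rfl : a = -1 ∨ a = 0 ∨ a = 1 := by omega
    · exact edgeOK_of_column n2 (by simp)
    · refine Or.inr ⟨r, i, by simpa using hs, ?_, ?_⟩
      · rcases h₁ with rfl | ⟨rfl, h₁⟩
        · exact Or.inl ⟨by norm_num, Or.inl n1⟩
        · obtain rfl : a₀ = -1 := by omega
          right; push_cast; linarith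
      · rcases h₀ with rfl | ⟨rfl, h₀⟩
        · exact Or.inl ⟨by norm_num, Or.inl n2⟩
        · obtain rfl : a₁ = 1 := by omega
          right; push_cast; linarith
    · exact edgeOK_of_column n1 (by simp)
  refine isLarge_row hp.symm hδ (by omega) (by omega) (by omega) hδ0 (H.isInterface hK) ?_
    (by omega) (by omega) ⟨1, by omega, n1⟩ ⟨-1, by omega, n2⟩
    (key (fun a b => K.cell_comm _ _) D.split₁ (by tauto) (by tauto))
    (key (fun a b => K.cell_comm _ _) D.split₂ (by tauto) (by tauto)) hP
  exact fun a b _ _ _ _ _ _ => H.shift_mem_T hK hp.symm (abs_le.2 (by omega)) (abs_le.2 (by omega))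

end Mergeable

end InterfaceMesh

end Merging

/-! ### The branches of the patterns, and the induced mesh. -/

namespace Merging

namespace InterfaceMesh

variable {M : InterfaceMesh} {K L : Cell} {u v w : ℤ × ℤ} {C I : List Cell} {δ : ℝ}

namespace Mergeable

variable (H : M.Mergeable C)

include H

/-- If not all inputs of a pattern are large, then the macro-element is a large rectangle. -/
theorem large_of_pattern (hδ0 : 0 < δ) (hδ : δ ≤ 1 / 5) {E : Option (List Cell)}
    (h : M.Pattern δ C I E) : (E = none → ∀ K ∈ I, M.IsLarge δ K) ∧
      ∀ l, E = some l → ∃ R, macroElem (I ++ l) = R.toSet ∧ M.IsLarge δ R := by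
  cases h with
  | @p1 K u v i r₁ r₂ hK hT D h1 h2 =>
    unfold merge1
    dsimp only
    split_ifs with c0 c1 c2 c3
    · exact ⟨fun _ => by simpa [and_assoc] using c0, fun l hl => by simp at hl⟩
    all_goals refine ⟨fun h => by simp at h, fun l hl => ?_⟩
    all_goals obtain rfl := Option.some_injective _ hl
    · refine H.isLarge_p1 hδ hK hT D h1 h2 (Or.inr ⟨rfl, c1.2⟩) (Or.inr ⟨rfl, c1.1⟩)
        (Cell.mem_map_cell (l := [(1, 0), (0, 0), (0, 1), (1, 1)]) (fun a b => ?_) ?_)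
      · simp only [List.mem_cons, List.not_mem_nil, Prod.mk.injEq, or_false]; omega
      · simp only [List.map_cons, List.map_nil, Cell.cell_zero, ← K.shift_left, ← K.shift_right,
          ← K.shift_uv, List.cons_append, List.nil_append]
    · refine H.isLarge_p1 hδ hK hT D h1 h2 (Or.inl rfl) (Or.inr ⟨rfl, c2.1⟩)
        (Cell.mem_map_cell (l := [(1, 0), (0, 0), (0, 1), (1, 1), (-1, 0), (-1, 1)])
          (fun a b => ?_) ?_)
      · simp only [List.mem_cons, List.not_mem_nil, Prod.mk.injEq, or_false]; omega
      · simp only [List.map_cons, List.map_nil, Cell.cell_zero, ← K.shift_left, ← K.shift_right,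
          ← K.shift_uv, ← K.shift_neg_left, ← K.shift_v_sub_u, List.cons_append, List.nil_append]
    · refine H.isLarge_p1 hδ hK hT D h1 h2 (Or.inr ⟨rfl, c3.2⟩) (Or.inl rfl)
        (Cell.mem_map_cell (l := [(1, 0), (0, 0), (0, 1), (1, 1), (1, -1), (0, -1)])
          (fun a b => ?_) ?_)
      · simp only [List.mem_cons, List.not_mem_nil, Prod.mk.injEq, or_false]; omega
      · simp only [List.map_cons, List.map_nil, Cell.cell_zero, ← K.shift_left, ← K.shift_right,
          ← K.shift_uv, ← K.shift_neg_right, ← K.shift_u_sub_v, List.cons_append, List.nil_append]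
    · refine H.isLarge_p1 hδ hK hT D h1 h2 (Or.inl rfl) (Or.inl rfl)
        (Cell.mem_map_cell (l := [(1, 0), (0, 0), (0, 1), (1, 1), (1, -1), (0, -1), (-1, -1),
          (-1, 0), (-1, 1)]) (fun a b => ?_) ?_)
      · simp only [List.mem_cons, List.not_mem_nil, Prod.mk.injEq, or_false]; omega
      · simp only [List.map_cons, List.map_nil, Cell.cell_zero, ← K.shift_left, ← K.shift_right,
          ← K.shift_uv, ← K.shift_neg_left, ← K.shift_neg_right, ← K.shift_v_sub_u,
          ← K.shift_u_sub_v, ← K.shift_neg_sub, List.cons_append, List.nil_append]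
  | @p2 K u v i r₁ r₂ hK hT D h1 h2 =>
    unfold merge2
    dsimp only
    split_ifs with c0 c1 c2 c3
    · exact ⟨fun _ => by simpa [and_assoc] using c0, fun l hl => by simp at hl⟩
    all_goals refine ⟨fun h => by simp at h, fun l hl => ?_⟩
    all_goals obtain rfl := Option.some_injective _ hl
    · refine H.isLarge_p2 hδ hK hT D h1 h2 (Or.inr ⟨rfl, c1.1⟩) (Or.inr ⟨rfl, c1.2⟩)
        (Cell.mem_map_cell (l := [(1, 0), (0, 0), (0, 1), (1, 1)]) (fun a b => ?_) ?_)
      · simp only [List.mem_cons, List.not_mem_nil, Prod.mk.injEq, or_false]; omega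
      · simp only [List.map_cons, List.map_nil, Cell.cell_zero, ← K.shift_left, ← K.shift_right,
          ← K.shift_uv, List.cons_append, List.nil_append]
    · refine H.isLarge_p2 hδ hK hT D h1 h2 (Or.inr ⟨rfl, c2.1⟩) (Or.inl rfl)
        (Cell.mem_map_cell (l := [(1, 0), (0, 0), (0, 1), (1, 1), (1, 2), (0, 2)])
          (fun a b => ?_) ?_)
      · simp only [List.mem_cons, List.not_mem_nil, Prod.mk.injEq, or_false]; omega
      · simp only [List.map_cons, List.map_nil, Cell.cell_zero, ← K.shift_left, ← K.shift_right,
          ← K.shift_uv, ← K.shift_u_add_two_v, ← K.shift_two_v, List.cons_append, List.nil_append]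
    · refine H.isLarge_p2 hδ hK hT D h1 h2 (Or.inl rfl) (Or.inr ⟨rfl, c3.2⟩)
        (Cell.mem_map_cell (l := [(1, 0), (0, 0), (0, 1), (1, 1), (2, 0), (2, 1)])
          (fun a b => ?_) ?_)
      · simp only [List.mem_cons, List.not_mem_nil, Prod.mk.injEq, or_false]; omega
      · simp only [List.map_cons, List.map_nil, Cell.cell_zero, ← K.shift_left, ← K.shift_right,
          ← K.shift_uv, ← K.shift_two_u, ← K.shift_two_u_add_v, List.cons_append, List.nil_append]
    · refine H.isLarge_p2 hδ hK hT D h1 h2 (Or.inl rfl) (Or.inl rfl)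
        (Cell.mem_map_cell (l := [(1, 0), (0, 0), (0, 1), (1, 1), (2, 0), (2, 1), (2, 2),
          (1, 2), (0, 2)]) (fun a b => ?_) ?_)
      · simp only [List.mem_cons, List.not_mem_nil, Prod.mk.injEq, or_false]; omega
      · simp only [List.map_cons, List.map_nil, Cell.cell_zero, ← K.shift_left, ← K.shift_right,
          ← K.shift_uv, ← K.shift_two_u, ← K.shift_two_u_add_v, ← K.shift_two_u_add_two_v,
          ← K.shift_u_add_two_v, ← K.shift_two_v, List.cons_append, List.nil_append]
  | @p3 K u w i r₁ r₂ hK hT D h1 =>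
    unfold merge3
    dsimp only
    split_ifs with c0 c1 c2 c3
    · exact ⟨fun _ => by simpa [and_assoc] using c0, fun l hl => by simp at hl⟩
    all_goals refine ⟨fun h => by simp at h, fun l hl => ?_⟩
    all_goals obtain rfl := Option.some_injective _ hl
    · refine H.isLarge_p3 hδ0 hδ hK hT D h1 (a₀ := 0) (a₁ := 1)
        (Or.inr ⟨rfl, by push_cast; linarith [c1.1]⟩) (Or.inr ⟨rfl, by push_cast; linarith [c1.2]⟩)
        (Cell.mem_map_cell (l := [(0, 0), (1, 0)]) (fun a b => ?_) ?_)
      · simp only [List.mem_cons, List.not_mem_nil, Prod.mk.injEq, or_false]; omega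
      · simp only [List.map_cons, List.map_nil, Cell.cell_zero, ← K.shift_left, List.append_nil]
    · refine H.isLarge_p3 hδ0 hδ hK hT D h1 (a₀ := 0) (a₁ := 2)
        (Or.inr ⟨rfl, by push_cast; linarith⟩) (Or.inl rfl)
        (Cell.mem_map_cell (l := [(0, 0), (1, 0), (2, 0)]) (fun a b => ?_) ?_)
      · simp only [List.mem_cons, List.not_mem_nil, Prod.mk.injEq, or_false]; omega
      · simp only [List.map_cons, List.map_nil, Cell.cell_zero, ← K.shift_left, ← K.shift_two_u,
          List.cons_append, List.nil_append]
    · refine H.isLarge_p3 hδ0 hδ hK hT D h1 (a₀ := -1) (a₁ := 1)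
        (Or.inl rfl) (Or.inr ⟨rfl, by push_cast; linarith⟩)
        (Cell.mem_map_cell (l := [(0, 0), (1, 0), (-1, 0)]) (fun a b => ?_) ?_)
      · simp only [List.mem_cons, List.not_mem_nil, Prod.mk.injEq, or_false]; omega
      · simp only [List.map_cons, List.map_nil, Cell.cell_zero, ← K.shift_left, ← K.shift_neg_left,
          List.cons_append, List.nil_append]
    · refine H.isLarge_p3 hδ0 hδ hK hT D h1 (a₀ := -1) (a₁ := 2) (Or.inl rfl) (Or.inl rfl)
        (Cell.mem_map_cell (l := [(0, 0), (1, 0), (2, 0), (-1, 0)]) (fun a b => ?_) ?_)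
      · simp only [List.mem_cons, List.not_mem_nil, Prod.mk.injEq, or_false]; omega
      · simp only [List.map_cons, List.map_nil, Cell.cell_zero, ← K.shift_left, ← K.shift_neg_left,
          ← K.shift_two_u, List.cons_append, List.nil_append]
  | @p4 K u w₁ w₂ i r₁ r₂ j s₁ s₂ hK hT m1 m2 h1 h2 D1 D2 =>
    unfold merge4
    dsimp only
    split_ifs with c0 c1 c2 c3
    · exact ⟨fun _ => by simpa [and_assoc] using c0, fun l hl => by simp at hl⟩
    all_goals refine ⟨fun h => by simp at h, fun l hl => ?_⟩
    all_goals obtain rfl := Option.some_injective _ hl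
    · refine H.isLarge_p4 hδ0 hδ hK hT m1 m2 D1 D2 (a₀ := -1) (a₁ := 1)
        (Or.inr ⟨rfl, by push_cast; linarith [c1.1]⟩) (Or.inr ⟨rfl, by push_cast; linarith [c1.2]⟩)
        (Cell.mem_map_cell (l := [(-1, 0), (0, 0), (1, 0)]) (fun a b => ?_) ?_)
      · simp only [List.mem_cons, List.not_mem_nil, Prod.mk.injEq, or_false]; omega
      · simp only [List.map_cons, List.map_nil, Cell.cell_zero, ← K.shift_left, ← K.shift_neg_left,
          List.append_nil]
    · refine H.isLarge_p4 hδ0 hδ hK hT m1 m2 D1 D2 (a₀ := -2) (a₁ := 1)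
        (Or.inl rfl) (Or.inr ⟨rfl, by push_cast; linarith⟩)
        (Cell.mem_map_cell (l := [(-1, 0), (0, 0), (1, 0), (-2, 0)]) (fun a b => ?_) ?_)
      · simp only [List.mem_cons, List.not_mem_nil, Prod.mk.injEq, or_false]; omega
      · simp only [List.map_cons, List.map_nil, Cell.cell_zero, ← K.shift_left, ← K.shift_neg_left,
          ← K.shift_neg_two_u, List.cons_append, List.nil_append]
    · refine H.isLarge_p4 hδ0 hδ hK hT m1 m2 D1 D2 (a₀ := -1) (a₁ := 2)
        (Or.inr ⟨rfl, by push_cast; linarith⟩) (Or.inl rfl)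
        (Cell.mem_map_cell (l := [(-1, 0), (0, 0), (1, 0), (2, 0)]) (fun a b => ?_) ?_)
      · simp only [List.mem_cons, List.not_mem_nil, Prod.mk.injEq, or_false]; omega
      · simp only [List.map_cons, List.map_nil, Cell.cell_zero, ← K.shift_left, ← K.shift_neg_left,
          ← K.shift_two_u, List.cons_append, List.nil_append]
    · refine H.isLarge_p4 hδ0 hδ hK hT m1 m2 D1 D2 (a₀ := -2) (a₁ := 2) (Or.inl rfl) (Or.inl rfl)
        (Cell.mem_map_cell (l := [(-1, 0), (0, 0), (1, 0), (-2, 0), (2, 0)]) (fun a b => ?_) ?_)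
      · simp only [List.mem_cons, List.not_mem_nil, Prod.mk.injEq, or_false]; omega
      · simp only [List.map_cons, List.map_nil, Cell.cell_zero, ← K.shift_left, ← K.shift_neg_left,
          ← K.shift_neg_two_u, ← K.shift_two_u, List.cons_append, List.nil_append]
  | @p5 K w u hK hp hT =>
    unfold merge5
    dsimp only
    split_ifs with c0 c1 c2
    · exact ⟨fun _ => by simpa using c0, fun l hl => by simp at hl⟩
    all_goals refine ⟨fun h => by simp at h, fun l hl => ?_⟩
    all_goals obtain rfl := Option.some_injective _ hl
    · refine H.isLarge_p5 hδ0 hδ hK hp hT (a₀ := 0) (a₁ := 1)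
        (Or.inr ⟨rfl, by linarith [c1.1], by linarith [c1.2]⟩) (Or.inl rfl) (by norm_num)
        (Cell.mem_map_cell (l := [(0, 0), (1, 0)]) (fun a b => ?_) ?_)
      · simp only [List.mem_cons, List.not_mem_nil, Prod.mk.injEq, or_false]; omega
      · simp only [List.map_cons, List.map_nil, Cell.cell_zero, ← K.shift_left, List.cons_append,
          List.nil_append]
    · refine H.isLarge_p5 hδ0 hδ hK hp hT (a₀ := -1) (a₁ := 0) (Or.inl rfl) (Or.inr ⟨rfl, c2⟩)
        (by norm_num) (Cell.mem_map_cell (l := [(0, 0), (-1, 0)]) (fun a b => ?_) ?_)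
      · simp only [List.mem_cons, List.not_mem_nil, Prod.mk.injEq, or_false]; omega
      · simp only [List.map_cons, List.map_nil, Cell.cell_zero, ← K.shift_neg_left,
          List.cons_append, List.nil_append]
    · refine H.isLarge_p5 hδ0 hδ hK hp hT (a₀ := -1) (a₁ := 1) (Or.inl rfl) (Or.inl rfl)
        (by norm_num) (Cell.mem_map_cell (l := [(0, 0), (1, 0), (-1, 0)]) (fun a b => ?_) ?_)
      · simp only [List.mem_cons, List.not_mem_nil, Prod.mk.injEq, or_false]; omega
      · simp only [List.map_cons, List.map_nil, Cell.cell_zero, ← K.shift_left, ← K.shift_neg_left,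
          List.cons_append, List.nil_append]

end Mergeable

/-! ### The induced mesh -/

/-- An interior point common to both unions lies in the closure of some `X` of the first list;
nearby interior points of `X` belong to the second union as well, so `X` would be in both lists. -/
theorem macroElem_disjoint {P Q : List Cell} (hP : ∀ X ∈ P, X ∈ M.T) (hQ : ∀ X ∈ Q, X ∈ M.T)
    (h : ∀ X ∈ P, X ∉ Q) : Disjoint (macroElem P) (macroElem Q) := by
  rw [disjoint_left]
  intro p hp hq
  obtain ⟨X, hX, hpX⟩ := mem_iUnion₂.1 (interior_subset hp)
  rw [← Cell.closure_toSet] at hpX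
  obtain ⟨q, ⟨hqP, hqQ⟩, hqX⟩ := mem_closure_iff.1 hpX _
    (isOpen_interior.inter isOpen_interior) ⟨hp, hq⟩
  obtain ⟨Y, hY, hqY⟩ := mem_iUnion₂.1 (interior_subset hqQ)
  exact h X hX (eq_of_inter_closed (hP X hX) (hQ Y hY) ⟨q, hqX, hqY⟩ ▸ hY)

theorem _root_.Merging.macroElem_singleton (K : Cell) : macroElem [K] = K.toSet := by
  simp [macroElem, Cell.interior_closed]

theorem _root_.Merging.toSet_subset_macroElem {P : List Cell} (hK : K ∈ P) :
    K.toSet ⊆ macroElem P :=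
  interior_maximal (K.toSet_subset_closed.trans
    (subset_biUnion_of_mem (s := {c | c ∈ P}) (u := Cell.closed) hK)) K.isOpen_toSet

theorem _root_.Merging.exists_induced_superset {σ : List Call} (hK : K ∈ C) :
    ∃ U ∈ induced C σ, K.toSet ⊆ U := by
  by_cases hr : Remaining σ K
  · exact ⟨K.toSet, Or.inr ⟨K, hK, hr, rfl⟩, Subset.rfl⟩
  · unfold Remaining at hr
    push Not at hr
    obtain ⟨c, hc, hKc⟩ := hr
    refine ⟨c.output K, Or.inl ⟨c, hc, K, hKc, rfl⟩, ?_⟩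
    unfold Call.output
    cases c.result with
    | none => exact Subset.rfl
    | some l => exact toSet_subset_macroElem (List.mem_append_left _ hKc)

namespace Mergeable

variable (H : M.Mergeable C) {σ : List Call}

include H

theorem used_spec (h : M.IsFinal δ C σ) {c : Call} (hc : c ∈ σ) (hG : L ∈ c.used) :
    L ∈ M.T ∧ ¬ M.IsInterface L := by
  have := H.usable_of_pattern ((H.invariant_of_reach h.1).pattern c hc) L hG
  exact ⟨this.1, this.2.1⟩

theorem call_unique (h : M.IsFinal δ C σ) {c c' : Call} (hc : c ∈ σ) (hc' : c' ∈ σ)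
    (hK : K ∈ c.inputs) (hK' : K ∈ c'.inputs) : c = c' := by
  by_contra hne
  have hsym : Std.Symm fun c c' : Call => ∀ K ∈ c.inputs, K ∉ c'.inputs :=
    ⟨fun a b hab K hb ha => hab K ha hb⟩
  exact (H.invariant_of_reach h.1).disjoint.forall hc hc' hne K hK hK'

theorem used_unique (h : M.IsFinal δ C σ) {c c' : Call} (hc : c ∈ σ) (hc' : c' ∈ σ)
    (hK : K ∈ c.used) (hK' : K ∈ c'.used) : c = c' := by
  by_contra hne
  have hsym : Std.Symm fun c c' : Call => ∀ K ∈ c.used, K ∉ c'.used :=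
    ⟨fun a b hab K hb ha => hab K ha hb⟩
  exact (H.used_disjoint h).forall hc hc' hne K hK hK'

theorem inputs_subset (h : M.IsFinal δ C σ) {c : Call} (hc : c ∈ σ) (hK : K ∈ c.inputs) : K ∈ C :=
  (H.mem_of_pattern ((H.invariant_of_reach h.1).pattern c hc)).2 K hK

/-- Unmerged elements are written as macro-elements of a single element, so that disjointness of the
induced mesh reduces to disjointness of lists. -/
theorem induced_spec (h : M.IsFinal δ C σ) {U : Set Pt} (hU : U ∈ induced C σ) :
    (∃ c ∈ σ, c.result ≠ none ∧ U = macroElem (c.inputs ++ c.used)) ∨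
      ∃ K ∈ C, (∀ c ∈ σ, K ∈ c.inputs → c.result = none) ∧ U = macroElem [K] := by
  rcases hU with ⟨c, hc, K, hK, rfl⟩ | ⟨K, hK, hr, rfl⟩
  · unfold Call.output
    cases hres : c.result with
    | none =>
      refine Or.inr ⟨K, H.inputs_subset h hc hK, fun c' hc' hK' => ?_, (macroElem_singleton K).symm⟩
      rw [H.call_unique h hc' hc hK' hK, hres]
    | some l => exact Or.inl ⟨c, hc, by simp [hres], by simp [Call.used, hres]⟩
  · exact Or.inr ⟨K, hK, fun c hc hKc => absurd hKc (hr c hc), (macroElem_singleton K).symm⟩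

theorem induced_pairwiseDisjoint (h : M.IsFinal δ C σ) :
    (induced C σ).PairwiseDisjoint id := by
  have hT : ∀ c ∈ σ, ∀ X ∈ c.inputs ++ c.used, X ∈ M.T := fun c hc X hX =>
    (List.mem_append.1 hX).elim (fun hX => (H.isInterface (H.inputs_subset h hc hX)).1)
      fun hX => (H.used_spec h hc hX).1
  have hT' : ∀ K ∈ C, ∀ X ∈ [K], X ∈ M.T := fun K hK X hX =>
    List.mem_singleton.1 hX ▸ (H.isInterface hK).1
  have mixed : ∀ c ∈ σ, c.result ≠ none → ∀ K ∈ C, (∀ c ∈ σ, K ∈ c.inputs → c.result = none) →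
      Disjoint (macroElem (c.inputs ++ c.used)) (macroElem [K]) := by
    intro c hc hres K hK hr
    refine macroElem_disjoint (hT c hc) (hT' K hK) fun X hX hX' => ?_
    obtain rfl := List.mem_singleton.1 hX'
    rcases List.mem_append.1 hX with hX | hX
    · exact hres (hr c hc hX)
    · exact (H.used_spec h hc hX).2 (H.isInterface hK)
  intro U hU V hV hne
  change Disjoint U V
  rcases H.induced_spec h hU with ⟨c, hc, hres, rfl⟩ | ⟨K, hK, hr, rfl⟩ <;>
    rcases H.induced_spec h hV with ⟨c', hc', hres', rfl⟩ | ⟨K', hK', hr', rfl⟩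
  · have hcc : c ≠ c' := fun e => hne (by rw [e])
    refine macroElem_disjoint (hT c hc) (hT c' hc') fun X hX hX' => ?_
    rcases List.mem_append.1 hX with hX | hX <;> rcases List.mem_append.1 hX' with hX' | hX'
    · exact hcc (H.call_unique h hc hc' hX hX')
    · exact (H.used_spec h hc' hX').2 (H.isInterface (H.inputs_subset h hc hX))
    · exact (H.used_spec h hc hX).2 (H.isInterface (H.inputs_subset h hc' hX'))
    · exact hcc (H.used_unique h hc hc' hX hX')
  · exact mixed c hc hres K' hK' hr'
  · exact (mixed c' hc' hres' K hK hr).symm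
  · refine macroElem_disjoint (hT' K hK) (hT' K' hK') fun X hX hX' => hne ?_
    rw [← List.mem_singleton.1 hX, ← List.mem_singleton.1 hX']

theorem isLarge_of_mem_induced (hδ0 : 0 < δ) (hδ : δ ≤ 1 / 5) (h : M.IsFinal δ C σ) {U : Set Pt}
    (hU : U ∈ induced C σ) : ∃ R : Cell, U = R.toSet ∧ M.IsLarge δ R := by
  rcases hU with ⟨c, hc, K, hK, rfl⟩ | ⟨K, hK, hr, rfl⟩
  · obtain ⟨h1, h2⟩ := H.large_of_pattern hδ0 hδ ((H.invariant_of_reach h.1).pattern c hc)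
    unfold Call.output
    cases hres : c.result with
    | none => exact ⟨K, rfl, h1 hres K hK⟩
    | some l => exact h2 l hres
  · refine ⟨K, rfl, ?_⟩
    -- Elements of types 1 and 2 have all been treated; what remains is of type 3 and large without
    -- merging.
    have hno : ¬ (M.IsT1 K ∨ M.IsT2 K) := fun hT => by
      obtain ⟨c, hc, hKc⟩ := H.exists_call_of_isFinal h hK hT
      exact hr c hc hKc
    rcases (H.isInterface hK).type with hT | hT | hT
    · exact absurd (Or.inl hT) hno
    · exact absurd (Or.inr hT) hno
    · exact hT.isLarge (H.block1 hK) (by linarith)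

end Mergeable

end InterfaceMesh

end Merging

end

theorem theorem3p1 (M : Merging.InterfaceMesh) (δ₀ : ℝ) (hδ₀ : 0 < δ₀) (hδ₀' : δ₀ ≤ 1 / 5)
    (C : List Merging.Cell) (hC : M.IsAdmissible C) (hn : 2 ≤ C.length)
    (hends :
      (C.Nodup ∧ (∀ K ∈ C.head?, M.IsT2 K) ∧ (∀ K ∈ C.getLast?, M.IsT2 K) ∧ M.NoSingleGap C) ∨
      (Merging.InterfaceMesh.IsClosedList C ∧ ∃ K ∈ C, ¬ M.IsT1 K)) :
    -- no execution of the algorithm goes on forever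
    (¬ ∃ f : ℕ → List Merging.Call, f 0 = [] ∧ ∀ m, M.Step δ₀ C (f m) (f (m + 1))) ∧
    -- whenever an execution has come to its end:
    (∀ σ, M.IsFinal δ₀ C σ →
      -- all elements of types 1 and 2 of the chain have been treated, each by one call only
      (∀ K ∈ C, M.IsT1 K ∨ M.IsT2 K → ∃ c ∈ σ, K ∈ c.inputs) ∧
      (σ.Pairwise fun c c' => ∀ K ∈ c.inputs, K ∉ c'.inputs) ∧
      -- the other elements that are merged are non-interface elements of the mesh
      (∀ c ∈ σ, ∀ K ∈ c.used, K ∈ M.T ∧ ¬ M.IsInterface K) ∧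
      -- none of them is used by two patterns
      (σ.Pairwise fun c c' => ∀ K ∈ c.used, K ∉ c'.used) ∧
      -- the elements of the induced mesh are disjoint and contain the elements of the chain
      (Merging.induced C σ).PairwiseDisjoint id ∧
      (∀ K ∈ C, ∃ U ∈ Merging.induced C σ, K.toSet ⊆ U) ∧
      -- all elements of the induced mesh are rectangles and large elements
      (∀ U ∈ Merging.induced C σ, ∃ R : Merging.Cell, U = R.toSet ∧ M.IsLarge δ₀ R)) := by
  have H : M.Mergeable C := ⟨hC, hn, hends⟩
  exact ⟨H.not_forever, fun σ h => ⟨fun K hK hT => H.exists_call_of_isFinal h hK hT,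
    (H.invariant_of_reach h.1).disjoint, fun c hc K hK => H.used_spec h hc hK, H.used_disjoint h,
    H.induced_pairwiseDisjoint h, fun K hK => Merging.exists_induced_superset hK,
    fun U hU => H.isLarge_of_mem_induced hδ₀ hδ₀' h hU⟩⟩
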